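/- Let $n\ge 1$ and let $\mathfrak a=\bigoplus_{a=1}^{n-1}\mathbb C x_a$ be an abelian Lie algebra; write $x_a[i]=x_a\otimes t^i\in\mathfrak a[t]$. For $1\le m\le n$, $k\ge 0$ let $V^{(m)}_k=\mathbb C[x_1,\dots,x_{n-1}]/J^{(m)}_k$, where $J^{(m)}_k$ is generated by $x_m,\dots,x_{n-1}$ and all monomials of degree $k+1$ in $x_1,\dots,x_{m-1}$ (so $V^{(n)}_k$ is the symmetric tensor representation $S^k(\mathbb C^n)$ of $\mathfrak{sl}_n$ restricted to $\mathfrak a$). Let $\mathbf n=(n_1,\dots,n_N)$, $\mathbf k=(k_1,\dots,k_N)$ with $1\le n_p\le n$, $k_p\ge 0$. *Fusion product.* For distinct $\mathcal Z=(\zeta_1,\dots,\zeta_N)\in\mathbb C^N$, the algebra $U(\mathfrak a[t])=\mathbb C[x_a[i]]$ acts on $V^{(n_1)}_{k_1}\otimes\cdots\otimes V^{(n_N)}_{k_N}$ by $x_a[i]\mapsto\sum_p\zeta_p^i x_a^{(p)}$, where $x_a^{(p)}$ is the action of $x_a$ on the $p$-th factor. Let $v=1\otimes\cdots\otimes1$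 and filter this space by $F^{\le d}=U(\mathfrak a[t])_{\le d}\,v$, where $\deg x_a[i]=i$. The fusion product $V_{\mathcal Z}(\mathbf n,\mathbf k)$ is the associated graded space; it is graded by degree and by weight, the weight of $x_a[i]$ being the $a$-th unit vector. *The module $W(\mathbf n,\mathbf k)$.* Let $N_a=\#\{p: n_p>a\}$, $R=\mathbb C[x_a[i]\mid 1\le a\le n-1,\,0\le i\le N_a-1]$, $x_a(z)=\sum_{i=0}^{N_a-1}x_a[i]z^{N_a-1-i}$, and $W(\mathbf n,\mathbf k)=R/J(\mathbf n,\mathbf k)$, where $J(\mathbf n,\mathbf k)$ is generated by the coefficients of $z^j$ in $\prod_{a=1}^{n-1}x_a(z)^{\nu_a}$ for all $\nu\in\mathbb Z_{\ge0}^{n-1}$ and all $j<\sum_{p}\bigl(\sum_{a=1}^{n_p-1}\nu_a-k_p\bigr)_+$. The character of a graded space $M$ is $\sum q^dz_1^{m_1}\cdots z_{n-1}^{m_{n-1}}\dim M_{d,m_1,\dots,m_{n-1}}$. *Partitions.* Let $\kappa^{(b)}$ be the conjugate of the partition formed by the $k_p$ with $n_p=b$, and $\mu^{(a)}=\sum_{b=1}^a\kappa^{(b)}$.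 Conversely, let $\mu^{(1)}\subset\cdots\subset\mu^{(n)}$ be partitions all of whose differences $\mu^{(a)}-\mu^{(a-1)}$ (with $\mu^{(0)}=\emptyset$) are partitions; call such a sequence admissible, and define $\chi^{(n)}[\mu^{(n)},\dots,\mu^{(1)}](q,z_1,\dots,z_{n-1})$ as the character of $W(\mathbf n,\mathbf k)$, where the $k_p$ with $n_p=a$ are the parts of the conjugate of $\mu^{(a)}-\mu^{(a-1)}$, for $1\le a\le n$. Let $[m]!=\prod_{j=1}^m\frac{1-q^j}{1-q}$, $\left[{m\atop l}\right]=\frac{[m]!}{[l]![m-l]!}$ for $0\le l\le m$ and $0$ otherwise, and $$F_{\kappa,\nu}(q)=q^{\sum_{a=1}^{k-1}\nu_{a+1}(\kappa_a-\nu_a)}\prod_{a=1}^{k}\left[{\kappa_a-\nu_{a+1}\atop \nu_a-\nu_{a+1}}\right],\qquad k=\text{length of }\kappa .$$ **Theorem.** (0) For all $\mathbf n,\mathbf k$ and distinct $\mathcal Z$, the characters of $W(\mathbf n,\mathbf k)$ and of the fusion product $V_{\mathcal Z}(\mathbf n,\mathbf k)$ are both equal to $\chi^{(n)}[\mu^{(n)},\dots,\mu^{(1)}]$,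 with the $\mu^{(a)}$ determined by $(\mathbf n,\mathbf k)$ as above. (1) For $n\ge 2$ and every admissible sequence, $$\chi^{(n)}[\mu^{(n)},\dots,\mu^{(1)}](q,z_1,\dots,z_{n-1})=\sum_{\mu^{(n)}\supset\nu\supset\mu^{(n-1)}}z_{n-1}^{|\mu^{(n)}|-|\nu|}F_{\mu^{(n)}-\mu^{(n-1)},\,\nu-\mu^{(n-1)}}(q)\,\chi^{(n-1)}[\nu,\mu^{(n-2)},\dots,\mu^{(1)}](q,z_1,\dots,z_{n-2}),$$ the sum being over partitions $\nu$ (the coefficient $F$ vanishes unless $\nu-\mu^{(n-1)}$ is a partition, in which case $\chi^{(n-1)}[\nu,\dots]$ is defined). (2) For every admissible sequence, $$\chi^{(n)}[\mu^{(n)},\dots,\mu^{(1)}]=\sum\prod_{a=1}^{n-1}\Bigl(z_a^{|\nu^{(a+1)}|-|\nu^{(a)}|}F_{\nu^{(a+1)}-\mu^{(a)},\,\nu^{(a)}-\mu^{(a)}}(q)\Bigr),$$ summed over the sequences of partitions $\mu^{(n)}=\nu^{(n)}\supset\nu^{(n-1)}\supset\cdots\supset\nu^{(1)}$ with $\nu^{(a)}\supset\mu^{(a)}$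 for $1\le a\le n-1$. (3) For every partition $\mu$, $$\chi^{(n)}[\mu,\emptyset,\dots,\emptyset](q,z_1,\dots,z_{n-1})=\sum_{\lambda\in\mathbb Z_{\ge0}^n,\ |\lambda|=|\mu|}z_1^{\lambda_2}\cdots z_{n-1}^{\lambda_n}\,\tilde S_{\lambda,\mu}(q),$$ where $\tilde S_{\lambda,\mu}(q)$ is the $A_{n-1}$ $q$-supernomial coefficient, given by $$\tilde S_{\lambda,\mu}(q)=\sum q^{\sum_{a=1}^{n-1}\sum_{i\ge1}\nu^{(a)}_{i+1}(\nu^{(a+1)}_i-\nu^{(a)}_i)}\prod_{a=1}^{n-1}\prod_{i=1}^{\ell(\mu)}\left[{\nu^{(a+1)}_i-\nu^{(a)}_{i+1}\atop\nu^{(a)}_i-\nu^{(a)}_{i+1}}\right],$$ summed over partitions $\nu^{(1)}\subset\cdots\subset\nu^{(n)}=\mu$ with $|\nu^{(a)}|=\lambda_1+\cdots+\lambda_a$ for $1\le a\le n$. In particular, for all $k_1,\dots,k_N\ge0$ and distinct $\mathcal Z$, the right-hand side with $\mu=(k_1,\dots,k_N)'$ is the character of the fusion product of the symmetric tensors $V^{(n)}_{k_1},\dots,V^{(n)}_{k_N}$.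 -/

import Mathlib

open scoped TensorProduct

namespace FusionProduct

noncomputable section

/-! ## The modules over the abelian current algebra

`Gen n` indexes the basis `x_1, …, x_{n-1}` of the abelian Lie algebra `𝔞`.  A family of modules is
given by a finite index type `ι` (the positions `p`), and by `ns p = n_p`, `ks p = k_p`. -/

/-- The index set `{1, …, n-1}` of the generators `x_a`. -/
abbrev Gen (n : ℕ) : Type := {a : ℕ // a ∈ Finset.Ico 1 n}

/-- The exponent of `q^i z_a`, which records that `x_a[i]` has degree `i` and weight the `a`-th unit
vector.  Formal variables are indexed by `ℕ`: the variable `0` is `q`, and the variable `a ≥ 1` is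
`z_a`. -/
def bideg (a i : ℕ) : ℕ →₀ ℕ := Finsupp.single 0 i + Finsupp.single a 1

section Modules

variable {ι : Type} [Fintype ι]

/-- `N_a`, the number of positions `p` with `n_p > a`. -/
def numActive (ns : ι → ℕ) (a : ℕ) : ℕ := (Finset.univ.filter fun p => a < ns p).card

/-- The index set of the indeterminates `x_a[i]`, `1 ≤ a ≤ n-1`, `0 ≤ i ≤ N_a - 1`. -/
abbrev CurVar (n : ℕ) (ns : ι → ℕ) : Type := Σ a : Gen n, Fin (numActive ns a)

/-- The polynomial ring `R` in the indeterminates `x_a[i]`, `1 ≤ a ≤ n-1`, `0 ≤ i ≤ N_a - 1`. -/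
abbrev CurRing (n : ℕ) (ns : ι → ℕ) : Type := MvPolynomial (CurVar n ns) ℂ

/-- The generating polynomial `x_a(z) = ∑_{i=0}^{N_a-1} x_a[i] z^{N_a-1-i}` in `R[z]`. -/
def current (n : ℕ) (ns : ι → ℕ) (a : Gen n) : Polynomial (CurRing n ns) :=
  ∑ i : Fin (numActive ns a),
    Polynomial.monomial (numActive ns a - 1 - (i : ℕ)) (MvPolynomial.X ⟨a, i⟩)

/-- `μ(ν, k) = ∑_p (∑_{a=1}^{n_p-1} ν_a - k_p)_+`; the truncated subtraction of `ℕ` is `(·)_+`. -/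
def vanishingOrder {n : ℕ} (ns ks : ι → ℕ) (ν : Gen n → ℕ) : ℕ :=
  ∑ p, ((∑ a ∈ Finset.univ.filter (fun a : Gen n => (a : ℕ) < ns p), ν a) - ks p)

/-- The ideal `J(n, k)` of `R`, generated by the coefficients of `z^j` in `∏_a x_a(z)^{ν_a}` for all
`ν` and all `j < μ(ν, k)`. -/
def relIdeal (n : ℕ) (ns ks : ι → ℕ) : Ideal (CurRing n ns) :=
  Ideal.span {c | ∃ (ν : Gen n → ℕ) (j : ℕ), j < vanishingOrder ns ks ν ∧
    c = (∏ a, current n ns a ^ ν a).coeff j}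

/-- The homogeneous component of `W(n, k) = R / J(n, k)` with bidegree `e`, that is, of degree `e 0`
and weight `(e 1, …, e (n-1))`: the image of the corresponding component of `R`. -/
def WComponent (n : ℕ) (ns ks : ι → ℕ) (e : ℕ →₀ ℕ) :
    Submodule ℂ (CurRing n ns ⧸ relIdeal n ns ks) :=
  (MvPolynomial.weightedHomogeneousSubmodule ℂ
    (fun x : CurVar n ns => bideg (x.1 : ℕ) (x.2 : ℕ)) e).map
    (Ideal.Quotient.mkₐ ℂ (relIdeal n ns ks)).toLinearMap

/-- The character of `W(n, k)`, as a formal power series in `q` (variable `0`) and the `z_a`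
(variable `a`). -/
def chW (n : ℕ) (ns ks : ι → ℕ) : MvPowerSeries ℕ ℤ :=
  fun e => (Module.finrank ℂ (WComponent n ns ks e) : ℤ)

/-- The ideal `J^{(m)}_k` of `ℂ[x_1, …, x_{n-1}]`, generated by `x_m, …, x_{n-1}` and the monomials of
degree `k+1` in `x_1, …, x_{m-1}`. -/
def symIdeal (n m k : ℕ) : Ideal (MvPolynomial (Gen n) ℂ) :=
  Ideal.span ({f | ∃ a : Gen n, m ≤ (a : ℕ) ∧ f = MvPolynomial.X a} ∪
    {f | ∃ ν : Gen n →₀ ℕ, (∀ a : Gen n, m ≤ (a : ℕ) → ν a = 0) ∧ ν.degree = k + 1 ∧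
      f = MvPolynomial.monomial ν 1})

/-- The cyclic `𝔞`-module `V^{(m)}_k = ℂ[x_1, …, x_{n-1}] / J^{(m)}_k`, with cyclic vector `1`.  For
`m = n` it is the `k`-th symmetric tensor representation of `𝔰𝔩_n`, restricted to `𝔞`. -/
abbrev SymMod (n m k : ℕ) : Type := MvPolynomial (Gen n) ℂ ⧸ symIdeal n m k

/-- The tensor product `V^{(n_1)}_{k_1} ⊗ ⋯ ⊗ V^{(n_N)}_{k_N}`. -/
def TensorMod (n : ℕ) (ns ks : ι → ℕ) : Type := ⨂[ℂ] p, SymMod n (ns p) (ks p)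

instance (n : ℕ) (ns ks : ι → ℕ) : CommRing (TensorMod n ns ks) :=
  inferInstanceAs (CommRing (⨂[ℂ] p, SymMod n (ns p) (ks p)))

instance (n : ℕ) (ns ks : ι → ℕ) : Algebra ℂ (TensorMod n ns ks) :=
  inferInstanceAs (Algebra ℂ (⨂[ℂ] p, SymMod n (ns p) (ks p)))

open Classical in
/-- The embedding of the `p`-th factor, `y ↦ 1 ⊗ ⋯ ⊗ y ⊗ ⋯ ⊗ 1`. -/
def inFactor (n : ℕ) (ns ks : ι → ℕ) (p : ι) : SymMod n (ns p) (ks p) →ₐ[ℂ] TensorMod n ns ks :=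
  PiTensorProduct.singleAlgHom (R := ℂ) (A := fun p => SymMod n (ns p) (ks p)) p

/-- The universal enveloping algebra `U(𝔞[t]) = ℂ[x_a[i] | 1 ≤ a ≤ n-1, i ≥ 0]`. -/
abbrev CurAlg (n : ℕ) : Type := MvPolynomial (Gen n × ℕ) ℂ

/-- The map `P ↦ P · v` from `U(𝔞[t])` to the tensor product of the evaluation modules
`V^{(n_p)}_{k_p}(z_p)`, where `v = 1 ⊗ ⋯ ⊗ 1` is the cyclic vector: `x_a[i]` acts as
`∑_p z_p^i x_a^{(p)}`, with `x_a^{(p)}` the multiplication by `x_a` in the `p`-th factor. -/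
def evalAct (n : ℕ) (ns ks : ι → ℕ) (z : ι → ℂ) : CurAlg n →ₐ[ℂ] TensorMod n ns ks :=
  MvPolynomial.aeval fun x : Gen n × ℕ => ∑ p, z p ^ x.2 •
    inFactor n ns ks p (Ideal.Quotient.mk (symIdeal n (ns p) (ks p)) (MvPolynomial.X x.1))

/-- The subspace of the tensor product spanned by the `P · v`, with `P ∈ U(𝔞[t])` homogeneous of
degree `< d` (where `x_a[i]` has degree `i`). -/
def filtLT (n : ℕ) (ns ks : ι → ℕ) (z : ι → ℂ) (d : ℕ) : Submodule ℂ (TensorMod n ns ks) :=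
  ⨆ i : Fin d, (MvPolynomial.weightedHomogeneousSubmodule ℂ
    (fun x : Gen n × ℕ => x.2) (i : ℕ)).map (evalAct n ns ks z).toLinearMap

/-- The component of the fusion product `V^{(n_1)}_{k_1} * ⋯ * V^{(n_N)}_{k_N}` at the points `z_p`
with bidegree `e`.  The fusion product is the associated graded space `⨁_d F^{≤ d} / F^{< d}` of the
filtered tensor product; its component of degree `d = e 0` and weight `(e 1, …, e (n-1))` is the
image in `F^{≤ d} / F^{< d}`, a subspace of the tensor product modulo `F^{< d}`, of the elements of
`U(𝔞[t])` of that degree and weight, applied to the cyclic vector. -/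
def fusionComponent (n : ℕ) (ns ks : ι → ℕ) (z : ι → ℂ) (e : ℕ →₀ ℕ) :
    Submodule ℂ (TensorMod n ns ks ⧸ filtLT n ns ks z (e 0)) :=
  ((MvPolynomial.weightedHomogeneousSubmodule ℂ
    (fun x : Gen n × ℕ => bideg (x.1 : ℕ) x.2) e).map (evalAct n ns ks z).toLinearMap).map
    (filtLT n ns ks z (e 0)).mkQ

/-- The character of the fusion product at the points `z_p`. -/
def chFusion (n : ℕ) (ns ks : ι → ℕ) (z : ι → ℂ) : MvPowerSeries ℕ ℤ :=
  fun e => (Module.finrank ℂ (fusionComponent n ns ks z e) : ℤ)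

end Modules

/-! ## Partitions

A partition is a finitely supported, weakly decreasing function `λ : ℕ →₀ ℕ`, and `λ i` is the part
`λ_{i+1}`.  Inclusion of diagrams is the pointwise order, and `|λ|` is `λ.degree`. -/

/-- `(1^k)`, a column of height `k`. -/
def column (k : ℕ) : ℕ →₀ ℕ := ∑ i ∈ Finset.range k, Finsupp.single i 1

/-- The `j`-th part (counted from `0`) of the conjugate partition. -/
def conjPart (κ : ℕ →₀ ℕ) (j : ℕ) : ℕ := (κ.support.filter fun i => j < κ i).card

/-- The partition `κ^{(b)}`: the conjugate of the partition formed by the `k_p` with `n_p = b`. -/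
def kappa {ι : Type} [Fintype ι] (ns ks : ι → ℕ) (b : ℕ) : ℕ →₀ ℕ :=
  ∑ p ∈ Finset.univ.filter (fun p => ns p = b), column (ks p)

/-- The sequence `μ^{(1)} ⊂ ⋯ ⊂ μ^{(n)}`, `n = r + 1`, with `μ^{(a)} = ∑_{b=1}^a κ^{(b)}`; the
partition `μ^{(a)}` stands at the index `a - 1`. -/
def muOf {ι : Type} [Fintype ι] (r : ℕ) (ns ks : ι → ℕ) : Fin (r + 1) → ℕ →₀ ℕ :=
  fun a => ∑ b ∈ Finset.Icc 1 ((a : ℕ) + 1), kappa ns ks b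

/-- The successive differences `μ^{(a)} - μ^{(a-1)}` with `μ^{(0)} = ∅`. -/
def diff {r : ℕ} (μ : Fin (r + 1) → ℕ →₀ ℕ) : Fin (r + 1) → ℕ →₀ ℕ :=
  Fin.cases (μ 0) fun a => μ a.succ - μ a.castSucc

/-- `μ^{(1)} ⊂ ⋯ ⊂ μ^{(n)}`, and all the differences `μ^{(a)} - μ^{(a-1)}` are partitions.  These are
the sequences that arise from the data `(n_p, k_p)`. -/
def Admissible {r : ℕ} (μ : Fin (r + 1) → ℕ →₀ ℕ) : Prop :=
  Monotone μ ∧ ∀ a, Antitone (diff μ a)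

/-- The character `χ^{(n)}[μ^{(n)}, …, μ^{(1)}]`, `n = r + 1`: the character of `W(n, k)` where the
`k_p` with `n_p = a` are the parts of the conjugate of `μ^{(a)} - μ^{(a-1)}`. -/
def chi {r : ℕ} (μ : Fin (r + 1) → ℕ →₀ ℕ) : MvPowerSeries ℕ ℤ :=
  chW (ι := Σ a : Fin (r + 1), Fin (diff μ a 0)) (r + 1)
    (fun p => (p.1 : ℕ) + 1) (fun p => conjPart (diff μ p.1) p.2)

/-! ## `q`-binomials and the fermionic sums -/

/-- `[n]! = ∏_{j=1}^n (1 - q^j) / (1 - q)`, where `(1 - q^j) / (1 - q) = 1 + q + ⋯ + q^{j-1}`. -/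
def qFact (n : ℕ) : Polynomial ℤ :=
  ∏ j ∈ Finset.Icc 1 n, ∑ i ∈ Finset.range j, Polynomial.X ^ i

/-- The `q`-binomial `[m]! / ([n]! [m-n]!)` for `0 ≤ n ≤ m`, and `0` otherwise.  The denominator is
monic and the division is exact, see `qBinom_mul`. -/
def qBinom (m n : ℤ) : Polynomial ℤ :=
  if 0 ≤ n ∧ n ≤ m then qFact m.toNat /ₘ (qFact n.toNat * qFact (m - n).toNat) else 0

theorem qFact_succ (n : ℕ) :
    qFact (n + 1) = qFact n * ∑ i ∈ Finset.range (n + 1), Polynomial.X ^ i := by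
  unfold qFact
  rw [Finset.prod_Icc_succ_top (by omega)]

theorem qFact_monic (n : ℕ) : (qFact n).Monic := by
  refine Polynomial.monic_prod_of_monic _ _ fun j hj => ?_
  have h : j ≠ 0 := by
    have := (Finset.mem_Icc.mp hj).1
    omega
  exact Polynomial.monic_geom_sum_X h

theorem qFact_mul_dvd (a b : ℕ) : qFact a * qFact b ∣ qFact (a + b) := by
  induction h : a + b generalizing a b with
  | zero =>
    obtain ⟨rfl, rfl⟩ : a = 0 ∧ b = 0 := by omega
    simp [qFact]
  | succ s ih =>
    rcases a with _ | a
    · obtain rfl : b = s + 1 := by omega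
      simp [qFact]
    rcases b with _ | b
    · obtain rfl : a = s := by omega
      simp [qFact]
    have h1 := ih a (b + 1) (by omega)
    have h2 := ih (a + 1) b (by omega)
    have hs : s + 1 = (a + 1) + (b + 1) := by omega
    have e : (∑ i ∈ Finset.range (s + 1), (Polynomial.X : Polynomial ℤ) ^ i)
        = (∑ i ∈ Finset.range (a + 1), Polynomial.X ^ i)
          + Polynomial.X ^ (a + 1) * ∑ i ∈ Finset.range (b + 1), Polynomial.X ^ i := by
      rw [hs, Finset.sum_range_add, Finset.mul_sum]
      simp [pow_add]
    rw [qFact_succ s, e, mul_add]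
    refine dvd_add ?_ ?_
    · rw [qFact_succ a]
      have := mul_dvd_mul_right h1
        (∑ i ∈ Finset.range (a + 1), (Polynomial.X : Polynomial ℤ) ^ i)
      convert this using 1
      ring
    · rw [qFact_succ b]
      have := mul_dvd_mul_right h2
        (∑ i ∈ Finset.range (b + 1), (Polynomial.X : Polynomial ℤ) ^ i)
      rw [show qFact s * (Polynomial.X ^ (a + 1) *
          ∑ i ∈ Finset.range (b + 1), (Polynomial.X : Polynomial ℤ) ^ i)
          = Polynomial.X ^ (a + 1) * (qFact s *
          ∑ i ∈ Finset.range (b + 1), (Polynomial.X : Polynomial ℤ) ^ i) by ring, ← mul_assoc]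
      exact this.mul_left _

theorem qBinom_mul {m n : ℕ} (h : n ≤ m) :
    qBinom m n * (qFact n * qFact (m - n)) = qFact m := by
  have hm : (qFact n * qFact (m - n)).Monic := (qFact_monic n).mul (qFact_monic (m - n))
  have hd : qFact n * qFact (m - n) ∣ qFact m := by
    have := qFact_mul_dvd n (m - n)
    rwa [Nat.add_sub_cancel' h] at this
  have e : ((m : ℤ) - n).toNat = m - n := by omega
  have h0 := (Polynomial.modByMonic_eq_zero_iff_dvd hm).mpr hd
  have h1 := Polynomial.modByMonic_add_div (qFact m) (qFact n * qFact (m - n))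
  rw [h0, zero_add] at h1
  rw [qBinom, if_pos ⟨by omega, by omega⟩, e, Int.toNat_natCast, Int.toNat_natCast, mul_comm]
  exact h1

/-- `F_{κ,ν}(q) = q^{∑_{a=1}^{k-1} ν_{a+1} (κ_a - ν_a)} ∏_{a=1}^k [κ_a - ν_{a+1}; ν_a - ν_{a+1}]` for
`ν ⊂ κ`, where `k` is the length of `κ`.  The product vanishes if `κ` is a partition and `ν` is not. -/
def F (κ ν : ℕ →₀ ℕ) : Polynomial ℤ :=
  Polynomial.X ^ (∑ a ∈ Finset.range (κ.support.card - 1), ν (a + 1) * (κ a - ν a)) *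
    ∏ a ∈ Finset.range κ.support.card,
      qBinom ((κ a : ℤ) - (ν (a + 1) : ℤ)) ((ν a : ℤ) - (ν (a + 1) : ℤ))

/-- A polynomial in `q` as a formal power series in `q` and the `z_a`. -/
def inQ (f : Polynomial ℤ) : MvPowerSeries ℕ ℤ := Polynomial.aeval (MvPowerSeries.X 0) f

open Classical in
/-- The partitions `ν` with `ρ ⊂ ν ⊂ κ`. -/
def between (ρ κ : ℕ →₀ ℕ) : Finset (ℕ →₀ ℕ) :=
  (Finset.Icc ρ κ).filter fun ν => Antitone ν

open Classical in
/-- The sequences of partitions `μ^{(n)} = ν^{(n)} ⊃ ν^{(n-1)} ⊃ ⋯ ⊃ ν^{(1)}` with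
`ν^{(a)} ⊃ μ^{(a)}`. -/
def chains {r : ℕ} (μ : Fin (r + 1) → ℕ →₀ ℕ) : Finset (Fin (r + 1) → ℕ →₀ ℕ) :=
  (Fintype.piFinset fun a => between (μ a) (μ (Fin.last r))).filter fun ν =>
    Monotone ν ∧ ν (Fin.last r) = μ (Fin.last r)

/-- The sequence `(∅, …, ∅, μ)`. -/
def onlyLast (r : ℕ) (μ : ℕ →₀ ℕ) : Fin (r + 1) → ℕ →₀ ℕ := Pi.single (Fin.last r) μ

open Classical in
/-- The `A_{n-1}` `q`-supernomial coefficient `S̃_{λ,μ}(q)`, `n = r + 1`, for a composition `λ` with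
`n` parts and a partition `μ`: the sum over all sequences of partitions
`ν^{(1)} ⊂ ⋯ ⊂ ν^{(n)} = μ` with `|ν^{(a)}| = λ_1 + ⋯ + λ_a` of
`q^{∑_{a,i} ν^{(a)}_{i+1} (ν^{(a+1)}_i - ν^{(a)}_i)}
  ∏_{a,i} [ν^{(a+1)}_i - ν^{(a)}_{i+1}; ν^{(a)}_i - ν^{(a)}_{i+1}]`,
with `1 ≤ a ≤ n-1` and `1 ≤ i ≤ ℓ(μ)`. -/
def supernomial {r : ℕ} (lam : Fin (r + 1) → ℕ) (μ : ℕ →₀ ℕ) : Polynomial ℤ :=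
  ∑ ν ∈ (chains (onlyLast r μ)).filter
      (fun ν => ∀ a, (ν a).degree = ∑ b ∈ Finset.Iic a, lam b),
    Polynomial.X ^ (∑ a : Fin r, ∑ i ∈ Finset.range μ.support.card,
        ν a.castSucc (i + 1) * (ν a.succ i - ν a.castSucc i)) *
      ∏ a : Fin r, ∏ i ∈ Finset.range μ.support.card,
        qBinom ((ν a.succ i : ℤ) - (ν a.castSucc (i + 1) : ℤ))
          ((ν a.castSucc i : ℤ) - (ν a.castSucc (i + 1) : ℤ))

end

end FusionProduct

open FusionProduct

/-! The argument is dual and uses no basis of the modules. A linear form on the part of weight `w`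
of `R` is a function `p` on the monomials of weight `w`. It kills `J(n, k)` iff, for all `ν` and all
monomials `P`, its value on `P ∏ x_a(z)^{ν_a}`, a polynomial in `z`, is divisible by `z` to the
power `∑_p (∑_{a < n_p} ν_a - k_p)_+`. Replacing this power of `z` by `∏_p (z - ζ_p)^{(∑_{a < n_p}
ν_a - k_p)_+}` deforms the conditions. `gradedDim` is the dimension of the degenerate solution space
in one degree, `totalDim` that of the solution space at distinct points. Passing to lowest
components gives `totalDim ≤ ∑_d gradedDim`. Everything rests on the equality
(`totalDim_eq_sum_gradedDim`) and on a recursion for `gradedDim` (`sum_gradedDim_setActive`), which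
have a common source.

The source is an induction that strips off the largest color `c`. Let `K = N_c`. A product of `M +
1` factors `x_c[i]` is a multi-index up to permutation; without the symmetry, the solutions form a
representation of the symmetric group. The dimensions of the parts that are alternating in `j`
indices and symmetric in the other `M + 1 - j` have alternating sum zero (`sum_finrank_hookPart`),
because `∑_A (-1)^{|A|} det P_A = det (1 - P) = 0` for a permutation matrix `P`. At the degenerate
point, reading off an alternating function at its top index bounds the `j`-th part above by a sum
over the `j`-subsets `α` of `{0, …, K-1}`: the levels `k_i` with `i ∈ α` drop by one, `M + 1 - j`
symmetric indices remain, and the degree is shifted by the sum of `α` (`finrank_altSol_le`). At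
distinct points, determinants of Lagrange polynomials produce the same sum as a lower bound
(`sum_finrank_le_altSol`). For `j ≥ 1` the induction hypothesis matches the two bounds and
semicontinuity closes the circle, so all are equalities. The Euler characteristic carries the
equality over to `j = 0` and gives, with `T_M(k)` the generating function in `q`, the recursion `∑_α
(-1)^{|α|} q^{∑ α} T_{M+1-|α|}(k - 1_α) = 0` for decreasing `k` (`core_step`).

This recursion determines `T_M` from `T_0`. Its solution is `T_M(κ) = ∑_ρ F_{κ,ρ} T_0(ρ)` over `ρ ⊂
κ` with `|κ| - |ρ| = M`, where partitions stand for the conjugates of the lists of levels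
(`eq_shapeSum_of_recursion`); the verification reduces to a `q`-binomial identity for a block of
equal levels (`sum_block_eq_zero`). Consequently the series depend on `(n, k)` only through the
partitions `μ^{(n)} - μ^{(a)}` (`gradedSeries_congr`). This makes `χ` well defined on the data and
turns the removal of a color into the recursion in `n`; iteration gives the fermionic and
supernomial sums.

For the fusion product, a linear form on the tensor product restricts to a solution at distinct
points, since each `x_a^{(p)}` generates a nilpotent contribution at `ζ_p` (`monoValues_mem_sol`).
Its lowest component is a degenerate solution, which bounds each fusion component by `gradedDim`.
Conversely every solution at distinct points comes from such a form (`ker_evalMap_le`), so `∑_w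
totalDim` is at most the dimension of the tensor product. As the fusion components exhaust that
dimension, all the bounds are equalities. -/

namespace FusionProduct

noncomputable section

open Polynomial (C X)

/-! ### Euler characteristic of a representation of the symmetric group. -/

section Koszul

variable {τ : Type*} [DecidableEq τ]

/-- The `A × A` minor of the permutation matrix of `g`: the sign of `g` on `A` if `g` preserves `A`,
and `0` otherwise. -/
def permMinor (A : Finset τ) (g : Equiv.Perm τ) : ℂ :=
  (Matrix.of fun i j : A => if g j = i then (1 : ℂ) else 0).det

theorem permMinor_mul_of_fix {A : Finset τ} {σ : Equiv.Perm τ} (hσ : ∀ x ∈ A, σ x = x)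
    (g : Equiv.Perm τ) : permMinor A (σ * g) = permMinor A g := by
  rw [permMinor, permMinor]
  congr 1
  ext i j
  simp only [Matrix.of_apply, Equiv.Perm.mul_apply]
  congr 1
  rw [eq_iff_iff]
  constructor
  · intro h
    apply σ.injective
    rw [h, hσ i i.2]
  · intro h
    rw [h, hσ i i.2]

theorem mem_iff_of_permMinor_ne_zero {A : Finset τ} {g : Equiv.Perm τ} (h : permMinor A g ≠ 0)
    (x : τ) : g x ∈ A ↔ x ∈ A := by
  have h1 : ∀ i ∈ A, ∃ j ∈ A, g j = i := by
    intro i hi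
    by_contra! hj
    exact h (Matrix.det_eq_zero_of_row_eq_zero ⟨i, hi⟩ fun j => by simp [hj j j.2])
  have h2 : A ⊆ A.map g.toEmbedding := fun i hi => by
    obtain ⟨j, hj, rfl⟩ := h1 i hi
    simpa using hj
  have h3 := Finset.eq_of_subset_of_card_le h2 (by simp)
  constructor
  · intro hx
    rw [h3] at hx
    simpa using hx
  · intro hx
    rw [h3]
    simpa using hx

variable [Fintype τ]

/-- Expanding `det (1 - P)` multilinearly in the rows gives the signed sum of the principal minors
of the permutation matrix `P`. The determinant vanishes because the columns of `P` sum to `1`. -/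
theorem sum_permMinor [Nonempty τ] (g : Equiv.Perm τ) :
    ∑ A : Finset τ, (-1 : ℂ) ^ A.card * permMinor A g = 0 := by
  set P : Matrix τ τ ℂ := Matrix.of fun i j => if g j = i then (1 : ℂ) else 0 with hP
  have h0 : (-P + 1).det = 0 := by
    rw [← Matrix.det_transpose]
    apply Matrix.exists_mulVec_eq_zero_iff.mp
    refine ⟨fun _ => 1, fun h => one_ne_zero (congr_fun h (Classical.arbitrary τ)), ?_⟩
    ext i
    simp [Matrix.mulVec, dotProduct, Matrix.one_apply, hP, Finset.sum_add_distrib]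
  have h1 := (Matrix.detRowAlternating (n := τ) (R := ℂ)).map_add_univ (fun i => (-P) i)
    (fun i => (1 : Matrix τ τ ℂ) i)
  have h2 : Matrix.detRowAlternating ((fun i => (-P) i) + fun i => (1 : Matrix τ τ ℂ) i) = 0 := h0
  rw [h2] at h1
  rw [h1]
  refine Finset.sum_congr rfl fun A _ => ?_
  have h3 := Matrix.det_piecewise_one_eq_submatrix_det (-P) A
  have h4 : Matrix.detRowAlternating (A.piecewise (fun i => (-P) i) fun i => (1 : Matrix τ τ ℂ) i)
      = ((-P).submatrix (Subtype.val : A → τ) Subtype.val).det := h3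
  rw [h4, Matrix.submatrix_neg, Pi.neg_apply, Pi.neg_apply, Matrix.det_neg]
  simp only [Fintype.card_coe, permMinor, hP, Matrix.submatrix]
  rfl

theorem permMinor_mul_of_fix_compl {A : Finset τ} {σ : Equiv.Perm τ} (hσ : ∀ x ∉ A, σ x = x)
    (g : Equiv.Perm τ) : permMinor A (σ * g) = (Equiv.Perm.sign σ : ℤ) * permMinor A g := by
  have hA : ∀ x, σ x ∈ A ↔ x ∈ A := by
    intro x
    constructor
    · intro hx
      by_contra h
      rw [hσ x h] at hx
      exact h hx
    · intro hx
      by_contra h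
      rw [σ.injective (hσ _ h)] at h
      exact h hx
  obtain ⟨s, hs⟩ : ∃ s : Equiv.Perm A, s = σ.subtypePerm hA := ⟨_, rfl⟩
  have hsign : Equiv.Perm.sign s = Equiv.Perm.sign σ := by
    rw [hs]
    convert Equiv.Perm.sign_subtypePerm (p := fun x => x ∈ A) σ hA fun x hx => ?_
    by_contra h
    exact hx (hσ x h)
  have hval : ∀ i, σ (s⁻¹ i : A) = i := by
    intro i
    have h1 : s (s⁻¹ i) = i := s.apply_symm_apply i
    have h2 : ((s (s⁻¹ i) : A) : τ) = σ (s⁻¹ i : A) := by rw [hs]; rfl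
    rw [← h2, h1]
  have hdet := Matrix.det_permute s⁻¹ (Matrix.of fun i j : A => if g j = i then (1 : ℂ) else 0)
  rw [Equiv.Perm.sign_inv, hsign] at hdet
  rw [permMinor, permMinor, ← hdet]
  congr 1
  ext i j
  simp only [Matrix.of_apply, Matrix.submatrix_apply, id, Equiv.Perm.mul_apply]
  refine if_congr ⟨fun h => σ.injective ?_, fun h => ?_⟩ rfl rfl
  · rw [h, hval]
  · rw [h, hval]

/-- These permutations are the stabilizer of the coloring of `τ` by membership in `A`. -/
theorem card_perm_preserving (A : Finset τ) :
    (Finset.univ.filter fun g : Equiv.Perm τ => ∀ x, g x ∈ A ↔ x ∈ A).card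
      = A.card.factorial * (Aᶜ).card.factorial := by
  have := DomMulAct.stabilizer_card (α := τ) (fun x => decide (x ∈ A))
  rw [Fintype.card_subtype] at this
  convert this using 1
  · congr 1
    ext g
    simp only [Finset.mem_filter, Finset.mem_univ, true_and, funext_iff, Function.comp]
    simp
  · rw [Fintype.prod_bool]
    simp [Fintype.card_subtype, ← Finset.compl_filter]

variable {V : Type*} [AddCommGroup V] [Module ℂ V]

/-- The isotypic subspace of a representation of the symmetric group on `τ`: alternating in the
positions in `A`, symmetric in the other ones. -/
def hookPart (ρ : Equiv.Perm τ →* Module.End ℂ V) (A : Finset τ) : Submodule ℂ V where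
  carrier := {v | (∀ σ : Equiv.Perm τ, (∀ x ∉ A, σ x = x) →
      ρ σ v = ((Equiv.Perm.sign σ : ℤ) : ℂ) • v) ∧
    ∀ σ : Equiv.Perm τ, (∀ x ∈ A, σ x = x) → ρ σ v = v}
  add_mem' := by
    rintro v w ⟨h1, h2⟩ ⟨h3, h4⟩
    exact ⟨fun σ h => by rw [map_add, h1 σ h, h3 σ h, smul_add],
      fun σ h => by rw [map_add, h2 σ h, h4 σ h]⟩
  zero_mem' := by simp
  smul_mem' := by
    rintro c v ⟨h1, h2⟩
    exact ⟨fun σ h => by rw [map_smul, h1 σ h, smul_comm],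
      fun σ h => by rw [map_smul, h2 σ h]⟩

/-- A `g` preserving `A` is a permutation of `A` times one of the complement. Both the minor and the
action on `v` are then the sign of the first factor, and the two signs cancel. Otherwise the minor
has a zero row. -/
theorem permMinor_smul_of_mem_hookPart (ρ : Equiv.Perm τ →* Module.End ℂ V) {A : Finset τ} {v : V}
    (hv : v ∈ hookPart ρ A) (g : Equiv.Perm τ) :
    permMinor A g • ρ g v = if ∀ x, g x ∈ A ↔ x ∈ A then v else 0 := by
  split_ifs with h
  · set σ : Equiv.Perm τ := Equiv.Perm.ofSubtype (g.subtypePerm (p := (· ∈ A)) h) with hσ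
    have h1 : ∀ x ∉ A, σ x = x := fun x hx => Equiv.Perm.ofSubtype_apply_of_not_mem _ hx
    have h2 : ∀ x ∈ A, σ x = g x := fun x hx => by
      rw [hσ, Equiv.Perm.ofSubtype_apply_of_mem _ hx]; rfl
    have h3 : ∀ x ∈ A, (σ⁻¹ * g) x = x := fun x hx => by
      rw [Equiv.Perm.mul_apply, ← h2 x hx]; simp
    have hg : g = σ * (σ⁻¹ * g) := by group
    have hone : permMinor A (1 : Equiv.Perm τ) = 1 := by
      have : (Matrix.of fun i j : A => if (1 : Equiv.Perm τ) j = i then (1 : ℂ) else 0) = 1 := by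
        ext i j
        simp only [Matrix.of_apply, Equiv.Perm.one_apply, Matrix.one_apply, Subtype.ext_iff]
        exact if_congr eq_comm rfl rfl
      rw [permMinor, this, Matrix.det_one]
    have e1 : permMinor A g = (Equiv.Perm.sign σ : ℤ) := by
      have := permMinor_mul_of_fix h3 1
      rw [mul_one] at this
      conv_lhs => rw [hg]
      rw [ permMinor_mul_of_fix_compl h1, this, hone, mul_one]
    have e2 : ρ g v = ((Equiv.Perm.sign σ : ℤ) : ℂ) • v := by
      conv_lhs => rw [hg]
      rw [map_mul, Module.End.mul_apply, hv.2 _ h3, hv.1 _ h1]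
    rw [e1, e2, smul_smul]
    rcases Int.units_eq_one_or (Equiv.Perm.sign σ) with h | h <;> simp [h]
  · by_cases h0 : permMinor A g = 0
    · simp [h0]
    · exact absurd (mem_iff_of_permMinor_ne_zero h0) h

/-- The element `∑_g permMinor A g • ρ g` maps into the hook part and acts on it as the scalar `|A|!
|Aᶜ|!`. After division by this scalar it is a projection, and its trace is the dimension. -/
theorem finrank_hookPart [FiniteDimensional ℂ V] (ρ : Equiv.Perm τ →* Module.End ℂ V) (A : Finset τ) :
    ((A.card.factorial * (Aᶜ).card.factorial : ℕ) : ℂ) * Module.finrank ℂ (hookPart ρ A)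
      = ∑ g, permMinor A g * LinearMap.trace ℂ V (ρ g) := by
  set m : ℂ := ((A.card.factorial * (Aᶜ).card.factorial : ℕ) : ℂ) with hm
  have hm0 : m ≠ 0 := by
    rw [hm]; exact_mod_cast (Nat.mul_pos (Nat.factorial_pos _) (Nat.factorial_pos _)).ne'
  set e : Module.End ℂ V := ∑ g, permMinor A g • ρ g with he
  have h1 : ∀ v, e v ∈ hookPart ρ A := by
    intro v
    refine ⟨fun σ hσ => ?_, fun σ hσ => ?_⟩
    · rw [he, ← Module.End.mul_apply, Finset.mul_sum, LinearMap.sum_apply, LinearMap.sum_apply,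
        Finset.smul_sum]
      rw [← Equiv.sum_comp (Equiv.mulLeft σ⁻¹) fun g => (ρ σ * permMinor A g • ρ g) v]
      refine Finset.sum_congr rfl fun g _ => ?_
      simp only [Equiv.coe_mulLeft, mul_smul_comm, ← map_mul, mul_inv_cancel_left,
        LinearMap.smul_apply, smul_smul]
      congr 1
      have := permMinor_mul_of_fix_compl hσ (σ⁻¹ * g)
      rw [mul_inv_cancel_left] at this
      rw [this, ← mul_assoc]
      rcases Int.units_eq_one_or (Equiv.Perm.sign σ) with h | h <;> simp [h]
    · rw [he, ← Module.End.mul_apply, Finset.mul_sum, LinearMap.sum_apply, LinearMap.sum_apply,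
        ← Equiv.sum_comp (Equiv.mulLeft σ⁻¹)]
      refine Finset.sum_congr rfl fun g _ => ?_
      simp only [Equiv.coe_mulLeft, mul_smul_comm, ← map_mul, mul_inv_cancel_left,
        LinearMap.smul_apply]
      have := permMinor_mul_of_fix hσ (σ⁻¹ * g)
      rw [mul_inv_cancel_left] at this
      rw [this]
  have h2 : ∀ v ∈ hookPart ρ A, e v = m • v := by
    intro v hv
    rw [he, LinearMap.sum_apply]
    simp only [LinearMap.smul_apply, permMinor_smul_of_mem_hookPart ρ hv]
    rw [Finset.sum_ite, Finset.sum_const_zero, add_zero, Finset.sum_const, card_perm_preserving,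
      ← Nat.cast_smul_eq_nsmul ℂ]
  have hproj : LinearMap.IsProj (hookPart ρ A) (m⁻¹ • e) :=
    ⟨fun v => Submodule.smul_mem _ _ (h1 v), fun v hv => by
      rw [LinearMap.smul_apply, h2 v hv, smul_smul, inv_mul_cancel₀ hm0, one_smul]⟩
  have h3 := hproj.trace
  rw [map_smul, smul_eq_mul] at h3
  rw [← h3, mul_inv_cancel_left₀ hm0, he, map_sum]
  simp

/-- The Euler characteristic of the Koszul complex of a representation of the symmetric group
vanishes. -/
theorem sum_finrank_hookPart [Nonempty τ] [FiniteDimensional ℂ V] (ρ : Equiv.Perm τ →* Module.End ℂ V) (f : ℕ → ℕ)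
    (hf : ∀ A, Module.finrank ℂ (hookPart ρ A) = f A.card) :
    ∑ j ∈ Finset.range (Fintype.card τ + 1), (-1 : ℤ) ^ j * f j = 0 := by
  have h0 : ∑ A : Finset τ, (-1 : ℂ) ^ A.card *
      (((A.card.factorial * (Aᶜ).card.factorial : ℕ) : ℂ) * f A.card) = 0 := by
    simp only [← hf, finrank_hookPart, Finset.mul_sum]
    rw [Finset.sum_comm]
    refine Finset.sum_eq_zero fun g _ => ?_
    simp only [← mul_assoc]
    rw [← Finset.sum_mul, sum_permMinor, zero_mul]
  -- All subsets of size `j` contribute equally, and the binomial coefficient times `j! (|τ| - j)!`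
  -- is `|τ|!`.
  have h1 : ∑ A : Finset τ, (-1 : ℂ) ^ A.card *
      (((A.card.factorial * (Aᶜ).card.factorial : ℕ) : ℂ) * f A.card)
      = ((Fintype.card τ).factorial : ℂ) *
        ∑ j ∈ Finset.range (Fintype.card τ + 1), (-1 : ℂ) ^ j * f j := by
    rw [← Finset.powerset_univ, Finset.sum_powerset, Finset.mul_sum, Finset.card_univ]
    refine Finset.sum_congr rfl fun j hj => ?_
    have hj : j ≤ Fintype.card τ := Nat.lt_succ_iff.mp (Finset.mem_range.mp hj)
    have e : ∀ A ∈ Finset.powersetCard j (Finset.univ : Finset τ), (-1 : ℂ) ^ A.card *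
        (((A.card.factorial * (Aᶜ).card.factorial : ℕ) : ℂ) * f A.card)
        = (-1 : ℂ) ^ j * (((j.factorial * (Fintype.card τ - j).factorial : ℕ) : ℂ) * f j) := by
      intro A hA
      have := (Finset.mem_powersetCard.mp hA).2
      rw [Finset.card_compl, this]
    rw [Finset.sum_congr rfl e, Finset.sum_const, Finset.card_powersetCard, Finset.card_univ,
      nsmul_eq_mul, ← Nat.choose_mul_factorial_mul_factorial hj]
    push_cast
    ring
  rw [h1, mul_eq_zero] at h0
  rcases h0 with h0 | h0
  · exact absurd h0 (by exact_mod_cast (Nat.factorial_pos _).ne')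
  · exact_mod_cast h0

end Koszul

/-! ### Dimension bounds from linear maps. -/

section LinearAlgebra

variable {V W : Type*} [AddCommGroup V] [Module ℂ V] [FiniteDimensional ℂ V]
  [AddCommGroup W] [Module ℂ W] [FiniteDimensional ℂ W]

theorem finrank_le_add_of_map (φ : V →ₗ[ℂ] W) {A A' : Submodule ℂ V} {B : Submodule ℂ W}
    (hB : ∀ v ∈ A, φ v ∈ B) (hker : ∀ v ∈ A, φ v = 0 → v ∈ A') :
    Module.finrank ℂ A ≤ Module.finrank ℂ A' + Module.finrank ℂ B := by
  have h := (φ.domRestrict A).finrank_range_add_finrank_ker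
  have h1 : Module.finrank ℂ (LinearMap.range (φ.domRestrict A)) ≤ Module.finrank ℂ B := by
    apply Submodule.finrank_mono
    rintro _ ⟨v, rfl⟩
    exact hB v v.2
  have h2 : Module.finrank ℂ (LinearMap.ker (φ.domRestrict A)) ≤ Module.finrank ℂ A' := by
    have : (LinearMap.ker (φ.domRestrict A)).map A.subtype ≤ A' := by
      rintro _ ⟨v, hv, rfl⟩
      exact hker v v.2 hv
    rw [(Submodule.equivMapOfInjective A.subtype A.injective_subtype _).finrank_eq]
    exact Submodule.finrank_mono this
  omega

theorem finrank_le_of_map (φ : V →ₗ[ℂ] W) {A : Submodule ℂ V} {B : Submodule ℂ W}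
    (hB : ∀ v ∈ A, φ v ∈ B) (hker : ∀ v ∈ A, φ v = 0 → v = 0) :
    Module.finrank ℂ A ≤ Module.finrank ℂ B := by
  have := finrank_le_add_of_map φ (A' := ⊥) hB fun v hv h => by simpa using hker v hv h
  simpa using this

end LinearAlgebra

/-! ### Divisibility conditions and their degeneration. -/

section Solutions

variable {E N : Type*} [Fintype E]

/-- The functions `p` on `E` for which each of the polynomials `∑ p(ε) c_x(ε)` is divisible by the
given polynomial `Q_x`. -/
def sol (c : N → E → Polynomial ℂ) (Q : N → Polynomial ℂ) : Submodule ℂ (E → ℂ) where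
  carrier := {p | ∀ x, Q x ∣ ∑ ε, p ε • c x ε}
  add_mem' := fun {p q} hp hq x => by
    simp only [Pi.add_apply, add_smul, Finset.sum_add_distrib]
    exact dvd_add (hp x) (hq x)
  zero_mem' := fun x => by simp
  smul_mem' := fun a p hp x => by
    simp only [Pi.smul_apply, smul_assoc, ← Finset.smul_sum]
    rw [Polynomial.smul_eq_C_mul]
    exact (hp x).mul_left _

theorem mem_sol {c : N → E → Polynomial ℂ} {Q : N → Polynomial ℂ} {p : E → ℂ} :
    p ∈ sol c Q ↔ ∀ x, Q x ∣ ∑ ε, p ε • c x ε := Iff.rfl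

/-- The functions supported in degree `d`. -/
def homog (deg : E → ℕ) (d : ℤ) : Submodule ℂ (E → ℂ) where
  carrier := {p | ∀ ε, (deg ε : ℤ) ≠ d → p ε = 0}
  add_mem' := fun {p q} hp hq ε h => by simp [hp ε h, hq ε h]
  zero_mem' := fun ε _ => rfl
  smul_mem' := fun a p hp ε h => by simp [hp ε h]

/-- The component of degree `d` of a function. -/
def component (deg : E → ℕ) (d : ℕ) : (E → ℂ) →ₗ[ℂ] (E → ℂ) where
  toFun p ε := if deg ε = d then p ε else 0
  map_add' p q := by ext ε; by_cases h : deg ε = d <;> simp [h]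
  map_smul' a p := by ext ε; by_cases h : deg ε = d <;> simp [h]

omit [Fintype E] in
theorem component_apply (deg : E → ℕ) (d : ℕ) (p : E → ℂ) (ε : E) :
    component deg d p ε = if deg ε = d then p ε else 0 := rfl

/-- The lowest component of a solution is a solution at the degenerate point. -/
theorem component_mem_sol {c : N → E → Polynomial ℂ} {Q : N → Polynomial ℂ} {deg : E → ℕ}
    {e : N → ℕ} (hc : ∀ x ε t, (c x ε).coeff t ≠ 0 → t + deg ε = e x) {d : ℕ} {p : E → ℂ}
    (hp : p ∈ sol c Q) (hd : ∀ ε, deg ε < d → p ε = 0) :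
    component deg d p ∈ sol c fun x => X ^ (Q x).natDegree := by
  intro x
  rw [Polynomial.X_pow_dvd_iff]
  intro t ht
  by_cases hte : t + d = e x
  -- As the components of `p` below degree `d` vanish, the sum has degree at most `e x - d = t`.
  -- This is less than the degree of its divisor `Q x`, so the sum is zero.
  · have hG : ∑ ε, p ε • c x ε = 0 := by
      refine Polynomial.eq_zero_of_dvd_of_natDegree_lt (hp x) (lt_of_le_of_lt ?_ ht)
      rw [Polynomial.natDegree_le_iff_coeff_eq_zero]
      intro u hu
      rw [Polynomial.finsetSum_coeff]
      refine Finset.sum_eq_zero fun ε _ => ?_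
      rw [Polynomial.coeff_smul]
      by_cases h : (c x ε).coeff u = 0
      · simp [h]
      · have := hc x ε u h
        rw [hd ε (by omega), zero_smul]
    rw [← Polynomial.coeff_zero t, ← hG, Polynomial.finsetSum_coeff, Polynomial.finsetSum_coeff]
    refine Finset.sum_congr rfl fun ε _ => ?_
    rw [Polynomial.coeff_smul, Polynomial.coeff_smul, component_apply]
    split_ifs with h
    · rfl
    · by_cases h' : (c x ε).coeff t = 0
      · simp [h']
      · have := hc x ε t h'
        omega
  · rw [Polynomial.finsetSum_coeff]
    refine Finset.sum_eq_zero fun ε _ => ?_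
    rw [Polynomial.coeff_smul, component_apply]
    split_ifs with h
    · by_cases h' : (c x ε).coeff t = 0
      · simp [h']
      · have := hc x ε t h'
        omega
    · simp

omit [Fintype E] in
theorem component_mem_homog (deg : E → ℕ) (d : ℕ) (p : E → ℂ) :
    component deg d p ∈ homog deg d := fun ε h => by
  rw [component_apply, if_neg (by exact_mod_cast h)]

/-- Semicontinuity: filter the solutions by vanishing below degree `m`. The component of degree `m`
embeds each successive quotient into the degenerate solutions of that degree. -/
theorem finrank_sol_le {c : N → E → Polynomial ℂ} {Q : N → Polynomial ℂ} {deg : E → ℕ}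
    {e : N → ℕ} (hc : ∀ x ε t, (c x ε).coeff t ≠ 0 → t + deg ε = e x) {S : Submodule ℂ (E → ℂ)}
    (hS : ∀ d, ∀ p ∈ S, component deg d p ∈ S) {B : ℕ} (hB : ∀ ε, deg ε < B) :
    Module.finrank ℂ (S ⊓ sol c Q : Submodule ℂ (E → ℂ)) ≤ ∑ d ∈ Finset.range B,
      Module.finrank ℂ ((S ⊓ homog deg d) ⊓ sol c fun x => X ^ (Q x).natDegree :
        Submodule ℂ (E → ℂ)) := by
  let Z : ℕ → Submodule ℂ (E → ℂ) := fun d =>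
    { carrier := {p | ∀ ε, deg ε < d → p ε = 0}
      add_mem' := fun {p q} hp hq ε h => by simp [hp ε h, hq ε h]
      zero_mem' := fun ε _ => rfl
      smul_mem' := fun a p hp ε h => by simp [hp ε h] }
  have key : ∀ m ≤ B, Module.finrank ℂ (S ⊓ sol c Q : Submodule ℂ (E → ℂ)) ≤
      (∑ d ∈ Finset.range m, Module.finrank ℂ
        ((S ⊓ homog deg d) ⊓ sol c fun x => X ^ (Q x).natDegree : Submodule ℂ (E → ℂ)))
      + Module.finrank ℂ ((S ⊓ sol c Q) ⊓ Z m : Submodule ℂ (E → ℂ)) := by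
    intro m hm
    induction m with
    | zero =>
      have : Z 0 = ⊤ := by
        ext p
        simp [Z]
      rw [this, inf_top_eq, Finset.sum_range_zero, zero_add]
    | succ m ih =>
      refine (ih (by omega)).trans ?_
      rw [Finset.sum_range_succ, add_assoc]
      refine Nat.add_le_add_left ?_ _
      rw [add_comm]
      refine finrank_le_add_of_map (component deg m) ?_ ?_
      · rintro p ⟨⟨h1, h2⟩, h3⟩
        exact ⟨⟨hS m p h1, component_mem_homog _ _ _⟩, component_mem_sol hc h2 h3⟩
      · rintro p ⟨h12, h3⟩ h4
        refine ⟨h12, fun ε hε => ?_⟩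
        rcases Nat.lt_succ_iff_lt_or_eq.mp hε with h | h
        · exact h3 ε h
        · have := congr_fun h4 ε
          rwa [component_apply, if_pos h] at this
  have hZ : Z B = ⊥ := by
    ext p
    simp only [Submodule.mem_bot]
    constructor
    · intro h
      ext ε
      exact h ε (hB ε)
    · rintro rfl ε _
      rfl
  have := key B le_rfl
  rwa [hZ, inf_bot_eq, finrank_bot, add_zero] at this

end Solutions

/-! ### Functions of several indices: alternating parts and an upper bound. -/

section Slots

variable {τ : Type*} [Fintype τ] [DecidableEq τ] {K : ℕ}

/-- The weight of a multi-index: a factor `z^{K-1-i}` for each position in `T`, while the other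
positions are prescribed by `r`. -/
def slot (T : Finset τ) (r i : τ → Fin K) : Polynomial ℂ :=
  ∏ t, if t ∈ T then X ^ (K - 1 - (i t : ℕ)) else if i t = r t then 1 else 0

variable {E N : Type*}

/-- The conditions on functions of a multi-index and of a point of `E`. -/
def extC (c : N → E → Polynomial ℂ) :
    N × Finset τ × (τ → Fin K) → (τ → Fin K) × E → Polynomial ℂ :=
  fun x y => slot x.2.1 x.2.2 y.1 * c x.1 y.2

/-- The slots in `T` carry `T.card` further factors `x_c(z)`. The argument `n` stays free, so that
the construction can be applied again to another group of indices. -/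
def extQ (Q : N → ℕ → Polynomial ℂ) :
    N × Finset τ × (τ → Fin K) → ℕ → Polynomial ℂ :=
  fun x n => Q x.1 (x.2.1.card + n)

theorem slot_insert_zero {j : ℕ} (T : Finset (Fin j)) (r v : Fin j → Fin K) (r0 v0 : Fin K) :
    slot (insert 0 (T.map (Fin.succEmb j))) (Fin.cons r0 r : Fin (j + 1) → Fin K) (Fin.cons v0 v)
      = X ^ (K - 1 - (v0 : ℕ)) * slot T r v := by
  simp [slot, Fin.prod_univ_succ, Fin.succ_ne_zero]

theorem slot_map_succ {j : ℕ} (T : Finset (Fin j)) (r v : Fin j → Fin K) (r0 v0 : Fin K) :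
    slot (T.map (Fin.succEmb j)) (Fin.cons r0 r : Fin (j + 1) → Fin K) (Fin.cons v0 v)
      = (if v0 = r0 then 1 else 0) * slot T r v := by
  simp [slot, Fin.prod_univ_succ, Fin.succ_ne_zero]

variable [Fintype E]

/-- The alternating functions of `j` indices below `h` with values in the graded family of spaces
`S`, subject to the conditions `c`. -/
def altSol (S : ℤ → Submodule ℂ (E → ℂ)) (c : N → E → Polynomial ℂ) (Q : N → ℕ → Polynomial ℂ)
    (j h : ℕ) (d : ℤ) : Submodule ℂ ((Fin j → Fin K) × E → ℂ) where
  carrier := {f | (∀ g : Equiv.Perm (Fin j), ∀ v ε,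
      f (v ∘ g, ε) = ((Equiv.Perm.sign g : ℤ) : ℂ) * f (v, ε)) ∧
    (∀ v : Fin j → Fin K, (fun ε => f (v, ε)) ∈ S (d - ∑ t, ((v t : ℕ) : ℤ))) ∧
    (∀ v : Fin j → Fin K, ∀ t, h ≤ (v t : ℕ) → ∀ ε, f (v, ε) = 0) ∧
    f ∈ sol (extC c) fun x => extQ Q x 0}
  add_mem' := by
    rintro f g ⟨h1, h2, h3, h4⟩ ⟨k1, k2, k3, k4⟩
    refine ⟨fun π v ε => ?_, fun v => Submodule.add_mem _ (h2 v) (k2 v), fun v t ht ε => ?_,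
      Submodule.add_mem _ h4 k4⟩
    · rw [Pi.add_apply, h1, k1, Pi.add_apply, mul_add]
    · rw [Pi.add_apply, h3 v t ht, k3 v t ht, add_zero]
  zero_mem' := ⟨by simp, fun v => Submodule.zero_mem _, by simp, Submodule.zero_mem _⟩
  smul_mem' := by
    rintro a f ⟨h1, h2, h3, h4⟩
    refine ⟨fun π v ε => ?_, fun v => Submodule.smul_mem _ a (h2 v), fun v t ht ε => ?_,
      Submodule.smul_mem _ a h4⟩
    · rw [Pi.smul_apply, h1, Pi.smul_apply, smul_eq_mul, smul_eq_mul, mul_left_comm]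
    · rw [Pi.smul_apply, h3 v t ht, smul_zero]

theorem sum_cons {j : ℕ} {M : Type*} [AddCommMonoid M] (φ : (Fin (j + 1) → Fin K) × E → M) :
    ∑ y, φ y = ∑ v0 : Fin K, ∑ y : (Fin j → Fin K) × E, φ (Fin.cons v0 y.1, y.2) := by
  rw [Fintype.sum_prod_type, ← (Fin.consEquiv fun _ => Fin K).sum_comp, Fintype.sum_prod_type]
  refine Finset.sum_congr rfl fun v0 _ => ?_
  rw [Fintype.sum_prod_type]
  rfl

theorem finrank_altSol_zero (S : ℤ → Submodule ℂ (E → ℂ)) (c : N → E → Polynomial ℂ)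
    (Q : N → ℕ → Polynomial ℂ) (h : ℕ) (d : ℤ) :
    Module.finrank ℂ (altSol (K := K) S c Q 0 h d)
      = Module.finrank ℂ (S d ⊓ sol c fun x => Q x 0 : Submodule ℂ (E → ℂ)) := by
  have hslot : ∀ (T : Finset (Fin 0)) (r v : Fin 0 → Fin K), slot T r v = 1 := by
    intro T r v; simp [slot]
  have hsum : ∀ (f : (Fin 0 → Fin K) × E → ℂ) (x : N × Finset (Fin 0) × (Fin 0 → Fin K)),
      ∑ y, f y • extC c x y = ∑ ε, f (finZeroElim, ε) • c x.1 ε := by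
    intro f x
    rw [Fintype.sum_prod_type]
    simp only [extC, hslot, one_mul]
    rw [Fintype.sum_unique]
    refine Finset.sum_congr rfl fun ε _ => ?_
    congr 2
  apply le_antisymm
  · refine finrank_le_of_map (LinearMap.pi fun ε => LinearMap.proj (finZeroElim, ε)) ?_ ?_
    · rintro f ⟨h1, h2, h3, h4⟩
      refine ⟨?_, fun x => ?_⟩
      · have := h2 finZeroElim
        rwa [Fin.sum_univ_zero, sub_zero] at this
      · have := h4 (x, ∅, finZeroElim)
        rw [hsum] at this
        simpa [extQ] using this
    · intro f _ hf
      ext ⟨v, ε⟩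
      rw [Subsingleton.elim v finZeroElim]
      exact congr_fun hf ε
  · refine finrank_le_of_map (LinearMap.pi fun y => LinearMap.proj y.2) ?_ ?_
    · rintro p ⟨h1, h2⟩
      refine ⟨fun g v ε => ?_, fun v => ?_, fun v t => t.elim0, fun x => ?_⟩
      · simp [Subsingleton.elim g 1]
      · simpa using h1
      · rw [hsum]
        have : x.2.1 = ∅ := Subsingleton.elim _ _
        simpa [extQ, this] using h2 x.1
    · intro p _ hp
      ext ε
      exact congr_fun hp (finZeroElim, ε)

/-- The order of vanishing `b + ∑_i (s + n - k_i)_+`. -/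
def vord (b s : N → ℕ) (k : Fin K → ℤ) (x : N) (n : ℕ) : ℕ :=
  b x + ∑ i, ((s x : ℤ) + n - k i).toNat

/-- The levels `k_i`, lowered by `1` at the positions in `α`. -/
def lower (k : Fin K → ℤ) (α : Finset (Fin K)) : Fin K → ℤ :=
  fun i => k i - if i ∈ α then 1 else 0

theorem lower_empty (k : Fin K → ℤ) : lower k ∅ = k := by
  ext i; simp [lower]

theorem lower_insert (k : Fin K → ℤ) {i : Fin K} {α : Finset (Fin K)} (hi : i ∉ α) :
    lower (lower k {i}) α = lower k (insert i α) := by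
  ext a
  by_cases h : a = i
  · subst h; simp [lower, hi]
  · simp [lower, h]

/-- Lowering `k_i` raises the order only if `k_i ≤ s + n`, and then by `1`. In that case all `p ≥ i`
have `k_p ≤ k_i ≤ s + n`, so passing from `n` to `n + 1` raises the order by at least their number
`K - i`. This jump is what `restrict_mem_altSol` needs to gain one order of vanishing. -/
theorem vord_lower_singleton (b s : N → ℕ) (k : Fin K → ℤ) (i : Fin K)
    (hk : ∀ p, i ≤ p → k p ≤ k i) (x : N) (n : ℕ) :
    vord b s (lower k {i}) x n ≤ vord b s k x n ∨
    vord b s (lower k {i}) x n ≤ vord b s k x n + 1 ∧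
      vord b s k x n + (K - 1 - (i : ℕ)) < vord b s k x (n + 1) := by
  have h1 : vord b s (lower k {i}) x n
      = vord b s k x n + if k i ≤ (s x : ℤ) + n then 1 else 0 := by
    rw [vord, vord, add_assoc]
    congr 1
    rw [← Finset.add_sum_erase _ _ (Finset.mem_univ i),
      ← Finset.add_sum_erase _ (fun p => ((s x : ℤ) + n - k p).toNat) (Finset.mem_univ i)]
    have h2 : ∀ p ∈ Finset.univ.erase i, ((s x : ℤ) + n - lower k {i} p).toNat
        = ((s x : ℤ) + n - k p).toNat := by
      intro p hp
      simp [lower, Finset.ne_of_mem_erase hp]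
    rw [Finset.sum_congr rfl h2]
    have h3 : ((s x : ℤ) + n - lower k {i} i).toNat
        = ((s x : ℤ) + n - k i).toNat + if k i ≤ (s x : ℤ) + n then 1 else 0 := by
      simp only [lower, Finset.mem_singleton, if_true]
      split_ifs <;> omega
    rw [h3]
    ring
  rw [h1]
  split_ifs with h
  · right
    refine ⟨le_rfl, ?_⟩
    have h4 : ∀ p, ((s x : ℤ) + n - k p).toNat + (if i ≤ p then 1 else 0)
        ≤ ((s x : ℤ) + (n + 1 : ℕ) - k p).toNat := by
      intro p
      split_ifs with hp
      · have := hk p hp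
        omega
      · omega
    have h5 := Finset.sum_le_sum fun p (_ : p ∈ (Finset.univ : Finset (Fin K))) => h4 p
    rw [Finset.sum_add_distrib] at h5
    have h6 : ∑ p : Fin K, (if i ≤ p then 1 else 0) = K - i := by
      rw [Finset.sum_boole, Finset.filter_le_eq_Ici, Fin.card_Ici, Nat.cast_id]
    rw [h6] at h5
    have := i.2
    simp only [vord]
    omega
  · left
    omega

/-- Fixing the first index at the top value `i` gives a function that is alternating in the
remaining indices, now below `i`, and it satisfies the conditions with the level `k_i` lowered. -/
theorem restrict_mem_altSol {S : ℤ → Submodule ℂ (E → ℂ)} {c : N → E → Polynomial ℂ}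
    {o o' : N → ℕ → ℕ} {j : ℕ} {i : Fin K} {d : ℤ}
    (ho : ∀ x n, o' x n ≤ o x n ∨ o' x n ≤ o x n + 1 ∧ o x n + (K - 1 - (i : ℕ)) < o x (n + 1))
    {f : (Fin (j + 1) → Fin K) × E → ℂ}
    (hf : f ∈ altSol S c (fun x n => X ^ o x n) (j + 1) (i + 1) d) :
    (fun y : (Fin j → Fin K) × E => f (Fin.cons i y.1, y.2))
      ∈ altSol S c (fun x n => X ^ o' x n) j i (d - (i : ℕ)) := by
  obtain ⟨h1, h2, h3, h4⟩ := hf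
  refine ⟨fun g v ε => ?_, fun v => ?_, fun v t ht ε => ?_, fun x => ?_⟩
  · have := h1 (Equiv.Perm.decomposeFin.symm (0, g)) (Fin.cons i v) ε
    rw [Equiv.Perm.decomposeFin.symm_sign, if_pos rfl, one_mul] at this
    have e : (Fin.cons i v : Fin (j + 1) → Fin K) ∘ Equiv.Perm.decomposeFin.symm (0, g)
        = Fin.cons i (v ∘ g) := by
      funext t
      refine Fin.cases ?_ (fun t => ?_) t
      · simp
      · simp
    rwa [e] at this
  · have := h2 (Fin.cons i v)
    rw [Fin.sum_univ_succ] at this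
    simpa [sub_sub] using this
  · rcases ht.lt_or_eq with ht | ht
    · exact h3 (Fin.cons i v) t.succ (by simpa using ht) ε
    -- If the top value `i` occurs a second time, exchanging the two occurrences gives `f = -f`.
    · have := h1 (Equiv.swap 0 t.succ) (Fin.cons i v) ε
      rw [Equiv.Perm.sign_swap (Fin.succ_ne_zero t).symm] at this
      have e : (Fin.cons i v : Fin (j + 1) → Fin K) ∘ Equiv.swap 0 t.succ = Fin.cons i v := by
        have hv : v t = i := Fin.ext ht.symm
        ext u
        rcases eq_or_ne u 0 with rfl | h0
        · simp [hv]
        · rcases eq_or_ne u t.succ with rfl | h0'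
          · simp [hv]
          · simp [Equiv.swap_apply_of_ne_of_ne h0 h0']
      rw [e] at this
      simp only [Units.val_neg, Units.val_one, Int.cast_neg, Int.cast_one, neg_mul, one_mul] at this
      exact self_eq_neg.mp this
  · obtain ⟨x, T, r⟩ := x
    set G : Fin K → Polynomial ℂ := fun v0 =>
      ∑ y : (Fin j → Fin K) × E, f (Fin.cons v0 y.1, y.2) • (slot T r y.1 * c x y.2) with hG
    have hG0 : ∀ v0 : Fin K, i < v0 → G v0 = 0 := by
      intro v0 hv
      refine Finset.sum_eq_zero fun y _ => ?_
      rw [h3 (Fin.cons v0 y.1) 0 (by simpa using hv), zero_smul]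
    have hG1 : X ^ o x T.card ∣ G i := by
      have := h4 (x, T.map (Fin.succEmb j), Fin.cons i r)
      simp only [extQ, Finset.card_map, add_zero, sum_cons, extC, slot_map_succ] at this
      rw [Finset.sum_eq_single i] at this
      · simpa using this
      · intro v0 _ hv
        simp [hv]
      · simp
    have hG1' : ∀ v0, X ^ o x T.card ∣ G v0 := by
      intro v0
      have := h4 (x, T.map (Fin.succEmb j), Fin.cons v0 r)
      simp only [extQ, Finset.card_map, add_zero, sum_cons, extC, slot_map_succ] at this
      rw [Finset.sum_eq_single v0] at this
      · simpa using this
      · intro v1 _ hv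
        simp [hv]
      · simp
    have hG2 : X ^ o x (T.card + 1) ∣ ∑ v0 : Fin K, X ^ (K - 1 - (v0 : ℕ)) * G v0 := by
      have := h4 (x, insert 0 (T.map (Fin.succEmb j)), Fin.cons i r)
      have hc : (insert 0 (T.map (Fin.succEmb j))).card = T.card + 1 := by
        rw [Finset.card_insert_of_notMem (by simp [Fin.succ_ne_zero]), Finset.card_map]
      simp only [extQ, hc, add_zero, sum_cons, extC, slot_insert_zero] at this
      convert this using 1
      refine Finset.sum_congr rfl fun v0 _ => ?_
      rw [hG, Finset.mul_sum]
      refine Finset.sum_congr rfl fun y _ => ?_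
      rw [mul_smul_comm, mul_assoc]
    change (X : Polynomial ℂ) ^ o' x (T.card + 0) ∣ G i
    rw [add_zero]
    rcases ho x T.card with h | ⟨h, h'⟩
    · exact (pow_dvd_pow _ h).trans hG1
    · refine (pow_dvd_pow _ h).trans ?_
      rw [Polynomial.X_pow_dvd_iff]
      intro t ht
      rcases Nat.lt_succ_iff_lt_or_eq.mp ht with ht | rfl
      · exact Polynomial.X_pow_dvd_iff.mp hG1 t ht
      -- The one coefficient still missing is that of `z^o` in `G i`. It is the coefficient of
      -- `z^{o+K-1-i}` in the condition with one more factor `x_c(z)`: a first index `v0 < i`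
      -- contributes a coefficient of `G v0` below order `o`, which vanishes, and for `v0 > i`
      -- already `G v0 = 0`.
      · have h5 := Polynomial.X_pow_dvd_iff.mp hG2 _ h'
        rw [Polynomial.finsetSum_coeff, Finset.sum_eq_single i] at h5
        · rwa [Polynomial.coeff_X_pow_mul', if_pos (by omega), Nat.add_sub_cancel] at h5
        · intro v0 _ hv
          rcases lt_or_gt_of_ne hv with hv | hv
          · rw [Polynomial.coeff_X_pow_mul']
            split_ifs
            · refine Polynomial.X_pow_dvd_iff.mp (hG1' v0) _ ?_
              have := i.2
              have : (v0 : ℕ) < i := hv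
              omega
            · rfl
          · rw [hG0 v0 hv]; simp
        · simp

/-- Upper bound for the alternating functions, by their lowest coefficients. -/
theorem finrank_altSol_le (S : ℤ → Submodule ℂ (E → ℂ)) (c : N → E → Polynomial ℂ) (b s : N → ℕ)
    (h : ℕ) (hK : h ≤ K) : ∀ (j : ℕ) (k : Fin K → ℤ) (d : ℤ),
    (∀ i : Fin K, (i : ℕ) < h → ∀ p, i ≤ p → k p ≤ k i) →
    Module.finrank ℂ (altSol (K := K) S c (fun x n => X ^ vord b s k x n) j h d) ≤
      ∑ α ∈ Finset.powersetCard j (Finset.univ.filter fun i : Fin K => (i : ℕ) < h),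
        Module.finrank ℂ (S (d - ∑ i ∈ α, ((i : ℕ) : ℤ)) ⊓
          sol c fun x => X ^ vord b s (lower k α) x 0 : Submodule ℂ (E → ℂ)) := by
  induction h with
  | zero =>
    intro j k d _
    rcases j with _ | j
    · rw [finrank_altSol_zero]
      rw [Finset.powersetCard_zero, Finset.sum_singleton, Finset.sum_empty, sub_zero, lower_empty]
    · have : altSol (K := K) S c (fun x n => X ^ vord b s k x n) (j + 1) 0 d = ⊥ := by
        rw [eq_bot_iff]
        rintro f ⟨_, _, h3, _⟩
        rw [Submodule.mem_bot]
        ext ⟨v, ε⟩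
        exact h3 v 0 (Nat.zero_le _) ε
      rw [this]
      simp
  | succ h ih =>
    intro j k d hk
    rcases j with _ | j
    · rw [finrank_altSol_zero]
      rw [Finset.powersetCard_zero, Finset.sum_singleton, Finset.sum_empty, sub_zero, lower_empty]
    · set i : Fin K := ⟨h, hK⟩ with hi
      have hfil : (Finset.univ.filter fun a : Fin K => (a : ℕ) < h + 1)
          = insert i (Finset.univ.filter fun a : Fin K => (a : ℕ) < h) := by
        ext a
        simp only [Finset.mem_filter, Finset.mem_univ, true_and, Finset.mem_insert, Fin.ext_iff, hi]
        omega
      have hni : i ∉ Finset.univ.filter fun a : Fin K => (a : ℕ) < h := by simp [hi]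
      -- Reading off the value at first index `h` has as kernel the functions whose indices all lie
      -- below `h`. The first summand is for the subsets without `h`, the second for those
      -- containing it.
      have hstep : Module.finrank ℂ
          (altSol (K := K) S c (fun x n => X ^ vord b s k x n) (j + 1) (h + 1) d) ≤
          Module.finrank ℂ (altSol (K := K) S c (fun x n => X ^ vord b s k x n) (j + 1) h d) +
          Module.finrank ℂ (altSol (K := K) S c (fun x n => X ^ vord b s (lower k {i}) x n) j h
            (d - h)) := by
        refine finrank_le_add_of_map
          (LinearMap.pi fun y => LinearMap.proj (Fin.cons i y.1, y.2)) ?_ ?_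
        · intro f hf
          exact restrict_mem_altSol (i := i)
            (vord_lower_singleton b s k i (hk i (Nat.lt_succ_self _))) hf
        · rintro f ⟨h1, h2, h3, h4⟩ hf
          refine ⟨h1, h2, fun v t ht ε => ?_, h4⟩
          rcases ht.lt_or_eq with ht | ht
          · exact h3 v t ht ε
          · have hv : (v ∘ Equiv.swap 0 t) 0 = i := by
              rw [Function.comp_apply, Equiv.swap_apply_left]
              exact Fin.ext ht.symm
            have e1 : f (v ∘ Equiv.swap 0 t, ε) = 0 := by
              have := congr_fun hf (Fin.tail (v ∘ Equiv.swap 0 t), ε)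
              simp only [LinearMap.pi_apply, LinearMap.proj_apply, Pi.zero_apply] at this
              rwa [← hv, Fin.cons_self_tail] at this
            rw [h1] at e1
            rcases Int.units_eq_one_or (Equiv.Perm.sign (Equiv.swap 0 t)) with e | e <;>
              simpa [e] using e1
      refine hstep.trans ?_
      rw [hfil, Finset.powersetCard_succ_insert hni, Finset.sum_union]
      · refine add_le_add (ih (by omega) (j + 1) k d fun a ha => hk a (by omega)) ?_
        refine (ih (by omega) j (lower k {i}) (d - h) ?_).trans (le_of_eq ?_)
        · intro a ha p hap
          have h1 := hk a (by omega) p hap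
          have h2 : a ≠ i := fun e => by rw [e] at ha; exact lt_irrefl _ ha
          simp only [lower, Finset.mem_singleton, h2, if_false]
          split_ifs <;> omega
        · rw [Finset.sum_image]
          · refine Finset.sum_congr rfl fun α hα => ?_
            have hiα : i ∉ α := fun h => hni ((Finset.mem_powersetCard.mp hα).1 h)
            rw [lower_insert k hiα, Finset.sum_insert hiα, sub_sub]
          · intro α hα β hβ hαβ
            have hiα : i ∉ α := fun h => hni ((Finset.mem_powersetCard.mp hα).1 h)
            have hiβ : i ∉ β := fun h => hni ((Finset.mem_powersetCard.mp hβ).1 h)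
            rw [← Finset.erase_insert hiα, ← Finset.erase_insert hiβ]
            exact congrArg (fun s => Finset.erase s i) hαβ
      · rw [Finset.disjoint_left]
        intro α hα hα'
        obtain ⟨β, _, rfl⟩ := Finset.mem_image.mp hα'
        exact hni ((Finset.mem_powersetCard.mp hα).1 (Finset.mem_insert_self i β))

end Slots

/-! ### A lower bound at distinct points by Lagrange interpolation. -/

section Lagrange

variable {K : ℕ} {E N : Type*} [Fintype E]

/-- The product of the `z - ζ_i` over `i ≠ p`. -/
def lagr (ζ : Fin K → ℂ) (p : Fin K) : Polynomial ℂ := ∏ i ∈ Finset.univ.erase p, (X - C (ζ i))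

theorem lagr_eval (ζ : Fin K → ℂ) {p i : Fin K} (h : i ≠ p) : (lagr ζ p).eval (ζ i) = 0 := by
  rw [lagr, Polynomial.eval_prod]
  exact Finset.prod_eq_zero (Finset.mem_erase.mpr ⟨h, Finset.mem_univ i⟩) (by simp)

theorem lagr_eval_ne_zero {ζ : Fin K → ℂ} (hζ : Function.Injective ζ) (p : Fin K) :
    (lagr ζ p).eval (ζ p) ≠ 0 := by
  rw [lagr, Polynomial.eval_prod]
  refine Finset.prod_ne_zero_iff.mpr fun i hi => ?_
  simp only [Polynomial.eval_sub, Polynomial.eval_X, Polynomial.eval_C]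
  exact sub_ne_zero.mpr fun h => Finset.ne_of_mem_erase hi (hζ h).symm

theorem sum_rev_eq (P : Polynomial ℂ) (hP : P.natDegree < K) :
    ∑ i : Fin K, C (P.coeff (K - 1 - (i : ℕ))) * X ^ (K - 1 - (i : ℕ)) = P := by
  conv_rhs => rw [P.as_sum_range' K hP]
  rw [Finset.sum_range, ← Equiv.sum_comp Fin.revPerm fun i : Fin K =>
    Polynomial.monomial (i : ℕ) (P.coeff i)]
  refine Finset.sum_congr rfl fun i _ => ?_
  have : (Fin.revPerm i : ℕ) = K - 1 - (i : ℕ) := by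
    rw [Fin.revPerm_apply, Fin.val_rev]; omega
  rw [this, Polynomial.C_mul_X_pow_eq_monomial]

theorem lagr_natDegree (ζ : Fin K → ℂ) (p : Fin K) : (lagr ζ p).natDegree < K := by
  rw [lagr, Polynomial.natDegree_prod_of_monic _ _ fun i _ => Polynomial.monic_X_sub_C _]
  have := p.2
  simp
  omega

/-- The divisibility conditions at distinct points. -/
def qz (q0 : N → Polynomial ℂ) (s : N → ℕ) (ζ : Fin K → ℂ) (k : Fin K → ℤ) (x : N) (n : ℕ) :
    Polynomial ℂ :=
  q0 x * ∏ i, (X - C (ζ i)) ^ ((s x : ℤ) + n - k i).toNat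

/-- At `ζ_i` each factor `lagr ζ (a t)` vanishes once unless `a t = i`. By injectivity at most one
`t` is lost, only for `i ∈ α`, and this loss is compensated by the lowered level `k_i`. -/
theorem qz_dvd (q0 : N → Polynomial ℂ) (s : N → ℕ) (ζ : Fin K → ℂ) (k : Fin K → ℤ) (x : N)
    {j : ℕ} (a : Fin j → Fin K) (ha : Function.Injective a) (α : Finset (Fin K))
    (hα : ∀ t, a t ∈ α) (T : Finset (Fin j)) :
    qz q0 s ζ k x T.card ∣ qz q0 s ζ (lower k α) x 0 * ∏ t ∈ T, lagr ζ (a t) := by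
  have h1 : ∏ t ∈ T, lagr ζ (a t)
      = ∏ i, (X - C (ζ i)) ^ (T.filter fun t => a t ≠ i).card := by
    have : ∀ t ∈ T, lagr ζ (a t) = ∏ i, if a t ≠ i then X - C (ζ i) else 1 := by
      intro t _
      rw [lagr, ← Finset.prod_filter]
      congr 1
      ext i
      simp [eq_comm]
    rw [Finset.prod_congr rfl this, Finset.prod_comm]
    refine Finset.prod_congr rfl fun i _ => ?_
    rw [← Finset.prod_filter, Finset.prod_const]
  rw [h1, qz, qz, mul_assoc, ← Finset.prod_mul_distrib]
  refine mul_dvd_mul_left _ (Finset.prod_dvd_prod_of_dvd _ _ fun i _ => ?_)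
  rw [← pow_add]
  refine pow_dvd_pow _ ?_
  have h2 := Finset.card_filter_add_card_filter_not (s := T) (fun t => a t ≠ i)
  have h3 : (T.filter fun t => ¬ a t ≠ i).card ≤ if i ∈ α then 1 else 0 := by
    split_ifs with h
    · rw [Finset.card_le_one]
      intro t ht u hu
      apply ha
      have h4 := (Finset.mem_filter.mp ht).2
      have h5 := (Finset.mem_filter.mp hu).2
      push Not at h4 h5
      rw [h4, h5]
    · rw [Nat.le_zero, Finset.card_eq_zero, Finset.filter_eq_empty_iff]
      intro t _
      push Not
      rintro rfl
      exact h (hα t)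
  simp only [lower]
  split_ifs at h3 ⊢ with h
  · push_cast
    omega
  · push_cast
    omega

/-- The determinant of the Lagrange polynomials at the points in `α`. -/
def lagrDet (ζ : Fin K → ℂ) {j : ℕ} (a : Fin j → Fin K) (v : Fin j → Fin K) : ℂ :=
  (Matrix.of fun t s : Fin j => (lagr ζ (a t)).coeff (K - 1 - (v s : ℕ))).det

theorem lagrDet_comp (ζ : Fin K → ℂ) {j : ℕ} (a v : Fin j → Fin K) (g : Equiv.Perm (Fin j)) :
    lagrDet ζ a (v ∘ g) = ((Equiv.Perm.sign g : ℤ) : ℂ) * lagrDet ζ a v := by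
  rw [lagrDet, lagrDet, ← Matrix.det_permute']
  rfl

/-- Pairing the determinant with a product over the slots pairs each Lagrange polynomial with its
slot. With `z^{K-1-i}` in a slot this reproduces the Lagrange polynomial itself, which explains the
reversed coefficients in `lagrDet`. -/
theorem sum_lagrDet (ζ : Fin K → ℂ) {j : ℕ} (a : Fin j → Fin K)
    (y : Fin j → Fin K → Polynomial ℂ) :
    ∑ v : Fin j → Fin K, C (lagrDet ζ a v) * ∏ s, y s (v s)
      = ∑ g : Equiv.Perm (Fin j), ((Equiv.Perm.sign g : ℤ) : Polynomial ℂ) *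
        ∏ s, ∑ i : Fin K, C ((lagr ζ (a (g s))).coeff (K - 1 - (i : ℕ))) * y s i := by
  have h1 : ∀ v : Fin j → Fin K, C (lagrDet ζ a v) * ∏ s, y s (v s)
      = ∑ g : Equiv.Perm (Fin j), ((Equiv.Perm.sign g : ℤ) : Polynomial ℂ) *
        ∏ s, C ((lagr ζ (a (g s))).coeff (K - 1 - (v s : ℕ))) * y s (v s) := by
    intro v
    rw [lagrDet, Matrix.det_apply', map_sum, Finset.sum_mul]
    refine Finset.sum_congr rfl fun g _ => ?_
    rw [Finset.prod_mul_distrib, map_mul, map_prod, mul_assoc]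
    simp
  rw [Finset.sum_congr rfl fun v _ => h1 v, Finset.sum_comm]
  refine Finset.sum_congr rfl fun g _ => ?_
  rw [← Finset.mul_sum, Finset.prod_univ_sum, Fintype.piFinset_univ]

theorem lagrDet_mul_mem (S0 : Submodule ℂ (E → ℂ)) (c : N → E → Polynomial ℂ)
    (q0 : N → Polynomial ℂ) (s : N → ℕ) (ζ : Fin K → ℂ) (k : Fin K → ℤ) (j : ℕ) (d : ℤ)
    (a : Fin j → Fin K) (ha : Function.Injective a) (α : Finset (Fin K)) (hα : ∀ t, a t ∈ α)
    {g : E → ℂ} (hg : g ∈ S0 ⊓ sol c fun x => qz q0 s ζ (lower k α) x 0) :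
    (fun y : (Fin j → Fin K) × E => lagrDet ζ a y.1 * g y.2) ∈
      altSol (fun _ => S0) c (qz q0 s ζ k) j K d := by
  refine ⟨fun π v ε => ?_, fun v => ?_, fun v t ht => absurd (v t).2 (by omega), fun x => ?_⟩
  · change lagrDet ζ a (v ∘ π) * g ε = _ * (lagrDet ζ a v * g ε)
    rw [lagrDet_comp, mul_assoc]
  · exact Submodule.smul_mem _ (lagrDet ζ a v) hg.1
  · obtain ⟨x, T, r⟩ := x
    have h1 : ∑ y : (Fin j → Fin K) × E, (lagrDet ζ a y.1 * g y.2) • extC c (x, T, r) y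
        = (∑ v, C (lagrDet ζ a v) * slot T r v) * ∑ ε, g ε • c x ε := by
      rw [Fintype.sum_prod_type, Finset.sum_mul_sum]
      refine Finset.sum_congr rfl fun v _ => Finset.sum_congr rfl fun ε _ => ?_
      simp only [extC, Polynomial.smul_eq_C_mul, map_mul]
      ring
    rw [h1]
    simp only [slot]
    rw [sum_lagrDet ζ a fun s i =>
      if s ∈ T then X ^ (K - 1 - (i : ℕ)) else if i = r s then (1 : Polynomial ℂ) else 0,
      Finset.sum_mul]
    refine Finset.dvd_sum fun π _ => ?_
    rw [mul_assoc]
    refine Dvd.dvd.mul_left ?_ _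
    have h2 : ∏ t ∈ T, lagr ζ (a (π t)) ∣ ∏ t, ∑ i : Fin K,
        C ((lagr ζ (a (π t))).coeff (K - 1 - (i : ℕ))) *
        (if t ∈ T then X ^ (K - 1 - (i : ℕ)) else if i = r t then (1 : Polynomial ℂ) else 0) := by
      rw [← Finset.prod_mul_prod_compl T]
      refine Dvd.dvd.mul_right (dvd_of_eq (Finset.prod_congr rfl fun t ht => ?_)) _
      simp only [ht, if_true]
      rw [sum_rev_eq _ (lagr_natDegree ζ _)]
    rw [mul_comm]
    refine (qz_dvd q0 s ζ k x (a ∘ π) (ha.comp π.injective) α (fun t => hα _) T).trans ?_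
    exact mul_dvd_mul (hg.2 x) h2

/-- Lower bound for the alternating functions at distinct points, by Lagrange interpolation. -/
theorem sum_finrank_le_altSol (S0 : Submodule ℂ (E → ℂ)) (c : N → E → Polynomial ℂ)
    (q0 : N → Polynomial ℂ) (s : N → ℕ) {ζ : Fin K → ℂ} (hζ : Function.Injective ζ)
    (k : Fin K → ℤ) (j : ℕ) (d : ℤ) :
    ∑ α ∈ Finset.powersetCard j (Finset.univ : Finset (Fin K)),
      Module.finrank ℂ (S0 ⊓ sol c fun x => qz q0 s ζ (lower k α) x 0 : Submodule ℂ (E → ℂ))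
      ≤ Module.finrank ℂ (altSol (K := K) (fun _ => S0) c (qz q0 s ζ k) j K d) := by
  let I := {α // α ∈ Finset.powersetCard j (Finset.univ : Finset (Fin K))}
  let A : I → Submodule ℂ (E → ℂ) := fun α => S0 ⊓ sol c fun x => qz q0 s ζ (lower k α.1) x 0
  let emb : I → Fin j → Fin K := fun α =>
    α.1.orderEmbOfFin (Finset.mem_powersetCard.mp α.2).2
  have hemb : ∀ α : I, ∀ t, emb α t ∈ α.1 := fun α t => Finset.orderEmbOfFin_mem _ _ _
  have hinj : ∀ α : I, Function.Injective (emb α) := fun α => (Finset.orderEmbOfFin _ _).injective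
  let Φ : (∀ α, A α) →ₗ[ℂ] ((Fin j → Fin K) × E → ℂ) :=
    { toFun := fun g y => ∑ α, lagrDet ζ (emb α) y.1 * (g α : E → ℂ) y.2
      map_add' := fun g g' => by
        ext y
        simp [mul_add, Finset.sum_add_distrib]
      map_smul' := fun b g => by
        ext y
        simp [Finset.mul_sum, mul_left_comm] }
  have h1 : ∑ α ∈ Finset.powersetCard j (Finset.univ : Finset (Fin K)),
      Module.finrank ℂ (S0 ⊓ sol c fun x => qz q0 s ζ (lower k α) x 0 : Submodule ℂ (E → ℂ))
      = Module.finrank ℂ (⊤ : Submodule ℂ (∀ α, A α)) := by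
    rw [finrank_top, Module.finrank_pi_fintype, ← Finset.sum_coe_sort]
  rw [h1]
  refine finrank_le_of_map Φ (fun g _ => ?_) fun g _ hg => ?_
  · have : Φ g = ∑ α, fun y : (Fin j → Fin K) × E => lagrDet ζ (emb α) y.1 * (g α : E → ℂ) y.2 := by
      ext y
      simp [Φ]
    rw [this]
    exact Submodule.sum_mem _ fun α _ =>
      lagrDet_mul_mem S0 c q0 s ζ k j d (emb α) (hinj α) α.1 (hemb α) (g α).2
  · funext β
    ext ε
    -- Evaluating all the slots at the points of `β` isolates the summand `α = β`: the matrix of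
    -- values of the Lagrange polynomials of `α` has a zero column if `α ≠ β`, and is diagonal and
    -- invertible if `α = β`.
    have h2 : ∑ v : Fin j → Fin K, (∏ t, C (ζ (emb β t) ^ (K - 1 - (v t : ℕ)))) * C (Φ g (v, ε))
        = 0 := by
      rw [hg]
      simp
    have h3 : ∑ v : Fin j → Fin K, (∏ t, C (ζ (emb β t) ^ (K - 1 - (v t : ℕ)))) * C (Φ g (v, ε))
        = ∑ α, (∑ v : Fin j → Fin K, C (lagrDet ζ (emb α) v) *
          ∏ t, C (ζ (emb β t) ^ (K - 1 - (v t : ℕ)))) * C ((g α : E → ℂ) ε) := by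
      simp only [Finset.sum_mul]
      rw [Finset.sum_comm]
      refine Finset.sum_congr rfl fun v _ => ?_
      simp only [Φ, LinearMap.coe_mk, AddHom.coe_mk, map_sum, map_mul, Finset.mul_sum]
      refine Finset.sum_congr rfl fun α _ => ?_
      ring
    have h4 : ∀ α, ∑ v : Fin j → Fin K, C (lagrDet ζ (emb α) v) *
        ∏ t, C (ζ (emb β t) ^ (K - 1 - (v t : ℕ)))
        = C ((Matrix.of fun t u : Fin j => (lagr ζ (emb α t)).eval (ζ (emb β u))).det) := by
      intro α
      rw [sum_lagrDet ζ (emb α) fun t i => C (ζ (emb β t) ^ (K - 1 - (i : ℕ))), Matrix.det_apply',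
        map_sum]
      refine Finset.sum_congr rfl fun π _ => ?_
      rw [map_mul, map_prod]
      congr 1
      refine Finset.prod_congr rfl fun t _ => ?_
      rw [Matrix.of_apply]
      conv_rhs => rw [← sum_rev_eq _ (lagr_natDegree ζ (emb α (π t)))]
      simp [Polynomial.eval_finsetSum]
    have h5 : ∀ α, α ≠ β →
        (Matrix.of fun t u : Fin j => (lagr ζ (emb α t)).eval (ζ (emb β u))).det = 0 := by
      intro α hα
      obtain ⟨u, hu⟩ : ∃ u, emb β u ∉ α.1 := by
        by_contra! h
        apply hα
        have hsub : β.1 ⊆ α.1 := by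
          intro i hi
          have : i ∈ Set.range (emb β) := by
            simp only [emb]
            rw [Finset.range_orderEmbOfFin]
            exact hi
          obtain ⟨u, rfl⟩ := this
          exact h u
        refine Subtype.ext (Finset.eq_of_subset_of_card_le hsub ?_).symm
        rw [(Finset.mem_powersetCard.mp α.2).2, (Finset.mem_powersetCard.mp β.2).2]
      refine Matrix.det_eq_zero_of_column_eq_zero u fun t => ?_
      rw [Matrix.of_apply]
      exact lagr_eval ζ fun h => hu (h ▸ hemb α t)
    have h6 : (Matrix.of fun t u : Fin j => (lagr ζ (emb β t)).eval (ζ (emb β u))).det ≠ 0 := by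
      have : (Matrix.of fun t u : Fin j => (lagr ζ (emb β t)).eval (ζ (emb β u)))
          = Matrix.diagonal fun t => (lagr ζ (emb β t)).eval (ζ (emb β t)) := by
        ext t u
        rw [Matrix.of_apply]
        by_cases h : t = u
        · subst h; simp
        · rw [Matrix.diagonal_apply_ne _ h]
          exact lagr_eval ζ fun h' => h (hinj β h').symm
      rw [this, Matrix.det_diagonal]
      exact Finset.prod_ne_zero_iff.mpr fun t _ => lagr_eval_ne_zero hζ _
    rw [h3, Finset.sum_eq_single β] at h2
    · rw [h4, ← map_mul, Polynomial.C_eq_zero, mul_eq_zero] at h2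
      exact h2.resolve_left h6
    · intro α _ hα
      rw [h4, h5 α hα]
      simp
    · simp

end Lagrange

/-! ### The permutation action on functions of a multi-index. -/

section Symmetric

variable {K : ℕ} {E N : Type*}

/-- The functions that are symmetric in the multi-index. -/
def symFun (τ : Type*) (K : ℕ) (E : Type*) : Submodule ℂ ((τ → Fin K) × E → ℂ) where
  carrier := {f | ∀ (g : Equiv.Perm τ) i ε, f (i ∘ g, ε) = f (i, ε)}
  add_mem' := fun {p q} hp hq g i ε => by simp [hp g i ε, hq g i ε]
  zero_mem' := fun g i ε => rfl
  smul_mem' := fun a p hp g i ε => by simp [hp g i ε]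

variable {τ : Type*} [Fintype τ]

def extDeg (deg : E → ℕ) : (τ → Fin K) × E → ℕ := fun y => ∑ t, (y.1 t : ℕ) + deg y.2

/-- The functions supported in degree `d`, or all functions. -/
def grade (graded : Bool) (deg : E → ℕ) (d : ℤ) : Submodule ℂ (E → ℂ) :=
  if graded then homog deg d else ⊤

variable [Fintype E] [DecidableEq τ]

/-- The functions of a multi-index satisfying the conditions `c`, without symmetry. -/
def multiSol (τ : Type*) [Fintype τ] [DecidableEq τ] (graded : Bool) (deg : E → ℕ)
    (c : N → E → Polynomial ℂ) (Q : N → ℕ → Polynomial ℂ) (d : ℤ) :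
    Submodule ℂ ((τ → Fin K) × E → ℂ) :=
  grade graded (extDeg deg) d ⊓ sol (extC c) fun x => extQ Q x 0

omit [Fintype E] in
theorem slot_comp (T : Finset τ) (r i : τ → Fin K) (g : Equiv.Perm τ) :
    slot T r (i ∘ g) = slot (T.map g.toEmbedding) (r ∘ g.symm) i := by
  rw [slot, slot, ← Equiv.prod_comp g fun t => if t ∈ T.map g.toEmbedding then
    (X : Polynomial ℂ) ^ (K - 1 - (i t : ℕ)) else if i t = (r ∘ g.symm) t then 1 else 0]
  refine Finset.prod_congr rfl fun t _ => ?_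
  simp

theorem comp_mem_multiSol {graded : Bool} {deg : E → ℕ}
    {c : N → E → Polynomial ℂ} {Q : N → ℕ → Polynomial ℂ} {d : ℤ} {f : (τ → Fin K) × E → ℂ}
    (hf : f ∈ multiSol τ graded deg c Q d) (g : Equiv.Perm τ) :
    (fun y : (τ → Fin K) × E => f (y.1 ∘ g, y.2)) ∈ multiSol τ graded deg c Q d := by
  refine ⟨?_, ?_⟩
  · have := hf.1
    cases graded
    · exact Submodule.mem_top
    · intro y hy
      refine this _ fun h => hy ?_
      rw [← h]
      simp only [extDeg, Function.comp_apply]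
      rw [Equiv.sum_comp g fun t => (y.1 t : ℕ)]
  · rintro ⟨x, T, r⟩
    have h1 := hf.2 (x, T.map g.symm.toEmbedding, r ∘ g)
    have h2 : ∑ y : (τ → Fin K) × E, f (y.1 ∘ g, y.2) • extC c (x, T, r) y
        = ∑ y : (τ → Fin K) × E, f y • extC c (x, T.map g.symm.toEmbedding, r ∘ g) y := by
      rw [Fintype.sum_prod_type, Fintype.sum_prod_type,
        ← (Equiv.arrowCongr g (Equiv.refl (Fin K))).sum_comp]
      refine Finset.sum_congr rfl fun i _ => Finset.sum_congr rfl fun ε _ => ?_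
      have e1 : (Equiv.arrowCongr g (Equiv.refl (Fin K)) i) ∘ g = i := by
        ext t; simp
      have e2 : slot T r (Equiv.arrowCongr g (Equiv.refl (Fin K)) i)
          = slot (T.map g.symm.toEmbedding) (r ∘ g) i := by
        have := slot_comp T r i g.symm
        rw [Equiv.symm_symm] at this
        rw [← this]
        rfl
      simp only [extC, e2]
      rw [e1]
    rw [h2]
    simpa [extQ] using h1

/-- The action of the permutations of the indices. -/
def permRep (τ : Type*) [Fintype τ] [DecidableEq τ] (graded : Bool) (deg : E → ℕ)
    (c : N → E → Polynomial ℂ) (Q : N → ℕ → Polynomial ℂ) (d : ℤ) :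
    Equiv.Perm τ →* Module.End ℂ (multiSol (K := K) τ graded deg c Q d) where
  toFun g :=
    { toFun := fun f => ⟨fun y => (f : (τ → Fin K) × E → ℂ) (y.1 ∘ g, y.2),
        comp_mem_multiSol f.2 g⟩
      map_add' := fun _ _ => rfl
      map_smul' := fun _ _ => rfl }
  map_one' := rfl
  map_mul' := fun _ _ => rfl

end Symmetric

/-! ### Hook parts of that action as spaces of alternating functions. -/

section Hook

variable {K : ℕ} {E N : Type*} {τ : Type*} [Fintype τ] [DecidableEq τ] {j m : ℕ}

/-- The splitting of a multi-index along a splitting of the set of indices. -/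
def splitIndex (K : ℕ) (E : Type*) (e : τ ≃ Fin j ⊕ Fin m) :
    (Fin j → Fin K) × (Fin m → Fin K) × E ≃ (τ → Fin K) × E where
  toFun y := (Sum.elim y.1 y.2.1 ∘ e, y.2.2)
  invFun y := (y.1 ∘ e.symm ∘ Sum.inl, y.1 ∘ e.symm ∘ Sum.inr, y.2)
  left_inv y := by
    refine Prod.ext ?_ (Prod.ext ?_ rfl) <;> (funext t; simp)
  right_inv y := by
    refine Prod.ext ?_ rfl
    funext t
    obtain ⟨a, rfl⟩ := e.symm.surjective t
    rcases a with a | a <;> simp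

theorem slot_splitIndex (e : τ ≃ Fin j ⊕ Fin m) (T1 : Finset (Fin j)) (T2 : Finset (Fin m))
    (r1 v : Fin j → Fin K) (r2 u : Fin m → Fin K) :
    slot ((T1.disjSum T2).map e.symm.toEmbedding) (Sum.elim r1 r2 ∘ e) (Sum.elim v u ∘ e)
      = slot T1 r1 v * slot T2 r2 u := by
  rw [slot, ← Equiv.prod_comp e.symm, Fintype.prod_sum_type, slot, slot]
  congr 1 <;> refine Finset.prod_congr rfl fun t _ => ?_ <;> simp

theorem sum_splitIndex [Fintype E] (e : τ ≃ Fin j ⊕ Fin m) (c : N → E → Polynomial ℂ)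
    (f : (τ → Fin K) × E → ℂ) (x : N)
    (T1 : Finset (Fin j)) (T2 : Finset (Fin m)) (r1 : Fin j → Fin K) (r2 : Fin m → Fin K) :
    ∑ y, f y • extC c (x, (T1.disjSum T2).map e.symm.toEmbedding, Sum.elim r1 r2 ∘ e) y
      = ∑ y, f (splitIndex K E e y) • extC (extC c) ((x, T2, r2), T1, r1) y := by
  rw [← (splitIndex K E e).sum_comp]
  refine Finset.sum_congr rfl fun y _ => ?_
  congr 1
  simp only [extC, splitIndex, Equiv.coe_fn_mk, slot_splitIndex, mul_assoc]

/-- Slots multiply and the sizes of the two parts of `T` add, so conditions on all indices at once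
are the same as conditions imposed on the two groups of indices in succession. -/
theorem sol_splitIndex [Fintype E] (e : τ ≃ Fin j ⊕ Fin m) (c : N → E → Polynomial ℂ)
    (Q : N → ℕ → Polynomial ℂ) (f : (τ → Fin K) × E → ℂ) :
    (f ∈ sol (extC c) fun x => extQ Q x 0) ↔
      (fun y => f (splitIndex K E e y)) ∈ sol (extC (extC c)) fun x => extQ (extQ Q) x 0 := by
  constructor
  · rintro h ⟨⟨x, T2, r2⟩, T1, r1⟩
    rw [← sum_splitIndex]
    have := h (x, (T1.disjSum T2).map e.symm.toEmbedding, Sum.elim r1 r2 ∘ e)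
    simpa [extQ, add_comm] using this
  · rintro h ⟨x, T, r⟩
    have h1 := h ((x, (T.map e.toEmbedding).toRight, r ∘ e.symm ∘ Sum.inr),
      (T.map e.toEmbedding).toLeft, r ∘ e.symm ∘ Sum.inl)
    rw [← sum_splitIndex, Finset.toLeft_disjSum_toRight] at h1
    have e1 : (T.map e.toEmbedding).map e.symm.toEmbedding = T := by
      ext t; simp
    have e2 : Sum.elim (r ∘ e.symm ∘ Sum.inl) (r ∘ e.symm ∘ Sum.inr) ∘ e = r := by
      funext t
      obtain ⟨a, rfl⟩ := e.symm.surjective t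
      rcases a with a | a <;> simp
    rw [e1, e2] at h1
    have e3 : (T.map e.toEmbedding).toRight.card + (T.map e.toEmbedding).toLeft.card
        = T.card := by
      rw [add_comm, Finset.card_toLeft_add_card_toRight, Finset.card_map]
    simpa [extQ, e3] using h1

omit [DecidableEq τ] in
theorem extDeg_splitIndex (e : τ ≃ Fin j ⊕ Fin m) (deg : E → ℕ)
    (y : (Fin j → Fin K) × (Fin m → Fin K) × E) :
    extDeg deg (splitIndex K E e y) = ∑ t, (y.1 t : ℕ) + extDeg deg y.2 := by
  simp only [extDeg, splitIndex, Equiv.coe_fn_mk, ← add_assoc]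
  congr 1
  rw [← Equiv.sum_comp e.symm, Fintype.sum_sum_type]
  simp

omit [DecidableEq τ] in
theorem grade_splitIndex (e : τ ≃ Fin j ⊕ Fin m) (graded : Bool) (deg : E → ℕ) (d : ℤ)
    (f : (τ → Fin K) × E → ℂ) :
    f ∈ grade graded (extDeg deg) d ↔ ∀ v : Fin j → Fin K,
      (fun y => f (splitIndex K E e (v, y))) ∈
        grade graded (extDeg deg) (d - ∑ t, ((v t : ℕ) : ℤ)) := by
  cases graded
  · simp [grade]
  · simp only [grade, if_true]
    constructor
    · intro h v y hy
      refine h _ fun h' => hy ?_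
      rw [extDeg_splitIndex] at h'
      push_cast at h'
      omega
    · intro h y hy
      obtain ⟨⟨v, u⟩, rfl⟩ := (splitIndex K E e).surjective y
      refine h v u fun h' => hy ?_
      rw [extDeg_splitIndex]
      push_cast
      omega

omit [Fintype τ] [DecidableEq τ] in
theorem splitIndex_sumCongr (e : τ ≃ Fin j ⊕ Fin m) (g : Equiv.Perm (Fin j))
    (g' : Equiv.Perm (Fin m)) (v : Fin j → Fin K) (u : Fin m → Fin K) (ε : E) :
    splitIndex K E e (v ∘ g, u ∘ g', ε)
      = ((splitIndex K E e (v, u, ε)).1 ∘ (e.permCongr.symm (Equiv.Perm.sumCongr g g')), ε) := by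
  refine Prod.ext ?_ rfl
  funext t
  rcases h : e t with a | a <;> simp [splitIndex, h]

omit [Fintype τ] [DecidableEq τ] in
theorem exists_sumCongr (e : τ ≃ Fin j ⊕ Fin m) {A : Finset τ}
    (he : ∀ t, t ∈ A ↔ (e t).isLeft = true) (σ : Equiv.Perm τ)
    (hσ : ∀ t, t ∈ A ↔ σ t ∈ A) :
    ∃ g g', σ = e.permCongr.symm (Equiv.Perm.sumCongr g g') := by
  have h := Equiv.Perm.mem_sumCongrHom_range_of_perm_mapsTo_inl (σ := e.permCongr σ) (by
    rintro _ ⟨a, rfl⟩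
    have h1 : e.symm (Sum.inl a) ∈ A := (he _).mpr (by simp)
    have h2 := (he _).mp ((hσ _).mp h1)
    obtain ⟨b, hb⟩ := Sum.isLeft_iff.mp h2
    exact ⟨b, by simp [hb]⟩)
  obtain ⟨⟨g, g'⟩, h⟩ := h
  refine ⟨g, g', ?_⟩
  rw [Equiv.eq_symm_apply]
  exact h.symm

theorem sign_sumCongr_one (e : τ ≃ Fin j ⊕ Fin m) (g : Equiv.Perm (Fin j))
    (g' : Equiv.Perm (Fin m)) :
    Equiv.Perm.sign (e.permCongr.symm (Equiv.Perm.sumCongr g g'))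
      = Equiv.Perm.sign g * Equiv.Perm.sign g' := by
  rw [← Equiv.Perm.sign_permCongr e, Equiv.apply_symm_apply, Equiv.Perm.sign_sumCongr]

variable [Fintype E]

/-- Numbering `A` and its complement splits the multi-index. Alternation in `A` becomes alternation
in the outer indices, and symmetry off `A` becomes the requirement that the values be symmetric
functions of the inner indices. -/
theorem finrank_hookPart_permRep (graded : Bool) (deg : E → ℕ) (c : N → E → Polynomial ℂ)
    (Q : N → ℕ → Polynomial ℂ) (d : ℤ) (A : Finset τ) (m : ℕ) (hm : A.card + m = Fintype.card τ) :
    Module.finrank ℂ (hookPart (permRep (K := K) τ graded deg c Q d) A) =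
      Module.finrank ℂ (altSol (K := K) (fun d => symFun (Fin m) K E ⊓ grade graded (extDeg deg) d)
        (extC c) (extQ Q) A.card K d) := by
  classical
  obtain ⟨e, he⟩ : ∃ e : τ ≃ Fin A.card ⊕ Fin m, ∀ t, t ∈ A ↔ (e t).isLeft = true := by
    have e2 : {t // t ∉ A} ≃ Fin m := Fintype.equivFinOfCardEq (by
      rw [Fintype.card_subtype_compl, Fintype.card_coe]; omega)
    refine ⟨(Equiv.sumCompl (· ∈ A)).symm.trans (Equiv.sumCongr A.equivFin e2), fun t => ?_⟩
    by_cases h : t ∈ A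
    · simp [h]
    · simp [h]
  set V := multiSol (K := K) τ graded deg c Q d with hV
  have h0 : Module.finrank ℂ (hookPart (permRep (K := K) τ graded deg c Q d) A)
      = Module.finrank ℂ ((hookPart (permRep (K := K) τ graded deg c Q d) A).map V.subtype) :=
    (Submodule.equivMapOfInjective V.subtype V.injective_subtype _).finrank_eq
  have hR : ∀ (g : Equiv.Perm τ) (f : V) y,
      ((permRep (K := K) τ graded deg c Q d g f : V) : (τ → Fin K) × E → ℂ) y
        = (f : (τ → Fin K) × E → ℂ) (y.1 ∘ g, y.2) := fun g f y => rfl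
  rw [h0]
  apply le_antisymm
  · refine finrank_le_of_map (LinearMap.funLeft ℂ ℂ (splitIndex K E e)) ?_ ?_
    · rintro _ ⟨f, ⟨hf1, hf2⟩, rfl⟩
      refine ⟨?_, ?_, ?_, ?_⟩
      · rintro g v ⟨u, ε⟩
        have h1 := hf1 (e.permCongr.symm (Equiv.Perm.sumCongr g 1)) (by
          intro t ht
          rw [he, Bool.not_eq_true, Sum.isLeft_eq_false, Sum.isRight_iff] at ht
          obtain ⟨b, hb⟩ := ht
          rw [← Equiv.eq_symm_apply] at hb
          simp [hb])
        have h2 := congr_fun (congrArg Subtype.val h1) (splitIndex K E e (v, u, ε))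
        rw [hR] at h2
        have h3 := splitIndex_sumCongr (E := E) e g 1 v u ε
        simp only [LinearMap.funLeft_apply]
        have h4 : u ∘ (1 : Equiv.Perm (Fin m)) = u := rfl
        rw [h4] at h3
        rw [h3]
        refine h2.trans ?_
        rw [sign_sumCongr_one]
        simp
      · intro v
        refine ⟨?_, ?_⟩
        · intro g u ε
          have h1 := hf2 (e.permCongr.symm (Equiv.Perm.sumCongr 1 g)) (by
            intro t ht
            rw [he, Sum.isLeft_iff] at ht
            obtain ⟨b, hb⟩ := ht
            rw [← Equiv.eq_symm_apply] at hb
            simp [hb])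
          have h2 := congr_fun (congrArg Subtype.val h1) (splitIndex K E e (v, u, ε))
          rw [hR] at h2
          have h3 := splitIndex_sumCongr (E := E) e 1 g v u ε
          have h4 : v ∘ (1 : Equiv.Perm (Fin A.card)) = v := rfl
          rw [h4] at h3
          simp only [LinearMap.funLeft_apply]
          rw [h3]
          exact h2
        · exact (grade_splitIndex e graded deg d _).mp f.2.1 v
      · intro v t ht
        exact absurd (v t).2 (by omega)
      · exact (sol_splitIndex e c Q _).mp f.2.2
    · intro f _ hf
      have := LinearMap.funLeft_injective_of_surjective ℂ ℂ _ (splitIndex K E e).surjective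
      exact this (by rw [hf, map_zero])
  · refine finrank_le_of_map (LinearMap.funLeft ℂ ℂ (splitIndex K E e).symm) ?_ ?_
    · rintro F ⟨h1, h2, _, h4⟩
      set f : (τ → Fin K) × E → ℂ := LinearMap.funLeft ℂ ℂ (splitIndex K E e).symm F with hf
      have hfF : ∀ y, f (splitIndex K E e y) = F y := by
        intro y
        rw [hf, LinearMap.funLeft_apply, Equiv.symm_apply_apply]
      have hfV : f ∈ V := by
        refine ⟨(grade_splitIndex e graded deg d f).mpr fun v => ?_,
          (sol_splitIndex e c Q f).mpr ?_⟩
        · simp only [hfF]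
          exact (h2 v).2
        · simp only [hfF]
          exact h4
      refine ⟨⟨f, hfV⟩, ⟨?_, ?_⟩, rfl⟩
      · intro σ hσ
        -- A permutation that fixes the complement of `A` pointwise preserves `A`, so it splits; its
        -- second component is the identity.
        obtain ⟨g, g', rfl⟩ := exists_sumCongr e he σ (by
          intro t
          by_cases ht : t ∈ A
          · simp only [ht, true_iff]
            by_contra h
            have := hσ _ h
            rw [EmbeddingLike.apply_eq_iff_eq] at this
            rw [this] at h
            exact h ht
          · simp [ht, hσ t ht])
        have hg' : g' = 1 := by
          refine Equiv.ext fun a => ?_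
          have := hσ (e.symm (Sum.inr a)) (by rw [he]; simp)
          simpa using this
        subst hg'
        apply Subtype.ext
        funext y
        obtain ⟨⟨v, u, ε⟩, rfl⟩ := (splitIndex K E e).surjective y
        rw [hR]
        have h3 := splitIndex_sumCongr (E := E) e g 1 v u ε
        change f (_, ε) = _ * f _
        rw [← h3, hfF, hfF, sign_sumCongr_one]
        simpa using h1 g v (u, ε)
      · intro σ hσ
        obtain ⟨g, g', rfl⟩ := exists_sumCongr e he σ (by
          intro t
          by_cases ht : t ∈ A
          · simp [ht, hσ t ht]
          · simp only [ht, false_iff]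
            intro h
            have := hσ _ h
            rw [EmbeddingLike.apply_eq_iff_eq] at this
            rw [this] at h
            exact ht h)
        have hg : g = 1 := by
          refine Equiv.ext fun a => ?_
          have := hσ (e.symm (Sum.inl a)) (by rw [he]; simp)
          simpa using this
        subst hg
        apply Subtype.ext
        funext y
        obtain ⟨⟨v, u, ε⟩, rfl⟩ := (splitIndex K E e).surjective y
        rw [hR]
        have h3 := splitIndex_sumCongr (E := E) e 1 g' v u ε
        change f (_, ε) = f _
        rw [← h3, hfF, hfF]
        exact (h2 v).1 g' u ε
    · intro f _ hf
      have := LinearMap.funLeft_injective_of_surjective ℂ ℂ _ (splitIndex K E e).symm.surjective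
      exact this (by rw [hf, map_zero])

/-- The Euler characteristic of the spaces of functions that are alternating in `j` indices and
symmetric in `M - j` indices. -/
theorem sum_finrank_altSol (graded : Bool) (deg : E → ℕ) (c : N → E → Polynomial ℂ)
    (Q : N → ℕ → Polynomial ℂ) (d : ℤ) (M : ℕ) :
    ∑ j ∈ Finset.range (M + 2), (-1 : ℤ) ^ j * Module.finrank ℂ (altSol (K := K)
      (fun d => symFun (Fin (M + 1 - j)) K E ⊓ grade graded (extDeg deg) d)
        (extC c) (extQ Q) j K d) = 0 := by
  have := sum_finrank_hookPart (permRep (K := K) (Fin (M + 1)) graded deg c Q d)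
    (fun j => Module.finrank ℂ (altSol (K := K)
      (fun d => symFun (Fin (M + 1 - j)) K E ⊓ grade graded (extDeg deg) d)
        (extC c) (extQ Q) j K d)) fun A => by
      refine finrank_hookPart_permRep graded deg c Q d A _ ?_
      have := A.card_le_univ
      rw [Fintype.card_fin] at *
      omega
  simpa using this

end Hook

/-! ### The sandwich: equality of dimensions and the recursion. -/

section Core

variable {K : ℕ} {E N : Type*}

/-- Homogeneity of the slots: in `T` the exponent `K - 1 - i` and the degree `i` add up to `K - 1`,
while outside `T` the degree is the prescribed index. -/
theorem slot_coeff {τ : Type*} [Fintype τ] [DecidableEq τ] (T : Finset τ) (r v : τ → Fin K) (t : ℕ)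
    (h : (slot T r v).coeff t ≠ 0) :
    t + ∑ a, (v a : ℕ) = ∑ a, if a ∈ T then K - 1 else (r a : ℕ) := by
  have h1 : slot T r v = if (∀ a, a ∉ T → v a = r a) then X ^ (∑ a ∈ T, (K - 1 - (v a : ℕ)))
      else 0 := by
    split_ifs with h'
    · rw [slot, ← Finset.prod_pow_eq_pow_sum, ← Finset.prod_mul_prod_compl T]
      have e2 : ∀ a ∈ Tᶜ, (if a ∈ T then (X : Polynomial ℂ) ^ (K - 1 - (v a : ℕ))
          else if v a = r a then 1 else 0) = 1 := by
        intro a ha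
        rw [if_neg (Finset.mem_compl.mp ha), if_pos (h' a (Finset.mem_compl.mp ha))]
      rw [Finset.prod_congr rfl e2, Finset.prod_const_one, mul_one]
      exact Finset.prod_congr rfl fun a ha => if_pos ha
    · push Not at h'
      obtain ⟨a, ha, ha'⟩ := h'
      exact Finset.prod_eq_zero (Finset.mem_univ a) (by rw [if_neg ha, if_neg ha'])
  rw [h1] at h
  split_ifs at h with h'
  · rw [Polynomial.coeff_X_pow] at h
    have ht : t = ∑ a ∈ T, (K - 1 - (v a : ℕ)) := by
      by_contra hne
      exact h (if_neg hne)
    rw [ht, ← Finset.sum_add_sum_compl T fun a => (v a : ℕ), ← add_assoc, ← Finset.sum_add_distrib,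
      ← Finset.sum_add_sum_compl T fun a => if a ∈ T then K - 1 else (r a : ℕ)]
    congr 1
    · refine Finset.sum_congr rfl fun a ha => ?_
      have := (v a).2
      rw [if_pos ha]
      omega
    · refine Finset.sum_congr rfl fun a ha => ?_
      rw [if_neg (Finset.mem_compl.mp ha), h' a (Finset.mem_compl.mp ha)]
  · simp at h

theorem extC_coeff {τ : Type*} [Fintype τ] [DecidableEq τ] {c : N → E → Polynomial ℂ}
    {deg : E → ℕ} {e : N → ℕ} (hc : ∀ x ε t, (c x ε).coeff t ≠ 0 → t + deg ε = e x)
    (x : N × Finset τ × (τ → Fin K)) (y : (τ → Fin K) × E) (t : ℕ)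
    (h : (extC c x y).coeff t ≠ 0) :
    t + extDeg deg y = (∑ a, if a ∈ x.2.1 then K - 1 else (x.2.2 a : ℕ)) + e x.1 := by
  rw [extC, Polynomial.coeff_mul] at h
  obtain ⟨⟨u, u'⟩, hu, h'⟩ := Finset.exists_ne_zero_of_sum_ne_zero h
  replace hu : u + u' = t := Finset.HasAntidiagonal.mem_antidiagonal.mp hu
  have h1 := slot_coeff _ _ _ _ (left_ne_zero_of_mul h')
  have h2 := hc _ _ _ (right_ne_zero_of_mul h')
  rw [← h1, ← h2, ← hu, extDeg]
  ring

theorem extQ_qz {τ : Type*} (q0 : N → Polynomial ℂ) (s : N → ℕ) (ζ : Fin K → ℂ)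
    (k : Fin K → ℤ) :
    extQ (τ := τ) (K := K) (qz q0 s ζ k) = qz (fun x => q0 x.1) (fun x => s x.1 + x.2.1.card) ζ k := by
  funext x n
  simp only [extQ, qz]
  congr 1
  refine Finset.prod_congr rfl fun i _ => ?_
  congr 2
  push_cast
  ring

theorem extQ_vord {τ : Type*} (b s : N → ℕ) (k : Fin K → ℤ) :
    extQ (τ := τ) (K := K) (fun x n => X ^ vord b s k x n)
      = fun x n => X ^ vord (fun x => b x.1) (fun x => s x.1 + x.2.1.card) k x n := by
  funext x n
  simp only [extQ, vord]
  congr 2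
  refine Finset.sum_congr rfl fun i _ => ?_
  congr 1
  push_cast
  ring

theorem natDegree_qz {q0 : N → Polynomial ℂ} (hq : ∀ x, (q0 x).Monic) (s : N → ℕ) (ζ : Fin K → ℂ)
    (k : Fin K → ℤ) (x : N) (n : ℕ) :
    (qz q0 s ζ k x n).natDegree = vord (fun x => (q0 x).natDegree) s k x n := by
  have h : ∀ i ∈ (Finset.univ : Finset (Fin K)),
      ((X - C (ζ i)) ^ ((s x : ℤ) + n - k i).toNat).Monic :=
    fun i _ => (Polynomial.monic_X_sub_C _).pow _
  rw [qz, (hq x).natDegree_mul (Polynomial.monic_prod_of_monic _ _ h),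
    Polynomial.natDegree_prod_of_monic _ _ h, vord]
  congr 1
  refine Finset.sum_congr rfl fun i _ => ?_
  rw [(Polynomial.monic_X_sub_C _).natDegree_pow, Polynomial.natDegree_X_sub_C, mul_one]

theorem qz_comp (q0 : N → Polynomial ℂ) (s : N → ℕ) (ζ : Fin K → ℂ) (k : Fin K → ℤ)
    (σ : Equiv.Perm (Fin K)) : qz q0 s (ζ ∘ σ) (k ∘ σ) = qz q0 s ζ k := by
  funext x n
  simp only [qz, Function.comp_apply]
  rw [Equiv.prod_comp σ fun i => (X - C (ζ i)) ^ ((s x : ℤ) + n - k i).toNat]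

theorem vord_comp (b s : N → ℕ) (k : Fin K → ℤ) (σ : Equiv.Perm (Fin K)) :
    vord b s (k ∘ σ) = vord b s k := by
  funext x n
  simp only [vord, Function.comp_apply]
  rw [Equiv.sum_comp σ fun i => ((s x : ℤ) + n - k i).toNat]

variable [Fintype E]

/-- Semicontinuity for the alternating functions. -/
theorem finrank_altSol_le_sum {S : Submodule ℂ (E → ℂ)} {deg : E → ℕ}
    (hS : ∀ d, ∀ p ∈ S, component deg d p ∈ S) {c : N → E → Polynomial ℂ} {e : N → ℕ}
    (hc : ∀ x ε t, (c x ε).coeff t ≠ 0 → t + deg ε = e x) (Q : N → ℕ → Polynomial ℂ)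
    (j : ℕ) {B : ℕ} (hB : ∀ y : (Fin j → Fin K) × E, extDeg deg y < B) :
    Module.finrank ℂ (altSol (K := K) (fun d => S ⊓ grade false deg d) c Q j K 0) ≤
      ∑ d ∈ Finset.range B, Module.finrank ℂ (altSol (K := K) (fun d => S ⊓ grade true deg d) c
        (fun x n => X ^ (Q x n).natDegree) j K d) := by
  set A : Submodule ℂ ((Fin j → Fin K) × E → ℂ) :=
    altSol (K := K) (fun _ => S) c (fun _ _ => 1) j K 0 with hA
  have h1 : altSol (K := K) (fun d => S ⊓ grade false deg d) c Q j K 0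
      ≤ A ⊓ sol (extC c) fun x => extQ Q x 0 := by
    rintro f ⟨h1, h2, h3, h4⟩
    exact ⟨⟨h1, fun v => (h2 v).1, h3, fun x => one_dvd _⟩, h4⟩
  refine (Submodule.finrank_mono h1).trans ((finrank_sol_le (extC_coeff hc) (S := A) ?_ hB).trans
    (Finset.sum_le_sum fun d _ => Submodule.finrank_mono ?_))
  · rintro d f ⟨h1, h2, h3, h4⟩
    refine ⟨fun g v ε => ?_, fun v => ?_, fun v t ht => absurd (v t).2 (by omega),
      fun x => one_dvd _⟩
    · have e1 : extDeg deg (v ∘ g, ε) = extDeg deg (v, ε) := by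
        simp only [extDeg, Function.comp_apply]
        rw [Equiv.sum_comp g fun t => (v t : ℕ)]
      simp only [component_apply, e1, h1 g v ε]
      split_ifs <;> simp
    · by_cases hd : ∑ t, (v t : ℕ) ≤ d
      · have := hS (d - ∑ t, (v t : ℕ)) _ (h2 v)
        convert this using 1
        funext ε
        simp only [component_apply, extDeg]
        congr 1
        exact propext ⟨by omega, by omega⟩
      · convert S.zero_mem using 1
        funext ε
        rw [component_apply, if_neg]
        · rfl
        · simp only [extDeg]
          omega
  · rintro f ⟨⟨⟨h1, h2, h3, _⟩, h5⟩, h4⟩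
    refine ⟨h1, fun v => ⟨h2 v, fun ε hε => h5 (v, ε) fun h => hε ?_⟩, h3, h4⟩
    simp only [extDeg] at h
    push_cast at h
    omega

variable (deg : E → ℕ) (c : N → E → Polynomial ℂ) (q0 : N → Polynomial ℂ) (b s : N → ℕ)
  (ζ : Fin K → ℂ) (k : Fin K → ℤ)

/-- The dimension of the space of functions that are symmetric in `m` indices, at distinct
points. -/
def dimZ (m : ℕ) : ℕ := Module.finrank ℂ (symFun (Fin m) K E ⊓
  sol (extC c) fun x => extQ (qz q0 s ζ k) x 0 : Submodule ℂ ((Fin m → Fin K) × E → ℂ))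

/-- The dimension of the space of functions that are symmetric in `m` indices, at the degenerate
point, in degree `d`. -/
def dimO (m : ℕ) (d : ℤ) : ℕ := Module.finrank ℂ ((symFun (Fin m) K E ⊓ homog (extDeg deg) d) ⊓
  sol (extC c) fun x => extQ (fun x n => X ^ vord b s k x n) x 0 :
    Submodule ℂ ((Fin m → Fin K) × E → ℂ))

theorem dimO_of_neg (m : ℕ) {d : ℤ} (hd : d < 0) : dimO deg c b s k m d = 0 := by
  have : homog (extDeg (τ := Fin m) (K := K) deg) d = ⊥ := by
    rw [eq_bot_iff]
    intro p hp
    rw [Submodule.mem_bot]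
    funext y
    exact hp y (by omega)
  rw [dimO, this]
  simp

omit [Fintype E] in
theorem component_mem_symFun {m : ℕ} (d : ℕ) (p : (Fin m → Fin K) × E → ℂ)
    (hp : p ∈ symFun (Fin m) K E) : component (extDeg deg) d p ∈ symFun (Fin m) K E := by
  intro g i ε
  have e1 : extDeg deg (i ∘ g, ε) = extDeg deg (i, ε) := by
    simp only [extDeg, Function.comp_apply]
    rw [Equiv.sum_comp g fun t => (i t : ℕ)]
  simp only [component_apply, e1, hp g i ε]

/-- A shift to the right can only push mass out of the window `[0, B)`. An inequality suffices for
the circle of bounds in `core_step`. -/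
theorem sum_int_shift_le (u : ℕ) : ∀ (f : ℤ → ℕ), (∀ d < 0, f d = 0) → ∀ B : ℕ,
    ∑ d ∈ Finset.range B, f (d - u) ≤ ∑ d ∈ Finset.range B, f d := by
  induction u with
  | zero => simp
  | succ u ih =>
    intro f hf B
    have h1 := ih (fun d => f (d - 1)) (fun d hd => hf _ (by omega)) B
    have h2 : ∑ d ∈ Finset.range B, f (d - (u + 1 : ℕ))
        = ∑ d ∈ Finset.range B, f ((d : ℤ) - u - 1) :=
      Finset.sum_congr rfl fun d _ => by congr 1; push_cast; ring
    rw [h2]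
    refine h1.trans ?_
    rcases B with _ | B
    · simp
    · rw [Finset.sum_range_succ', Finset.sum_range_succ]
      refine add_le_add (Finset.sum_le_sum fun d _ => ?_) ?_
      · simp
      · rw [hf _ (by simp)]
        exact Nat.zero_le _

/-- The equality of dimensions for `M + 1` symmetric indices, and the recursion in each degree, from
the equality of dimensions for fewer indices. -/
theorem core_step {e : N → ℕ} (hc : ∀ x ε t, (c x ε).coeff t ≠ 0 → t + deg ε = e x)
    (hq : ∀ x, (q0 x).Monic) (hb : b = fun x => (q0 x).natDegree) (hζ : Function.Injective ζ)
    (hk : Antitone k) (M B : ℕ) (hB : ∀ ε, (M + 1) * K + deg ε < B)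
    (ih : ∀ m ≤ M, ∀ k', dimZ c q0 s ζ k' m = ∑ d ∈ Finset.range B, dimO deg c b s k' m d) :
    dimZ c q0 s ζ k (M + 1) = ∑ d ∈ Finset.range B, dimO deg c b s k (M + 1) d ∧
    ∀ d ∈ Finset.range B, ∑ j ∈ Finset.range (M + 2), (-1 : ℤ) ^ j *
      ∑ α ∈ Finset.powersetCard j (Finset.univ : Finset (Fin K)),
        (dimO deg c b s (lower k α) (M + 1 - j) (d - ∑ i ∈ α, ((i : ℕ) : ℤ)) : ℤ) = 0 := by
  set aZ : ℕ → ℕ := fun j => Module.finrank ℂ (altSol (K := K)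
    (fun d => symFun (Fin (M + 1 - j)) K E ⊓ grade false (extDeg deg) d)
      (extC c) (extQ (qz q0 s ζ k)) j K 0) with haZ
  set aO : ℕ → ℕ → ℕ := fun j d => Module.finrank ℂ (altSol (K := K)
    (fun d => symFun (Fin (M + 1 - j)) K E ⊓ grade true (extDeg deg) d)
      (extC c) (extQ fun x n => X ^ vord b s k x n) j K d) with haO
  set rO : ℕ → ℕ → ℕ := fun j d =>
    ∑ α ∈ Finset.powersetCard j (Finset.univ : Finset (Fin K)),
      dimO deg c b s (lower k α) (M + 1 - j) (d - ∑ i ∈ α, ((i : ℕ) : ℤ)) with hrO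
  have hKZ : ∑ j ∈ Finset.range (M + 2), (-1 : ℤ) ^ j * aZ j = 0 :=
    sum_finrank_altSol false deg c _ 0 M
  have hKO : ∀ d, ∑ j ∈ Finset.range (M + 2), (-1 : ℤ) ^ j * aO j d = 0 := fun d =>
    sum_finrank_altSol true deg c _ d M
  -- Semicontinuity. The bound `B` exceeds every degree, since `j` alternating and `M + 1 - j`
  -- symmetric indices contribute at most `(M + 1) * K`.
  have hS : ∀ j ≤ M + 1, aZ j ≤ ∑ d ∈ Finset.range B, aO j d := by
    intro j hj
    have := finrank_altSol_le_sum (S := symFun (Fin (M + 1 - j)) K E) (deg := extDeg deg)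
      (c := extC c) (e := fun x => (∑ a, if a ∈ x.2.1 then K - 1 else (x.2.2 a : ℕ)) + e x.1)
      (fun d p hp => component_mem_symFun deg d p hp) (extC_coeff hc) (extQ (qz q0 s ζ k)) j (B := B)
      (by
        intro y
        have h1 : ∑ t, (y.1 t : ℕ) ≤ j * K := by
          refine (Finset.sum_le_card_nsmul _ _ K fun t _ => (y.1 t).2.le).trans ?_
          simp
        have h2 : ∑ t, (y.2.1 t : ℕ) ≤ (M + 1 - j) * K := by
          refine (Finset.sum_le_card_nsmul _ _ K fun t _ => (y.2.1 t).2.le).trans ?_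
          simp
        have h3 : j * K + (M + 1 - j) * K = (M + 1) * K := by
          rw [← add_mul]; congr 1; omega
        have h4 := hB y.2.2
        simp only [extDeg]
        omega)
    have hQ : (fun x n => X ^ (extQ (τ := Fin (M + 1 - j)) (K := K) (qz q0 s ζ k) x n).natDegree)
        = extQ (fun x n => (X : Polynomial ℂ) ^ vord b s k x n) := by
      funext x n
      simp only [extQ]
      rw [natDegree_qz hq, hb]
    rw [hQ] at this
    exact this
  have hU : ∀ j d, aO j d ≤ rO j d := by
    intro j d
    have := finrank_altSol_le (K := K) (fun d => symFun (Fin (M + 1 - j)) K E ⊓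
      grade true (extDeg deg) d) (extC c) (fun x => b x.1) (fun x => s x.1 + x.2.1.card) K le_rfl
      j k d fun i _ p hp => hk hp
    have hu : (Finset.univ.filter fun i : Fin K => (i : ℕ) < K) = Finset.univ :=
      Finset.filter_true_of_mem fun i _ => i.2
    rw [hu, ← extQ_vord] at this
    refine this.trans (Finset.sum_le_sum fun α _ => ?_)
    rw [dimO, extQ_vord]
    exact le_rfl
  have hL : ∀ j, ∑ α ∈ Finset.powersetCard j (Finset.univ : Finset (Fin K)),
      dimZ c q0 s ζ (lower k α) (M + 1 - j) ≤ aZ j := by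
    intro j
    have := sum_finrank_le_altSol (K := K) (symFun (Fin (M + 1 - j)) K E ⊓ ⊤) (extC c)
      (fun x => q0 x.1) (fun x => s x.1 + x.2.1.card) hζ k j 0
    rw [← extQ_qz] at this
    refine le_trans (Finset.sum_le_sum fun α _ => ?_) this
    rw [dimZ, extQ_qz, inf_top_eq]
  -- The induction hypothesis applies because `j ≥ 1` leaves at most `M` symmetric indices; it is
  -- needed for arbitrary levels, as `lower k α` need not be decreasing.
  have hI : ∀ j, 1 ≤ j → ∑ d ∈ Finset.range B, rO j d
      ≤ ∑ α ∈ Finset.powersetCard j (Finset.univ : Finset (Fin K)),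
        dimZ c q0 s ζ (lower k α) (M + 1 - j) := by
    intro j hj
    simp only [hrO]
    rw [Finset.sum_comm]
    refine Finset.sum_le_sum fun α _ => ?_
    rw [ih _ (by omega)]
    have := sum_int_shift_le (∑ i ∈ α, (i : ℕ)) (dimO deg c b s (lower k α) (M + 1 - j))
      (fun d hd => dimO_of_neg _ _ _ _ _ _ hd) B
    push_cast at this
    exact this
  -- The circle closes: `aZ j ≤ ∑ aO j ≤ ∑ rO j ≤ ∑_α dimZ ≤ aZ j`. In `hE'` the equality of the
  -- sums forces `aO j d = rO j d` in each degree.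
  have hE : ∀ j, 1 ≤ j → j ≤ M + 1 → aZ j = ∑ d ∈ Finset.range B, aO j d := fun j h1 h2 =>
    le_antisymm (hS j h2) ((Finset.sum_le_sum fun d _ => hU j d).trans ((hI j h1).trans (hL j)))
  have hE' : ∀ j, 1 ≤ j → j ≤ M + 1 → ∀ d ∈ Finset.range B, aO j d = rO j d := fun j h1 h2 =>
    (Finset.sum_eq_sum_iff_of_le fun d _ => hU j d).mp
      (le_antisymm (Finset.sum_le_sum fun d _ => hU j d)
        ((hI j h1).trans ((hL j).trans (hS j h2))))
  have h0Z : aZ 0 = dimZ c q0 s ζ k (M + 1) := by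
    rw [haZ]
    simp only
    rw [finrank_altSol_zero, dimZ]
    have h1 : (symFun (Fin (M + 1 - 0)) K E ⊓ grade false (extDeg deg) 0)
        = symFun (Fin (M + 1)) K E := inf_top_eq _
    rw [h1]
    rfl
  have h0O : ∀ d : ℕ, aO 0 d = dimO deg c b s k (M + 1) d := by
    intro d
    rw [haO]
    simp only
    rw [finrank_altSol_zero, dimO]
    rfl
  have h0r : ∀ d : ℕ, rO 0 d = dimO deg c b s k (M + 1) d := by
    intro d
    simp only [hrO]
    rw [Finset.powersetCard_zero, Finset.sum_singleton, lower_empty, Finset.sum_empty, sub_zero,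
      Nat.sub_zero]
  refine ⟨?_, fun d hd => ?_⟩
  · have h1 : ∑ j ∈ Finset.range (M + 2), (-1 : ℤ) ^ j * (∑ d ∈ Finset.range B, aO j d : ℕ) = 0 := by
      push_cast
      simp only [Finset.mul_sum]
      rw [Finset.sum_comm]
      exact Finset.sum_eq_zero fun d _ => hKO d
    rw [Finset.sum_range_succ'] at h1 hKZ
    have h2 : ∑ j ∈ Finset.range (M + 1), (-1 : ℤ) ^ (j + 1) * (aZ (j + 1) : ℤ)
        = ∑ j ∈ Finset.range (M + 1), (-1 : ℤ) ^ (j + 1) *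
          (∑ d ∈ Finset.range B, aO (j + 1) d : ℕ) := by
      refine Finset.sum_congr rfl fun j hj => ?_
      rw [hE (j + 1) (by omega) (by have := Finset.mem_range.mp hj; omega)]
    rw [h2] at hKZ
    rw [← h0Z]
    simp only [← h0O]
    have : (aZ 0 : ℤ) = (∑ d ∈ Finset.range B, aO 0 d : ℕ) := by
      simp only [pow_zero, one_mul] at h1 hKZ
      linarith
    exact_mod_cast this
  · rw [← hKO d]
    refine Finset.sum_congr rfl fun j hj => ?_
    congr 1
    rcases Nat.eq_zero_or_pos j with rfl | hj0
    · rw [h0O, ← h0r]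
      simp [hrO]
    · rw [hE' j hj0 (by have := Finset.mem_range.mp hj; omega) d hd]
      simp [hrO]

/-- The dimensions at distinct points and at the degenerate point agree, if they do so without
symmetric indices. -/
theorem dimZ_eq_sum_dimO {e : N → ℕ} (hc : ∀ x ε t, (c x ε).coeff t ≠ 0 → t + deg ε = e x)
    (hq : ∀ x, (q0 x).Monic) (hb : b = fun x => (q0 x).natDegree) (M : ℕ) :
    ∀ (ζ : Fin K → ℂ), Function.Injective ζ → ∀ B, (∀ ε, M * K + deg ε < B) →
    (∀ k, dimZ c q0 s ζ k 0 = ∑ d ∈ Finset.range B, dimO deg c b s k 0 d) →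
    ∀ k, dimZ c q0 s ζ k M = ∑ d ∈ Finset.range B, dimO deg c b s k M d := by
  have hZ : ∀ (σ : Equiv.Perm (Fin K)) ζ k m, dimZ c q0 s (ζ ∘ σ) (k ∘ σ) m = dimZ c q0 s ζ k m := by
    intro σ ζ k m
    rw [dimZ, qz_comp, dimZ]
  have hO : ∀ (σ : Equiv.Perm (Fin K)) k m d,
      dimO deg c b s (k ∘ σ) m d = dimO deg c b s k m d := by
    intro σ k m d
    rw [dimO, vord_comp, dimO]
  induction M using Nat.strong_induction_on with
  | _ M ih =>
    intro ζ hζ B hB hbase k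
    rcases M with _ | M
    · exact hbase k
    -- Permuting the points together with their levels changes neither dimension, so the levels may
    -- be taken decreasing, as the upper bound requires.
    · obtain ⟨σ, hσ⟩ : ∃ σ : Equiv.Perm (Fin K), Antitone (k ∘ σ) :=
        ⟨Tuple.sort fun i => -k i, fun i i' h =>
          neg_le_neg_iff.mp (Tuple.monotone_sort (fun i => -k i) h)⟩
      have key := core_step deg c q0 b s (ζ ∘ σ) (k ∘ σ) hc hq hb (hζ.comp σ.injective) hσ M B hB
        (by
          intro m hm k'
          refine ih m (by omega) (ζ ∘ σ) (hζ.comp σ.injective) B (fun ε => ?_) (fun k'' => ?_) k'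
          · have := hB ε
            have := Nat.mul_le_mul_right K (show m ≤ M + 1 by omega)
            omega
          · have h1 := hbase (k'' ∘ σ.symm)
            rw [← hZ σ] at h1
            have h2 : (k'' ∘ σ.symm) ∘ σ = k'' := by funext i; simp
            rw [h2] at h1
            rw [h1]
            refine Finset.sum_congr rfl fun d _ => ?_
            rw [← hO σ, h2])
      rw [← hZ σ, key.1]
      exact Finset.sum_congr rfl fun d _ => hO σ k _ d

/-- The recursion for the graded dimensions at the degenerate point. -/
theorem sum_dimO_eq_zero {e : N → ℕ} (hc : ∀ x ε t, (c x ε).coeff t ≠ 0 → t + deg ε = e x)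
    (hq : ∀ x, (q0 x).Monic) (hb : b = fun x => (q0 x).natDegree) (M : ℕ)
    (hζ : Function.Injective ζ)
    (hbase : ∀ B, (∀ ε, deg ε < B) →
      ∀ k, dimZ c q0 s ζ k 0 = ∑ d ∈ Finset.range B, dimO deg c b s k 0 d)
    (hk : Antitone k) (d : ℤ) :
    ∑ j ∈ Finset.range (M + 2), (-1 : ℤ) ^ j *
      ∑ α ∈ Finset.powersetCard j (Finset.univ : Finset (Fin K)),
        (dimO deg c b s (lower k α) (M + 1 - j) (d - ∑ i ∈ α, ((i : ℕ) : ℤ)) : ℤ) = 0 := by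
  rcases lt_or_ge d 0 with hd | hd
  · refine Finset.sum_eq_zero fun j _ => ?_
    rw [Finset.sum_eq_zero fun α _ => ?_, mul_zero]
    rw [dimO_of_neg, Nat.cast_zero]
    have : 0 ≤ ∑ i ∈ α, ((i : ℕ) : ℤ) := Finset.sum_nonneg fun i _ => by omega
    omega
  · obtain ⟨d, rfl⟩ := Int.eq_ofNat_of_zero_le hd
    -- Any bound works that exceeds all the occurring degrees and the degree `d` in question.
    set B := (M + 1) * K + (∑ ε, deg ε) + d + 1 with hB
    have hB' : ∀ ε, (M + 1) * K + deg ε < B := by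
      intro ε
      have := Finset.single_le_sum (fun ε _ => Nat.zero_le (deg ε)) (Finset.mem_univ ε)
      omega
    refine (core_step deg c q0 b s ζ k hc hq hb hζ hk M B hB' fun m hm k' => ?_).2 d
      (Finset.mem_range.mpr (by omega))
    refine dimZ_eq_sum_dimO deg c q0 b s hc hq hb m ζ hζ B (fun ε => ?_) (hbase B fun ε => ?_) k'
    · have := hB' ε
      have := Nat.mul_le_mul_right K (show m ≤ M + 1 by omega)
      omega
    · have := hB' ε
      omega

end Core

/-! ### Monomials as multi-indices up to permutation. -/

section MultiIndex

variable {α : Type*}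

theorem exists_sum_single_eq (m : ℕ) : ∀ f : α →₀ ℕ, f.degree = m →
    ∃ r : Fin m → α, ∑ t, Finsupp.single (r t) 1 = f := by
  classical
  induction m with
  | zero =>
    intro f hf
    exact ⟨Fin.elim0, by simpa using ((Finsupp.degree_eq_zero_iff f).mp hf).symm⟩
  | succ m ih =>
    intro f hf
    have hf0 : f ≠ 0 := by
      rintro rfl
      simp at hf
    obtain ⟨a, ha⟩ := Finsupp.ne_iff.mp hf0
    have h1 : Finsupp.single a 1 ≤ f := by
      rw [Finsupp.single_le_iff]
      exact Nat.one_le_iff_ne_zero.mpr ha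
    have h2 : Finsupp.single a 1 + (f - Finsupp.single a 1) = f := add_tsub_cancel_of_le h1
    obtain ⟨r, hr⟩ := ih (f - Finsupp.single a 1) (by
      have := congrArg Finsupp.degree h2
      rw [map_add, Finsupp.degree_single, hf] at this
      omega)
    exact ⟨Fin.cons a r, by rw [Fin.sum_univ_succ, Fin.cons_zero]; simp only [Fin.cons_succ, hr, h2]⟩

theorem exists_perm_of_sum_single_eq {τ : Type*} [Fintype τ] [DecidableEq α] {u u' : τ → α}
    (h : ∑ t, Finsupp.single (u t) 1 = ∑ t, Finsupp.single (u' t) (1 : ℕ)) :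
    ∃ g : Equiv.Perm τ, u' = u ∘ g := by
  have hcard : ∀ a, Nonempty ({t // u' t = a} ≃ {t // u t = a}) := by
    intro a
    rw [← Fintype.card_eq, Fintype.card_subtype, Fintype.card_subtype]
    have := DFunLike.congr_fun h a
    simp only [Finsupp.finsetSum_apply, Finsupp.single_apply, Finset.sum_boole, Nat.cast_id] at this
    exact this.symm
  refine ⟨((Equiv.sigmaFiberEquiv u').symm.trans
    (Equiv.sigmaCongrRight fun a => (hcard a).some)).trans (Equiv.sigmaFiberEquiv u), ?_⟩
  funext t
  simp only [Function.comp_apply, Equiv.trans_apply]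
  exact ((hcard (u' t)).some ⟨t, rfl⟩).2.symm

end MultiIndex

/-! ### The concrete conditions on functions on monomials. -/

section Model

variable {n : ℕ} {ι : Type} [Fintype ι] {ns : ι → ℕ}

/-- The weight of a monomial in the `x_a[i]`. -/
def wt (ε : CurVar n ns →₀ ℕ) : ℕ →₀ ℕ := ε.mapDomain fun v => (v.1 : ℕ)

/-- The degree of a monomial in the `x_a[i]`. -/
def dg (ε : CurVar n ns →₀ ℕ) : ℕ := ε.sum fun v m => m * (v.2 : ℕ)

theorem wt_add (ε ε' : CurVar n ns →₀ ℕ) : wt (ε + ε') = wt ε + wt ε' := Finsupp.mapDomain_add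

theorem wt_single (v : CurVar n ns) (m : ℕ) : wt (Finsupp.single v m) = Finsupp.single (v.1 : ℕ) m :=
  Finsupp.mapDomain_single

theorem wt_zero : wt (0 : CurVar n ns →₀ ℕ) = 0 := Finsupp.mapDomain_zero

theorem wt_sum {τ : Type*} (s : Finset τ) (f : τ → CurVar n ns →₀ ℕ) :
    wt (∑ t ∈ s, f t) = ∑ t ∈ s, wt (f t) := Finsupp.mapDomain_finsetSum

theorem dg_add (ε ε' : CurVar n ns →₀ ℕ) : dg (ε + ε') = dg ε + dg ε' :=
  Finsupp.sum_add_index' (by simp) (by simp [add_mul])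

theorem dg_zero : dg (0 : CurVar n ns →₀ ℕ) = 0 := Finsupp.sum_zero_index

theorem dg_single (v : CurVar n ns) (m : ℕ) : dg (Finsupp.single v m) = m * (v.2 : ℕ) :=
  Finsupp.sum_single_index (by simp)

theorem dg_sum {τ : Type*} (s : Finset τ) (f : τ → CurVar n ns →₀ ℕ) :
    dg (∑ t ∈ s, f t) = ∑ t ∈ s, dg (f t) := by
  classical
  induction s using Finset.induction_on with
  | empty => simp [dg_zero]
  | insert a s ha ih => rw [Finset.sum_insert ha, Finset.sum_insert ha, dg_add, ih]

theorem wt_apply_col (ε : CurVar n ns →₀ ℕ) (a : Gen n) :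
    wt ε (a : ℕ) = ∑ i, ε ⟨a, i⟩ := by
  classical
  rw [wt, Finsupp.mapDomain, Finsupp.sum_fintype _ _ (by simp), Finsupp.finsetSum_apply,
    ← Finset.univ_sigma_univ, Finset.sum_sigma, Finset.sum_eq_single a]
  · simp
  · intro b _ hb
    refine Finset.sum_eq_zero fun i _ => ?_
    rw [Finsupp.single_apply, if_neg]
    exact fun h => hb (Subtype.ext h)
  · simp

theorem wt_apply_of_notMem (ε : CurVar n ns →₀ ℕ) {a : ℕ} (ha : a ∉ Finset.Ico 1 n) :
    wt ε a = 0 := by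
  refine Finsupp.mapDomain_of_notMem_range _ _ ?_
  rintro ⟨v, rfl⟩
  exact ha v.1.2

variable (n ns) in
/-- The monomials of weight `w`. -/
abbrev Exps (w : ℕ →₀ ℕ) : Type := {ε : CurVar n ns →₀ ℕ // wt ε = w}

instance (w : ℕ →₀ ℕ) : Finite (Exps n ns w) := by
  classical
  let b : CurVar n ns →₀ ℕ := Finsupp.equivFunOnFinite.symm fun v => w (v.1 : ℕ)
  refine Finite.of_injective (β := Set.Iic b) (fun ε => ⟨ε.1, fun v => ?_⟩) ?_
  · change ε.1 v ≤ w (v.1 : ℕ)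
    rw [← DFunLike.congr_fun ε.2 (v.1 : ℕ), wt_apply_col]
    exact Finset.single_le_sum (f := fun i => ε.1 ⟨v.1, i⟩) (fun i _ => Nat.zero_le _)
      (Finset.mem_univ v.2)
  · intro ε ε' h
    exact Subtype.ext (congrArg (fun x : Set.Iic b => x.1) h)

instance (w : ℕ →₀ ℕ) : Fintype (Exps n ns w) := Fintype.ofFinite _

variable (n ns) in
/-- The generating function `x_a(z)`, with coefficients in `ℂ[z]`. -/
def cur (a : Gen n) : MvPolynomial (CurVar n ns) (Polynomial ℂ) :=
  ∑ i : Fin (numActive ns a),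
    MvPolynomial.monomial (Finsupp.single ⟨a, i⟩ 1) (X ^ (numActive ns a - 1 - (i : ℕ)))

variable (n ns) in
/-- The product `∏_a x_a(z)^{ν_a}`, with coefficients in `ℂ[z]`. -/
def curProd (ν : Gen n → ℕ) : MvPolynomial (CurVar n ns) (Polynomial ℂ) := ∏ a, cur n ns a ^ ν a

theorem curProd_add (ν ν' : Gen n → ℕ) :
    curProd n ns (ν + ν') = curProd n ns ν * curProd n ns ν' := by
  simp only [curProd, Pi.add_apply, pow_add, Finset.prod_mul_distrib]

theorem curProd_single [DecidableEq (Gen n)] (a : Gen n) (h : ℕ) :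
    curProd n ns (Pi.single a h) = cur n ns a ^ h := by
  rw [curProd, Finset.prod_eq_single a]
  · simp
  · intro b _ hb
    simp [hb]
  · simp

/-- Polynomials that are homogeneous of weight `w`, and of degree `e` if `z` has degree `1`. -/
def IsBihom (w : ℕ →₀ ℕ) (e : ℕ) (f : MvPolynomial (CurVar n ns) (Polynomial ℂ)) : Prop :=
  ∀ ε t, (f.coeff ε).coeff t ≠ 0 → wt ε = w ∧ t + dg ε = e

theorem IsBihom.mul {w w' : ℕ →₀ ℕ} {e e' : ℕ} {f f' : MvPolynomial (CurVar n ns) (Polynomial ℂ)}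
    (hf : IsBihom w e f) (hf' : IsBihom w' e' f') : IsBihom (w + w') (e + e') (f * f') := by
  classical
  intro ε t h
  rw [MvPolynomial.coeff_mul, Polynomial.finsetSum_coeff] at h
  obtain ⟨⟨ε1, ε2⟩, hε, h⟩ := Finset.exists_ne_zero_of_sum_ne_zero h
  replace hε : ε1 + ε2 = ε := Finset.HasAntidiagonal.mem_antidiagonal.mp hε
  rw [Polynomial.coeff_mul] at h
  obtain ⟨⟨t1, t2⟩, ht, h⟩ := Finset.exists_ne_zero_of_sum_ne_zero h
  replace ht : t1 + t2 = t := Finset.HasAntidiagonal.mem_antidiagonal.mp ht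
  obtain ⟨h1, h2⟩ := hf _ _ (left_ne_zero_of_mul h)
  obtain ⟨h3, h4⟩ := hf' _ _ (right_ne_zero_of_mul h)
  simp only at h1 h2 h3 h4
  rw [← hε, ← ht, wt_add, dg_add, h1, h3, ← h2, ← h4]
  exact ⟨rfl, by ring⟩

theorem IsBihom.monomial (P : CurVar n ns →₀ ℕ) (m : ℕ) :
    IsBihom (wt P) (m + dg P) (MvPolynomial.monomial P (X ^ m)) := by
  classical
  intro ε t h
  rw [MvPolynomial.coeff_monomial] at h
  split_ifs at h with h'
  · subst h'
    rw [Polynomial.coeff_X_pow] at h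
    split_ifs at h with h'
    · exact ⟨rfl, by rw [h']⟩
    · exact absurd rfl h
  · simp at h

theorem IsBihom.one : IsBihom 0 0 (1 : MvPolynomial (CurVar n ns) (Polynomial ℂ)) := by
  have := IsBihom.monomial (0 : CurVar n ns →₀ ℕ) 0
  rw [wt_zero, dg_zero, pow_zero] at this
  exact this

theorem IsBihom.sum {w : ℕ →₀ ℕ} {e : ℕ} {τ : Type*} (s : Finset τ)
    {f : τ → MvPolynomial (CurVar n ns) (Polynomial ℂ)} (hf : ∀ a ∈ s, IsBihom w e (f a)) :
    IsBihom w e (∑ a ∈ s, f a) := by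
  intro ε t h
  rw [MvPolynomial.coeff_sum, Polynomial.finsetSum_coeff] at h
  obtain ⟨a, ha, h⟩ := Finset.exists_ne_zero_of_sum_ne_zero h
  exact hf a ha ε t h

theorem IsBihom.pow {w : ℕ →₀ ℕ} {e : ℕ} {f : MvPolynomial (CurVar n ns) (Polynomial ℂ)}
    (hf : IsBihom w e f) (m : ℕ) : IsBihom (m • w) (m * e) (f ^ m) := by
  induction m with
  | zero => simpa using IsBihom.one
  | succ m ih => rw [pow_succ, succ_nsmul, add_mul, one_mul]; exact ih.mul hf

theorem IsBihom.prod {τ : Type*} (s : Finset τ) {w : τ → ℕ →₀ ℕ} {e : τ → ℕ}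
    {f : τ → MvPolynomial (CurVar n ns) (Polynomial ℂ)} (hf : ∀ a, IsBihom (w a) (e a) (f a)) :
    IsBihom (∑ a ∈ s, w a) (∑ a ∈ s, e a) (∏ a ∈ s, f a) := by
  classical
  induction s using Finset.induction_on with
  | empty => simpa using IsBihom.one
  | insert a s ha ih =>
    rw [Finset.sum_insert ha, Finset.sum_insert ha, Finset.prod_insert ha]
    exact (hf a).mul ih

theorem isBihom_cur (a : Gen n) :
    IsBihom (Finsupp.single (a : ℕ) 1) (numActive ns a - 1) (cur n ns a) := by
  refine IsBihom.sum _ fun i _ => ?_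
  have := IsBihom.monomial (Finsupp.single (⟨a, i⟩ : CurVar n ns) 1) (numActive ns a - 1 - (i : ℕ))
  rw [wt_single, dg_single, one_mul] at this
  convert this using 1
  have := i.2
  simp only
  omega

/-- The weight `∑_a ν_a e_a`. -/
def wtOf (ν : Gen n → ℕ) : ℕ →₀ ℕ := ∑ a : Gen n, Finsupp.single (a : ℕ) (ν a)

theorem wtOf_apply (ν : Gen n → ℕ) (a : Gen n) : wtOf ν a = ν a := by
  rw [wtOf, Finsupp.finsetSum_apply, Finset.sum_eq_single a]
  · simp
  · intro b _ hb
    rw [Finsupp.single_apply, if_neg]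
    exact fun h => hb (Subtype.ext h)
  · simp

theorem isBihom_curProd (ν : Gen n → ℕ) :
    IsBihom (wtOf ν) (∑ a, ν a * (numActive ns a - 1)) (curProd n ns ν) := by
  have := IsBihom.prod Finset.univ fun a : Gen n => (isBihom_cur (ns := ns) a).pow (ν a)
  simp only [Finsupp.smul_single, smul_eq_mul, mul_one] at this
  exact this

variable (n ns) in
/-- The coefficient of a monomial in `P · ∏_a x_a(z)^{ν_a}`. -/
def curCoeff (w : ℕ →₀ ℕ) (x : (Gen n → ℕ) × (CurVar n ns →₀ ℕ)) (ε : Exps n ns w) :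
    Polynomial ℂ :=
  (MvPolynomial.monomial x.2 1 * curProd n ns x.1).coeff ε.1

theorem isBihom_curCoeff (x : (Gen n → ℕ) × (CurVar n ns →₀ ℕ)) :
    IsBihom (wt x.2 + wtOf x.1) (dg x.2 + ∑ a, x.1 a * (numActive ns a - 1))
      (MvPolynomial.monomial x.2 1 * curProd n ns x.1) := by
  have := (IsBihom.monomial x.2 0).mul (isBihom_curProd (ns := ns) x.1)
  rw [pow_zero, zero_add] at this
  exact this

theorem curCoeff_coeff {w : ℕ →₀ ℕ} (x : (Gen n → ℕ) × (CurVar n ns →₀ ℕ)) (ε : Exps n ns w)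
    (t : ℕ) (h : (curCoeff n ns w x ε).coeff t ≠ 0) :
    t + dg ε.1 = dg x.2 + ∑ a, x.1 a * (numActive ns a - 1) :=
  (isBihom_curCoeff x _ _ h).2

variable (n ns) in
/-- The linear extension of a function on the monomials of weight `w`. -/
def extend (w : ℕ →₀ ℕ) (p : Exps n ns w → ℂ) (g : MvPolynomial (CurVar n ns) (Polynomial ℂ)) :
    Polynomial ℂ := ∑ ε, p ε • g.coeff ε.1

variable (ns) in
/-- The monomial `∏_t x_c[u_t]`. -/
def colorMono {M : ℕ} (c : Gen n) (u : Fin M → Fin (numActive ns c)) : CurVar n ns →₀ ℕ :=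
  ∑ t, Finsupp.single ⟨c, u t⟩ 1

theorem wt_colorMono {M : ℕ} (c : Gen n) (u : Fin M → Fin (numActive ns c)) :
    wt (colorMono ns c u) = Finsupp.single (c : ℕ) M := by
  rw [colorMono, wt_sum]
  simp only [wt_single]
  rw [Finset.sum_const, Finset.card_univ, Fintype.card_fin, Finsupp.smul_single, smul_eq_mul,
    mul_one]

theorem dg_colorMono {M : ℕ} (c : Gen n) (u : Fin M → Fin (numActive ns c)) :
    dg (colorMono ns c u) = ∑ t, (u t : ℕ) := by
  rw [colorMono, dg_sum]
  simp only [dg_single, one_mul]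

variable (ns) in
/-- A monomial of weight `w + M e_c`, from the indices of the `x_c[i]` and the remaining monomial. -/
def joinExps {w : ℕ →₀ ℕ} {M : ℕ} (c : Gen n)
    (y : (Fin M → Fin (numActive ns c)) × Exps n ns w) :
    Exps n ns (w + Finsupp.single (c : ℕ) M) :=
  ⟨y.2.1 + colorMono ns c y.1, by rw [wt_add, wt_colorMono, y.2.2]⟩

theorem prod_monomial_eq {σ τ R : Type*} [CommSemiring R] (s : Finset τ) (f : τ → σ →₀ ℕ)
    (g : τ → R) : ∏ t ∈ s, MvPolynomial.monomial (f t) (g t)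
      = MvPolynomial.monomial (∑ t ∈ s, f t) (∏ t ∈ s, g t) := by
  classical
  induction s using Finset.induction_on with
  | empty => simp
  | insert a s ha ih =>
    rw [Finset.prod_insert ha, Finset.prod_insert ha, Finset.sum_insert ha, ih,
      MvPolynomial.monomial_mul]

/-- The origin of `slot`: choosing `x_c(z)` at the positions in `T` and `x_c[r_t]` at the others,
the coefficient of `∏_t x_c[u_t]` is `slot T r u`. -/
theorem prod_slot {M : ℕ} (c : Gen n) (T : Finset (Fin M)) (r : Fin M → Fin (numActive ns c)) :
    ∏ t, (if t ∈ T then cur n ns c else MvPolynomial.X ⟨c, r t⟩)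
      = ∑ u, MvPolynomial.monomial (colorMono ns c u) (slot T r u) := by
  have h1 : ∀ t, (if t ∈ T then cur n ns c else MvPolynomial.X ⟨c, r t⟩)
      = ∑ i : Fin (numActive ns c), MvPolynomial.monomial (Finsupp.single (⟨c, i⟩ : CurVar n ns) 1)
        (if t ∈ T then (X : Polynomial ℂ) ^ (numActive ns c - 1 - (i : ℕ))
          else if i = r t then 1 else 0) := by
    intro t
    split_ifs with h
    · rw [cur]
    · rw [Finset.sum_eq_single (r t)]
      · rw [if_pos rfl, MvPolynomial.X]
      · intro i _ hi
        rw [if_neg hi, MvPolynomial.monomial_zero]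
      · simp
  rw [Finset.prod_congr rfl fun t _ => h1 t, Finset.prod_univ_sum, Fintype.piFinset_univ]
  refine Finset.sum_congr rfl fun u _ => ?_
  rw [colorMono, slot, ← prod_monomial_eq]

/-- On the pullback of `p` along `joinExps`, an extended condition evaluates `p` on `g` times a
product of factors `x_c(z)` and `x_c[r_t]`. Both sides are additive in `g`, so monomials suffice. -/
theorem sum_extC_eq_extend {w : ℕ →₀ ℕ} {M : ℕ} (c : Gen n) (T : Finset (Fin M))
    (r : Fin M → Fin (numActive ns c)) (p : Exps n ns (w + Finsupp.single (c : ℕ) M) → ℂ)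
    (g : MvPolynomial (CurVar n ns) (Polynomial ℂ)) :
    ∑ y : (Fin M → Fin (numActive ns c)) × Exps n ns w,
      p (joinExps ns c y) • (slot T r y.1 * g.coeff y.2.1) =
    extend n ns _ p ((∏ t, if t ∈ T then cur n ns c else MvPolynomial.X ⟨c, r t⟩) * g) := by
  classical
  induction g using MvPolynomial.induction_on' with
  | add g g' h h' =>
    simp only [extend, mul_add, MvPolynomial.coeff_add, smul_add, Finset.sum_add_distrib] at *
    rw [h, h']
  | monomial P q =>
    rw [prod_slot, Finset.sum_mul, Fintype.sum_prod_type]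
    simp only [extend, MvPolynomial.coeff_sum, MvPolynomial.monomial_mul, Finset.smul_sum,
      MvPolynomial.coeff_monomial]
    rw [Finset.sum_comm (s := (Finset.univ : Finset (Exps n ns (w + Finsupp.single (c : ℕ) M))))]
    refine Finset.sum_congr rfl fun u _ => ?_
    by_cases hP : wt P = w
    · rw [Finset.sum_eq_single ⟨P, hP⟩, Finset.sum_eq_single (joinExps ns c (u, ⟨P, hP⟩))]
      · simp [joinExps, add_comm]
      · intro ε _ hε
        rw [if_neg, smul_zero]
        intro h
        exact hε (Subtype.ext (by rw [← h, joinExps, add_comm]))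
      · simp
      · intro ε _ hε
        rw [if_neg, mul_zero, smul_zero]
        intro h
        exact hε (Subtype.ext h.symm)
      · simp
    · rw [Finset.sum_eq_zero, Finset.sum_eq_zero]
      · intro ε _
        rw [if_neg, smul_zero]
        intro h
        have := congrArg wt h
        rw [ε.2, wt_add, wt_colorMono, add_comm] at this
        exact hP (add_right_cancel this)
      · intro ε _
        rw [if_neg, mul_zero, smul_zero]
        intro h
        exact hP (h ▸ ε.2)

end Model

/-! ### Splitting off the largest color. -/

section Bridge

variable {n : ℕ} {ι : Type} [Fintype ι] {ns : ι → ℕ}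

theorem colorMono_eq_mapDomain {M : ℕ} (c : Gen n) (u : Fin M → Fin (numActive ns c)) :
    colorMono ns c u = (∑ t, Finsupp.single (u t) 1).mapDomain (Sigma.mk c) := by
  rw [Finsupp.mapDomain_finsetSum, colorMono]
  simp only [Finsupp.mapDomain_single]

theorem colorMono_apply_of_ne {M : ℕ} {c : Gen n} (u : Fin M → Fin (numActive ns c))
    {v : CurVar n ns} (hv : v.1 ≠ c) : colorMono ns c u v = 0 := by
  rw [colorMono_eq_mapDomain]
  refine Finsupp.mapDomain_of_notMem_range _ _ ?_
  rintro ⟨i, rfl⟩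
  exact hv rfl

theorem exists_colorMono (ε : CurVar n ns →₀ ℕ) (c : Gen n) {m : ℕ} (h : wt ε (c : ℕ) = m) :
    ∃ (u : Fin m → Fin (numActive ns c)) (ε' : CurVar n ns →₀ ℕ),
      ε = ε' + colorMono ns c u ∧ wt ε' (c : ℕ) = 0 := by
  obtain ⟨u, hu⟩ := exists_sum_single_eq m
    (Finsupp.equivFunOnFinite.symm fun i : Fin (numActive ns c) => ε ⟨c, i⟩) (by
      rw [Finsupp.degree_eq_sum, ← h, wt_apply_col]
      rfl)
  have hle : colorMono ns c u ≤ ε := by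
    rintro ⟨a, i⟩
    by_cases ha : a = c
    · subst ha
      rw [colorMono_eq_mapDomain, hu, Finsupp.mapDomain_apply sigma_mk_injective]
      exact le_rfl
    · rw [colorMono_apply_of_ne u ha]
      exact Nat.zero_le _
  refine ⟨u, ε - colorMono ns c u, (tsub_add_cancel_of_le hle).symm, ?_⟩
  have h1 := congrArg wt (tsub_add_cancel_of_le hle)
  rw [wt_add, wt_colorMono] at h1
  have h2 := DFunLike.congr_fun h1 (c : ℕ)
  rw [Finsupp.add_apply, Finsupp.single_eq_same, h] at h2
  omega

theorem joinExps_surjective {w : ℕ →₀ ℕ} {M : ℕ} {c : Gen n} (hw : w (c : ℕ) = 0) :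
    Function.Surjective (joinExps ns c : _ → Exps n ns (w + Finsupp.single (c : ℕ) M)) := by
  rintro ⟨ε, hε⟩
  obtain ⟨u, ε', h1, h2⟩ := exists_colorMono ε c (m := M) (by rw [hε]; simp [hw])
  have h3 : wt ε' = w := by
    rw [h1, wt_add, wt_colorMono] at hε
    exact add_right_cancel hε
  exact ⟨(u, ⟨ε', h3⟩), Subtype.ext h1.symm⟩

theorem eq_zero_of_wt_eq_zero {ε : CurVar n ns →₀ ℕ} {v : CurVar n ns} (h : wt ε (v.1 : ℕ) = 0) :
    ε v = 0 := by
  rw [wt_apply_col, Finset.sum_eq_zero_iff] at h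
  exact h v.2 (Finset.mem_univ _)

theorem exists_perm_of_joinExps_eq {w : ℕ →₀ ℕ} {M : ℕ} {c : Gen n} (hw : w (c : ℕ) = 0)
    {y y' : (Fin M → Fin (numActive ns c)) × Exps n ns w} (h : joinExps ns c y = joinExps ns c y') :
    ∃ g : Equiv.Perm (Fin M), y' = (y.1 ∘ g, y.2) := by
  have h1 : y.2.1 + colorMono ns c y.1 = y'.2.1 + colorMono ns c y'.1 := congrArg Subtype.val h
  have h2 : colorMono ns c y.1 = colorMono ns c y'.1 := by
    ext v
    by_cases hv : v.1 = c
    · have h3 := DFunLike.congr_fun h1 v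
      rw [Finsupp.add_apply, Finsupp.add_apply, eq_zero_of_wt_eq_zero (ε := y.2.1),
        eq_zero_of_wt_eq_zero (ε := y'.2.1), zero_add, zero_add] at h3
      · exact h3
      · rw [y'.2.2, hv, hw]
      · rw [y.2.2, hv, hw]
    · rw [colorMono_apply_of_ne _ hv, colorMono_apply_of_ne _ hv]
  classical
  obtain ⟨g, hg⟩ := exists_perm_of_sum_single_eq h2
  refine ⟨g, Prod.ext (funext fun t => ?_) (Subtype.ext ?_)⟩
  · have := congr_fun hg t
    simpa using this
  · rw [h2] at h1
    exact (add_right_cancel h1).symm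

/-- The indices `(ν, P)` with `ν` supported in the colors up to `c`. -/
abbrev CoreIdx (ns : ι → ℕ) (c : Gen n) : Type :=
  {ν : Gen n → ℕ // ∀ a, c < a → ν a = 0} × (CurVar n ns →₀ ℕ)

variable (ns) in
def coreCoeff (c : Gen n) (w : ℕ →₀ ℕ) (x : CoreIdx ns c) (ε : Exps n ns w) : Polynomial ℂ :=
  curCoeff n ns w (x.1.1, x.2) ε

theorem prod_cur_eq {M : ℕ} (c : Gen n) (T : Finset (Fin M)) (r : Fin M → Fin (numActive ns c)) :
    ∏ t, (if t ∈ T then cur n ns c else MvPolynomial.X ⟨c, r t⟩)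
      = cur n ns c ^ T.card * MvPolynomial.monomial (∑ t ∈ Tᶜ, Finsupp.single ⟨c, r t⟩ 1) 1 := by
  rw [← Finset.prod_mul_prod_compl T]
  congr 1
  · rw [Finset.prod_congr rfl fun t ht => if_pos ht, Finset.prod_const]
  · rw [Finset.prod_congr rfl fun t ht => if_neg (Finset.mem_compl.mp ht)]
    simp only [MvPolynomial.X]
    rw [prod_monomial_eq, Finset.prod_const_one]

theorem sum_extC_coreCoeff {w : ℕ →₀ ℕ} {M : ℕ} (c : Gen n)
    (p : Exps n ns (w + Finsupp.single (c : ℕ) M) → ℂ) (x : CoreIdx ns c) (T : Finset (Fin M))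
    (r : Fin M → Fin (numActive ns c)) :
    ∑ y, p (joinExps ns c y) • extC (coreCoeff ns c w) (x, T, r) y
      = ∑ ε, p ε • curCoeff n ns _ (x.1.1 + Pi.single c T.card,
        x.2 + ∑ t ∈ Tᶜ, Finsupp.single ⟨c, r t⟩ 1) ε := by
  simp only [extC, coreCoeff, curCoeff]
  rw [sum_extC_eq_extend, extend]
  refine Finset.sum_congr rfl fun ε _ => ?_
  have hmono : ∀ P P' : CurVar n ns →₀ ℕ, (MvPolynomial.monomial (P + P') (1 : Polynomial ℂ))
      = MvPolynomial.monomial P 1 * MvPolynomial.monomial P' 1 := by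
    intro P P'
    rw [MvPolynomial.monomial_mul, one_mul]
  rw [prod_cur_eq, curProd_add, curProd_single, hmono]
  generalize MvPolynomial.monomial x.2 (1 : Polynomial ℂ) = A1
  generalize MvPolynomial.monomial _ (1 : Polynomial ℂ) = A2
  generalize curProd n ns x.1.1 = A3
  generalize cur n ns c ^ T.card = A4
  rw [mul_comm A4, mul_mul_mul_comm, mul_comm A2, mul_comm A4]

/-- The conditions on a multi-index and on a monomial of smaller weight are the original conditions:
`T.card` of the factors come from `x_c(z)`, and the other `x_c[r_t]` are absorbed into the monomial
`P`. -/
theorem mem_sol_iff_joinExps {w : ℕ →₀ ℕ} {M : ℕ} {c : Gen n} (hw : ∀ a : ℕ, (c : ℕ) ≤ a → w a = 0)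
    (Q : (Gen n → ℕ) → Polynomial ℂ) (p : Exps n ns (w + Finsupp.single (c : ℕ) M) → ℂ) :
    (p ∈ sol (curCoeff n ns _) fun x => Q x.1) ↔
      (fun y => p (joinExps ns c y)) ∈ sol (extC (coreCoeff ns c w))
        fun x => extQ (fun x h => Q (x.1.1 + Pi.single c h)) x 0 := by
  constructor
  · intro h
    rw [mem_sol]
    rintro ⟨x, T, r⟩
    rw [sum_extC_coreCoeff]
    simp only [extQ, add_zero]
    have h1 := mem_sol.mp h (x.1.1 + Pi.single c T.card,
      x.2 + ∑ t ∈ Tᶜ, Finsupp.single ⟨c, r t⟩ 1)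
    clear h
    with_reducible exact h1
  · intro h
    rw [mem_sol]
    rintro ⟨ν, P⟩
    -- A condition of the wrong weight is vacuous. Otherwise comparison of weights shows that `ν`
    -- vanishes above `c` and that `M` is `ν c` plus the number of factors of color `c` in `P`.
    by_cases h0 : ∑ ε, p ε • curCoeff n ns _ (ν, P) ε = 0
    · rw [h0]
      exact dvd_zero _
    · obtain ⟨ε, _, hε⟩ := Finset.exists_ne_zero_of_sum_ne_zero h0
      have hε' : curCoeff n ns _ (ν, P) ε ≠ 0 := fun h => hε (by rw [h, smul_zero])
      obtain ⟨t, ht⟩ : ∃ t, (curCoeff n ns _ (ν, P) ε).coeff t ≠ 0 := by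
        by_contra! h'
        exact hε' (Polynomial.ext (by simpa using h'))
      have hwt := (isBihom_curCoeff (ns := ns) (ν, P) _ _ ht).1
      rw [ε.2] at hwt
      simp only at hwt
      have hν : ∀ a, c < a → ν a = 0 := by
        intro a ha
        have h1 := DFunLike.congr_fun hwt (a : ℕ)
        have hca : (c : ℕ) < a := ha
        rw [Finsupp.add_apply, Finsupp.add_apply, wtOf_apply, hw _ hca.le,
          Finsupp.single_apply, if_neg (by omega)] at h1
        omega
      have hM : M = ν c + wt P (c : ℕ) := by
        have h1 := DFunLike.congr_fun hwt (c : ℕ)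
        rw [Finsupp.add_apply, Finsupp.add_apply, wtOf_apply, hw _ le_rfl,
          Finsupp.single_eq_same] at h1
        omega
      obtain ⟨m, hm⟩ : ∃ m, wt P (c : ℕ) = m := ⟨_, rfl⟩
      rw [hm] at hM
      obtain ⟨u, P', hP, -⟩ := exists_colorMono P c hm
      -- `u'` only fills the entries of `r` at the positions in `T`, which do not matter. It is
      -- taken from an existing monomial because `Fin (numActive ns c)` may be empty.
      obtain ⟨⟨u', -⟩, -⟩ := joinExps_surjective (ns := ns) (hw _ le_rfl) ε
      obtain ⟨l, hl⟩ : ∃ l, ν c = l := ⟨_, rfl⟩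
      rw [hl] at hM
      subst hM
      have h1 := mem_sol.mp h ((⟨ν - Pi.single c l, fun a ha => by simp [hν a ha]⟩, P'),
        Finset.univ.filter (fun t => (t : ℕ) < l),
        Fin.addCases (fun i => u' (Fin.castAdd m i)) u)
      have hT : (Finset.univ.filter fun t : Fin (l + m) => (t : ℕ) < l).card = l := by
        rw [Fin.card_filter_val_lt]
        omega
      have hν' : ν - Pi.single c l + Pi.single c l = ν := by
        refine tsub_add_cancel_of_le fun a => ?_
        by_cases ha : a = c
        · subst ha; simp [hl]
        · simp [ha]
      have hP' : P' + ∑ t ∈ (Finset.univ.filter fun t : Fin (l + m) => (t : ℕ) < l)ᶜ,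
          Finsupp.single (⟨c, (Fin.addCases (fun i => u' (Fin.castAdd m i)) u : _ → _) t⟩ :
            CurVar n ns) 1 = P := by
        rw [hP, colorMono]
        congr 1
        rw [Finset.compl_filter, Finset.sum_filter, Fin.sum_univ_add]
        simp
      rw [sum_extC_coreCoeff] at h1
      simp only [extQ, add_zero] at h1
      rw [hT, hν', hP'] at h1
      exact h1

theorem finrank_joinExps (graded : Bool) {w : ℕ →₀ ℕ} {M : ℕ} {c : Gen n}
    (hw : ∀ a : ℕ, (c : ℕ) ≤ a → w a = 0) (Q : (Gen n → ℕ) → Polynomial ℂ) (d : ℤ) :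
    Module.finrank ℂ ((symFun (Fin M) (numActive ns c) (Exps n ns w) ⊓
      grade graded (extDeg fun ε => dg ε.1) d) ⊓ sol (extC (coreCoeff ns c w))
        fun x => extQ (fun x h => Q (x.1.1 + Pi.single c h)) x 0 :
          Submodule ℂ ((Fin M → Fin (numActive ns c)) × Exps n ns w → ℂ))
    = Module.finrank ℂ (grade graded (fun ε => dg ε.1) d ⊓ sol (curCoeff n ns _) fun x => Q x.1 :
      Submodule ℂ (Exps n ns (w + Finsupp.single (c : ℕ) M) → ℂ)) := by
  have hsurj : Function.Surjective (joinExps ns c : _ → Exps n ns (w + Finsupp.single (c : ℕ) M)) :=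
    joinExps_surjective (hw _ le_rfl)
  have hdg : ∀ y : (Fin M → Fin (numActive ns c)) × Exps n ns w,
      dg (joinExps ns c y).1 = extDeg (fun ε : Exps n ns w => dg ε.1) y := by
    intro y
    rw [joinExps, dg_add, dg_colorMono, extDeg, add_comm]
  have hgrade : ∀ p : Exps n ns (w + Finsupp.single (c : ℕ) M) → ℂ,
      p ∈ grade graded (fun ε => dg ε.1) d ↔
      (fun y => p (joinExps ns c y)) ∈ grade graded (extDeg fun ε => dg ε.1) d := by
    intro p
    cases graded
    · exact iff_of_true Submodule.mem_top Submodule.mem_top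
    · constructor
      · intro h y hy
        exact h _ (by simpa only [hdg] using hy)
      · intro h ε hε
        obtain ⟨y, rfl⟩ := hsurj ε
        exact h y (by simpa only [← hdg] using hε)
  apply le_antisymm
  -- Two multi-indices giving the same monomial differ by a permutation, so a symmetric function
  -- does not depend on the chosen representative.
  · have hfac : ∀ f ∈ symFun (Fin M) (numActive ns c) (Exps n ns w),
        (fun y => f (Function.surjInv hsurj (joinExps ns c y))) = f := by
      intro f hf
      funext y
      obtain ⟨g, hg⟩ := exists_perm_of_joinExps_eq (hw _ le_rfl)
        (Function.surjInv_eq hsurj (joinExps ns c y)).symm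
      rw [hg]
      exact hf g _ _
    refine finrank_le_of_map (LinearMap.funLeft ℂ ℂ (Function.surjInv hsurj)) ?_ ?_
    · rintro f ⟨⟨h1, h2⟩, h3⟩
      refine ⟨(hgrade _).mpr ?_, (mem_sol_iff_joinExps hw Q _).mpr ?_⟩ <;>
        simp only [LinearMap.funLeft_apply, hfac f h1] <;> assumption
    · rintro f ⟨⟨h1, h2⟩, h3⟩ h4
      rw [← hfac f h1]
      funext y
      exact congr_fun h4 (joinExps ns c y)
  · refine finrank_le_of_map (LinearMap.funLeft ℂ ℂ (joinExps ns c)) ?_ ?_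
    · rintro p ⟨h1, h2⟩
      refine ⟨⟨fun g i ε => ?_, (hgrade p).mp h1⟩, (mem_sol_iff_joinExps hw Q p).mp h2⟩
      simp only [LinearMap.funLeft_apply]
      congr 1
      refine Subtype.ext ?_
      simp only [joinExps, colorMono, Function.comp_apply]
      rw [Equiv.sum_comp g fun t => Finsupp.single (⟨c, i t⟩ : CurVar n ns) 1]
    · intro p _ hp
      have := LinearMap.funLeft_injective_of_surjective ℂ ℂ _ hsurj
      exact this (by rw [hp, map_zero])

end Bridge

/-! ### Dimensions at distinct points and at the degenerate point. -/

section Dimensions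

variable {n : ℕ} {ι : Type} [Fintype ι]

/-- The order of vanishing at the position `p`. -/
def posOrd (ns : ι → ℕ) (ks : ι → ℤ) (ν : Gen n → ℕ) (p : ι) : ℕ :=
  ((∑ a ∈ Finset.univ.filter (fun a : Gen n => (a : ℕ) < ns p), ν a : ℕ) - ks p : ℤ).toNat

/-- The polynomial `∏_p (z - ζ_p)^{(∑_{a < n_p} ν_a - k_p)_+}`. -/
def divisor (ns : ι → ℕ) (z : ι → ℂ) (ks : ι → ℤ) (ν : Gen n → ℕ) : Polynomial ℂ :=
  ∏ p, (X - C (z p)) ^ posOrd ns ks ν p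

theorem divisor_monic (ns : ι → ℕ) (z : ι → ℂ) (ks : ι → ℤ) (ν : Gen n → ℕ) :
    (divisor ns z ks ν).Monic :=
  Polynomial.monic_prod_of_monic _ _ fun p _ => (Polynomial.monic_X_sub_C (z p)).pow _

theorem natDegree_divisor (ns : ι → ℕ) (z : ι → ℂ) (ks : ι → ℤ) (ν : Gen n → ℕ) :
    (divisor ns z ks ν).natDegree = ∑ p, posOrd ns ks ν p := by
  rw [divisor, Polynomial.natDegree_prod_of_monic _ _ fun p _ =>
    (Polynomial.monic_X_sub_C (z p)).pow _]
  refine Finset.sum_congr rfl fun p _ => ?_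
  rw [(Polynomial.monic_X_sub_C _).natDegree_pow, Polynomial.natDegree_X_sub_C, mul_one]

variable (n) in
/-- The dimension of the space dual to the weight space at distinct points. -/
def totalDim (ns : ι → ℕ) (z : ι → ℂ) (ks : ι → ℤ) (w : ℕ →₀ ℕ) : ℕ :=
  Module.finrank ℂ (sol (curCoeff n ns w) fun x => divisor ns z ks x.1)

variable (n) in
/-- The dimension of the space dual to the weight space at the degenerate point, in degree `d`. -/
def gradedDim (ns : ι → ℕ) (ks : ι → ℤ) (w : ℕ →₀ ℕ) (d : ℤ) : ℕ :=
  Module.finrank ℂ (homog (fun ε => dg ε.1) d ⊓ sol (curCoeff n ns w)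
    fun x => X ^ ∑ p, posOrd ns ks x.1 p : Submodule ℂ (Exps n ns w → ℂ))

theorem gradedDim_eq_zero {ns : ι → ℕ} {ks : ι → ℤ} {w : ℕ →₀ ℕ} {d : ℤ}
    (hd : ∀ ε : Exps n ns w, (dg ε.1 : ℤ) ≠ d) : gradedDim n ns ks w d = 0 := by
  have : homog (fun ε : Exps n ns w => dg ε.1) d = ⊥ := by
    rw [eq_bot_iff]
    intro p hp
    rw [Submodule.mem_bot]
    funext y
    exact hp y (hd y)
  rw [gradedDim, this]
  simp

theorem sum_gradedDim_eq {ns : ι → ℕ} {ks : ι → ℤ} {w : ℕ →₀ ℕ} {B B' : ℕ}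
    (hB : ∀ ε : Exps n ns w, dg ε.1 < B) (hB' : B ≤ B') :
    ∑ d ∈ Finset.range B', gradedDim n ns ks w d = ∑ d ∈ Finset.range B, gradedDim n ns ks w d := by
  symm
  refine Finset.sum_subset (Finset.range_mono hB') fun d _ hd => gradedDim_eq_zero fun ε => ?_
  have := hB ε
  rw [Finset.mem_range] at hd
  omega

/-- The levels `k_p`, with prescribed values at the positions where the color `c` is active. -/
def setActive (ns : ι → ℕ) (ks : ι → ℤ) {c : Gen n}
    (e : Fin (numActive ns c) ≃ {p // (c : ℕ) < ns p})
    (k : Fin (numActive ns c) → ℤ) (p : ι) : ℤ :=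
  if h : (c : ℕ) < ns p then k (e.symm ⟨p, h⟩) else ks p

theorem setActive_apply {ns : ι → ℕ} {ks : ι → ℤ} {c : Gen n}
    (e : Fin (numActive ns c) ≃ {p // (c : ℕ) < ns p}) (k : Fin (numActive ns c) → ℤ)
    (i : Fin (numActive ns c)) : setActive ns ks e k (e i) = k i := by
  rw [setActive, dif_pos (e i).2]
  simp

theorem setActive_self {ns : ι → ℕ} {ks : ι → ℤ} {c : Gen n}
    (e : Fin (numActive ns c) ≃ {p // (c : ℕ) < ns p}) :
    setActive ns ks e (fun i => ks (e i)) = ks := by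
  funext p
  rw [setActive]
  split_ifs <;> simp

def coreDivisor (ns : ι → ℕ) (z : ι → ℂ) (ks : ι → ℤ) (c : Gen n) (x : CoreIdx ns c) :
    Polynomial ℂ :=
  ∏ p ∈ Finset.univ.filter (fun p => ¬ (c : ℕ) < ns p), (X - C (z p)) ^ posOrd ns ks x.1.1 p

theorem coreDivisor_monic (ns : ι → ℕ) (z : ι → ℂ) (ks : ι → ℤ) (c : Gen n) (x : CoreIdx ns c) :
    (coreDivisor ns z ks c x).Monic :=
  Polynomial.monic_prod_of_monic _ _ fun p _ => (Polynomial.monic_X_sub_C (z p)).pow _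

def coreTotal {ns : ι → ℕ} {c : Gen n} (x : CoreIdx ns c) : ℕ := ∑ a, x.1.1 a

/-- At an inactive position the exponent of `x_c(z)` does not enter. At an active one every color up
to `c` is active, and `ν` vanishes above `c`, so the exponent depends on `ν` only through its total.
This puts the divisor in the form `qz`, with `coreDivisor` as the constant factor. -/
theorem divisor_setActive (ns : ι → ℕ) (z : ι → ℂ) (ks : ι → ℤ) {c : Gen n}
    (e : Fin (numActive ns c) ≃ {p // (c : ℕ) < ns p}) (k : Fin (numActive ns c) → ℤ)
    (x : CoreIdx ns c) (h : ℕ) :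
    divisor ns z (setActive ns ks e k) (x.1.1 + Pi.single c h)
      = qz (coreDivisor ns z ks c) coreTotal (fun i => z (e i)) k x h := by
  rw [divisor, ← Finset.prod_filter_not_mul_prod_filter _ fun p => (c : ℕ) < ns p, qz]
  congr 1
  · refine Finset.prod_congr rfl fun p hp => ?_
    have hp' := (Finset.mem_filter.mp hp).2
    congr 1
    rw [posOrd, posOrd, setActive, dif_neg hp']
    congr 3
    refine Finset.sum_congr rfl fun a ha => ?_
    have ha' := (Finset.mem_filter.mp ha).2
    have hac : a ≠ c := by rintro rfl; exact hp' ha'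
    simp [hac]
  · rw [Finset.prod_subtype (F := inferInstance) _ (p := fun p => (c : ℕ) < ns p) fun p => by simp,
      ← Equiv.prod_comp e]
    refine Finset.prod_congr rfl fun i _ => ?_
    congr 1
    rw [posOrd, setActive_apply]
    congr 2
    have h1 : ∑ a ∈ Finset.univ.filter (fun a : Gen n => (a : ℕ) < ns (e i)),
        (x.1.1 + Pi.single c h : Gen n → ℕ) a = ∑ a, (x.1.1 + Pi.single c h : Gen n → ℕ) a := by
      refine Finset.sum_subset (Finset.subset_univ _) fun a _ ha => ?_
      have hca : c < a := by
        have h2 := (e i).2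
        simp only [Finset.mem_filter, Finset.mem_univ, true_and, not_lt] at ha
        exact Subtype.coe_lt_coe.mp (lt_of_lt_of_le h2 ha)
      simp [x.1.2 a hca, hca.ne']
    rw [h1]
    simp [coreTotal, Finset.sum_add_distrib]

theorem dimZ_eq_totalDim (ns : ι → ℕ) (z : ι → ℂ) (ks : ι → ℤ) {c : Gen n}
    (e : Fin (numActive ns c) ≃ {p // (c : ℕ) < ns p}) (k : Fin (numActive ns c) → ℤ)
    {w : ℕ →₀ ℕ} (hw : ∀ a : ℕ, (c : ℕ) ≤ a → w a = 0) (M : ℕ) :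
    dimZ (coreCoeff ns c w) (coreDivisor ns z ks c) coreTotal (fun i => z (e i)) k M
      = totalDim n ns z (setActive ns ks e k) (w + Finsupp.single (c : ℕ) M) := by
  have h := finrank_joinExps (ns := ns) false (M := M) hw (divisor ns z (setActive ns ks e k)) 0
  have h1 : ∀ {V : Type} [AddCommGroup V] [Module ℂ V] (S S' : Submodule ℂ V), S = S' →
      Module.finrank ℂ S = Module.finrank ℂ S' := by
    rintro V _ _ S S' rfl; rfl
  rw [dimZ, totalDim]
  refine Eq.trans ?_ (h.trans ?_)
  · refine h1 _ _ ?_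
    have h2 : (fun (x : CoreIdx ns c) h => divisor ns z (setActive ns ks e k) (x.1.1 + Pi.single c h))
        = qz (coreDivisor ns z ks c) coreTotal (fun i => z (e i)) k := by
      funext x h
      exact divisor_setActive ns z ks e k x h
    rw [h2]
    exact congrArg (· ⊓ _) (inf_top_eq _).symm
  · exact h1 _ _ (top_inf_eq _)

theorem dimO_eq_gradedDim (ns : ι → ℕ) (z : ι → ℂ) (ks : ι → ℤ) {c : Gen n}
    (e : Fin (numActive ns c) ≃ {p // (c : ℕ) < ns p}) (k : Fin (numActive ns c) → ℤ)
    {w : ℕ →₀ ℕ} (hw : ∀ a : ℕ, (c : ℕ) ≤ a → w a = 0) (M : ℕ) (d : ℤ) :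
    dimO (fun ε => dg ε.1) (coreCoeff ns c w) (fun x => (coreDivisor ns z ks c x).natDegree)
      coreTotal k M d
      = gradedDim n ns (setActive ns ks e k) (w + Finsupp.single (c : ℕ) M) d := by
  have h := finrank_joinExps (ns := ns) true (M := M) hw
    (fun ν => X ^ ∑ p, posOrd ns (setActive ns ks e k) ν p) d
  rw [dimO, gradedDim]
  refine Eq.trans ?_ h
  have h2 : (fun (x : CoreIdx ns c) h => (X : Polynomial ℂ) ^
      ∑ p, posOrd ns (setActive ns ks e k) (x.1.1 + Pi.single c h) p)
      = fun x h => X ^ vord (fun x => (coreDivisor ns z ks c x).natDegree) coreTotal k x h := by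
    funext x h
    rw [← natDegree_divisor ns z, divisor_setActive, natDegree_qz (coreDivisor_monic ns z ks c)]
  rw [h2]
  rfl

def coreDegree {ns : ι → ℕ} {c : Gen n} (x : CoreIdx ns c) : ℕ :=
  dg x.2 + ∑ a, x.1.1 a * (numActive ns a - 1)

theorem coreCoeff_coeff {ns : ι → ℕ} {c : Gen n} {w : ℕ →₀ ℕ} (x : CoreIdx ns c)
    (ε : Exps n ns w) (t : ℕ) (h : (coreCoeff ns c w x ε).coeff t ≠ 0) :
    t + dg ε.1 = coreDegree x := curCoeff_coeff _ _ _ h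

theorem exists_activeEquiv (ns : ι → ℕ) (c : Gen n) :
    Nonempty (Fin (numActive ns c) ≃ {p // (c : ℕ) < ns p}) := by
  rw [← Fintype.card_eq, Fintype.card_fin, Fintype.card_subtype, numActive]

instance (ns : ι → ℕ) : Unique (Exps n ns 0) where
  default := ⟨0, wt_zero⟩
  uniq := fun ε => by
    refine Subtype.ext (Finsupp.ext fun v => eq_zero_of_wt_eq_zero ?_)
    rw [ε.2]
    rfl

/-- In weight `0` the only monomial is `1`, and every coefficient is a constant. A monic polynomial
divides a nonzero constant only if it has degree `0`, so the degrees of the divisors decide. -/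
theorem sol_zero_eq (ns : ι → ℕ) {Q Q' : (Gen n → ℕ) × (CurVar n ns →₀ ℕ) → Polynomial ℂ}
    (hQ : ∀ x, (Q x).Monic) (hQ' : ∀ x, (Q' x).Monic) (h : ∀ x, (Q x).natDegree = (Q' x).natDegree) :
    sol (curCoeff n ns 0) Q = sol (curCoeff n ns 0) Q' := by
  have key : ∀ (Q : (Gen n → ℕ) × (CurVar n ns →₀ ℕ) → Polynomial ℂ), (∀ x, (Q x).Monic) →
      ∀ p, p ∈ sol (curCoeff n ns 0) Q ↔ ∀ x,
        p default • curCoeff n ns 0 x default = 0 ∨ (Q x).natDegree = 0 := by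
    intro Q hQ p
    rw [mem_sol]
    refine forall_congr' fun x => ?_
    rw [Fintype.sum_unique]
    constructor
    · intro h
      by_cases h0 : p default • curCoeff n ns 0 x default = 0
      · exact Or.inl h0
      · right
        have hwt : ∀ t, 0 < t → (curCoeff n ns 0 x default).coeff t = 0 := by
          intro t ht
          by_contra h'
          have h1 := isBihom_curCoeff (ns := ns) x _ _ h'
          have h2 : wt x.2 + wtOf x.1 = 0 := h1.1.symm.trans wt_zero
          rw [add_eq_zero] at h2
          have h3 : x.2 = 0 := Finsupp.ext fun v => eq_zero_of_wt_eq_zero (by rw [h2.1]; rfl)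
          have h4 : ∀ a, x.1 a = 0 := fun a => by
            rw [← wtOf_apply x.1 a, h2.2]; rfl
          have h5 := h1.2
          rw [h3, dg_zero] at h5
          simp only [h4, zero_mul, Finset.sum_const_zero] at h5
          omega
        have h6 := Polynomial.natDegree_le_of_dvd h h0
        have h7 : (p default • curCoeff n ns 0 x default).natDegree = 0 := by
          rw [Polynomial.natDegree_eq_zero_iff_degree_le_zero, Polynomial.degree_le_iff_coeff_zero]
          intro t ht
          rw [Polynomial.coeff_smul, hwt t (by exact_mod_cast ht), smul_zero]
        omega
    · rintro (h | h)
      · rw [h]; exact dvd_zero _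
      · rw [Polynomial.eq_one_of_monic_natDegree_zero (hQ x) h]; exact one_dvd _
  ext p
  rw [key Q hQ, key Q' hQ']
  simp only [h]

/-- The dimensions at distinct points and at the degenerate point agree. -/
theorem totalDim_eq_sum_gradedDim (ns : ι → ℕ) {z : ι → ℂ} (hz : Function.Injective z)
    (w : ℕ →₀ ℕ) : ∀ (ks : ι → ℤ) (B : ℕ), (∀ ε : Exps n ns w, dg ε.1 < B) →
    totalDim n ns z ks w = ∑ d ∈ Finset.range B, gradedDim n ns ks w d := by
  -- Induction on a bound for the colors that occur in `w`; each step removes all factors of the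
  -- largest color.
  suffices H : ∀ m : ℕ, ∀ w : ℕ →₀ ℕ, (∀ a, m ≤ a → w a = 0) → ∀ (ks : ι → ℤ) (B : ℕ),
      (∀ ε : Exps n ns w, dg ε.1 < B) →
      totalDim n ns z ks w = ∑ d ∈ Finset.range B, gradedDim n ns ks w d by
    refine H (w.support.sup id + 1) w fun a ha => ?_
    by_contra h
    have : id a ≤ w.support.sup id := Finset.le_sup (Finsupp.mem_support_iff.mpr h)
    simp only [id] at this
    omega
  intro m
  induction m with
  | zero =>
    intro w hw ks B hB
    obtain rfl : w = 0 := Finsupp.ext fun a => hw a (Nat.zero_le _)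
    have h0 : dg (default : Exps n ns 0).1 = 0 := dg_zero
    have hB0 : 0 < B := lt_of_le_of_lt (Nat.zero_le _) (hB default)
    rw [Finset.sum_eq_single 0]
    · have h1 : homog (fun ε : Exps n ns 0 => dg ε.1) (0 : ℕ) = ⊤ := by
        rw [eq_top_iff]
        intro p _ ε hε
        rw [Unique.eq_default ε] at hε
        exact absurd (congrArg Nat.cast h0) hε
      rw [totalDim, gradedDim, h1, top_inf_eq, sol_zero_eq ns (Q := fun x => divisor ns z ks x.1)
        (Q' := fun x => X ^ ∑ p, posOrd ns ks x.1 p)]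
      · exact fun x => divisor_monic _ _ _ _
      · exact fun x => Polynomial.monic_X_pow _
      · intro x
        rw [natDegree_divisor, Polynomial.natDegree_X_pow]
    · intro d _ hd
      refine gradedDim_eq_zero fun ε => ?_
      rw [Unique.eq_default ε, h0]
      exact_mod_cast hd.symm
    · intro h
      exact absurd (Finset.mem_range.mpr hB0) h
  | succ m ih =>
    intro w hw ks B hB
    by_cases hm0 : w m = 0
    · refine ih w (fun a ha => ?_) ks B hB
      rcases ha.lt_or_eq with h | rfl
      · exact hw a h
      · exact hm0
    by_cases hm : m ∈ Finset.Ico 1 n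
    · let c : Gen n := ⟨m, hm⟩
      have hw1 : w = w.erase m + Finsupp.single (c : ℕ) (w m) := (Finsupp.erase_add_single m w).symm
      have hw2 : ∀ a : ℕ, (c : ℕ) ≤ a → w.erase m a = 0 := by
        intro a ha
        rcases eq_or_ne a m with rfl | h
        · exact Finsupp.erase_same
        · rw [Finsupp.erase_ne h]
          exact hw a (by change m ≤ a at ha; omega)
      generalize w.erase m = w' at hw1 hw2
      generalize w m = M at hw1
      subst hw1
      obtain ⟨e⟩ := exists_activeEquiv ns c
      -- The given `B` bounds only the degrees of the monomials; `B'` also meets the cruder bound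
      -- required for multi-indices.
      set B' := B + M * numActive ns c + ∑ ε : Exps n ns w', dg ε.1 + 1 with hB'
      have hdg : ∀ ε : Exps n ns w', M * numActive ns c + dg ε.1 < B' := by
        intro ε
        have := Finset.single_le_sum (f := fun ε : Exps n ns w' => dg ε.1)
          (fun ε _ => Nat.zero_le _) (Finset.mem_univ ε)
        omega
      have key := dimZ_eq_sum_dimO (fun ε => dg ε.1) (coreCoeff ns c w') (coreDivisor ns z ks c) _
        coreTotal coreCoeff_coeff (coreDivisor_monic ns z ks c) rfl M (fun i => z (e i))
        (fun i i' h => e.injective (Subtype.ext (hz h))) B' hdg (fun k => by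
          rw [dimZ_eq_totalDim ns z ks e k hw2 0]
          simp only [dimO_eq_gradedDim ns z ks e k hw2 0, Finsupp.single_zero, add_zero]
          exact ih w' (fun a ha => hw2 a ha) _ B' fun ε => by
            have := hdg ε
            omega) (fun i => ks (e i))
      rw [dimZ_eq_totalDim ns z ks e _ hw2 M, setActive_self] at key
      simp only [dimO_eq_gradedDim ns z ks e _ hw2 M, setActive_self] at key
      rw [key]
      exact sum_gradedDim_eq hB (by omega)
    · have : IsEmpty (Exps n ns w) := ⟨fun ε => hm0 (by
        rw [← DFunLike.congr_fun ε.2 m]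
        exact wt_apply_of_notMem ε.1 hm)⟩
      rw [totalDim, Module.finrank_zero_of_subsingleton, Finset.sum_eq_zero]
      intro d _
      exact gradedDim_eq_zero fun ε => isEmptyElim ε

theorem exists_injective_complex (ι : Type) [Fintype ι] : ∃ z : ι → ℂ, Function.Injective z :=
  ⟨fun p => ((Fintype.equivFin ι p : ℕ) : ℂ), fun _ _ h =>
    (Fintype.equivFin ι).injective (Fin.ext (Nat.cast_injective h))⟩

/-- The recursion for the graded dimensions. -/
theorem sum_gradedDim_setActive (ns : ι → ℕ) (ks : ι → ℤ) {c : Gen n}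
    (e : Fin (numActive ns c) ≃ {p // (c : ℕ) < ns p}) {k : Fin (numActive ns c) → ℤ}
    (hk : Antitone k) {w : ℕ →₀ ℕ} (hw : ∀ a : ℕ, (c : ℕ) ≤ a → w a = 0) (M : ℕ) (d : ℤ) :
    ∑ j ∈ Finset.range (M + 2), (-1 : ℤ) ^ j *
      ∑ α ∈ Finset.powersetCard j (Finset.univ : Finset (Fin (numActive ns c))),
        (gradedDim n ns (setActive ns ks e (lower k α)) (w + Finsupp.single (c : ℕ) (M + 1 - j))
          (d - ∑ i ∈ α, ((i : ℕ) : ℤ)) : ℤ) = 0 := by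
  -- The statement involves no points; auxiliary distinct ones are needed for the sandwich.
  obtain ⟨z, hz⟩ := exists_injective_complex ι
  have key := sum_dimO_eq_zero (fun ε => dg ε.1) (coreCoeff ns c w) (coreDivisor ns z ks c) _
    coreTotal (fun i => z (e i)) k coreCoeff_coeff (coreDivisor_monic ns z ks c) rfl M
    (fun i i' h => e.injective (Subtype.ext (hz h))) (fun B hB k => by
      rw [dimZ_eq_totalDim ns z ks e k hw 0]
      simp only [dimO_eq_gradedDim ns z ks e k hw 0, Finsupp.single_zero, add_zero]
      exact totalDim_eq_sum_gradedDim ns hz w _ B hB) hk d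
  simp only [dimO_eq_gradedDim ns z ks e _ hw] at key
  exact key

end Dimensions

/-! ### The `q`-Pascal rule and an alternating `q`-binomial sum. -/

section QBinomials

theorem qFact_ne_zero (n : ℕ) : qFact n ≠ 0 := (qFact_monic n).ne_zero

theorem qBinom_of_lt {m n : ℤ} (h : m < n) : qBinom m n = 0 := by
  rw [qBinom, if_neg (by omega)]

theorem qBinom_zero_right (m : ℕ) : qBinom m 0 = 1 := by
  have := qBinom_mul (Nat.zero_le m)
  rw [Nat.sub_zero, qFact, Finset.Icc_eq_empty (by omega), Finset.prod_empty, one_mul] at this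
  exact mul_right_cancel₀ (qFact_ne_zero m) (by rw [one_mul]; exact_mod_cast this)

theorem qBinom_self (m : ℕ) : qBinom m m = 1 := by
  have := qBinom_mul (le_refl m)
  rw [Nat.sub_self, show qFact 0 = 1 by simp [qFact], mul_one] at this
  exact mul_right_cancel₀ (qFact_ne_zero m) (by rw [one_mul]; exact this)

theorem qBinom_succ_succ (m l : ℕ) :
    qBinom (m + 1 : ℕ) (l + 1 : ℕ) = X ^ (m - l) * qBinom m l + qBinom m (l + 1 : ℕ) := by
  rcases lt_trichotomy m l with h | rfl | h
  · rw [qBinom_of_lt (by omega), qBinom_of_lt (by omega), qBinom_of_lt (by omega)]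
    simp
  · rw [qBinom_self, qBinom_self, qBinom_of_lt (by omega)]
    simp
  · obtain ⟨t, rfl⟩ : ∃ t, m = l + 1 + t := ⟨m - (l + 1), by omega⟩
    have h1 := qBinom_mul (show l + 1 ≤ l + 1 + t + 1 by omega)
    have h2 := qBinom_mul (show l ≤ l + 1 + t by omega)
    have h3 := qBinom_mul (show l + 1 ≤ l + 1 + t by omega)
    rw [show l + 1 + t + 1 - (l + 1) = t + 1 by omega] at h1
    rw [show l + 1 + t - l = t + 1 by omega] at h2
    rw [show l + 1 + t - (l + 1) = t by omega] at h3
    refine mul_right_cancel₀ (mul_ne_zero (qFact_ne_zero (l + 1)) (qFact_ne_zero (t + 1))) ?_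
    rw [h1, qFact_succ (l + 1 + t), add_mul, show l + 1 + t - l = t + 1 by omega]
    have h4 : X ^ (t + 1) * qBinom (l + 1 + t : ℕ) l * (qFact (l + 1) * qFact (t + 1))
        = X ^ (t + 1) * (∑ i ∈ Finset.range (l + 1), X ^ i) * qFact (l + 1 + t) := by
      rw [qFact_succ l, ← h2]
      ring
    have h5 : qBinom (l + 1 + t : ℕ) (l + 1 : ℕ) * (qFact (l + 1) * qFact (t + 1))
        = (∑ i ∈ Finset.range (t + 1), X ^ i) * qFact (l + 1 + t) := by
      rw [qFact_succ t, ← h3]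
      ring
    rw [h4, h5, show l + 1 + t + 1 = (t + 1) + (l + 1) by omega, Finset.sum_range_add]
    simp only [pow_add _ (t + 1), ← Finset.mul_sum]
    ring

/-- The alternating sum of the contributions of a block of equal levels. -/
theorem sum_block_eq_zero (R : ℕ) : ∀ a0 d : ℕ, R < d →
    ∑ β ∈ (Finset.Ico a0 (a0 + d)).powerset, (-1 : Polynomial ℤ) ^ β.card * X ^ (∑ i ∈ β, i) *
      (X ^ (a0 * (d - β.card - R)) * qBinom (d - β.card : ℕ) R) = 0 := by
  -- Pair `β` with `β ∪ {a0}`. For `R = 0` the two terms cancel. For `R + 1` the `q`-Pascal rule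
  -- turns their sum into the term of `β` for the data `R`, `a0 + 1`, `d`, so induction on `R`
  -- applies.
  have split : ∀ (g : Finset ℕ → Polynomial ℤ) (a0 d : ℕ),
      ∑ β ∈ (Finset.Ico a0 (a0 + (d + 1))).powerset, g β
        = ∑ β ∈ (Finset.Ico (a0 + 1) (a0 + 1 + d)).powerset, (g β + g (insert a0 β)) := by
    intro g a0 d
    have h1 : Finset.Ico a0 (a0 + (d + 1)) = insert a0 (Finset.Ico (a0 + 1) (a0 + 1 + d)) := by
      ext i
      simp only [Finset.mem_Ico, Finset.mem_insert]
      omega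
    rw [h1, Finset.sum_powerset_insert (by simp), Finset.sum_add_distrib]
  have hmem : ∀ {a0 d : ℕ} {β : Finset ℕ}, β ∈ (Finset.Ico (a0 + 1) (a0 + 1 + d)).powerset →
      a0 ∉ β ∧ β.card ≤ d := by
    intro a0 d β hβ
    have h := Finset.mem_powerset.mp hβ
    refine ⟨fun h' => by simpa using h h', ?_⟩
    simpa using Finset.card_le_card h
  induction R with
  | zero =>
    intro a0 d hd
    obtain ⟨d, rfl⟩ : ∃ d', d = d' + 1 := ⟨d - 1, by omega⟩
    rw [split]
    refine Finset.sum_eq_zero fun β hβ => ?_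
    obtain ⟨h1, h2⟩ := hmem hβ
    rw [Finset.card_insert_of_notMem h1, Finset.sum_insert h1, Nat.cast_zero, qBinom_zero_right,
      qBinom_zero_right, show d + 1 - β.card - 0 = (d + 1 - (β.card + 1) - 0) + 1 by omega, mul_add,
      pow_add, pow_add, pow_add]
    ring
  | succ R ih =>
    intro a0 d hd
    obtain ⟨d, rfl⟩ : ∃ d', d = d' + 1 := ⟨d - 1, by omega⟩
    rw [split, ← ih (a0 + 1) d (by omega)]
    refine Finset.sum_congr rfl fun β hβ => ?_
    obtain ⟨h1, h2⟩ := hmem hβ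
    rw [Finset.card_insert_of_notMem h1, Finset.sum_insert h1,
      show d + 1 - (β.card + 1) = d - β.card by omega,
      show d + 1 - β.card = d - β.card + 1 by omega]
    generalize d - β.card = m
    rw [qBinom_succ_succ, Nat.add_sub_add_right]
    rcases lt_trichotomy m R with h | rfl | h
    · rw [qBinom_of_lt (show ((m : ℕ) : ℤ) < (R : ℕ) by omega),
        qBinom_of_lt (show ((m : ℕ) : ℤ) < (R + 1 : ℕ) by omega)]
      ring
    · rw [qBinom_of_lt (show ((m : ℕ) : ℤ) < (m + 1 : ℕ) by omega)]
      simp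
    · obtain ⟨t, rfl⟩ : ∃ t, m = R + t + 1 := ⟨m - R - 1, by omega⟩
      rw [show R + t + 1 - R = t + 1 by omega, show R + t + 1 - (R + 1) = t by omega]
      ring

end QBinomials

/-! ### Conjugate partitions and the factors of `F`. -/

section Shapes

theorem column_apply (k a : ℕ) : column k a = if a < k then 1 else 0 := by
  rw [column, Finsupp.finsetSum_apply]
  simp [Finsupp.single_apply]

theorem sum_column_apply {τ : Type*} [Fintype τ] (k : τ → ℕ) (a : ℕ) :
    (∑ i, column (k i)) a = (Finset.univ.filter fun i => a < k i).card := by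
  rw [Finsupp.finsetSum_apply]
  simp [column_apply]

theorem antitone_sum_column {τ : Type*} [Fintype τ] (k : τ → ℕ) :
    Antitone ⇑(∑ i, column (k i)) := by
  intro a b h
  rw [sum_column_apply, sum_column_apply]
  exact Finset.card_le_card fun i hi => by
    simp only [Finset.mem_filter, Finset.mem_univ, true_and] at hi ⊢
    omega

theorem lt_card_iff {K : ℕ} {k : Fin K → ℕ} (hk : Antitone k) (a : ℕ) (i : Fin K) :
    (i : ℕ) < (Finset.univ.filter fun i => a < k i).card ↔ a < k i := by
  constructor
  · intro h
    by_contra h'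
    have : (Finset.univ.filter fun i => a < k i) ⊆ Finset.Iio i := by
      intro p hp
      have hp' := (Finset.mem_filter.mp hp).2
      rw [Finset.mem_Iio]
      by_contra hip
      have := hk (not_lt.mp hip)
      omega
    have := Finset.card_le_card this
    rw [Fin.card_Iio] at this
    omega
  · intro h
    have : Finset.Iic i ⊆ Finset.univ.filter fun i => a < k i := by
      intro p hp
      have := hk (Finset.mem_Iic.mp hp)
      simp only [Finset.mem_filter, Finset.mem_univ, true_and]
      omega
    have := Finset.card_le_card this
    rw [Fin.card_Iic] at this
    omega

theorem conjPart_sum_column {K : ℕ} {k : Fin K → ℕ} (hk : Antitone k) (i : Fin K) :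
    conjPart (∑ i, column (k i)) i = k i := by
  have h : ((∑ i, column (k i)).support.filter fun a => (i : ℕ) < (∑ i, column (k i)) a)
      = Finset.range (k i) := by
    ext a
    rw [Finset.mem_filter, Finsupp.mem_support_iff, sum_column_apply, lt_card_iff hk,
      Finset.mem_range]
    constructor
    · exact fun h => h.2
    · intro h
      refine ⟨?_, h⟩
      rw [← Nat.pos_iff_ne_zero, Finset.card_pos]
      exact ⟨i, by simpa using h⟩
  rw [conjPart, h, Finset.card_range]

theorem mem_support_iff_of_antitone {κ : ℕ →₀ ℕ} (hκ : Antitone κ) (a : ℕ) :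
    κ a ≠ 0 ↔ a < κ.support.card := by
  constructor
  · intro h
    have : Finset.range (a + 1) ⊆ κ.support := by
      intro b hb
      have := hκ (show b ≤ a by have := Finset.mem_range.mp hb; omega)
      rw [Finsupp.mem_support_iff]
      omega
    have := Finset.card_le_card this
    rw [Finset.card_range] at this
    omega
  · intro h h0
    have : κ.support ⊆ Finset.range a := by
      intro b hb
      rw [Finset.mem_range]
      by_contra hba
      have := hκ (not_lt.mp hba)
      rw [Finsupp.mem_support_iff] at hb
      omega
    have := Finset.card_le_card this
    rw [Finset.card_range] at this
    omega

theorem degree_sum_column {τ : Type*} [Fintype τ] (k : τ → ℕ) :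
    (∑ i, column (k i)).degree = ∑ i, k i := by
  rw [map_sum]
  refine Finset.sum_congr rfl fun i _ => ?_
  rw [column, map_sum]
  simp

/-- The factor of `F_{κ,ρ}` at one index. -/
def Ffactor (x y y' : ℕ) : Polynomial ℤ :=
  X ^ (y' * (x - y)) * qBinom ((x : ℤ) - y') ((y : ℤ) - y')

theorem Ffactor_of_lt {x y y' : ℕ} (h : x < y) : Ffactor x y y' = 0 := by
  rw [Ffactor, qBinom_of_lt (by omega), mul_zero]

/-- Rows beyond the length of `κ` contribute factors `1`, and the last row contributes no power of
`q` because `ρ` vanishes beyond it. The product may therefore run over any common range, which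
permits the comparison of different shapes. -/
theorem F_eq_prod {κ ρ : ℕ →₀ ℕ} (hκ : Antitone κ) (hρ : ρ ≤ κ) {L : ℕ}
    (hL : κ.support.card ≤ L) : F κ ρ = ∏ a ∈ Finset.range L, Ffactor (κ a) (ρ a) (ρ (a + 1)) := by
  have h0 : ∀ a, κ.support.card ≤ a → κ a = 0 ∧ ρ a = 0 := by
    intro a ha
    have h1 : κ a = 0 := by
      by_contra h
      have := (mem_support_iff_of_antitone hκ a).mp h
      omega
    have := hρ a
    exact ⟨h1, by omega⟩
  have h1 : ∏ a ∈ Finset.range L, Ffactor (κ a) (ρ a) (ρ (a + 1))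
      = ∏ a ∈ Finset.range κ.support.card, Ffactor (κ a) (ρ a) (ρ (a + 1)) := by
    symm
    refine Finset.prod_subset (Finset.range_mono hL) fun a _ ha => ?_
    rw [Finset.mem_range, not_lt] at ha
    rw [Ffactor, (h0 a ha).1, (h0 a ha).2, (h0 (a + 1) (by omega)).2]
    simpa using qBinom_self 0
  rw [h1]
  simp only [Ffactor]
  rw [Finset.prod_mul_distrib, Finset.prod_pow_eq_pow_sum, F]
  congr 2
  rcases h : κ.support.card with _ | l
  · rfl
  · rw [Finset.sum_range_succ, Nat.add_sub_cancel, (h0 (l + 1) h.le).2, zero_mul, add_zero]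

end Shapes

/-! ### Cancellation of the lowerings for a fixed shape. -/

section Solve

open Classical in
theorem mem_between {ρ κ ν : ℕ →₀ ℕ} : ν ∈ between ρ κ ↔ ρ ≤ ν ∧ ν ≤ κ ∧ Antitone ν := by
  rw [between, Finset.mem_filter, Finset.mem_Icc, and_assoc]

theorem sum_powerset_split {τ A : Type*} [DecidableEq τ] [AddCommMonoid A] {s t : Finset τ}
    (hst : s ⊆ t) (g : Finset τ → A) :
    ∑ α ∈ t.powerset, g α = ∑ γ ∈ (t \ s).powerset, ∑ β ∈ s.powerset, g (γ ∪ β) := by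
  rw [← Finset.sum_product']
  symm
  refine Finset.sum_nbij' (fun x => x.1 ∪ x.2) (fun α => (α \ s, α ∩ s)) ?_ ?_ ?_ ?_ ?_
  · rintro ⟨γ, β⟩ h
    rw [Finset.mem_product, Finset.mem_powerset, Finset.mem_powerset] at h
    rw [Finset.mem_powerset]
    exact Finset.union_subset (h.1.trans Finset.sdiff_subset) (h.2.trans hst)
  · intro α h
    rw [Finset.mem_powerset] at h
    rw [Finset.mem_product, Finset.mem_powerset, Finset.mem_powerset]
    exact ⟨Finset.sdiff_subset_sdiff h le_rfl, Finset.inter_subset_right⟩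
  · rintro ⟨γ, β⟩ h
    rw [Finset.mem_product, Finset.mem_powerset, Finset.mem_powerset] at h
    have h1 : Disjoint γ s := Finset.disjoint_of_subset_left h.1 Finset.sdiff_disjoint
    refine Prod.ext ?_ ?_
    · simp only
      rw [Finset.union_sdiff_distrib, Finset.sdiff_eq_self_of_disjoint h1,
        Finset.sdiff_eq_empty_iff_subset.mpr h.2, Finset.union_empty]
    · simp only
      rw [Finset.union_inter_distrib_right, Finset.disjoint_iff_inter_eq_empty.mp h1,
        Finset.inter_eq_left.mpr h.2, Finset.empty_union]
  · intro α _
    exact Finset.sdiff_union_inter α s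
  · intros
    rfl

variable {K : ℕ}

/-- The number of positions in `α` with level `a + 1`. -/
def levelCount (k : Fin K → ℕ) (α : Finset (Fin K)) (a : ℕ) : ℕ :=
  (α.filter fun i => k i = a + 1).card

/-- The alternating sum over the lowerings vanishes, for each shape different from `κ`. -/
theorem sum_prod_Ffactor_eq_zero {k : Fin K → ℕ} (hk : Antitone k) {ρ : ℕ →₀ ℕ} (hρ : Antitone ρ)
    (hle : ρ ≤ ∑ i, column (k i)) (hne : ρ ≠ ∑ i, column (k i)) {L : ℕ}
    (hL : (∑ i, column (k i)).support.card ≤ L) :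
    ∑ α ∈ (Finset.univ.filter fun i => 0 < k i).powerset, (-1 : Polynomial ℤ) ^ α.card *
      X ^ (∑ i ∈ α, (i : ℕ)) * ∏ a ∈ Finset.range L,
        Ffactor ((∑ i, column (k i)) a - levelCount k α a) (ρ a) (ρ (a + 1)) = 0 := by
  set κ := ∑ i, column (k i) with hκ
  have hκa : Antitone κ := antitone_sum_column k
  have hnonempty : (κ - ρ).support.Nonempty := by
    rw [Finsupp.support_nonempty_iff]
    intro h
    exact hne (le_antisymm hle (tsub_eq_zero_iff_le.mp h))
  -- The last row in which `ρ` differs from `κ`. Lowering positions of level `b + 1` affects only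
  -- this row.
  set b := (κ - ρ).support.max' hnonempty with hb
  have hb1 : ρ b < κ b := by
    have := Finset.max'_mem _ hnonempty
    rw [← hb, Finsupp.mem_support_iff, Finsupp.tsub_apply] at this
    omega
  have hb2 : ρ (b + 1) = κ (b + 1) := by
    by_contra h
    have h1 : b + 1 ∈ (κ - ρ).support := by
      rw [Finsupp.mem_support_iff, Finsupp.tsub_apply]
      have := hle (b + 1)
      omega
    have := Finset.le_max' _ _ h1
    omega
  have hbL : b < L := lt_of_lt_of_le ((mem_support_iff_of_antitone hκa b).mp (by omega)) hL
  set s := Finset.univ.filter fun i => k i = b + 1 with hs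
  have hst : s ⊆ Finset.univ.filter fun i => 0 < k i := by
    intro i hi
    have := (Finset.mem_filter.mp hi).2
    simp only [Finset.mem_filter, Finset.mem_univ, true_and]
    omega
  -- Since `k` is decreasing, the positions of level `b + 1` form the interval from `κ (b + 1) = ρ
  -- (b + 1)` to `κ b`.
  have hblock : s.image (fun i : Fin K => (i : ℕ)) = Finset.Ico (ρ (b + 1)) (κ b) := by
    ext i
    rw [Finset.mem_image, Finset.mem_Ico, hb2]
    constructor
    · rintro ⟨i, hi, rfl⟩
      have h1 := (Finset.mem_filter.mp hi).2
      have h2 := lt_card_iff hk b i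
      have h3 := lt_card_iff hk (b + 1) i
      rw [← sum_column_apply k] at h2 h3
      rw [← hκ] at h2 h3
      omega
    · rintro ⟨h1, h2⟩
      have hiK : i < K := by
        refine lt_of_lt_of_le h2 ?_
        rw [hκ, sum_column_apply]
        exact (Finset.card_le_univ _).trans (by simp)
      refine ⟨⟨i, hiK⟩, ?_, rfl⟩
      have h3 := lt_card_iff hk b ⟨i, hiK⟩
      have h4 := lt_card_iff hk (b + 1) ⟨i, hiK⟩
      rw [← sum_column_apply k] at h3 h4
      rw [← hκ] at h3 h4
      simp only [hs, Finset.mem_filter, Finset.mem_univ, true_and]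
      simp only at h3 h4
      omega
  have hρb : ρ (b + 1) ≤ ρ b := hρ (by omega)
  rw [sum_powerset_split hst]
  refine Finset.sum_eq_zero fun γ hγ => ?_
  rw [Finset.mem_powerset] at hγ
  have hγs : ∀ i ∈ γ, k i ≠ b + 1 := by
    intro i hi h
    have := hγ hi
    rw [Finset.mem_sdiff] at this
    exact this.2 (by simpa [hs] using h)
  have hterm : ∀ β ∈ s.powerset, (-1 : Polynomial ℤ) ^ (γ ∪ β).card *
      X ^ (∑ i ∈ γ ∪ β, (i : ℕ)) * ∏ a ∈ Finset.range L,
        Ffactor (κ a - levelCount k (γ ∪ β) a) (ρ a) (ρ (a + 1))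
      = ((-1) ^ γ.card * X ^ (∑ i ∈ γ, (i : ℕ)) * ∏ a ∈ (Finset.range L).erase b,
        Ffactor (κ a - levelCount k γ a) (ρ a) (ρ (a + 1))) *
        ((-1) ^ β.card * X ^ (∑ i ∈ β, (i : ℕ)) * Ffactor (κ b - β.card) (ρ b) (ρ (b + 1))) := by
    intro β hβ
    rw [Finset.mem_powerset] at hβ
    have hβs : ∀ i ∈ β, k i = b + 1 := fun i hi => (Finset.mem_filter.mp (hβ hi)).2
    have hdisj : Disjoint γ β := by
      rw [Finset.disjoint_left]
      exact fun i h1 h2 => hγs i h1 (hβs i h2)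
    rw [Finset.card_union_of_disjoint hdisj, Finset.sum_union hdisj,
      ← Finset.mul_prod_erase _ _ (Finset.mem_range.mpr hbL)]
    have h1 : levelCount k (γ ∪ β) b = β.card := by
      rw [levelCount, Finset.filter_union, Finset.filter_false_of_mem hγs, Finset.empty_union,
        Finset.filter_true_of_mem hβs]
    have h2 : ∀ a ∈ (Finset.range L).erase b, Ffactor (κ a - levelCount k (γ ∪ β) a) (ρ a) (ρ (a + 1))
        = Ffactor (κ a - levelCount k γ a) (ρ a) (ρ (a + 1)) := by
      intro a ha
      rw [levelCount, levelCount, Finset.filter_union, Finset.filter_false_of_mem (s := β),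
        Finset.union_empty]
      intro i hi h
      have h3 := hβs i hi
      have h4 := Finset.ne_of_mem_erase ha
      omega
    rw [h1, Finset.prod_congr rfl h2, pow_add, pow_add]
    ring
  rw [Finset.sum_congr rfl hterm, ← Finset.mul_sum]
  refine mul_eq_zero_of_right _ ?_
  -- The block starts at `ρ (b + 1)`, which is also the multiplier in the exponent of `q` of the
  -- factor at row `b`. The condition `R < d` is `ρ b < κ b`.
  have key := sum_block_eq_zero (ρ b - ρ (b + 1)) (ρ (b + 1)) (κ b - ρ (b + 1)) (by omega)
  rw [show ρ (b + 1) + (κ b - ρ (b + 1)) = κ b by omega, ← hblock, Finset.powerset_image,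
    Finset.sum_image (fun x _ y _ h => Finset.image_injective Fin.val_injective h)] at key
  rw [← key]
  refine Finset.sum_congr rfl fun β hβ => ?_
  have hcard : (β.image fun i : Fin K => (i : ℕ)).card = β.card :=
    Finset.card_image_of_injective _ Fin.val_injective
  have hβc : β.card ≤ κ b - ρ (b + 1) := by
    have := Finset.card_le_card (Finset.mem_powerset.mp hβ)
    rw [← Finset.card_image_of_injective s Fin.val_injective] at this
    have h2 : (s.image Fin.val).card = κ b - ρ (b + 1) := by
      rw [← Nat.card_Ico, ← hblock]
    omega
  rw [hcard, Finset.sum_image (fun x _ y _ h => Fin.val_injective h), Ffactor]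
  congr 2
  · congr 2
    omega
  · congr 1 <;> omega

end Solve

/-! ### Solution of the recursion in terms of `F`. -/

section Solve

variable {K : ℕ}

theorem sum_column_sub {k : Fin K → ℕ} {α : Finset (Fin K)} (hα : ∀ i ∈ α, 0 < k i) (a : ℕ) :
    (∑ i, column (k i - if i ∈ α then 1 else 0)) a
      = (∑ i, column (k i)) a - levelCount k α a := by
  rw [sum_column_apply, sum_column_apply, levelCount]
  have h : (Finset.univ.filter fun i => a < k i) = (Finset.univ.filter
      fun i => a < k i - if i ∈ α then 1 else 0) ∪ α.filter fun i => k i = a + 1 := by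
    ext i
    simp only [Finset.mem_filter, Finset.mem_univ, true_and, Finset.mem_union]
    by_cases hi : i ∈ α
    · have := hα i hi
      simp only [hi, if_true, true_and]
      omega
    · simp [hi]
  rw [h, Finset.card_union_of_disjoint, Nat.add_sub_cancel]
  rw [Finset.disjoint_left]
  intro i h1 h2
  obtain ⟨h3, h4⟩ := Finset.mem_filter.mp h2
  simp only [Finset.mem_filter, Finset.mem_univ, true_and, h3, if_true] at h1
  omega

theorem sum_sub_add_card {k : Fin K → ℕ} {α : Finset (Fin K)} (hα : ∀ i ∈ α, 0 < k i) :
    ∑ i, (k i - if i ∈ α then 1 else 0) + α.card = ∑ i, k i := by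
  have h1 : α.card = ∑ i, if i ∈ α then 1 else 0 := by simp
  rw [h1, ← Finset.sum_add_distrib]
  refine Finset.sum_congr rfl fun i _ => ?_
  split_ifs with hi
  · have := hα i hi
    omega
  · rfl

/-- The partitions `ρ ⊂ κ` with `|κ| - |ρ| = M`. -/
def shapes (κ : ℕ →₀ ℕ) (M : ℕ) : Finset (ℕ →₀ ℕ) :=
  (between 0 κ).filter fun ρ => ρ.degree + M = κ.degree

theorem mem_shapes {κ ρ : ℕ →₀ ℕ} {M : ℕ} :
    ρ ∈ shapes κ M ↔ ρ ≤ κ ∧ Antitone ρ ∧ ρ.degree + M = κ.degree := by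
  rw [shapes, Finset.mem_filter, mem_between]
  simp [and_assoc]

theorem degree_mono {κ ρ : ℕ →₀ ℕ} (h : ρ ≤ κ) : ρ.degree ≤ κ.degree := by
  rw [← add_tsub_cancel_of_le h, map_add]
  exact Nat.le_add_right _ _

theorem eq_of_le_of_degree {κ ρ : ℕ →₀ ℕ} (h : ρ ≤ κ) (hd : ρ.degree = κ.degree) : ρ = κ := by
  have h1 := congrArg Finsupp.degree (add_tsub_cancel_of_le h)
  rw [map_add, hd] at h1
  have h2 : (κ - ρ).degree = 0 := by omega
  rw [Finsupp.degree_eq_zero_iff] at h2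
  exact le_antisymm h (tsub_eq_zero_iff_le.mp h2)

theorem F_self {κ : ℕ →₀ ℕ} (hκ : Antitone κ) : F κ κ = 1 := by
  rw [F_eq_prod hκ le_rfl le_rfl]
  refine Finset.prod_eq_one fun a _ => ?_
  have h := hκ (Nat.le_succ a)
  rw [Ffactor, Nat.sub_self, mul_zero, pow_zero, one_mul, ← Nat.cast_sub h]
  exact qBinom_self _

variable {A : Type*} [CommRing A] (φ : Polynomial ℤ →+* A) (T : ℕ → (Fin K → ℤ) → A)

/-- The solution of the recursion in terms of the values at `0`. -/
def shapeSum (M : ℕ) (κ : ℕ →₀ ℕ) : A :=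
  ∑ ρ ∈ shapes κ M, φ (F κ ρ) * T 0 fun i => (conjPart ρ i : ℤ)

/-- A factor vanishes as soon as `ρ` sticks out of the lowered shape, so the sum may be extended to
all shapes inside `κ`, with the same size condition for every `α`. The index set no longer depends
on `α`, and the sum over `α` can be carried out for each `ρ`. -/
theorem shapeSum_lower {k : Fin K → ℕ} (M : ℕ) {α : Finset (Fin K)}
    (hα : ∀ i ∈ α, 0 < k i) :
    (if α.card ≤ M then shapeSum φ T (M - α.card) (∑ i, column (k i - if i ∈ α then 1 else 0))
      else 0) = ∑ ρ ∈ shapes (∑ i, column (k i)) M,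
        φ (∏ a ∈ Finset.range (∑ i, column (k i)).support.card,
          Ffactor ((∑ i, column (k i)) a - levelCount k α a) (ρ a) (ρ (a + 1))) *
          T 0 fun i => (conjPart ρ i : ℤ) := by
  set κ := ∑ i, column (k i) with hκ
  set κ' := ∑ i, column (k i - if i ∈ α then 1 else 0) with hκ'
  have hκa : Antitone κ := antitone_sum_column k
  have hκa' : Antitone κ' := antitone_sum_column _
  have hval : ∀ a, κ' a = κ a - levelCount k α a := sum_column_sub hα
  have hle : κ' ≤ κ := fun a => by rw [hval]; exact Nat.sub_le _ _
  have hdeg : κ'.degree + α.card = κ.degree := by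
    rw [hκ, hκ', degree_sum_column, degree_sum_column, sum_sub_add_card hα]
  have hsupp : κ'.support.card ≤ κ.support.card := Finset.card_le_card fun a ha => by
    rw [Finsupp.mem_support_iff] at ha ⊢
    have := hle a
    omega
  have hzero : ∀ ρ ∈ shapes κ M, ¬ ρ ≤ κ' → ∏ a ∈ Finset.range κ.support.card,
      Ffactor (κ a - levelCount k α a) (ρ a) (ρ (a + 1)) = 0 := by
    intro ρ hρ h
    obtain ⟨a, ha⟩ := not_forall.mp h
    have hρκ := (mem_shapes.mp hρ).1 a
    refine Finset.prod_eq_zero (i := a) ?_ (Ffactor_of_lt ?_)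
    · rw [Finset.mem_range, ← mem_support_iff_of_antitone hκa]
      omega
    · rw [← hval]
      omega
  split_ifs with hM
  · rw [shapeSum]
    have hsub : shapes κ' (M - α.card) ⊆ shapes κ M := by
      intro ρ hρ
      obtain ⟨h1, h2, h3⟩ := mem_shapes.mp hρ
      exact mem_shapes.mpr ⟨h1.trans hle, h2, by omega⟩
    rw [← Finset.sum_subset hsub]
    · refine Finset.sum_congr rfl fun ρ hρ => ?_
      obtain ⟨h1, h2, h3⟩ := mem_shapes.mp hρ
      rw [F_eq_prod hκa' h1 hsupp]
      simp only [hval]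
    · intro ρ hρ hρ'
      rw [hzero ρ hρ, map_zero, zero_mul]
      intro h
      obtain ⟨h1, h2, h3⟩ := mem_shapes.mp hρ
      exact hρ' (mem_shapes.mpr ⟨h, h2, by omega⟩)
  · symm
    refine Finset.sum_eq_zero fun ρ hρ => ?_
    rw [hzero ρ hρ, map_zero, zero_mul]
    intro h
    obtain ⟨h1, h2, h3⟩ := mem_shapes.mp hρ
    have := degree_mono h
    omega

/-- After `shapeSum_lower` the sums may be exchanged. Each `ρ` has `M + 1 > 0` boxes fewer than `κ`,
so `ρ ≠ κ` and `sum_prod_Ffactor_eq_zero` applies. -/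
theorem sum_shapeSum_eq_zero {k : Fin K → ℕ} (hk : Antitone k) (M : ℕ) :
    ∑ α ∈ (Finset.univ.filter fun i => 0 < k i).powerset,
      (-1 : A) ^ α.card * φ X ^ (∑ i ∈ α, (i : ℕ)) *
      (if α.card ≤ M + 1 then
        shapeSum φ T (M + 1 - α.card) (∑ i, column (k i - if i ∈ α then 1 else 0)) else 0) = 0 := by
  have h1 : ∀ α ∈ (Finset.univ.filter fun i => 0 < k i).powerset,
      (-1 : A) ^ α.card * φ X ^ (∑ i ∈ α, (i : ℕ)) *
      (if α.card ≤ M + 1 then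
        shapeSum φ T (M + 1 - α.card) (∑ i, column (k i - if i ∈ α then 1 else 0)) else 0)
      = ∑ ρ ∈ shapes (∑ i, column (k i)) (M + 1), φ ((-1) ^ α.card * X ^ (∑ i ∈ α, (i : ℕ)) *
        ∏ a ∈ Finset.range (∑ i, column (k i)).support.card,
          Ffactor ((∑ i, column (k i)) a - levelCount k α a) (ρ a) (ρ (a + 1))) *
          T 0 fun i => (conjPart ρ i : ℤ) := by
    intro α hα
    rw [shapeSum_lower φ T (M + 1) fun i hi =>
      (Finset.mem_filter.mp (Finset.mem_powerset.mp hα hi)).2, Finset.mul_sum]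
    refine Finset.sum_congr rfl fun ρ _ => ?_
    rw [map_mul, map_mul, map_pow, map_pow, map_neg, map_one]
    ring
  rw [Finset.sum_congr rfl h1, Finset.sum_comm]
  refine Finset.sum_eq_zero fun ρ hρ => ?_
  obtain ⟨h2, h3, h4⟩ := mem_shapes.mp hρ
  rw [← Finset.sum_mul, ← map_sum, sum_prod_Ffactor_eq_zero hk h3 h2 _ le_rfl, map_zero, zero_mul]
  rintro rfl
  omega

/-- The solution of the recursion. -/
theorem eq_shapeSum_of_recursion (hsymm : ∀ M k (σ : Equiv.Perm (Fin K)), T M (k ∘ σ) = T M k)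
    (hneg : ∀ M k i, k i < 0 → T M k = 0)
    (hrec : ∀ M k, Antitone k → ∑ α : Finset (Fin K), (-1 : A) ^ α.card *
      φ X ^ (∑ i ∈ α, (i : ℕ)) *
        (if α.card ≤ M + 1 then T (M + 1 - α.card) (lower k α) else 0) = 0)
    (M : ℕ) : ∀ k : Fin K → ℕ, T M (fun i => (k i : ℤ)) = shapeSum φ T M (∑ i, column (k i)) := by
  induction M using Nat.strong_induction_on with
  | _ M ih =>
    suffices H : ∀ k : Fin K → ℕ, Antitone k →
        T M (fun i => (k i : ℤ)) = shapeSum φ T M (∑ i, column (k i)) by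
      intro k
      obtain ⟨σ, hσ⟩ : ∃ σ : Equiv.Perm (Fin K), Antitone (k ∘ σ) :=
        ⟨Tuple.sort fun i => -(k i : ℤ), fun i i' h => by
          have := Tuple.monotone_sort (fun i => -(k i : ℤ)) h
          simp only [Function.comp_apply] at this ⊢
          omega⟩
      have := H (k ∘ σ) hσ
      simp only [Function.comp_apply] at this
      rw [Equiv.sum_comp σ fun i => column (k i)] at this
      rw [← this]
      exact (hsymm M _ σ).symm
    intro k hk
    rcases M with _ | M
    · have h1 : shapes (∑ i, column (k i)) 0 = {∑ i, column (k i)} := by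
        ext ρ
        rw [mem_shapes, Finset.mem_singleton]
        constructor
        · rintro ⟨h1, _, h3⟩
          exact eq_of_le_of_degree h1 h3
        · rintro rfl
          exact ⟨le_rfl, antitone_sum_column k, rfl⟩
      rw [shapeSum, h1, Finset.sum_singleton, F_self (antitone_sum_column k), map_one, one_mul]
      simp only [conjPart_sum_column hk]
    · have hG := sum_shapeSum_eq_zero φ T hk M
      have hT := hrec M (fun i => (k i : ℤ)) fun i i' h =>
        Nat.cast_le.mpr (hk h)
      -- Lowering a level `0` makes it negative, where `T` vanishes; only lowerings of positive
      -- levels survive.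
      have hT' : ∑ α ∈ (Finset.univ.filter fun i => 0 < k i).powerset,
          (-1 : A) ^ α.card * φ X ^ (∑ i ∈ α, (i : ℕ)) *
          (if α.card ≤ M + 1 then T (M + 1 - α.card) (lower (fun i => (k i : ℤ)) α) else 0)
          = 0 := by
        refine Eq.trans ?_ hT
        refine Finset.sum_subset (Finset.subset_univ _) fun α _ hα => ?_
        rw [Finset.mem_powerset, Finset.not_subset] at hα
        obtain ⟨i, hi, hi'⟩ := hα
        have : k i = 0 := by simpa using hi'
        rw [hneg _ (lower (fun i => (k i : ℤ)) α) i (by simp [lower, hi, this])]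
        simp
      have hlow : ∀ α ∈ (Finset.univ.filter fun i => 0 < k i).powerset,
          lower (fun i => (k i : ℤ)) α = fun i => ((k i - if i ∈ α then 1 else 0 : ℕ) : ℤ) := by
        intro α hα
        funext i
        rw [lower]
        split_ifs with hi
        · have := (Finset.mem_filter.mp (Finset.mem_powerset.mp hα hi)).2
          omega
        · simp
      -- The term `α = ∅` is the value to be determined. All others have smaller `M` and are known
      -- by induction.
      have hmem : ∅ ∈ (Finset.univ.filter fun i => 0 < k i).powerset := Finset.empty_mem_powerset _
      rw [← Finset.add_sum_erase _ _ hmem] at hG hT'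
      have heq : ∀ α ∈ (Finset.univ.filter fun i => 0 < k i).powerset.erase ∅,
          (-1 : A) ^ α.card * φ X ^ (∑ i ∈ α, (i : ℕ)) *
          (if α.card ≤ M + 1 then T (M + 1 - α.card) (lower (fun i => (k i : ℤ)) α) else 0)
          = (-1 : A) ^ α.card * φ X ^ (∑ i ∈ α, (i : ℕ)) *
          (if α.card ≤ M + 1 then
            shapeSum φ T (M + 1 - α.card) (∑ i, column (k i - if i ∈ α then 1 else 0)) else 0) := by
        intro α hα
        have h1 : 0 < α.card := Finset.card_pos.mpr
          (Finset.nonempty_iff_ne_empty.mpr (Finset.ne_of_mem_erase hα))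
        rw [hlow α (Finset.mem_of_mem_erase hα), ih (M + 1 - α.card) (by omega)]
      rw [Finset.sum_congr rfl heq] at hT'
      have h2 := add_right_cancel (hT'.trans hG.symm)
      simpa [lower_empty] using h2

end Solve

/-! ### Generating series of the graded dimensions. -/

section Series

variable {n : ℕ} {ι : Type} [Fintype ι]

/-- A negative level imposes vanishing already for `ν = 0`. With `P` a monomial of weight `w`, the
condition reads that `X` divides the constant `p(P)`. -/
theorem gradedDim_of_neg {ns : ι → ℕ} {ks : ι → ℤ} {p : ι} (hp : ks p < 0) (w : ℕ →₀ ℕ) (d : ℤ) :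
    gradedDim n ns ks w d = 0 := by
  have : (sol (curCoeff n ns w) fun x => X ^ ∑ p, posOrd ns ks x.1 p) = ⊥ := by
    rw [eq_bot_iff]
    intro f hf
    rw [Submodule.mem_bot]
    funext ε
    have h1 := mem_sol.mp hf (0, ε.1)
    rw [Finset.sum_eq_single ε] at h1
    · have h2 : curCoeff n ns w (0, ε.1) ε = 1 := by
        simp [curCoeff, curProd]
      have h3 : (X : Polynomial ℂ) ∣ X ^ ∑ p, posOrd (n := n) ns ks 0 p := by
        refine dvd_pow_self _ (ne_of_gt (lt_of_lt_of_le ?_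
          (Finset.single_le_sum (fun p _ => Nat.zero_le _) (Finset.mem_univ p))))
        simp [posOrd, hp]
      have h4 := h3.trans h1
      rw [h2, Polynomial.X_dvd_iff] at h4
      simpa using h4
    · intro ε' _ hε
      have : ε.1 ≠ ε'.1 := fun h => hε (Subtype.ext h.symm)
      simp [curCoeff, curProd, MvPolynomial.coeff_monomial, this]
    · simp
  rw [gradedDim, this]
  simp

theorem curCoeff_zero_ne_zero {ns : ι → ℕ} {x : (Gen n → ℕ) × (CurVar n ns →₀ ℕ)}
    (h : curCoeff n ns 0 x default ≠ 0) (a : Gen n) : x.1 a = 0 := by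
  obtain ⟨t, ht⟩ : ∃ t, (curCoeff n ns 0 x default).coeff t ≠ 0 := by
    by_contra! h'
    exact h (Polynomial.ext (by simpa using h'))
  have h1 : wt x.2 + wtOf x.1 = 0 := (isBihom_curCoeff (ns := ns) x _ _ ht).1.symm.trans wt_zero
  rw [add_eq_zero] at h1
  rw [← wtOf_apply x.1 a, h1.2]
  rfl

theorem gradedDim_zero (ns ks : ι → ℕ) (d : ℤ) :
    gradedDim n ns (fun p => (ks p : ℤ)) 0 d = if d = 0 then 1 else 0 := by
  have h0 : dg (default : Exps n ns 0).1 = 0 := dg_zero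
  split_ifs with hd
  · subst hd
    have h1 : homog (fun ε : Exps n ns 0 => dg ε.1) 0 = ⊤ := by
      rw [eq_top_iff]
      intro p _ ε hε
      rw [Unique.eq_default ε] at hε
      exact absurd (congrArg Nat.cast h0) hε
    have h2 : (sol (curCoeff n ns 0) fun x => X ^ ∑ p, posOrd ns (fun p => (ks p : ℤ)) x.1 p)
        = ⊤ := by
      rw [eq_top_iff]
      intro p _
      rw [mem_sol]
      intro x
      rw [Fintype.sum_unique fun ε => p ε • curCoeff n ns 0 x ε]
      by_cases h : curCoeff n ns 0 x default = 0
      · rw [h, smul_zero]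
        exact dvd_zero _
      · have h3 : ∑ p, posOrd ns (fun p => (ks p : ℤ)) x.1 p = 0 := by
          refine Finset.sum_eq_zero fun p _ => ?_
          rw [posOrd, Finset.sum_eq_zero fun a _ => curCoeff_zero_ne_zero h a]
          simp
        rw [h3, pow_zero]
        exact one_dvd _
    rw [gradedDim, h1, h2, top_inf_eq, finrank_top, Module.finrank_fintype_fun_eq_card,
      Fintype.card_unique]
  · refine gradedDim_eq_zero fun ε => ?_
    rw [Unique.eq_default ε, h0]
    exact fun h => hd (by exact_mod_cast h.symm)

variable (n) in
/-- The generating function of the graded dimensions in weight `w`. -/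
def gradedSeries (ns : ι → ℕ) (ks : ι → ℤ) (w : ℕ →₀ ℕ) : PowerSeries ℤ :=
  PowerSeries.mk fun d => (gradedDim n ns ks w d : ℤ)

theorem gradedSeries_of_notMem {ns : ι → ℕ} {ks : ι → ℤ} {w : ℕ →₀ ℕ} {a : ℕ} (ha : w a ≠ 0)
    (hn : a ∉ Finset.Ico 1 n) : gradedSeries n ns ks w = 0 := by
  ext d
  rw [gradedSeries, PowerSeries.coeff_mk, map_zero, gradedDim_eq_zero, Nat.cast_zero]
  intro ε
  refine absurd ?_ ha
  rw [← DFunLike.congr_fun ε.2 a]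
  exact wt_apply_of_notMem ε.1 hn

/-- In the form `dimO` the levels enter only through `vord`, which is symmetric in them. The points
do not enter, and `0` stands in for them. -/
theorem gradedDim_setActive_comp (ns : ι → ℕ) (ks : ι → ℤ) {c : Gen n}
    (e : Fin (numActive ns c) ≃ {p // (c : ℕ) < ns p}) (k : Fin (numActive ns c) → ℤ)
    (σ : Equiv.Perm (Fin (numActive ns c))) {w : ℕ →₀ ℕ} (hw : ∀ a : ℕ, (c : ℕ) ≤ a → w a = 0)
    (M : ℕ) (d : ℤ) :
    gradedDim n ns (setActive ns ks e (k ∘ σ)) (w + Finsupp.single (c : ℕ) M) d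
      = gradedDim n ns (setActive ns ks e k) (w + Finsupp.single (c : ℕ) M) d := by
  rw [← dimO_eq_gradedDim ns 0 ks e _ hw, ← dimO_eq_gradedDim ns 0 ks e _ hw, dimO, vord_comp, dimO]

/-- The graded dimensions in terms of those with one color less. -/
theorem gradedSeries_add_single (ns : ι → ℕ) (ks : ι → ℤ) {c : Gen n}
    (e : Fin (numActive ns c) ≃ {p // (c : ℕ) < ns p}) {w : ℕ →₀ ℕ}
    (hw : ∀ a : ℕ, (c : ℕ) ≤ a → w a = 0) (M : ℕ) (k : Fin (numActive ns c) → ℕ) :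
    gradedSeries n ns (setActive ns ks e fun i => (k i : ℤ)) (w + Finsupp.single (c : ℕ) M)
      = ∑ ρ ∈ shapes (∑ i, column (k i)) M, (F (∑ i, column (k i)) ρ : PowerSeries ℤ) *
        gradedSeries n ns (setActive ns ks e fun i => (conjPart ρ i : ℤ)) w := by
  have key := eq_shapeSum_of_recursion (Polynomial.coeToPowerSeries.ringHom (R := ℤ))
    (fun M k => gradedSeries n ns (setActive ns ks e k) (w + Finsupp.single (c : ℕ) M))
    (fun M k σ => ?_) (fun M k i hi => ?_) (fun M k hk => ?_) M k
  · rw [key, shapeSum]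
    simp only [Finsupp.single_zero, add_zero, Polynomial.coeToPowerSeries.ringHom_apply]
  · ext d
    simp only [gradedSeries, PowerSeries.coeff_mk]
    rw [gradedDim_setActive_comp ns ks e k σ hw]
  · ext d
    simp only [gradedSeries, PowerSeries.coeff_mk, map_zero]
    rw [gradedDim_of_neg (p := (e i : ι)) (by rwa [setActive_apply]), Nat.cast_zero]
  · ext d
    rw [map_zero, ← sum_gradedDim_setActive ns ks e hk hw M d, map_sum]
    have h1 : ∀ α : Finset (Fin (numActive ns c)), PowerSeries.coeff d ((-1 : PowerSeries ℤ) ^ α.card *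
        (Polynomial.coeToPowerSeries.ringHom (R := ℤ)) X ^ (∑ i ∈ α, (i : ℕ)) *
        (if α.card ≤ M + 1 then gradedSeries n ns (setActive ns ks e (lower k α))
          (w + Finsupp.single (c : ℕ) (M + 1 - α.card)) else 0))
        = if α.card ≤ M + 1 then (-1) ^ α.card *
          (gradedDim n ns (setActive ns ks e (lower k α))
            (w + Finsupp.single (c : ℕ) (M + 1 - α.card)) (d - ∑ i ∈ α, ((i : ℕ) : ℤ)) : ℤ)
          else 0 := by
      intro α
      split_ifs with hα
      · rw [Polynomial.coeToPowerSeries.ringHom_apply, Polynomial.coe_X, mul_assoc,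
          show (-1 : PowerSeries ℤ) ^ α.card = PowerSeries.C ((-1) ^ α.card) by simp,
          PowerSeries.coeff_C_mul, PowerSeries.coeff_X_pow_mul']
        congr 1
        split_ifs with hd
        · rw [gradedSeries, PowerSeries.coeff_mk]
          congr 2
          push_cast [hd]
          rfl
        · rw [gradedDim_eq_zero, Nat.cast_zero]
          intro ε hε
          apply hd
          have : ((∑ i ∈ α, (i : ℕ) : ℕ) : ℤ) ≤ d := by push_cast; omega
          exact_mod_cast this
      · simp
    rw [Finset.sum_congr rfl fun α _ => h1 α]
    -- The subsets are grouped by size to match the recursion for `gradedDim`; sizes above `M + 1`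
    -- contribute `0`.
    have h2 := Finset.sum_fiberwise_of_maps_to (s := (Finset.univ : Finset (Finset
      (Fin (numActive ns c))))) (t := Finset.range (numActive ns c + M + 2))
      (g := Finset.card) (fun α _ => by
        have := Finset.card_le_univ α
        rw [Fintype.card_fin] at this
        exact Finset.mem_range.mpr (by omega)) fun α => if α.card ≤ M + 1 then (-1) ^ α.card *
          (gradedDim n ns (setActive ns ks e (lower k α))
            (w + Finsupp.single (c : ℕ) (M + 1 - α.card)) (d - ∑ i ∈ α, ((i : ℕ) : ℤ)) : ℤ)
          else 0
    rw [← h2]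
    symm
    have h3 : Finset.range (M + 2) ⊆ Finset.range (numActive ns c + M + 2) :=
      Finset.range_mono (by omega)
    rw [← Finset.sum_subset h3]
    · refine Finset.sum_congr rfl fun j hj => ?_
      rw [Finset.mul_sum]
      refine Finset.sum_congr ?_ fun α hα => ?_
      · ext α
        simp [Finset.mem_powersetCard]
      · have h4 := (Finset.mem_filter.mp hα).2
        have h5 := Finset.mem_range.mp hj
        rw [h4, if_pos (by omega)]
    · intro j _ hj
      refine Finset.sum_eq_zero fun α hα => ?_
      have h4 := (Finset.mem_filter.mp hα).2
      rw [Finset.mem_range, not_lt] at hj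
      rw [if_neg (by omega)]

end Series

/-! ### Dependence on the partitions only. -/

section Invariance

theorem lt_conjPart_iff {ρ : ℕ →₀ ℕ} (hρ : Antitone ρ) (a i : ℕ) : a < conjPart ρ i ↔ i < ρ a := by
  rw [conjPart]
  constructor
  · intro h
    by_contra h'
    have : (ρ.support.filter fun b => i < ρ b) ⊆ Finset.range a := by
      intro b hb
      have hb' := (Finset.mem_filter.mp hb).2
      rw [Finset.mem_range]
      by_contra hab
      have := hρ (not_lt.mp hab)
      omega
    have := Finset.card_le_card this
    rw [Finset.card_range] at this
    omega
  · intro h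
    have : Finset.range (a + 1) ⊆ ρ.support.filter fun b => i < ρ b := by
      intro b hb
      have := hρ (show b ≤ a by have := Finset.mem_range.mp hb; omega)
      rw [Finset.mem_filter, Finsupp.mem_support_iff]
      omega
    have := Finset.card_le_card this
    rw [Finset.card_range] at this
    omega

theorem sum_column_conjPart {ρ : ℕ →₀ ℕ} (hρ : Antitone ρ) {K : ℕ} (hK : ρ 0 ≤ K) :
    ∑ i : Fin K, column (conjPart ρ i) = ρ := by
  ext a
  rw [sum_column_apply]
  simp only [lt_conjPart_iff hρ]
  rw [Fin.card_filter_val_lt]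
  have := hρ (Nat.zero_le a)
  omega

/-- The conjugate of the partition formed by the `k_p` with `n_p > a`. -/
def activeShape {ι : Type} [Fintype ι] (ns ks : ι → ℕ) (a : ℕ) : ℕ →₀ ℕ :=
  ∑ p ∈ Finset.univ.filter (fun p => a < ns p), column (ks p)

variable {n : ℕ} {ι : Type} [Fintype ι]

/-- The levels `k_p`, replaced by the parts of the conjugate of `ρ` where the color `c` is active. -/
def setShape (ns ks : ι → ℕ) {c : Gen n} (e : Fin (numActive ns c) ≃ {p // (c : ℕ) < ns p})
    (ρ : ℕ →₀ ℕ) (p : ι) : ℕ :=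
  if h : (c : ℕ) < ns p then conjPart ρ (e.symm ⟨p, h⟩) else ks p

theorem setActive_conjPart (ns ks : ι → ℕ) {c : Gen n}
    (e : Fin (numActive ns c) ≃ {p // (c : ℕ) < ns p}) (ρ : ℕ →₀ ℕ) :
    setActive ns (fun p => (ks p : ℤ)) e (fun i => (conjPart ρ i : ℤ))
      = fun p => (setShape ns ks e ρ p : ℤ) := by
  funext p
  rw [setActive, setShape]
  split_ifs <;> rfl

theorem sum_active {A : Type*} [AddCommMonoid A] {ns : ι → ℕ} {c : Gen n}
    (e : Fin (numActive ns c) ≃ {p // (c : ℕ) < ns p}) (f : ι → A) :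
    ∑ p ∈ Finset.univ.filter (fun p => (c : ℕ) < ns p), f p = ∑ i, f (e i) := by
  rw [Finset.sum_subtype (F := inferInstance) _ (p := fun p => (c : ℕ) < ns p) fun p => by simp,
    ← Equiv.sum_comp e]

theorem activeShape_eq_sum {ns ks : ι → ℕ} {c : Gen n}
    (e : Fin (numActive ns c) ≃ {p // (c : ℕ) < ns p}) :
    activeShape ns ks c = ∑ i, column (ks (e i)) := sum_active e _

theorem activeShape_apply_zero_le (ns ks : ι → ℕ) (c : ℕ) :
    activeShape ns ks c 0 ≤ numActive ns c := by
  rw [activeShape, Finsupp.finsetSum_apply, numActive, Finset.card_eq_sum_ones]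
  refine Finset.sum_le_sum fun p _ => ?_
  rw [column_apply]
  split_ifs <;> omega

theorem antitone_activeShape (ns ks : ι → ℕ) (c : ℕ) : Antitone (activeShape ns ks c) := by
  intro a b h
  rw [activeShape, Finsupp.finsetSum_apply, Finsupp.finsetSum_apply]
  refine Finset.sum_le_sum fun p _ => ?_
  rw [column_apply, column_apply]
  split_ifs <;> omega

/-- The graded dimensions in terms of those with one color less, for natural numbers `k_p`. -/
theorem gradedSeries_eq_sum_setShape (ns ks : ι → ℕ) {c : Gen n}
    (e : Fin (numActive ns c) ≃ {p // (c : ℕ) < ns p}) {w : ℕ →₀ ℕ}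
    (hw : ∀ a : ℕ, (c : ℕ) ≤ a → w a = 0) (M : ℕ) :
    gradedSeries n ns (fun p => (ks p : ℤ)) (w + Finsupp.single (c : ℕ) M)
      = ∑ ρ ∈ shapes (activeShape ns ks c) M, (F (activeShape ns ks c) ρ : PowerSeries ℤ) *
        gradedSeries n ns (fun p => (setShape ns ks e ρ p : ℤ)) w := by
  have h := gradedSeries_add_single ns (fun p => (ks p : ℤ)) e hw M fun i => ks (e i)
  rw [setActive_self e] at h
  rw [h, activeShape_eq_sum e]
  simp only [setActive_conjPart]

/-- For `a ≤ c` the positions with `n_p > c` are among those with `n_p > a`. Replacing their levels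
exchanges the summand `activeShape ns ks c` for `ρ`; the additive form avoids truncated subtraction.
-/
theorem activeShape_setShape (ns ks : ι → ℕ) {c : Gen n}
    (e : Fin (numActive ns c) ≃ {p // (c : ℕ) < ns p}) {ρ : ℕ →₀ ℕ} (hρ : Antitone ρ)
    (hle : ρ ≤ activeShape ns ks c) {a : ℕ} (ha : a ≤ c) :
    activeShape ns (setShape ns ks e ρ) a + activeShape ns ks c = activeShape ns ks a + ρ := by
  have hK : ρ 0 ≤ numActive ns c := (hle 0).trans (activeShape_apply_zero_le ns ks c)
  have split : ∀ f : ι → ℕ →₀ ℕ, ∑ p ∈ Finset.univ.filter (fun p => a < ns p), f p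
      = ∑ p ∈ Finset.univ.filter (fun p => a < ns p ∧ ¬ (c : ℕ) < ns p), f p
        + ∑ p ∈ Finset.univ.filter (fun p => (c : ℕ) < ns p), f p := by
    intro f
    rw [← Finset.sum_filter_add_sum_filter_not _ fun p => (c : ℕ) < ns p, add_comm,
      Finset.filter_filter, Finset.filter_filter]
    congr 2
    ext p
    simp only [Finset.mem_filter, Finset.mem_univ, true_and]
    omega
  have h1 : activeShape ns (setShape ns ks e ρ) c = ρ := by
    rw [activeShape_eq_sum e]
    refine Eq.trans (Finset.sum_congr rfl fun i _ => ?_) (sum_column_conjPart hρ hK)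
    rw [setShape, dif_pos (e i).2]
    simp
  rw [activeShape, split, ← activeShape, h1]
  conv_rhs => rw [activeShape, split, ← activeShape]
  have h2 : ∑ p ∈ Finset.univ.filter (fun p => a < ns p ∧ ¬ (c : ℕ) < ns p),
      column (setShape ns ks e ρ p)
      = ∑ p ∈ Finset.univ.filter (fun p => a < ns p ∧ ¬ (c : ℕ) < ns p), column (ks p) := by
    refine Finset.sum_congr rfl fun p hp => ?_
    rw [setShape, dif_neg (Finset.mem_filter.mp hp).2.2]
  rw [h2]
  abel

/-- The graded dimensions depend only on the shapes at the colors which occur. -/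
theorem gradedSeries_congr (w : ℕ →₀ ℕ) : ∀ {n n' : ℕ} {ι ι' : Type} [Fintype ι] [Fintype ι']
    (ns ks : ι → ℕ) (ns' ks' : ι' → ℕ),
    (∀ a, w a ≠ 0 → (a ∈ Finset.Ico 1 n ↔ a ∈ Finset.Ico 1 n')) →
    (∀ a, w a ≠ 0 → activeShape ns ks a = activeShape ns' ks' a) →
    gradedSeries n ns (fun p => (ks p : ℤ)) w = gradedSeries n' ns' (fun p => (ks' p : ℤ)) w := by
  suffices H : ∀ m : ℕ, ∀ w : ℕ →₀ ℕ, (∀ a, m ≤ a → w a = 0) → ∀ {n n' : ℕ} {ι ι' : Type}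
      [Fintype ι] [Fintype ι'] (ns ks : ι → ℕ) (ns' ks' : ι' → ℕ),
      (∀ a, w a ≠ 0 → (a ∈ Finset.Ico 1 n ↔ a ∈ Finset.Ico 1 n')) →
      (∀ a, w a ≠ 0 → activeShape ns ks a = activeShape ns' ks' a) →
      gradedSeries n ns (fun p => (ks p : ℤ)) w = gradedSeries n' ns' (fun p => (ks' p : ℤ)) w by
    intro n n' ι ι' _ _ ns ks ns' ks'
    refine H (w.support.sup id + 1) w (fun a ha => ?_) ns ks ns' ks'
    by_contra h
    have : id a ≤ w.support.sup id := Finset.le_sup (Finsupp.mem_support_iff.mpr h)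
    simp only [id] at this
    omega
  intro m
  induction m with
  | zero =>
    intro w hw n n' ι ι' _ _ ns ks ns' ks' _ _
    obtain rfl : w = 0 := Finsupp.ext fun a => hw a (Nat.zero_le _)
    ext d
    simp only [gradedSeries, PowerSeries.coeff_mk]
    rw [gradedDim_zero, gradedDim_zero]
  | succ m ih =>
    intro w hw n n' ι ι' _ _ ns ks ns' ks' hn hs
    by_cases hm0 : w m = 0
    · refine ih w (fun a ha => ?_) ns ks ns' ks' hn hs
      rcases ha.lt_or_eq with h | rfl
      · exact hw a h
      · exact hm0
    by_cases hm : m ∈ Finset.Ico 1 n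
    · have hm' := (hn m hm0).mp hm
      let c : Gen n := ⟨m, hm⟩
      let c' : Gen n' := ⟨m, hm'⟩
      have hw1 : w = w.erase m + Finsupp.single m (w m) := (Finsupp.erase_add_single m w).symm
      have hw2 : ∀ a : ℕ, m ≤ a → w.erase m a = 0 := by
        intro a ha
        rcases eq_or_ne a m with rfl | h
        · exact Finsupp.erase_same
        · rw [Finsupp.erase_ne h]
          exact hw a (by omega)
      have hw3 : ∀ a, w.erase m a ≠ 0 → w a ≠ 0 ∧ a < m := by
        intro a ha
        have h1 : a < m := by
          by_contra h
          exact ha (hw2 a (by omega))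
        rw [Finsupp.erase_ne h1.ne] at ha
        exact ⟨ha, h1⟩
      obtain ⟨e⟩ := exists_activeEquiv ns c
      obtain ⟨e'⟩ := exists_activeEquiv ns' c'
      have hc : activeShape ns ks m = activeShape ns' ks' m := hs m hm0
      rw [hw1]
      refine (gradedSeries_eq_sum_setShape ns ks e hw2 (w m)).trans
        (Eq.trans ?_ (gradedSeries_eq_sum_setShape ns' ks' e' hw2 (w m)).symm)
      change ∑ ρ ∈ shapes (activeShape ns ks m) (w m), (F (activeShape ns ks m) ρ : PowerSeries ℤ) *
        gradedSeries n ns (fun p => (setShape ns ks e ρ p : ℤ)) (w.erase m)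
        = ∑ ρ ∈ shapes (activeShape ns' ks' m) (w m), (F (activeShape ns' ks' m) ρ : PowerSeries ℤ) *
        gradedSeries n' ns' (fun p => (setShape ns' ks' e' ρ p : ℤ)) (w.erase m)
      rw [← hc]
      refine Finset.sum_congr rfl fun ρ hρ => ?_
      obtain ⟨h1, h2, _⟩ := mem_shapes.mp hρ
      congr 1
      -- Passing to `ρ` changes the shapes of all lower colors by the same amount on both sides.
      refine ih _ hw2 ns (setShape ns ks e ρ) ns' (setShape ns' ks' e' ρ) (fun a ha => hn a (hw3 a ha).1) fun a ha => ?_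
      have h3 := activeShape_setShape ns ks e h2 h1 (hw3 a ha).2.le
      have h4 := activeShape_setShape ns' ks' e' h2 (hc ▸ h1) (hw3 a ha).2.le
      rw [← hs a (hw3 a ha).1, ← h3] at h4
      change _ + activeShape ns' ks' m = _ + activeShape ns ks m at h4
      rw [hc] at h4
      exact (add_right_cancel h4).symm
    · rw [gradedSeries_of_notMem hm0 hm, gradedSeries_of_notMem hm0 fun h => hm ((hn m hm0).mpr h)]

end Invariance

/-! ### Duality between the quotient module and the solution spaces. -/

section QuotientSide

variable {n : ℕ} {ι : Type} [Fintype ι] {ns : ι → ℕ}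

theorem weight_bideg (ε : CurVar n ns →₀ ℕ) :
    Finsupp.weight (fun x : CurVar n ns => bideg (x.1 : ℕ) (x.2 : ℕ)) ε
      = Finsupp.single 0 (dg ε) + wt ε := by
  induction ε using Finsupp.induction_linear with
  | zero => rw [map_zero, dg_zero, wt_zero, Finsupp.single_zero, add_zero]
  | add f g hf hg =>
    rw [map_add, hf, hg, dg_add, wt_add, Finsupp.single_add]
    abel
  | single v m =>
    rw [Finsupp.weight_single, dg_single, wt_single, bideg, smul_add, Finsupp.smul_single,
      Finsupp.smul_single]
    simp

theorem wt_apply_zero (ε : CurVar n ns →₀ ℕ) : wt ε 0 = 0 := wt_apply_of_notMem ε (by simp)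

theorem weight_bideg_eq_iff (ε : CurVar n ns →₀ ℕ) (e : ℕ →₀ ℕ) :
    Finsupp.weight (fun x : CurVar n ns => bideg (x.1 : ℕ) (x.2 : ℕ)) ε = e ↔
      wt ε = e.erase 0 ∧ dg ε = e 0 := by
  rw [weight_bideg]
  constructor
  · rintro rfl
    refine ⟨?_, by simp [wt_apply_zero]⟩
    rw [Finsupp.erase_add, Finsupp.erase_single, zero_add, Finsupp.erase_of_notMem_support]
    simp [wt_apply_zero]
  · rintro ⟨h1, h2⟩
    rw [h1, h2, add_comm, Finsupp.erase_add_single]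

variable (n ns) in
/-- Exchanging the variable `z` and the variables `x_a[i]`. -/
def exchange : Polynomial (CurRing n ns) →+* MvPolynomial (CurVar n ns) (Polynomial ℂ) :=
  Polynomial.eval₂RingHom (MvPolynomial.map C) (MvPolynomial.C X)

theorem coeff_exchange (f : Polynomial (CurRing n ns)) (ε : CurVar n ns →₀ ℕ) (j : ℕ) :
    ((exchange n ns f).coeff ε).coeff j = (f.coeff j).coeff ε := by
  induction f using Polynomial.induction_on' with
  | add f g hf hg =>
    rw [map_add, MvPolynomial.coeff_add, Polynomial.coeff_add, hf, hg, Polynomial.coeff_add,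
      MvPolynomial.coeff_add]
  | monomial i r =>
    rw [exchange, Polynomial.coe_eval₂RingHom, Polynomial.eval₂_monomial, ← map_pow,
      mul_comm, MvPolynomial.coeff_C_mul, MvPolynomial.coeff_map, mul_comm,
      Polynomial.coeff_C_mul_X_pow, Polynomial.coeff_monomial]
    by_cases h : i = j
    · rw [if_pos h, if_pos h.symm]
    · rw [if_neg h, if_neg (Ne.symm h), MvPolynomial.coeff_zero]

theorem exchange_current (a : Gen n) : exchange n ns (current n ns a) = cur n ns a := by
  rw [current, cur, map_sum]
  refine Finset.sum_congr rfl fun i _ => ?_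
  rw [exchange, Polynomial.coe_eval₂RingHom, Polynomial.eval₂_monomial, MvPolynomial.map_X,
    ← map_pow, mul_comm, MvPolynomial.C_mul_X_eq_monomial]

theorem exchange_prod_current (ν : Gen n → ℕ) :
    exchange n ns (∏ a, current n ns a ^ ν a) = curProd n ns ν := by
  rw [map_prod, curProd]
  exact Finset.prod_congr rfl fun a _ => by rw [map_pow, exchange_current]

theorem curCoeff_coeff_eq {w : ℕ →₀ ℕ} (ν : Gen n → ℕ) (P : CurVar n ns →₀ ℕ) (ε : Exps n ns w)
    (j : ℕ) : (curCoeff n ns w (ν, P) ε).coeff j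
      = (MvPolynomial.monomial P 1 * (∏ a, current n ns a ^ ν a).coeff j).coeff ε.1 := by
  have h : MvPolynomial.monomial P (1 : Polynomial ℂ)
      = exchange n ns (C (MvPolynomial.monomial P 1)) := by
    rw [exchange, Polynomial.coe_eval₂RingHom, Polynomial.eval₂_C, MvPolynomial.map_monomial,
      Polynomial.C_1]
  rw [curCoeff, ← exchange_prod_current, h, ← map_mul, coeff_exchange, Polynomial.coeff_C_mul]

theorem vanishingOrder_eq (ks : ι → ℕ) (ν : Gen n → ℕ) :
    vanishingOrder ns ks ν = ∑ p, posOrd ns (fun p => (ks p : ℤ)) ν p := by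
  rw [vanishingOrder]
  refine Finset.sum_congr rfl fun p _ => ?_
  rw [posOrd]
  omega

theorem mem_sol_iff_coeff (ks : ι → ℕ) {w : ℕ →₀ ℕ} (p : Exps n ns w → ℂ) :
    (p ∈ sol (curCoeff n ns w) fun x => X ^ ∑ q, posOrd ns (fun q => (ks q : ℤ)) x.1 q) ↔
    ∀ (ν : Gen n → ℕ) (P : CurVar n ns →₀ ℕ), ∀ j < vanishingOrder ns ks ν,
      ∑ ε, p ε * (MvPolynomial.monomial P 1 * (∏ a, current n ns a ^ ν a).coeff j).coeff ε.1 = 0 := by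
  rw [mem_sol, Prod.forall]
  refine forall_congr' fun ν => forall_congr' fun P => ?_
  rw [Polynomial.X_pow_dvd_iff, ← vanishingOrder_eq]
  refine forall_congr' fun j => forall_congr' fun _ => ?_
  rw [Polynomial.finsetSum_coeff]
  simp only [Polynomial.coeff_smul, curCoeff_coeff_eq, smul_eq_mul]

theorem monomial_mem_homogeneous {e : ℕ →₀ ℕ} (ε : Exps n ns (e.erase 0)) (h : dg ε.1 = e 0) :
    MvPolynomial.monomial ε.1 1 ∈ MvPolynomial.weightedHomogeneousSubmodule ℂ
      (fun x : CurVar n ns => bideg (x.1 : ℕ) (x.2 : ℕ)) e :=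
  MvPolynomial.isWeightedHomogeneous_monomial _ _ _ ((weight_bideg_eq_iff _ _).mpr ⟨ε.2, h⟩)

/-- The class of a monomial in the component of bidegree `e`, and `0` for other degrees. -/
def monoClass (ks : ι → ℕ) (e : ℕ →₀ ℕ) (ε : Exps n ns (e.erase 0)) : WComponent n ns ks e :=
  if h : dg ε.1 = e 0 then ⟨Ideal.Quotient.mkₐ ℂ (relIdeal n ns ks) (MvPolynomial.monomial ε.1 1),
    Submodule.mem_map_of_mem (monomial_mem_homogeneous ε h)⟩ else 0

theorem span_monoClass (ks : ι → ℕ) (e : ℕ →₀ ℕ) :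
    Submodule.span ℂ (Set.range (monoClass (n := n) (ns := ns) ks e)) = ⊤ := by
  rw [eq_top_iff]
  rintro ⟨_, g, hg, rfl⟩ _
  have hmono : ∀ ε ∈ g.support, wt ε = e.erase 0 ∧ dg ε = e 0 := fun ε hε =>
    (weight_bideg_eq_iff _ _).mp (hg (MvPolynomial.mem_support_iff.mp hε))
  have h1 : (⟨Ideal.Quotient.mkₐ ℂ (relIdeal n ns ks) g, Submodule.mem_map_of_mem hg⟩ :
      WComponent n ns ks e) = ∑ ε ∈ g.support.attach, g.coeff ε.1 •
        monoClass ks e ⟨ε.1, (hmono ε.1 ε.2).1⟩ := by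
    apply Subtype.ext
    rw [Submodule.coe_sum]
    have h2 : g = ∑ ε ∈ g.support.attach, MvPolynomial.monomial ε.1 (g.coeff ε.1) := by
      rw [Finset.sum_attach g.support fun ε => MvPolynomial.monomial ε (g.coeff ε)]
      exact g.as_sum
    change Ideal.Quotient.mkₐ ℂ (relIdeal n ns ks) g = _
    refine (congrArg _ h2).trans ?_
    rw [map_sum]
    refine Finset.sum_congr rfl fun ε _ => ?_
    rw [Submodule.coe_smul, monoClass, dif_pos (hmono ε.1 ε.2).2]
    rw [← map_smul, MvPolynomial.smul_monomial, smul_eq_mul, mul_one]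
  refine Eq.subst (motive := (· ∈ _)) h1.symm ?_
  exact Submodule.sum_mem _ fun ε _ => Submodule.smul_mem _ _ (Submodule.subset_span ⟨_, rfl⟩)

/-- A linear form on the component is determined by its values on the classes of monomials, extended
by `0` to the other degrees. The functions that arise are those supported in degree `e 0` that
satisfy the degenerate conditions. -/
theorem finrank_WComponent (ks : ι → ℕ) (e : ℕ →₀ ℕ) :
    Module.finrank ℂ (WComponent n ns ks e)
      = gradedDim n ns (fun p => (ks p : ℤ)) (e.erase 0) (e 0) := by
  set q := Ideal.Quotient.mkₐ ℂ (relIdeal n ns ks) with hq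
  let Θ : Module.Dual ℂ (WComponent n ns ks e) →ₗ[ℂ] (Exps n ns (e.erase 0) → ℂ) :=
    LinearMap.pi fun ε => LinearMap.applyₗ (monoClass ks e ε)
  have hΘ : Function.Injective Θ := by
    rw [← LinearMap.ker_eq_bot, eq_bot_iff]
    intro ψ hψ
    rw [Submodule.mem_bot]
    refine LinearMap.ext_on_range (span_monoClass ks e) fun ε => ?_
    exact congr_fun hψ ε
  have hrange : LinearMap.range Θ = homog (fun ε => dg ε.1) (e 0 : ℕ) ⊓ sol (curCoeff n ns _)
      fun x => X ^ ∑ p, posOrd ns (fun p => (ks p : ℤ)) x.1 p := by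
    ext p
    constructor
    · rintro ⟨ψ, rfl⟩
      have h0 : ∀ ε : Exps n ns (e.erase 0), dg ε.1 ≠ e 0 → Θ ψ ε = 0 := by
        intro ε hε
        change ψ (monoClass ks e ε) = 0
        rw [monoClass, dif_neg hε, map_zero]
      refine ⟨fun ε hε => h0 ε (by exact_mod_cast hε), (mem_sol_iff_coeff ks _).mpr ?_⟩
      intro ν P j hj
      set g := MvPolynomial.monomial P 1 * (∏ a, current n ns a ^ ν a).coeff j with hg
      have hqg : q g = 0 := by
        rw [hq, Ideal.Quotient.mkₐ_eq_mk, Ideal.Quotient.eq_zero_iff_mem]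
        exact Ideal.mul_mem_left _ _ (Ideal.subset_span ⟨ν, j, hj, rfl⟩)
      have hhom : ∀ ε, g.coeff ε ≠ 0 → wt ε = wt P + wtOf ν ∧
          j + dg ε = dg P + ∑ a, ν a * (numActive ns a - 1) := by
        intro ε hε
        refine isBihom_curCoeff (ns := ns) (ν, P) ε j ?_
        have := curCoeff_coeff_eq ν P ⟨ε, rfl⟩ j
        rw [curCoeff] at this
        rw [this]
        exact hε
      -- The relation `g` is bihomogeneous. Either it lies entirely in bidegree `e`, and its class
      -- is a vanishing combination of monomial classes, or no monomial of bidegree `e` occurs in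
      -- it.
      by_cases hex : ∃ ε, g.coeff ε ≠ 0 ∧ wt ε = e.erase 0 ∧ dg ε = e 0
      · obtain ⟨ε0, h1, h2, h3⟩ := hex
        have hmem : ∀ ε, g.coeff ε ≠ 0 → wt ε = e.erase 0 ∧ dg ε = e 0 := by
          intro ε hε
          have h4 := hhom ε hε
          have h5 := hhom ε0 h1
          exact ⟨by rw [h4.1, ← h5.1, h2], by omega⟩
        have hsum : ∑ ε : Exps n ns (e.erase 0), g.coeff ε.1 • monoClass ks e ε = 0 := by
          apply Subtype.ext
          rw [Submodule.coe_sum, Submodule.coe_zero, ← hqg]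
          have hgs : g = ∑ ε : Exps n ns (e.erase 0), MvPolynomial.monomial ε.1 (g.coeff ε.1) := by
            ext ε
            rw [MvPolynomial.coeff_sum]
            by_cases hε : g.coeff ε = 0
            · rw [hε, Finset.sum_eq_zero]
              intro ε' _
              rw [MvPolynomial.coeff_monomial]
              split_ifs with h
              · rw [h, hε]
              · rfl
            · rw [Finset.sum_eq_single ⟨ε, (hmem ε hε).1⟩]
              · rw [MvPolynomial.coeff_monomial, if_pos rfl]
              · intro ε' _ hne
                rw [MvPolynomial.coeff_monomial, if_neg fun h => hne (Subtype.ext h)]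
              · simp
          conv_rhs => rw [hgs, map_sum]
          refine Finset.sum_congr rfl fun ε _ => ?_
          by_cases hε : g.coeff ε.1 = 0
          · rw [hε]
            simp
          · rw [Submodule.coe_smul, monoClass, dif_pos (hmem ε.1 hε).2]
            rw [← map_smul, MvPolynomial.smul_monomial, smul_eq_mul, mul_one]
        have := congrArg ψ hsum
        rw [map_sum, map_zero] at this
        rw [← this]
        refine Finset.sum_congr rfl fun ε _ => ?_
        rw [map_smul, smul_eq_mul, mul_comm]
        rfl
      · push Not at hex
        refine Finset.sum_eq_zero fun ε _ => ?_
        by_cases hε : g.coeff ε.1 = 0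
        · rw [hε, mul_zero]
        · rw [h0 ε (hex ε.1 hε ε.2), zero_mul]
    · rintro ⟨hp1, hp2⟩
      rw [SetLike.mem_coe, mem_sol_iff_coeff] at hp2
      let L : CurRing n ns →ₗ[ℂ] ℂ := ∑ ε : Exps n ns (e.erase 0), p ε • MvPolynomial.lcoeff ℂ ε.1
      have hL : ∀ g, L g = ∑ ε : Exps n ns (e.erase 0), p ε * g.coeff ε.1 := by
        intro g
        simp [L]
      have hJ : (relIdeal n ns ks).restrictScalars ℂ ≤ LinearMap.ker L := by
        have hgen : ∀ ν : Gen n → ℕ, ∀ j < vanishingOrder ns ks ν, ∀ f,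
            L (f * (∏ a, current n ns a ^ ν a).coeff j) = 0 := by
          intro ν j hj f
          induction f using MvPolynomial.induction_on' with
          | monomial P r =>
            have : MvPolynomial.monomial P r = r • MvPolynomial.monomial P (1 : ℂ) := by
              rw [MvPolynomial.smul_monomial, smul_eq_mul, mul_one]
            rw [this, smul_mul_assoc, map_smul, hL, hp2 ν P j hj, smul_zero]
          | add f f' h h' => rw [add_mul, map_add, h, h', add_zero]
        intro g hg
        rw [Submodule.restrictScalars_mem, relIdeal] at hg
        rw [LinearMap.mem_ker]
        induction hg using Submodule.span_induction with
        | mem x hx =>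
          obtain ⟨ν, j, hj, rfl⟩ := hx
          simpa using hgen ν j hj 1
        | zero => exact map_zero L
        | add x y _ _ hx hy => rw [map_add, hx, hy, add_zero]
        | smul f x hx _ =>
          clear * - hgen hx
          rw [smul_eq_mul]
          induction hx using Submodule.span_induction generalizing f with
          | mem x hx =>
            obtain ⟨ν, j, hj, rfl⟩ := hx
            exact hgen ν j hj f
          | zero => rw [mul_zero, map_zero]
          | add x y _ _ hx hy => rw [mul_add, map_add, hx, hy, add_zero]
          | smul g x _ hx =>
            rw [smul_eq_mul, ← mul_assoc]
            exact hx _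
      -- A solution defines a linear form on all of `R` that kills the ideal, so it descends to the
      -- quotient and restricts to the component.
      let ψ : Module.Dual ℂ (WComponent n ns ks e) :=
        (Submodule.liftQ ((relIdeal n ns ks).restrictScalars ℂ) L hJ).comp
          (WComponent n ns ks e).subtype
      refine ⟨ψ, ?_⟩
      funext ε
      change ψ (monoClass ks e ε) = p ε
      rw [monoClass]
      split_ifs with h
      · change L (MvPolynomial.monomial ε.1 1) = p ε
        rw [hL, Finset.sum_eq_single ε]
        · simp
        · intro ε' _ hne
          rw [MvPolynomial.coeff_monomial, if_neg fun h => hne (Subtype.ext h.symm), mul_zero]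
        · simp
      · rw [map_zero]
        exact (hp1 ε (by exact_mod_cast h)).symm
  rw [← Subspace.dual_finrank_eq, ← LinearMap.finrank_range_of_inj hΘ, hrange]
  rfl

theorem chW_eq (ks : ι → ℕ) (e : ℕ →₀ ℕ) :
    chW n ns ks e = PowerSeries.coeff (e 0) (gradedSeries n ns (fun p => (ks p : ℤ)) (e.erase 0)) := by
  rw [chW, finrank_WComponent, gradedSeries, PowerSeries.coeff_mk]

end QuotientSide

/-! ### Coefficients with respect to the `z_a`. -/

section Slices

/-- The coefficient of the monomial `w` in the `z_a`, as a power series in `q`. -/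
def slice (w : ℕ →₀ ℕ) (f : MvPowerSeries ℕ ℤ) : PowerSeries ℤ :=
  PowerSeries.mk fun d => MvPowerSeries.coeff (w.erase 0 + Finsupp.single 0 d) f

theorem slice_ext {f g : MvPowerSeries ℕ ℤ} (h : ∀ w : ℕ →₀ ℕ, w 0 = 0 → slice w f = slice w g) :
    f = g := by
  ext e
  have h1 := congrArg (PowerSeries.coeff (e 0)) (h (e.erase 0) Finsupp.erase_same)
  rw [slice, slice, PowerSeries.coeff_mk, PowerSeries.coeff_mk, Finsupp.erase_idem,
    Finsupp.erase_add_single] at h1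
  exact h1

theorem slice_add (w : ℕ →₀ ℕ) (f g : MvPowerSeries ℕ ℤ) :
    slice w (f + g) = slice w f + slice w g := by
  ext d
  simp [slice]

theorem slice_sum {τ : Type*} (w : ℕ →₀ ℕ) (s : Finset τ) (f : τ → MvPowerSeries ℕ ℤ) :
    slice w (∑ i ∈ s, f i) = ∑ i ∈ s, slice w (f i) := by
  ext d
  simp [slice]

theorem slice_inQ_mul (w : ℕ →₀ ℕ) (P : Polynomial ℤ) (f : MvPowerSeries ℕ ℤ) :
    slice w (inQ P * f) = (P : PowerSeries ℤ) * slice w f := by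
  induction P using Polynomial.induction_on' with
  | add P Q hP hQ =>
    rw [inQ, map_add, add_mul, slice_add, Polynomial.coe_add, add_mul]
    exact congrArg₂ _ hP hQ
  | monomial k c =>
    ext d
    rw [inQ, Polynomial.aeval_monomial, slice, PowerSeries.coeff_mk, ← Polynomial.C_mul_X_pow_eq_monomial,
      Polynomial.coe_mul, Polynomial.coe_C, Polynomial.coe_pow, Polynomial.coe_X,
      mul_assoc, mul_assoc, PowerSeries.coeff_C_mul,
      MvPowerSeries.algebraMap_apply, Algebra.algebraMap_self, RingHom.id_apply,
      MvPowerSeries.coeff_C_mul, MvPowerSeries.X_pow_eq, MvPowerSeries.coeff_monomial_mul,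
      PowerSeries.coeff_X_pow_mul', slice, PowerSeries.coeff_mk, one_mul]
    have h1 : Finsupp.single 0 k ≤ w.erase 0 + Finsupp.single 0 d ↔ k ≤ d := by
      rw [Finsupp.single_le_iff]
      simp
    simp only [h1]
    split_ifs with h
    · congr 3
      ext b
      rcases eq_or_ne b 0 with rfl | hb
      · simp
      · simp [Ne.symm hb]
    · rfl

theorem slice_X_pow_mul (w : ℕ →₀ ℕ) {a : ℕ} (ha : a ≠ 0) (m : ℕ) (f : MvPowerSeries ℕ ℤ) :
    slice w (MvPowerSeries.X a ^ m * f)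
      = if m ≤ w a then slice (w - Finsupp.single a m) f else 0 := by
  ext d
  rw [slice, PowerSeries.coeff_mk, MvPowerSeries.X_pow_eq, MvPowerSeries.coeff_monomial_mul, one_mul]
  have h1 : Finsupp.single a m ≤ w.erase 0 + Finsupp.single 0 d ↔ m ≤ w a := by
    rw [Finsupp.single_le_iff]
    simp [ha, Finsupp.erase_ne ha]
  simp only [h1]
  split_ifs with h
  · rw [slice, PowerSeries.coeff_mk]
    congr 2
    ext b
    rcases eq_or_ne b 0 with rfl | hb
    · simp [ha]
    · simp [Finsupp.single_apply, Ne.symm hb, Finsupp.erase_ne hb]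
  · rw [map_zero]

theorem slice_chW {n : ℕ} {ι : Type} [Fintype ι] (ns ks : ι → ℕ) {w : ℕ →₀ ℕ} (hw : w 0 = 0) :
    slice w (chW n ns ks) = gradedSeries n ns (fun p => (ks p : ℤ)) w := by
  ext d
  have h0 : w.erase 0 = w := Finsupp.erase_of_notMem_support (by simpa using hw)
  rw [slice, PowerSeries.coeff_mk, MvPowerSeries.coeff_apply, chW_eq, h0, Finsupp.add_apply, hw,
    zero_add, Finsupp.single_eq_same, Finsupp.erase_add, h0, Finsupp.erase_single, add_zero]

end Slices

/-! ### Admissible sequences and their standard data. -/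

section Shapes

theorem F_eq_zero_of_not_antitone {κ ρ : ℕ →₀ ℕ} (hκ : Antitone κ) (hρ : ρ ≤ κ)
    (h : ¬ Antitone ρ) : F κ ρ = 0 := by
  obtain ⟨a, ha⟩ : ∃ a, ρ a < ρ (a + 1) := by
    by_contra! h'
    exact h (antitone_nat_of_succ_le h')
  have h1 : κ (a + 1) ≠ 0 := by
    have := hρ (a + 1)
    omega
  have h2 := (mem_support_iff_of_antitone hκ _).mp h1
  rw [F_eq_prod hκ hρ le_rfl]
  refine Finset.prod_eq_zero (i := a) (Finset.mem_range.mpr (by omega)) ?_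
  rw [Ffactor, qBinom, if_neg (by omega), mul_zero]

theorem sum_Iic_diff {r : ℕ} {μ : Fin (r + 1) → ℕ →₀ ℕ} (hμ : Monotone μ) (a : Fin (r + 1)) :
    ∑ b ∈ Finset.Iic a, diff μ b = μ a := by
  induction a using Fin.induction with
  | zero =>
    rw [show (Finset.Iic (0 : Fin (r + 1))) = {0} from by ext; simp, Finset.sum_singleton]
    rfl
  | succ a ih =>
    have h : Finset.Iic a.succ = insert a.succ (Finset.Iic a.castSucc) := by
      ext b
      simp only [Finset.mem_Iic, Finset.mem_insert, Fin.le_def, Fin.ext_iff, Fin.val_succ,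
        Fin.val_castSucc]
      omega
    rw [h, Finset.sum_insert (by simp [Fin.le_def]), ih]
    exact tsub_add_cancel_of_le (hμ (by simp [Fin.le_def]))

/-- Sums of partitions are partitions, so successive differences may be replaced by all differences.
In this form the condition passes easily to shortened sequences. -/
theorem admissible_iff {r : ℕ} {μ : Fin (r + 1) → ℕ →₀ ℕ} :
    Admissible μ ↔ Antitone (μ 0) ∧ ∀ a b, a ≤ b → μ a ≤ μ b ∧ Antitone (μ b - μ a) := by
  constructor
  · rintro ⟨h1, h2⟩
    refine ⟨h2 0, fun a b hab => ⟨h1 hab, ?_⟩⟩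
    induction b using Fin.induction with
    | zero =>
      obtain rfl : a = 0 := by simpa using hab
      rw [tsub_self]
      exact fun _ _ _ => le_rfl
    | succ b ih =>
      rcases eq_or_lt_of_le hab with rfl | hlt
      · rw [tsub_self]
        exact fun _ _ _ => le_rfl
      · have hab' : a ≤ b.castSucc := by
          rw [Fin.le_def, Fin.val_castSucc]
          rw [Fin.lt_def, Fin.val_succ] at hlt
          omega
        have h3 : μ b.castSucc ≤ μ b.succ := h1 (by simp [Fin.le_def])
        rw [← tsub_add_tsub_cancel h3 (h1 hab')]
        intro i j hij
        exact add_le_add (h2 b.succ hij) (ih hab' hij)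
  · rintro ⟨h1, h2⟩
    refine ⟨fun a b hab => (h2 a b hab).1, fun a => ?_⟩
    induction a using Fin.cases with
    | zero => exact h1
    | succ a => exact (h2 a.castSucc a.succ (by simp [Fin.le_def])).2

theorem Admissible.update {r : ℕ} {μ : Fin (r + 2) → ℕ →₀ ℕ} (hμ : Admissible μ) {ν : ℕ →₀ ℕ}
    (h1 : μ (Fin.last r).castSucc ≤ ν) (h2 : Antitone (ν - μ (Fin.last r).castSucc)) :
    Admissible (Function.update (fun a : Fin (r + 1) => μ a.castSucc) (Fin.last r) ν) := by
  rw [admissible_iff] at hμ ⊢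
  have h3 : ∀ a : Fin (r + 1), μ a.castSucc ≤ ν ∧ Antitone (ν - μ a.castSucc) := by
    intro a
    obtain ⟨h4, h5⟩ := hμ.2 a.castSucc (Fin.last r).castSucc (Fin.castSucc_le_castSucc_iff.mpr (Fin.le_last a))
    refine ⟨h4.trans h1, ?_⟩
    rw [← tsub_add_tsub_cancel h1 h4]
    intro i j hij
    exact add_le_add (h2 hij) (h5 hij)
  constructor
  · rw [Function.update_apply]
    split_ifs with h
    · have h5 : Antitone (μ (Fin.last r).castSucc) := by
        rw [← h]
        exact hμ.1
      rw [← tsub_add_cancel_of_le h1]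
      intro i j hij
      exact add_le_add (h2 hij) (h5 hij)
    · exact hμ.1
  · intro a b hab
    rw [Function.update_apply, Function.update_apply]
    by_cases hb : b = Fin.last r <;> by_cases ha : a = Fin.last r <;> simp only [hb, ha, if_true, if_false]
    · rw [tsub_self]
      exact ⟨le_rfl, fun _ _ _ => le_rfl⟩
    · exact h3 a
    · subst ha
      exact absurd (le_antisymm (Fin.le_last b) hab) hb
    · exact hμ.2 _ _ (Fin.castSucc_le_castSucc_iff.mpr hab)

/-- The positions with `n_p > a + 1` carry exactly the differences of `μ` above the index `a`, and
these telescope. -/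
theorem activeShape_chi {r : ℕ} {μ : Fin (r + 1) → ℕ →₀ ℕ} (hμ : Admissible μ) (a : Fin r) :
    activeShape (ι := Σ b : Fin (r + 1), Fin (diff μ b 0)) (fun p => (p.1 : ℕ) + 1)
      (fun p => conjPart (diff μ p.1) p.2) ((a : ℕ) + 1) + μ a.castSucc = μ (Fin.last r) := by
  have h1 : activeShape (ι := Σ b : Fin (r + 1), Fin (diff μ b 0)) (fun p => (p.1 : ℕ) + 1)
      (fun p => conjPart (diff μ p.1) p.2) ((a : ℕ) + 1)
      = ∑ b ∈ Finset.univ.filter (fun b => ¬ b ≤ a.castSucc), diff μ b := by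
    rw [activeShape, Finset.sum_filter, Fintype.sum_sigma, Finset.sum_filter]
    refine Finset.sum_congr rfl fun b _ => ?_
    have h2 : (a : ℕ) + 1 < (b : ℕ) + 1 ↔ ¬ b ≤ a.castSucc := by
      rw [Fin.le_def, Fin.val_castSucc]
      omega
    simp only [h2]
    split_ifs with h
    · exact Finset.sum_const_zero
    · exact sum_column_conjPart (hμ.2 b) le_rfl
  have h3 : Finset.univ.filter (fun b => b ≤ a.castSucc) = Finset.Iic a.castSucc := by
    ext b
    simp
  have h4 : Finset.univ = Finset.Iic (Fin.last r) := by
    ext b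
    simp [Fin.le_last]
  rw [h1, ← sum_Iic_diff hμ.1 a.castSucc, ← sum_Iic_diff hμ.1 (Fin.last r), ← h3, ← h4, add_comm]
  exact Finset.sum_filter_add_sum_filter_not _ _ _

theorem Ico_succ_iff {r a : ℕ} : a ∈ Finset.Ico 1 (r + 1) ↔ ∃ b : Fin r, a = b + 1 := by
  rw [Finset.mem_Ico]
  constructor
  · intro h
    exact ⟨⟨a - 1, by omega⟩, by simp; omega⟩
  · rintro ⟨b, rfl⟩
    omega

theorem gradedSeries_congr_of_Ico {r : ℕ} {ι ι' : Type} [Fintype ι] [Fintype ι']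
    {ns ks : ι → ℕ} {ns' ks' : ι' → ℕ}
    (h : ∀ a : Fin r, activeShape ns ks (a + 1) = activeShape ns' ks' (a + 1)) (w : ℕ →₀ ℕ) :
    gradedSeries (r + 1) ns (fun p => (ks p : ℤ)) w
      = gradedSeries (r + 1) ns' (fun p => (ks' p : ℤ)) w := by
  by_cases hw : ∀ a, w a ≠ 0 → a ∈ Finset.Ico 1 (r + 1)
  · refine gradedSeries_congr w ns ks ns' ks' (fun _ _ => Iff.rfl) fun a ha => ?_
    obtain ⟨b, rfl⟩ := Ico_succ_iff.mp (hw a ha)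
    exact h b
  · push Not at hw
    obtain ⟨a, ha, hn⟩ := hw
    rw [gradedSeries_of_notMem ha hn, gradedSeries_of_notMem ha hn]

theorem antitone_kappa {ι : Type} [Fintype ι] (ns ks : ι → ℕ) (b : ℕ) : Antitone (kappa ns ks b) := by
  intro i j h
  rw [kappa, Finsupp.finsetSum_apply, Finsupp.finsetSum_apply]
  refine Finset.sum_le_sum fun p _ => ?_
  rw [column_apply, column_apply]
  split_ifs <;> omega

theorem muOf_eq {ι : Type} [Fintype ι] {r : ℕ} {ns ks : ι → ℕ} (h : ∀ p, 1 ≤ ns p)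
    (a : Fin (r + 1)) :
    muOf r ns ks a = ∑ p ∈ Finset.univ.filter (fun p => ns p ≤ a + 1), column (ks p) := by
  rw [muOf]
  simp only [kappa, Finset.sum_filter]
  rw [Finset.sum_comm]
  refine Finset.sum_congr rfl fun p _ => ?_
  rw [Finset.sum_ite_eq]
  have := h p
  simp only [Finset.mem_Icc, this, true_and]

theorem admissible_muOf {ι : Type} [Fintype ι] (r : ℕ) (ns ks : ι → ℕ) :
    Admissible (muOf r ns ks) := by
  have h : ∀ a : Fin r, muOf r ns ks a.succ = muOf r ns ks a.castSucc + kappa ns ks (a + 2) := by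
    intro a
    rw [muOf, muOf, Fin.val_succ, Finset.sum_Icc_succ_top (by omega)]
    rfl
  constructor
  · refine Fin.monotone_iff_le_succ.mpr fun a => ?_
    rw [h]
    exact le_self_add
  · intro a
    induction a using Fin.cases with
    | zero =>
      change Antitone (muOf r ns ks 0)
      simpa [muOf] using antitone_kappa ns ks 1
    | succ a =>
      change Antitone (muOf r ns ks a.succ - muOf r ns ks a.castSucc)
      rw [h, add_tsub_cancel_left]
      exact antitone_kappa ns ks _

/-- The data `(n, k)` and the standard data of `muOf` have the same active shapes, and the series
depend on nothing else. -/
theorem chW_eq_chi {ι : Type} [Fintype ι] {r : ℕ} {ns ks : ι → ℕ}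
    (h : ∀ p, 1 ≤ ns p ∧ ns p ≤ r + 1) : chW (r + 1) ns ks = chi (muOf r ns ks) := by
  refine slice_ext fun w hw => ?_
  rw [chi, slice_chW _ _ hw, slice_chW _ _ hw]
  refine gradedSeries_congr_of_Ico (fun a => ?_) w
  refine add_right_cancel (b := muOf r ns ks a.castSucc) ?_
  rw [activeShape_chi (admissible_muOf r ns ks), muOf_eq fun p => (h p).1, muOf_eq fun p => (h p).1,
    activeShape, Fin.val_castSucc, add_comm, ← Finset.sum_filter_add_sum_filter_not
      (Finset.univ.filter fun p => ns p ≤ ((Fin.last r : Fin (r + 1)) : ℕ) + 1)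
      (fun p => ns p ≤ a + 1)]
  congr 1 <;> refine Finset.sum_congr ?_ fun _ _ => rfl
  · ext p
    simp only [Finset.mem_filter, Finset.mem_univ, true_and, Fin.val_last]
    have := h p
    omega
  · ext p
    simp only [Finset.mem_filter, Finset.mem_univ, true_and, Fin.val_last]
    have := h p
    omega

end Shapes

/-! ### The recursion in `n`. -/

section Recursion

theorem slice_chi_of_notMem {r : ℕ} (μ : Fin (r + 1) → ℕ →₀ ℕ) {w : ℕ →₀ ℕ} (hw : w 0 = 0) {a : ℕ}
    (ha : w a ≠ 0) (h : a ∉ Finset.Ico 1 (r + 1)) : slice w (chi μ) = 0 := by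
  rw [chi, slice_chW _ _ hw, gradedSeries_of_notMem ha h]

/-- Once the levels at color `n - 1` are replaced by those of `ν - μ^{(n-1)}`, the shape at a lower
color `a` is `ν - μ^{(a)}`, as for the shortened sequence ending in `ν`. The top color no longer
occurs in `w`, so the difference between `n` and `n - 1` is invisible. -/
theorem slice_chi_setShape {r : ℕ} {μ : Fin (r + 2) → ℕ →₀ ℕ} (hμ : Admissible μ) {c : Gen (r + 2)}
    (hc : (c : ℕ) = r + 1)
    (e : Fin (numActive (ι := Σ b : Fin (r + 2), Fin (diff μ b 0)) (fun p => (p.1 : ℕ) + 1) c) ≃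
      {p : Σ b : Fin (r + 2), Fin (diff μ b 0) // (c : ℕ) < (p.1 : ℕ) + 1})
    {ν : ℕ →₀ ℕ} (h1 : μ (Fin.last r).castSucc ≤ ν) (h2 : Antitone (ν - μ (Fin.last r).castSucc))
    (h3 : ν ≤ μ (Fin.last (r + 1))) {w : ℕ →₀ ℕ} (hw0 : w 0 = 0) (hw : ∀ a, r + 1 ≤ a → w a = 0) :
    gradedSeries (r + 2) (fun p : Σ b : Fin (r + 2), Fin (diff μ b 0) => (p.1 : ℕ) + 1)
      (fun p => (setShape (fun p => (p.1 : ℕ) + 1) (fun p => conjPart (diff μ p.1) p.2) e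
        (ν - μ (Fin.last r).castSucc) p : ℤ)) w
      = slice w (chi (Function.update (fun a : Fin (r + 1) => μ a.castSucc) (Fin.last r) ν)) := by
  rw [chi, slice_chW _ _ hw0]
  have hadm := hμ.update h1 h2
  have hκ : activeShape (ι := Σ b : Fin (r + 2), Fin (diff μ b 0)) (fun p => (p.1 : ℕ) + 1)
      (fun p => conjPart (diff μ p.1) p.2) c + μ (Fin.last r).castSucc = μ (Fin.last (r + 1)) := by
    rw [hc]
    exact activeShape_chi hμ (Fin.last r)
  refine gradedSeries_congr w _ _ _ _ (fun a ha => ?_) fun a ha => ?_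
  · have : a < r + 1 := by
      by_contra h
      exact ha (hw a (by omega))
    simp only [Finset.mem_Ico]
    omega
  · have ha1 : a < r + 1 := by
      by_contra h
      exact ha (hw a (by omega))
    have ha0 : a ≠ 0 := by
      rintro rfl
      exact ha hw0
    obtain ⟨b, rfl⟩ : ∃ b : Fin r, a = b + 1 := ⟨⟨a - 1, by omega⟩, by simp; omega⟩
    have hle : ν - μ (Fin.last r).castSucc ≤ activeShape
        (ι := Σ b : Fin (r + 2), Fin (diff μ b 0)) (fun p => (p.1 : ℕ) + 1)
        (fun p => conjPart (diff μ p.1) p.2) c := by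
      rw [tsub_le_iff_right, hκ]
      exact h3
    have h4 := activeShape_setShape _ _ e h2 hle (a := b + 1) (by omega)
    have h5 := activeShape_chi hμ b.castSucc
    have h6 := activeShape_chi hadm b
    rw [Fin.val_castSucc] at h5
    rw [Function.update_self, Function.update_of_ne (Fin.castSucc_lt_last b).ne] at h6
    refine add_right_cancel (b := μ b.castSucc.castSucc) (Eq.trans ?_ h6.symm)
    refine add_right_cancel (b := activeShape
        (ι := Σ b : Fin (r + 2), Fin (diff μ b 0)) (fun p => (p.1 : ℕ) + 1)
        (fun p => conjPart (diff μ p.1) p.2) c + μ (Fin.last r).castSucc) ?_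
    rw [add_add_add_comm, h4, hκ, ← h5]
    rw [add_add_add_comm, tsub_add_cancel_of_le h1, add_comm]

/-- Compare the coefficients of each monomial in the `z_a`. The factors of the top color are removed
by `gradedSeries_eq_sum_setShape`, and the shapes there correspond to `ν` by `ρ = ν - μ^{(n-1)}`. -/
theorem chi_eq_sum_between {r : ℕ} {μ : Fin (r + 2) → ℕ →₀ ℕ} (hμ : Admissible μ) :
    chi μ = ∑ ν ∈ between (μ (Fin.last r).castSucc) (μ (Fin.last (r + 1))),
      MvPowerSeries.X (r + 1) ^ ((μ (Fin.last (r + 1))).degree - ν.degree) *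
        inQ (F (μ (Fin.last (r + 1)) - μ (Fin.last r).castSucc)
          (ν - μ (Fin.last r).castSucc)) *
        chi (Function.update (fun a : Fin (r + 1) => μ a.castSucc) (Fin.last r) ν) := by
  classical
  refine slice_ext fun w hw0 => ?_
  simp only [slice_sum, mul_assoc]
  simp only [slice_X_pow_mul w (show r + 1 ≠ 0 by omega)]
  have hle : μ (Fin.last r).castSucc ≤ μ (Fin.last (r + 1)) := hμ.1 (Fin.le_last _)
  -- A variable `z_a` with `a ≥ n` occurs on neither side.
  by_cases hw : ∃ a, r + 2 ≤ a ∧ w a ≠ 0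
  · obtain ⟨a, ha, hwa⟩ := hw
    rw [slice_chi_of_notMem μ hw0 hwa (by rw [Finset.mem_Ico]; omega)]
    symm
    refine Finset.sum_eq_zero fun ν _ => ?_
    split_ifs with h
    · rw [slice_inQ_mul, slice_chi_of_notMem (a := a), mul_zero]
      · simp [hw0]
      · rw [Finsupp.tsub_apply, Finsupp.single_eq_of_ne (by omega), Nat.sub_zero]
        exact hwa
      · rw [Finset.mem_Ico]
        omega
    · rfl
  push Not at hw
  set M := w (r + 1) with hM
  set w' := w.erase (r + 1) with hw'
  have hw'0 : w' 0 = 0 := by rw [hw', Finsupp.erase_ne (by omega), hw0]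
  have hw'1 : ∀ a, r + 1 ≤ a → w' a = 0 := by
    intro a ha
    rcases eq_or_ne a (r + 1) with rfl | h
    · exact Finsupp.erase_same
    · rw [hw', Finsupp.erase_ne h]
      exact hw a (by omega)
  have hww : w = w' + Finsupp.single (r + 1) M := (Finsupp.erase_add_single _ _).symm
  let c : Gen (r + 2) := ⟨r + 1, by rw [Finset.mem_Ico]; omega⟩
  obtain ⟨e⟩ := exists_activeEquiv
    (fun p : Σ b : Fin (r + 2), Fin (diff μ b 0) => (p.1 : ℕ) + 1) c
  have hκ : activeShape (ι := Σ b : Fin (r + 2), Fin (diff μ b 0)) (fun p => (p.1 : ℕ) + 1)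
      (fun p => conjPart (diff μ p.1) p.2) c
      = μ (Fin.last (r + 1)) - μ (Fin.last r).castSucc := by
    have := activeShape_chi hμ (Fin.last r)
    exact eq_tsub_of_add_eq this
  have hκa : Antitone (μ (Fin.last (r + 1)) - μ (Fin.last r).castSucc) := by
    rw [← hκ]
    exact antitone_activeShape _ _ _
  have hC := gradedSeries_eq_sum_setShape
    (fun p : Σ b : Fin (r + 2), Fin (diff μ b 0) => (p.1 : ℕ) + 1)
    (fun p => conjPart (diff μ p.1) p.2) e (w := w') hw'1 M
  rw [hκ] at hC
  have hL : slice w (chi μ) = ∑ ρ ∈ shapes (μ (Fin.last (r + 1)) - μ (Fin.last r).castSucc) M,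
      (F (μ (Fin.last (r + 1)) - μ (Fin.last r).castSucc) ρ : PowerSeries ℤ) *
        slice w' (chi (Function.update (fun a : Fin (r + 1) => μ a.castSucc) (Fin.last r)
          (ρ + μ (Fin.last r).castSucc))) := by
    rw [chi, slice_chW _ _ hw0]
    nth_rewrite 1 [hww]
    refine hC.trans (Finset.sum_congr rfl fun ρ hρ => ?_)
    obtain ⟨h1, h2, -⟩ := mem_shapes.mp hρ
    have h3 : ρ + μ (Fin.last r).castSucc - μ (Fin.last r).castSucc = ρ := add_tsub_cancel_right _ _
    rw [← slice_chi_setShape hμ (c := c) rfl e (ν := ρ + μ (Fin.last r).castSucc) le_add_self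
      (by rw [h3]; exact h2) ((le_tsub_iff_right hle).mp h1) hw'0 hw'1, h3]
  rw [hL]
  -- The shorter characters do not involve `z_{r+1}`, so only those `ν` survive for which the
  -- explicit power of `z_{r+1}` has exponent exactly `M`. If `ν - μ^{(n-1)}` is not a partition,
  -- `F` vanishes.
  have hterm : ∀ ν ∈ between (μ (Fin.last r).castSucc) (μ (Fin.last (r + 1))),
      (if (μ (Fin.last (r + 1))).degree - ν.degree ≤ M then
        slice (w - Finsupp.single (r + 1) ((μ (Fin.last (r + 1))).degree - ν.degree))
          (inQ (F (μ (Fin.last (r + 1)) - μ (Fin.last r).castSucc)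
            (ν - μ (Fin.last r).castSucc)) *
          chi (Function.update (fun a : Fin (r + 1) => μ a.castSucc) (Fin.last r) ν)) else 0)
      = if Antitone (ν - μ (Fin.last r).castSucc) ∧ ν.degree + M = (μ (Fin.last (r + 1))).degree then
          (F (μ (Fin.last (r + 1)) - μ (Fin.last r).castSucc)
            (ν - μ (Fin.last r).castSucc) : PowerSeries ℤ) * slice w'
          (chi (Function.update (fun a : Fin (r + 1) => μ a.castSucc) (Fin.last r) ν)) else 0 := by
    intro ν hν
    obtain ⟨h1, h2, h3⟩ := mem_between.mp hν
    have hd := degree_mono h2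
    rw [slice_inQ_mul]
    by_cases hanti : Antitone (ν - μ (Fin.last r).castSucc)
    · by_cases hdeg : ν.degree + M = (μ (Fin.last (r + 1))).degree
      · rw [if_pos (by omega), if_pos ⟨hanti, hdeg⟩, ← hdeg, Nat.add_sub_cancel_left]
        congr 2
        rw [hww]
        exact add_tsub_cancel_right _ _
      · have hn : ¬ (Antitone (ν - μ (Fin.last r).castSucc) ∧
            ν.degree + M = (μ (Fin.last (r + 1))).degree) := fun h => hdeg h.2
        rw [if_neg hn]
        split_ifs with h
        · rw [slice_chi_of_notMem (a := r + 1), mul_zero]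
          · simp [hw0]
          · rw [Finsupp.tsub_apply, Finsupp.single_eq_same]
            omega
          · rw [Finset.mem_Ico]
            omega
        · rfl
    · have hn : ¬ (Antitone (ν - μ (Fin.last r).castSucc) ∧
          ν.degree + M = (μ (Fin.last (r + 1))).degree) := fun h => hanti h.1
      rw [if_neg hn, F_eq_zero_of_not_antitone hκa (tsub_le_tsub_right h2 _) hanti,
        Polynomial.coe_zero, zero_mul, ite_self]
  rw [Finset.sum_congr rfl hterm, ← Finset.sum_filter]
  refine Finset.sum_nbij' (fun ρ => ρ + μ (Fin.last r).castSucc)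
    (fun ν => ν - μ (Fin.last r).castSucc) ?_ ?_ ?_ ?_ ?_
  · intro ρ hρ
    obtain ⟨h1, h2, h3⟩ := mem_shapes.mp hρ
    have h4 : ρ + μ (Fin.last r).castSucc - μ (Fin.last r).castSucc = ρ := add_tsub_cancel_right _ _
    rw [Finset.mem_filter, mem_between, h4]
    have hanti : Antitone (μ (Fin.last r).castSucc) := by
      have h5 := admissible_iff.mp hμ
      have h6 := h5.2 0 (Fin.last r).castSucc (Fin.zero_le _)
      rw [← tsub_add_cancel_of_le h6.1]
      intro i j hij
      exact add_le_add (h6.2 hij) (h5.1 hij)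
    refine ⟨⟨le_add_self, (le_tsub_iff_right hle).mp h1, fun i j hij => add_le_add (h2 hij) (hanti hij)⟩, h2, ?_⟩
    have h7 := congrArg Finsupp.degree (tsub_add_cancel_of_le hle)
    rw [map_add] at h7 ⊢
    omega
  · intro ν hν
    rw [Finset.mem_filter, mem_between] at hν
    obtain ⟨⟨h1, h2, h3⟩, h4, h5⟩ := hν
    rw [mem_shapes]
    refine ⟨tsub_le_tsub_right h2 _, h4, ?_⟩
    have h7 := congrArg Finsupp.degree (tsub_add_cancel_of_le hle)
    have h8 := congrArg Finsupp.degree (tsub_add_cancel_of_le h1)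
    rw [map_add] at h7 h8
    omega
  · intro ρ _
    exact add_tsub_cancel_right _ _
  · intro ν hν
    exact tsub_add_cancel_of_le (mem_between.mp (Finset.mem_filter.mp hν).1).1
  · intro ρ _
    rw [add_tsub_cancel_right]

end Recursion

/-! ### Fermionic and supernomial formulas. -/

section Fermionic

theorem inQ_prod {τ : Type*} (s : Finset τ) (P : τ → Polynomial ℤ) :
    inQ (∏ i ∈ s, P i) = ∏ i ∈ s, inQ (P i) := map_prod _ _ _

theorem inQ_sum {τ : Type*} (s : Finset τ) (P : τ → Polynomial ℤ) :
    inQ (∑ i ∈ s, P i) = ∑ i ∈ s, inQ (P i) := map_sum _ _ _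

theorem mem_chains {r : ℕ} {μ ν : Fin (r + 1) → ℕ →₀ ℕ} :
    ν ∈ chains μ ↔ (∀ a, μ a ≤ ν a ∧ Antitone (ν a)) ∧ Monotone ν ∧
      ν (Fin.last r) = μ (Fin.last r) := by
  rw [chains, Finset.mem_filter, Fintype.mem_piFinset]
  simp only [mem_between]
  constructor
  · rintro ⟨h1, h2⟩
    exact ⟨fun a => ⟨(h1 a).1, (h1 a).2.2⟩, h2⟩
  · rintro ⟨h1, h2, h3⟩
    refine ⟨fun a => ⟨(h1 a).1, ?_, (h1 a).2⟩, h2, h3⟩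
    rw [← h3]
    exact h2 (Fin.le_last a)

theorem chi_fin_one {μ : Fin 1 → ℕ →₀ ℕ} : chi μ = 1 := by
  refine slice_ext fun w hw => ?_
  have h1 : slice w (1 : MvPowerSeries ℕ ℤ) = if w = 0 then 1 else 0 := by
    ext d
    rw [slice, PowerSeries.coeff_mk, MvPowerSeries.coeff_one]
    have h0 : w.erase 0 = w := Finsupp.erase_of_notMem_support (by simpa using hw)
    rw [h0]
    by_cases hw0 : w = 0
    · subst hw0
      simp [PowerSeries.coeff_one]
    · rw [if_neg hw0, if_neg, map_zero]
      intro h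
      exact hw0 (by simpa using (add_eq_zero.mp h).1)
  rw [h1]
  split_ifs with h
  · subst h
    rw [chi, slice_chW _ _ hw, gradedSeries]
    ext d
    rw [PowerSeries.coeff_mk, gradedDim_zero, PowerSeries.coeff_one]
    simp
  · obtain ⟨a, ha⟩ := Finsupp.ne_iff.mp h
    exact slice_chi_of_notMem μ hw ha (by simp)

theorem antitone_last {r : ℕ} {μ : Fin (r + 1) → ℕ →₀ ℕ} (hμ : Admissible μ) (a : Fin (r + 1)) :
    Antitone (μ a) := by
  have h5 := admissible_iff.mp hμ
  have h6 := h5.2 0 a (Fin.zero_le _)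
  rw [← tsub_add_cancel_of_le h6.1]
  intro i j hij
  exact add_le_add (h6.2 hij) (h5.1 hij)

theorem chi_eq_sum_chains : ∀ {r : ℕ} {μ : Fin (r + 1) → ℕ →₀ ℕ}, Admissible μ →
    chi μ = ∑ ν ∈ chains μ, ∏ a : Fin r,
      (MvPowerSeries.X ((a : ℕ) + 1) ^ ((ν a.succ).degree - (ν a.castSucc).degree) *
        inQ (F (ν a.succ - μ a.castSucc) (ν a.castSucc - μ a.castSucc))) := by
  intro r
  induction r with
  | zero =>
    intro μ hμ
    have h : chains μ = {μ} := by
      ext ν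
      rw [mem_chains, Finset.mem_singleton]
      constructor
      · rintro ⟨-, -, h⟩
        funext a
        have ha : a = Fin.last 0 := Fin.ext (by omega)
        rw [ha, h]
      · rintro rfl
        exact ⟨fun a => ⟨le_rfl, antitone_last hμ a⟩, hμ.1, rfl⟩
    rw [h, Finset.sum_singleton, chi_fin_one, Finset.univ_eq_empty, Finset.prod_empty]
  | succ r ih =>
    intro μ hμ
    have hle : μ (Fin.last r).castSucc ≤ μ (Fin.last (r + 1)) := hμ.1 (Fin.le_last _)
    have hκ : Antitone (μ (Fin.last (r + 1)) - μ (Fin.last r).castSucc) := hμ.2 (Fin.last r).succ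
    rw [chi_eq_sum_between hμ]
    have hterm : ∀ ν ∈ between (μ (Fin.last r).castSucc) (μ (Fin.last (r + 1))),
        MvPowerSeries.X (r + 1) ^ ((μ (Fin.last (r + 1))).degree - ν.degree) *
          inQ (F (μ (Fin.last (r + 1)) - μ (Fin.last r).castSucc)
            (ν - μ (Fin.last r).castSucc)) *
          chi (Function.update (fun a : Fin (r + 1) => μ a.castSucc) (Fin.last r) ν)
        = ∑ ν' ∈ chains (Function.update (fun a : Fin (r + 1) => μ a.castSucc) (Fin.last r) ν),
          MvPowerSeries.X (r + 1) ^ ((μ (Fin.last (r + 1))).degree - ν.degree) *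
          inQ (F (μ (Fin.last (r + 1)) - μ (Fin.last r).castSucc)
            (ν - μ (Fin.last r).castSucc)) * ∏ a : Fin r,
            (MvPowerSeries.X ((a : ℕ) + 1) ^ ((ν' a.succ).degree - (ν' a.castSucc).degree) *
              inQ (F (ν' a.succ - μ a.castSucc.castSucc)
                (ν' a.castSucc - μ a.castSucc.castSucc))) := by
      intro ν hν
      obtain ⟨h1, h2, h3⟩ := mem_between.mp hν
      by_cases hanti : Antitone (ν - μ (Fin.last r).castSucc)
      · rw [ih (hμ.update h1 hanti), Finset.mul_sum]
        refine Finset.sum_congr rfl fun ν' _ => ?_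
        congr 1
        refine Finset.prod_congr rfl fun a _ => ?_
        rw [Function.update_of_ne (Fin.castSucc_lt_last a).ne]
      · rw [F_eq_zero_of_not_antitone hκ (tsub_le_tsub_right h2 _) hanti]
        simp [inQ]
    rw [Finset.sum_congr rfl hterm, Finset.sum_sigma']
    -- A chain is `μ^{(n)}` appended to a chain for the shortened sequence whose top is `ν =
    -- ν^{(n-1)}`.
    refine Finset.sum_nbij' (fun x => Fin.snoc (α := fun _ => ℕ →₀ ℕ) x.2 (μ (Fin.last (r + 1))))
      (fun ν => ⟨ν (Fin.last r).castSucc, fun a => ν a.castSucc⟩) ?_ ?_ ?_ ?_ ?_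
    · rintro ⟨ν, ν'⟩ h
      rw [Finset.mem_sigma, mem_between, mem_chains] at h
      obtain ⟨⟨h1, h2, h3⟩, h4, h5, h6⟩ := h
      simp only at h1 h2 h3 h4 h5 h6
      rw [Function.update_self] at h6
      rw [mem_chains]
      refine ⟨fun a => ?_, ?_, ?_⟩
      · induction a using Fin.lastCases with
        | last => rw [Fin.snoc_last]; exact ⟨le_rfl, antitone_last hμ _⟩
        | cast a =>
          rw [Fin.snoc_castSucc]
          refine ⟨?_, (h4 a).2⟩
          rcases eq_or_ne a (Fin.last r) with rfl | ha
          · change _ ≤ ν' (Fin.last r)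
            rw [h6]
            exact h1
          · have := (h4 a).1
            rwa [Function.update_of_ne ha] at this
      · refine Fin.monotone_iff_le_succ.mpr fun a => ?_
        induction a using Fin.lastCases with
        | last => rw [Fin.succ_last, Fin.snoc_last, Fin.snoc_castSucc]; exact h6.trans_le h2
        | cast a =>
          rw [Fin.snoc_castSucc, Fin.succ_castSucc, Fin.snoc_castSucc]
          exact h5 (by simp [Fin.le_def])
      · rw [Fin.snoc_last]
    · intro ν h
      rw [mem_chains] at h
      obtain ⟨h1, h2, h3⟩ := h
      rw [Finset.mem_sigma, mem_between, mem_chains]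
      refine ⟨⟨(h1 _).1, ?_, (h1 _).2⟩, fun a => ⟨?_, (h1 _).2⟩, fun a b hab => h2 (Fin.castSucc_le_castSucc_iff.mpr hab), ?_⟩
      · rw [← h3]
        exact h2 (Fin.le_last _)
      · rcases eq_or_ne a (Fin.last r) with rfl | ha
        · rw [Function.update_self]
        · rw [Function.update_of_ne ha]
          exact (h1 _).1
      · rw [Function.update_self]
    · rintro ⟨ν, ν'⟩ h
      rw [Finset.mem_sigma, mem_chains] at h
      obtain ⟨-, -, -, h6⟩ := h
      simp only at h6
      rw [Function.update_self] at h6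
      simp only [Fin.snoc_castSucc, h6]
    · intro ν h
      rw [mem_chains] at h
      funext a
      induction a using Fin.lastCases with
      | last => simp only [Fin.snoc_last, h.2.2]
      | cast a => simp only [Fin.snoc_castSucc]
    · rintro ⟨ν, ν'⟩ h
      rw [Finset.mem_sigma, mem_chains] at h
      obtain ⟨-, -, -, h6⟩ := h
      simp only at h6
      rw [Function.update_self] at h6
      rw [Fin.prod_univ_castSucc, mul_comm]
      simp only [Fin.snoc_castSucc, Fin.succ_castSucc, Fin.succ_last, Fin.snoc_last, h6,
        Fin.val_castSucc, Fin.val_last, Nat.succ_eq_add_one]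

theorem admissible_onlyLast (r : ℕ) {μ : ℕ →₀ ℕ} (hμ : Antitone μ) : Admissible (onlyLast r μ) := by
  have hz : Antitone ((0 : ℕ →₀ ℕ) : ℕ → ℕ) := fun _ _ _ => le_rfl
  rw [admissible_iff]
  constructor
  · rw [onlyLast, Pi.single_apply]
    split_ifs
    · exact hμ
    · exact hz
  · intro a b hab
    rw [onlyLast, Pi.single_apply, Pi.single_apply]
    by_cases hb : b = Fin.last r <;> by_cases ha : a = Fin.last r <;>
      simp only [hb, ha, if_true, if_false]
    · rw [tsub_self]
      exact ⟨le_rfl, hz⟩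
    · rw [tsub_zero]
      exact ⟨zero_le, hμ⟩
    · subst ha
      exact absurd (le_antisymm (Fin.le_last b) hab) hb
    · rw [tsub_self]
      exact ⟨le_rfl, hz⟩

theorem onlyLast_castSucc (r : ℕ) (μ : ℕ →₀ ℕ) (a : Fin r) : onlyLast r μ a.castSucc = 0 := by
  rw [onlyLast, Pi.single_eq_of_ne (Fin.castSucc_lt_last a).ne]

theorem onlyLast_last (r : ℕ) (μ : ℕ →₀ ℕ) : onlyLast r μ (Fin.last r) = μ := by
  rw [onlyLast, Pi.single_eq_same]

theorem prod_F_eq {r : ℕ} {μ : ℕ →₀ ℕ} {ν : Fin (r + 1) → ℕ →₀ ℕ}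
    (hν : ν ∈ chains (onlyLast r μ)) :
    ∏ a : Fin r, F (ν a.succ) (ν a.castSucc)
      = X ^ (∑ a : Fin r, ∑ i ∈ Finset.range μ.support.card,
        ν a.castSucc (i + 1) * (ν a.succ i - ν a.castSucc i)) *
      ∏ a : Fin r, ∏ i ∈ Finset.range μ.support.card,
        qBinom ((ν a.succ i : ℤ) - (ν a.castSucc (i + 1) : ℤ))
          ((ν a.castSucc i : ℤ) - (ν a.castSucc (i + 1) : ℤ)) := by
  obtain ⟨h1, h2, h3⟩ := mem_chains.mp hν
  rw [onlyLast_last] at h3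
  rw [← Finset.prod_pow_eq_pow_sum, ← Finset.prod_mul_distrib]
  refine Finset.prod_congr rfl fun a _ => ?_
  have h4 : ν a.succ ≤ μ := by
    rw [← h3]
    exact h2 (Fin.le_last _)
  have h5 : (ν a.succ).support.card ≤ μ.support.card := by
    refine Finset.card_le_card fun i hi => ?_
    rw [Finsupp.mem_support_iff] at hi ⊢
    have := h4 i
    omega
  rw [F_eq_prod (h1 a.succ).2 (h2 (by simp [Fin.le_def])) h5, ← Finset.prod_pow_eq_pow_sum,
    ← Finset.prod_mul_distrib]
  rfl

/-- The composition whose partial sums are the given numbers. -/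
def increments {r : ℕ} (d : Fin (r + 1) → ℕ) : Fin (r + 1) → ℕ :=
  Fin.cases (d 0) fun a => d a.succ - d a.castSucc

theorem forall_eq_sum_Iic_iff {r : ℕ} {d : Fin (r + 1) → ℕ} (hd : Monotone d) (lam : Fin (r + 1) → ℕ) :
    (∀ a, d a = ∑ b ∈ Finset.Iic a, lam b) ↔ lam = increments d := by
  have h0 : (Finset.Iic (0 : Fin (r + 1))) = {0} := by ext; simp
  have hs : ∀ a : Fin r, Finset.Iic a.succ = insert a.succ (Finset.Iic a.castSucc) := by
    intro a
    ext b
    simp only [Finset.mem_Iic, Finset.mem_insert, Fin.le_def, Fin.ext_iff, Fin.val_succ,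
      Fin.val_castSucc]
    omega
  have hn : ∀ a : Fin r, a.succ ∉ Finset.Iic a.castSucc := fun a => by simp [Fin.le_def]
  constructor
  · intro h
    funext a
    induction a using Fin.cases with
    | zero =>
      have := h 0
      rw [h0, Finset.sum_singleton] at this
      exact this.symm
    | succ a =>
      change lam a.succ = d a.succ - d a.castSucc
      rw [h a.succ, h a.castSucc, hs, Finset.sum_insert (hn a), Nat.add_sub_cancel]
  · rintro rfl a
    induction a using Fin.induction with
    | zero =>
      rw [h0, Finset.sum_singleton]
      rfl
    | succ a ih =>
      rw [hs, Finset.sum_insert (hn a), ← ih]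
      change _ = d a.succ - d a.castSucc + _
      have : d a.castSucc ≤ d a.succ := hd (by simp [Fin.le_def])
      omega

theorem chi_onlyLast (r : ℕ) {μ : ℕ →₀ ℕ} (hμ : Antitone μ) :
    chi (onlyLast r μ) = ∑ lam ∈ Finset.piAntidiag (Finset.univ : Finset (Fin (r + 1))) μ.degree,
      (∏ a : Fin r, MvPowerSeries.X ((a : ℕ) + 1) ^ lam a.succ) * inQ (supernomial lam μ) := by
  classical
  rw [chi_eq_sum_chains (admissible_onlyLast r hμ)]
  simp only [supernomial, inQ_sum, Finset.mul_sum, Finset.sum_filter]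
  rw [Finset.sum_comm]
  refine Finset.sum_congr rfl fun ν hν => ?_
  obtain ⟨h1, h2, h3⟩ := mem_chains.mp hν
  rw [onlyLast_last] at h3
  have hd : Monotone fun a => (ν a).degree := fun a b hab => degree_mono (h2 hab)
  have hsum := (forall_eq_sum_Iic_iff hd (increments fun a => (ν a).degree)).mpr rfl (Fin.last r)
  have hU : (Finset.Iic (Fin.last r)) = Finset.univ := by
    ext b
    simp [Fin.le_last]
  rw [hU, h3] at hsum
  -- The sizes of the members of a chain are the partial sums of exactly one `λ`, so each chain is
  -- counted once.
  simp only [forall_eq_sum_Iic_iff hd]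
  rw [Finset.sum_eq_single (increments fun a => (ν a).degree), if_pos rfl, ← prod_F_eq hν,
    inQ_prod, ← Finset.prod_mul_distrib]
  rotate_left
  · intro lam _ hne
    rw [if_neg hne, inQ, map_zero, mul_zero]
  · intro hn
    exact absurd (Finset.mem_piAntidiag.mpr ⟨hsum.symm, fun _ _ => Finset.mem_univ _⟩) hn
  refine Finset.prod_congr rfl fun a _ => ?_
  rw [onlyLast_castSucc, tsub_zero, tsub_zero]
  rfl

theorem muOf_const {ι : Type} [Fintype ι] (r : ℕ) (ks : ι → ℕ) :
    muOf r (fun _ => r + 1) ks = onlyLast r (∑ p, column (ks p)) := by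
  funext a
  rw [muOf_eq fun _ => by omega]
  induction a using Fin.lastCases with
  | last => rw [onlyLast_last, Fin.val_last, Finset.filter_true_of_mem fun _ _ => le_rfl]
  | cast a =>
    rw [onlyLast_castSucc, Finset.filter_false_of_mem, Finset.sum_empty]
    intro _ _
    have := a.2
    rw [Fin.val_castSucc]
    omega

end Fermionic

/-! ### Linear forms applied to polynomials, and powers of ideals. -/

section Pushforward

variable {A : Type*} [CommRing A] [Algebra ℂ A]

/-- A linear form, applied to the coefficients of a polynomial. -/
def pushPoly (φ : A →ₗ[ℂ] ℂ) (P : Polynomial A) : Polynomial ℂ :=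
  ∑ j ∈ P.support, Polynomial.monomial j (φ (P.coeff j))

theorem coeff_pushPoly (φ : A →ₗ[ℂ] ℂ) (P : Polynomial A) (j : ℕ) :
    (pushPoly φ P).coeff j = φ (P.coeff j) := by
  rw [pushPoly, Polynomial.finsetSum_coeff]
  simp only [Polynomial.coeff_monomial]
  rw [Finset.sum_ite_eq']
  split_ifs with h
  · rfl
  · rw [Polynomial.notMem_support_iff.mp h, map_zero]

theorem pushPoly_map_mul (φ : A →ₗ[ℂ] ℂ) (Q : Polynomial ℂ) (P : Polynomial A) :
    pushPoly φ (Q.map (algebraMap ℂ A) * P) = Q * pushPoly φ P := by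
  ext j
  rw [coeff_pushPoly, Polynomial.coeff_mul, Polynomial.coeff_mul, map_sum]
  refine Finset.sum_congr rfl fun x _ => ?_
  rw [Polynomial.coeff_map, ← Algebra.smul_def, map_smul, coeff_pushPoly, smul_eq_mul]

/-- In the binomial expansion the terms with more than `k` factors from `J` vanish, and the others
contain at least `S - k` factors from `T`. -/
theorem pow_sup_le_pow {R : Type*} [CommRing R] {J T : Ideal R} {k : ℕ} (hJ : J ^ (k + 1) = ⊥)
    (S : ℕ) : (J ⊔ T) ^ S ≤ T ^ (S - k) := by
  rw [← Submodule.add_eq_sup, add_pow]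
  refine Finset.sum_induction _ (· ≤ T ^ (S - k)) (fun _ _ => sup_le) bot_le fun m _ => ?_
  have h0 : J ^ m * T ^ (S - m) * (S.choose m : Ideal R) ≤ J ^ m * T ^ (S - m) := Ideal.mul_le_left
  refine h0.trans ?_
  rcases le_or_gt m k with h | h
  · exact Ideal.mul_le_right.trans (Ideal.pow_le_pow_right (by omega))
  · have : J ^ m = ⊥ := by
      rw [eq_bot_iff, ← hJ]
      exact Ideal.pow_le_pow_right h
    rw [this, Ideal.bot_mul]
    exact bot_le

end Pushforward

/-! ### The tensor product as a source of solutions at distinct points. -/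

section Evaluation

variable {n : ℕ} {ι : Type} [Fintype ι]

variable (n) in
/-- The action of `x_a` on the factor `p`. -/
def factorGen (ns ks : ι → ℕ) (p : ι) (a : Gen n) : TensorMod n ns ks :=
  inFactor n ns ks p (Ideal.Quotient.mk (symIdeal n (ns p) (ks p)) (MvPolynomial.X a))

omit [Fintype ι] in
theorem factorGen_eq_zero {ns ks : ι → ℕ} {p : ι} {a : Gen n} (h : ns p ≤ a) :
    factorGen n ns ks p a = 0 := by
  rw [factorGen, Ideal.Quotient.eq_zero_iff_mem.mpr, map_zero]
  exact Ideal.subset_span (Or.inl ⟨a, h, rfl⟩)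

/-- A monomial of degree `k + 1` is either a generator or divisible by some `x_a` with `a ≥ m`. -/
theorem idealOfVars_pow_le (n m k : ℕ) :
    MvPolynomial.idealOfVars (Gen n) ℂ ^ (k + 1) ≤ symIdeal n m k := by
  rw [MvPolynomial.pow_idealOfVars_eq_span, Ideal.span_le]
  rintro _ ⟨ν, hν, rfl⟩
  by_cases h : ∀ a : Gen n, m ≤ (a : ℕ) → ν a = 0
  · exact Ideal.subset_span (Or.inr ⟨ν, h, hν, rfl⟩)
  · push Not at h
    obtain ⟨a, ha, h0⟩ := h
    have h1 : MvPolynomial.X a ∈ symIdeal n m k := Ideal.subset_span (Or.inl ⟨a, ha, rfl⟩)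
    have h2 : (MvPolynomial.X a : MvPolynomial (Gen n) ℂ) ∣ MvPolynomial.monomial ν 1 := by
      rw [MvPolynomial.X_dvd_monomial]
      exact Or.inr h0
    exact Ideal.mem_of_dvd _ h2 h1

/-- The points at which the color `a` is active. -/
def activeSet (ns : ι → ℕ) (a : ℕ) : Finset ι := Finset.univ.filter fun p => a < ns p

theorem mem_activeSet {ns : ι → ℕ} {a : ℕ} {p : ι} : p ∈ activeSet ns a ↔ a < ns p := by
  rw [activeSet, Finset.mem_filter]
  simp

open Classical in
/-- The product of the `z - ζ_p` over the other active points. -/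
def othersPoly (ns : ι → ℕ) (z : ι → ℂ) (a : ℕ) (p : ι) : Polynomial ℂ :=
  ∏ p' ∈ (activeSet ns a).erase p, (X - C (z p'))

theorem natDegree_othersPoly {ns : ι → ℕ} (z : ι → ℂ) {a : ℕ} {p : ι} (h : p ∈ activeSet ns a) :
    (othersPoly ns z a p).natDegree = numActive ns a - 1 := by
  classical
  rw [othersPoly, Polynomial.natDegree_prod_of_monic _ _ fun i _ => Polynomial.monic_X_sub_C _]
  simp only [Polynomial.natDegree_X_sub_C, Finset.sum_const, smul_eq_mul, mul_one]
  rw [show numActive ns a = (activeSet ns a).card from rfl, ← Finset.card_erase_of_mem h]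

variable (n) in
/-- The generating function `∑_p x_a^{(p)} ∏_{p' ≠ p} (z - ζ_{p'})`. -/
def factorCurrent (ns ks : ι → ℕ) (z : ι → ℂ) (a : Gen n) : Polynomial (TensorMod n ns ks) :=
  ∑ p ∈ activeSet ns a, (othersPoly ns z a p).map (algebraMap ℂ _) * C (factorGen n ns ks p a)

variable (n) in
/-- The map `R → V_1 ⊗ ⋯ ⊗ V_N` that takes `x_a(z)` to the generating function above. -/
def evalMap (ns ks : ι → ℕ) (z : ι → ℂ) : CurRing n ns →ₐ[ℂ] TensorMod n ns ks :=
  MvPolynomial.aeval fun v => ∑ p ∈ activeSet ns v.1,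
    (othersPoly ns z v.1 p).coeff (numActive ns v.1 - 1 - (v.2 : ℕ)) • factorGen n ns ks p v.1

theorem map_evalMap_current (ns ks : ι → ℕ) (z : ι → ℂ) (a : Gen n) :
    (current n ns a).map (evalMap n ns ks z).toRingHom = factorCurrent n ns ks z a := by
  ext j
  rw [Polynomial.coeff_map, current, Polynomial.finsetSum_coeff, map_sum, factorCurrent,
    Polynomial.finsetSum_coeff]
  simp only [Polynomial.coeff_monomial, Polynomial.coeff_mul_C, Polynomial.coeff_map,
    ← Algebra.smul_def]
  rcases lt_or_ge j (numActive ns a) with h | h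
  · rw [Finset.sum_eq_single ⟨numActive ns a - 1 - j, by omega⟩]
    · rw [if_pos (by simp; omega)]
      change evalMap n ns ks z (MvPolynomial.X _) = _
      rw [evalMap, MvPolynomial.aeval_X]
      refine Finset.sum_congr rfl fun p _ => ?_
      congr 2
      simp only
      omega
    · intro i _ hi
      rw [if_neg, map_zero]
      intro h'
      apply hi
      ext
      simp only
      omega
    · simp
  · rw [Finset.sum_eq_zero, Finset.sum_eq_zero]
    · intro p hp
      rw [Polynomial.coeff_eq_zero_of_natDegree_lt, zero_smul]
      rw [natDegree_othersPoly z hp]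
      have : 0 < numActive ns a := Finset.card_pos.mpr ⟨p, hp⟩
      omega
    · intro i _
      rw [if_neg (by omega), map_zero]

/-- Modulo `z - ζ_p` only the term with `x_a^{(p)}` survives in the current. These elements generate
an ideal whose power of exponent `k_p + 1` is zero, so a product of `S` currents active at `p` is
divisible by the power of exponent `S - k_p`. -/
theorem X_sub_C_pow_dvd_factorCurrent (ns ks : ι → ℕ) (z : ι → ℂ) (ν : Gen n → ℕ) (p : ι) :
    ((X - C (z p)) ^ posOrd ns (fun p => (ks p : ℤ)) ν p).map (algebraMap ℂ (TensorMod n ns ks)) ∣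
      ∏ a, factorCurrent n ns ks z a ^ ν a := by
  classical
  set J : Ideal (Polynomial (TensorMod n ns ks)) := Ideal.map
    (((Polynomial.C.comp (inFactor n ns ks p).toRingHom)).comp
      (Ideal.Quotient.mk (symIdeal n (ns p) (ks p)))) (MvPolynomial.idealOfVars (Gen n) ℂ) with hJ
  have hJk : J ^ (ks p + 1) = ⊥ := by
    rw [hJ, ← Ideal.map_pow, eq_bot_iff, Ideal.map_le_iff_le_comap]
    intro f hf
    have := Ideal.Quotient.eq_zero_iff_mem.mpr (idealOfVars_pow_le n (ns p) (ks p) hf)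
    rw [Ideal.mem_comap, Ideal.mem_bot, RingHom.comp_apply, this, map_zero]
  set T : Ideal (Polynomial (TensorMod n ns ks)) :=
    Ideal.span {(X - C (z p)).map (algebraMap ℂ (TensorMod n ns ks))} with hT
  have hmem : ∀ a : Gen n, (a : ℕ) < ns p → factorCurrent n ns ks z a ∈ J ⊔ T := by
    intro a ha
    refine Ideal.sum_mem _ fun p' _ => ?_
    by_cases hp : p' = p
    · subst hp
      refine Ideal.mul_mem_left _ _ (Ideal.mem_sup_left ?_)
      exact Ideal.mem_map_of_mem _ (Ideal.subset_span ⟨a, rfl⟩)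
    · refine Ideal.mul_mem_right _ _ (Ideal.mem_sup_right ?_)
      rw [hT, Ideal.mem_span_singleton]
      refine Polynomial.map_dvd _ ?_
      exact Finset.dvd_prod_of_mem (fun p' => X - C (z p'))
        (Finset.mem_erase.mpr ⟨Ne.symm hp, mem_activeSet.mpr ha⟩)
  rw [← Finset.prod_filter_mul_prod_filter_not Finset.univ fun a : Gen n => (a : ℕ) < ns p]
  refine Dvd.dvd.mul_right ?_ _
  have h1 : ∏ a ∈ Finset.univ.filter (fun a : Gen n => (a : ℕ) < ns p),
      factorCurrent n ns ks z a ^ ν a ∈ (J ⊔ T) ^ ∑ a ∈ Finset.univ.filter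
        (fun a : Gen n => (a : ℕ) < ns p), ν a := by
    rw [← Finset.prod_pow_eq_pow_sum]
    refine Ideal.prod_mem_prod fun a ha => Ideal.pow_mem_pow (hmem a ?_) _
    exact (Finset.mem_filter.mp ha).2
  have h2 := pow_sup_le_pow hJk _ h1
  rw [hT, Ideal.span_singleton_pow, Ideal.mem_span_singleton] at h2
  rw [Polynomial.map_pow]
  convert h2 using 2
  rw [posOrd]
  omega

theorem divisor_dvd_pushPoly (ns ks : ι → ℕ) {z : ι → ℂ} (hz : Function.Injective z)
    (ν : Gen n → ℕ) (φ : TensorMod n ns ks →ₗ[ℂ] ℂ) (g : TensorMod n ns ks) :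
    divisor ns z (fun p => (ks p : ℤ)) ν ∣
      pushPoly φ (C g * ∏ a, factorCurrent n ns ks z a ^ ν a) := by
  rw [divisor]
  refine Finset.prod_dvd_of_coprime (fun p _ p' _ h => ?_) fun p _ => ?_
  · exact (Polynomial.pairwise_coprime_X_sub_C hz h).pow
  · obtain ⟨Q, hQ⟩ := X_sub_C_pow_dvd_factorCurrent ns ks z ν p
    rw [hQ, mul_left_comm, pushPoly_map_mul]
    exact dvd_mul_right _ _

variable (n) in
/-- The values of a linear form at the images of the monomials. -/
def monoValues (ns ks : ι → ℕ) (z : ι → ℂ) (w : ℕ →₀ ℕ) :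
    Module.Dual ℂ (TensorMod n ns ks) →ₗ[ℂ] (Exps n ns w → ℂ) :=
  LinearMap.pi fun ε => LinearMap.applyₗ (evalMap n ns ks z (MvPolynomial.monomial ε.1 1))

theorem monoValues_apply (ns ks : ι → ℕ) (z : ι → ℂ) (w : ℕ →₀ ℕ)
    (φ : Module.Dual ℂ (TensorMod n ns ks)) (ε : Exps n ns w) :
    monoValues n ns ks z w φ ε = φ (evalMap n ns ks z (MvPolynomial.monomial ε.1 1)) := rfl

/-- A form on the homogeneous polynomials of weight `w` in terms of its values on monomials. -/
theorem sum_exps_mul_coeff {ns : ι → ℕ} {w : ℕ →₀ ℕ} (L : CurRing n ns →ₗ[ℂ] ℂ) {f : CurRing n ns}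
    (hf : ∀ ε ∈ f.support, wt ε = w) :
    ∑ ε : Exps n ns w, L (MvPolynomial.monomial ε.1 1) * f.coeff ε.1 = L f := by
  classical
  have h1 : L f = ∑ ε ∈ f.support, L (MvPolynomial.monomial ε 1) * f.coeff ε := by
    conv_lhs => rw [f.as_sum, map_sum]
    refine Finset.sum_congr rfl fun ε _ => ?_
    rw [show MvPolynomial.monomial ε (f.coeff ε) = f.coeff ε • MvPolynomial.monomial ε 1 by
      rw [MvPolynomial.smul_monomial, smul_eq_mul, mul_one], map_smul, smul_eq_mul, mul_comm]
  rw [h1]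
  refine (Eq.trans ?_ (Finset.sum_map Finset.univ (Function.Embedding.subtype fun ε => wt ε = w)
    fun ε => L (MvPolynomial.monomial ε 1) * f.coeff ε)).symm
  refine Finset.sum_subset (fun ε hε => ?_) fun ε _ hε => ?_
  · exact Finset.mem_map.mpr ⟨⟨ε, hf ε hε⟩, Finset.mem_univ _, rfl⟩
  · rw [MvPolynomial.notMem_support_iff.mp hε, mul_zero]

end Evaluation

/-! ### The filtration and the passage from `x_a[i]` in `R` to the current algebra. -/

section Filtration

variable {n : ℕ} {ι : Type} [Fintype ι]

theorem wt_eq_of_coeff_ne_zero {ns : ι → ℕ} {ν : Gen n → ℕ} {P ε : CurVar n ns →₀ ℕ} {j : ℕ}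
    (h : (MvPolynomial.monomial P 1 * (∏ a, current n ns a ^ ν a).coeff j).coeff ε ≠ 0) :
    wt ε = wt P + wtOf ν := by
  have h1 := curCoeff_coeff_eq ν P (⟨ε, rfl⟩ : Exps n ns (wt ε)) j
  rw [← h1] at h
  exact (isBihom_curCoeff (ns := ns) (ν, P) ε j h).1

theorem evalMap_monomial_mul_coeff (ns ks : ι → ℕ) (z : ι → ℂ) (ν : Gen n → ℕ)
    (P : CurVar n ns →₀ ℕ) (j : ℕ) :
    evalMap n ns ks z (MvPolynomial.monomial P 1 * (∏ a, current n ns a ^ ν a).coeff j)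
      = (C (evalMap n ns ks z (MvPolynomial.monomial P 1)) *
        ∏ a, factorCurrent n ns ks z a ^ ν a).coeff j := by
  rw [map_mul, Polynomial.coeff_C_mul]
  congr 1
  change (evalMap n ns ks z).toRingHom _ = _
  rw [← Polynomial.coeff_map, Polynomial.map_prod]
  simp only [Polynomial.map_pow, map_evalMap_current]

/-- The conditions become values of `φ` on the coefficients of products of the currents, and those
products are divisible by powers of the coprime polynomials `z - ζ_p`. -/
theorem monoValues_mem_sol (ns ks : ι → ℕ) {z : ι → ℂ} (hz : Function.Injective z) (w : ℕ →₀ ℕ)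
    (φ : Module.Dual ℂ (TensorMod n ns ks)) :
    monoValues n ns ks z w φ ∈
      sol (curCoeff n ns w) fun x => divisor ns z (fun p => (ks p : ℤ)) x.1 := by
  rw [mem_sol, Prod.forall]
  intro ν P
  have key : ∀ j, (∑ ε, monoValues n ns ks z w φ ε • curCoeff n ns w (ν, P) ε).coeff j
      = ∑ ε : Exps n ns w, (φ.comp (evalMap n ns ks z).toLinearMap) (MvPolynomial.monomial ε.1 1) *
        (MvPolynomial.monomial P 1 * (∏ a, current n ns a ^ ν a).coeff j).coeff ε.1 := by
    intro j
    rw [Polynomial.finsetSum_coeff]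
    refine Finset.sum_congr rfl fun ε _ => ?_
    rw [Polynomial.coeff_smul, curCoeff_coeff_eq, smul_eq_mul]
    rfl
  by_cases hw : wt P + wtOf ν = w
  · have : (∑ ε, monoValues n ns ks z w φ ε • curCoeff n ns w (ν, P) ε)
        = pushPoly φ (C (evalMap n ns ks z (MvPolynomial.monomial P 1)) *
          ∏ a, factorCurrent n ns ks z a ^ ν a) := by
      ext j
      rw [key, sum_exps_mul_coeff, coeff_pushPoly, ← evalMap_monomial_mul_coeff]
      · rfl
      · intro ε hε
        rw [← hw]
        exact wt_eq_of_coeff_ne_zero (MvPolynomial.mem_support_iff.mp hε)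
    rw [this]
    exact divisor_dvd_pushPoly ns ks hz ν φ _
  · have : (∑ ε, monoValues n ns ks z w φ ε • curCoeff n ns w (ν, P) ε) = 0 := by
      ext j
      rw [key, Polynomial.coeff_zero]
      refine Finset.sum_eq_zero fun ε _ => ?_
      by_contra h
      refine hw ?_
      rw [← wt_eq_of_coeff_ne_zero (right_ne_zero_of_mul h)]
      exact ε.2
    rw [this]
    exact dvd_zero _

/-- The degree of a monomial in `U(𝔞[t])`. -/
def curDeg (m : Gen n × ℕ →₀ ℕ) : ℕ := Finsupp.weight (fun x : Gen n × ℕ => x.2) m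

theorem curDeg_add (m m' : Gen n × ℕ →₀ ℕ) : curDeg (m + m') = curDeg m + curDeg m' := map_add _ _ _

theorem curDeg_single (x : Gen n × ℕ) (k : ℕ) : curDeg (Finsupp.single x k) = k * x.2 := by
  rw [curDeg, Finsupp.weight_single, smul_eq_mul]

theorem evalAct_monomial_mem {ns ks : ι → ℕ} {z : ι → ℂ} {m : Gen n × ℕ →₀ ℕ} {d : ℕ}
    (h : curDeg m < d) : evalAct n ns ks z (MvPolynomial.monomial m 1) ∈ filtLT n ns ks z d := by
  rw [filtLT]
  refine Submodule.mem_iSup_of_mem ⟨curDeg m, h⟩ ?_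
  exact Submodule.mem_map_of_mem (MvPolynomial.isWeightedHomogeneous_monomial _ _ _ rfl)

theorem evalAct_mem_of_monomials {ns ks : ι → ℕ} {z : ι → ℂ} {f : CurAlg n}
    {S : Submodule ℂ (TensorMod n ns ks)}
    (h : ∀ m ∈ f.support, evalAct n ns ks z (MvPolynomial.monomial m 1) ∈ S) :
    evalAct n ns ks z f ∈ S := by
  rw [f.as_sum, map_sum]
  refine Submodule.sum_mem _ fun m hm => ?_
  rw [show MvPolynomial.monomial m (f.coeff m) = f.coeff m • MvPolynomial.monomial m 1 by
    rw [MvPolynomial.smul_monomial, smul_eq_mul, mul_one], map_smul]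
  exact Submodule.smul_mem _ _ (h m hm)

theorem filtLT_le {ns ks : ι → ℕ} {z : ι → ℂ} {d : ℕ} {S : Submodule ℂ (TensorMod n ns ks)}
    (h : ∀ m, curDeg m < d → evalAct n ns ks z (MvPolynomial.monomial m 1) ∈ S) :
    filtLT n ns ks z d ≤ S := by
  rw [filtLT, iSup_le_iff]
  rintro i _ ⟨f, hf, rfl⟩
  refine evalAct_mem_of_monomials fun m hm => h m ?_
  have := hf (MvPolynomial.mem_support_iff.mp hm)
  rw [curDeg, this]
  exact i.2

theorem filtLT_mono {ns ks : ι → ℕ} {z : ι → ℂ} {d d' : ℕ} (h : d ≤ d') :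
    filtLT n ns ks z d ≤ filtLT n ns ks z d' :=
  filtLT_le fun _ hm => evalAct_monomial_mem (hm.trans_le h)

/-- Both indices are strict bounds: degrees at most `d - 1` and `d' - 1` add up to less than `D`
when `d + d' ≤ D + 1`. -/
theorem mul_mem_filtLT {ns ks : ι → ℕ} {z : ι → ℂ} {d d' D : ℕ} (hD : d + d' ≤ D + 1)
    {u v : TensorMod n ns ks}
    (hu : u ∈ filtLT n ns ks z d) (hv : v ∈ filtLT n ns ks z d') : u * v ∈ filtLT n ns ks z D := by
  have h1 : filtLT n ns ks z d ≤ (filtLT n ns ks z D).comap (LinearMap.mulRight ℂ v) := by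
    refine filtLT_le fun m hm => ?_
    rw [Submodule.mem_comap, LinearMap.mulRight_apply]
    have h2 : filtLT n ns ks z d' ≤ (filtLT n ns ks z D).comap
        (LinearMap.mulLeft ℂ (evalAct n ns ks z (MvPolynomial.monomial m 1))) := by
      refine filtLT_le fun m' hm' => ?_
      rw [Submodule.mem_comap, LinearMap.mulLeft_apply, ← map_mul, MvPolynomial.monomial_mul,
        one_mul]
      refine evalAct_monomial_mem ?_
      rw [curDeg_add]
      omega
    exact h2 hv
  exact h1 hu

/-- The monic polynomial whose roots are the active points. -/
def activePoly (ns : ι → ℕ) (z : ι → ℂ) (a : ℕ) : Polynomial ℂ :=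
  ∏ p ∈ activeSet ns a, (X - C (z p))

theorem activePoly_monic (ns : ι → ℕ) (z : ι → ℂ) (a : ℕ) : (activePoly ns z a).Monic :=
  Polynomial.monic_prod_of_monic _ _ fun _ _ => Polynomial.monic_X_sub_C _

theorem natDegree_activePoly (ns : ι → ℕ) (z : ι → ℂ) (a : ℕ) :
    (activePoly ns z a).natDegree = numActive ns a := by
  rw [activePoly, Polynomial.natDegree_prod_of_monic _ _ fun i _ => Polynomial.monic_X_sub_C _]
  simp only [Polynomial.natDegree_X_sub_C, Finset.sum_const, smul_eq_mul, mul_one]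
  rfl

theorem coeff_activePoly (ns : ι → ℕ) (z : ι → ℂ) (a : ℕ) :
    (activePoly ns z a).coeff (numActive ns a) = 1 := by
  rw [← natDegree_activePoly ns z a]
  exact activePoly_monic ns z a

/-- Synthetic division of `activePoly` by `z - ζ_p`. -/
theorem coeff_othersPoly (ns : ι → ℕ) (z : ι → ℂ) {a : ℕ} {p : ι} (hp : p ∈ activeSet ns a) (m : ℕ) :
    (othersPoly ns z a p).coeff m = ∑ j ∈ Finset.Icc (m + 1) (numActive ns a),
      z p ^ (j - (m + 1)) * (activePoly ns z a).coeff j := by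
  classical
  have h1 : (X - C (z p)) * othersPoly ns z a p = activePoly ns z a :=
    Finset.mul_prod_erase _ _ hp
  have h2 : activePoly ns z a /ₘ (X - C (z p)) = othersPoly ns z a p := by
    rw [← h1]
    exact Polynomial.mul_divByMonic_cancel_left _ (Polynomial.monic_X_sub_C _)
  rw [← h2, Polynomial.coeff_divByMonic_X_sub_C, natDegree_activePoly]

theorem evalAct_X (ns ks : ι → ℕ) (z : ι → ℂ) (a : Gen n) (i : ℕ) :
    evalAct n ns ks z (MvPolynomial.X (a, i))
      = ∑ p ∈ activeSet ns a, z p ^ i • factorGen n ns ks p a := by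
  rw [evalAct, MvPolynomial.aeval_X]
  symm
  refine Finset.sum_subset (Finset.subset_univ _) fun p _ hp => ?_
  rw [factorGen_eq_zero, smul_zero]
  rw [mem_activeSet] at hp
  omega

theorem evalAct_X_mem {ns ks : ι → ℕ} {z : ι → ℂ} {a : Gen n} {i d : ℕ} (h : i < d) :
    evalAct n ns ks z (MvPolynomial.X (a, i)) ∈ filtLT n ns ks z d := by
  refine evalAct_monomial_mem ?_
  rw [curDeg_single]
  omega

theorem evalMap_X (ns ks : ι → ℕ) (z : ι → ℂ) (v : CurVar n ns) :
    evalMap n ns ks z (MvPolynomial.X v)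
      = ∑ j ∈ Finset.Icc (numActive ns v.1 - v.2) (numActive ns v.1),
        (activePoly ns z v.1).coeff j •
          evalAct n ns ks z (MvPolynomial.X (v.1, j - (numActive ns v.1 - v.2))) := by
  simp only [evalAct_X, Finset.smul_sum]
  rw [Finset.sum_comm, evalMap, MvPolynomial.aeval_X]
  refine Finset.sum_congr rfl fun p hp => ?_
  have h : numActive ns v.1 - 1 - (v.2 : ℕ) + 1 = numActive ns v.1 - v.2 := by
    have := v.2.2
    omega
  rw [coeff_othersPoly ns z hp, h, Finset.sum_smul]
  exact Finset.sum_congr rfl fun j _ => by rw [smul_smul, mul_comm]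

/-- The two families of generators differ by a unitriangular change: `activePoly` is monic, so the
top term of `evalMap_X` is the action of `x_a[i]`, and the other terms have smaller degree. -/
theorem evalMap_X_sub_mem (ns ks : ι → ℕ) (z : ι → ℂ) (v : CurVar n ns) :
    evalMap n ns ks z (MvPolynomial.X v) - evalAct n ns ks z (MvPolynomial.X (v.1, (v.2 : ℕ)))
      ∈ filtLT n ns ks z v.2 := by
  have hv := v.2.2
  rw [evalMap_X, ← Finset.Ico_insert_right (by omega), Finset.sum_insert (by simp),
    coeff_activePoly, one_smul, show numActive ns v.1 - (numActive ns v.1 - (v.2 : ℕ)) = v.2 by omega,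
    add_sub_cancel_left]
  refine Submodule.sum_mem _ fun j hj => Submodule.smul_mem _ _ (evalAct_X_mem ?_)
  rw [Finset.mem_Ico] at hj
  omega

/-- All active `ζ_p` are roots of the monic polynomial `activePoly` of degree `N_a`, which expresses
the `i`-th powers of the points by lower ones. -/
theorem evalAct_X_mem_of_le {ns ks : ι → ℕ} {z : ι → ℂ} {a : Gen n} {i : ℕ}
    (h : numActive ns a ≤ i) :
    evalAct n ns ks z (MvPolynomial.X (a, i)) ∈ filtLT n ns ks z i := by
  have h1 : ∑ j ∈ Finset.range (numActive ns a + 1), (activePoly ns z a).coeff j •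
      evalAct n ns ks z (MvPolynomial.X (a, j + (i - numActive ns a))) = 0 := by
    simp only [evalAct_X, Finset.smul_sum]
    rw [Finset.sum_comm]
    refine Finset.sum_eq_zero fun p hp => ?_
    have h2 : (activePoly ns z a).eval (z p) = 0 := by
      rw [activePoly, Polynomial.eval_prod]
      exact Finset.prod_eq_zero hp (by simp)
    rw [Polynomial.eval_eq_sum_range, natDegree_activePoly] at h2
    simp only [smul_smul, ← Finset.sum_smul, pow_add, ← mul_assoc, ← Finset.sum_mul]
    rw [h2, zero_mul, zero_smul]
  rw [Finset.sum_range_succ, coeff_activePoly, one_smul, Nat.add_sub_cancel' h] at h1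
  rw [eq_neg_of_add_eq_zero_right h1]
  refine Submodule.neg_mem _ (Submodule.sum_mem _ fun j hj => Submodule.smul_mem _ _ (evalAct_X_mem ?_))
  rw [Finset.mem_range] at hj
  omega

/-- The inclusion of the variables `x_a[i]`, `i < N_a`. -/
def curIncl (ns : ι → ℕ) (v : CurVar n ns) : Gen n × ℕ := (v.1, (v.2 : ℕ))

theorem curIncl_injective (ns : ι → ℕ) : Function.Injective (curIncl (n := n) ns) := by
  rintro ⟨a, i⟩ ⟨b, j⟩ h
  obtain ⟨h1, h2⟩ := Prod.mk.inj h
  simp only at h1 h2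
  subst h1
  rw [Fin.ext h2]

theorem curDeg_mapDomain {ns : ι → ℕ} (ε : CurVar n ns →₀ ℕ) :
    curDeg (ε.mapDomain (curIncl ns)) = dg ε := by
  induction ε using Finsupp.induction_linear with
  | zero =>
    rw [Finsupp.mapDomain_zero, dg_zero]
    exact map_zero _
  | add f g hf hg => rw [Finsupp.mapDomain_add, curDeg_add, dg_add, hf, hg]
  | single v m =>
    rw [Finsupp.mapDomain_single, curDeg_single, dg_single]
    rfl

theorem evalMap_monomial_sub_mem (ns ks : ι → ℕ) (z : ι → ℂ) (ε : CurVar n ns →₀ ℕ) :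
    evalMap n ns ks z (MvPolynomial.monomial ε 1) -
      evalAct n ns ks z (MvPolynomial.monomial (ε.mapDomain (curIncl ns)) 1)
      ∈ filtLT n ns ks z (dg ε) := by
  have hadd : ∀ f g : CurVar n ns →₀ ℕ, evalMap n ns ks z (MvPolynomial.monomial f 1) -
      evalAct n ns ks z (MvPolynomial.monomial (f.mapDomain (curIncl ns)) 1)
      ∈ filtLT n ns ks z (dg f) → evalMap n ns ks z (MvPolynomial.monomial g 1) -
      evalAct n ns ks z (MvPolynomial.monomial (g.mapDomain (curIncl ns)) 1)
      ∈ filtLT n ns ks z (dg g) → evalMap n ns ks z (MvPolynomial.monomial (f + g) 1) -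
      evalAct n ns ks z (MvPolynomial.monomial ((f + g).mapDomain (curIncl ns)) 1)
      ∈ filtLT n ns ks z (dg (f + g)) := by
    intro f g hf hg
    have e1 : (MvPolynomial.monomial (f + g) (1 : ℂ)) = MvPolynomial.monomial f 1 *
        MvPolynomial.monomial g 1 := by rw [MvPolynomial.monomial_mul, one_mul]
    have e2 : (MvPolynomial.monomial ((f + g).mapDomain (curIncl ns)) (1 : ℂ))
        = MvPolynomial.monomial (f.mapDomain (curIncl ns)) 1 *
          MvPolynomial.monomial (g.mapDomain (curIncl ns)) 1 := by
      rw [Finsupp.mapDomain_add, MvPolynomial.monomial_mul, one_mul]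
    rw [e1, e2, map_mul, map_mul, dg_add]
    have hf' : evalAct n ns ks z (MvPolynomial.monomial (f.mapDomain (curIncl ns)) 1)
        ∈ filtLT n ns ks z (dg f + 1) := evalAct_monomial_mem (by rw [curDeg_mapDomain]; omega)
    have hg' : evalMap n ns ks z (MvPolynomial.monomial g 1) ∈ filtLT n ns ks z (dg g + 1) := by
      have h1 : evalAct n ns ks z (MvPolynomial.monomial (g.mapDomain (curIncl ns)) 1)
        ∈ filtLT n ns ks z (dg g + 1) := evalAct_monomial_mem (by rw [curDeg_mapDomain]; omega)
      have h2 := Submodule.add_mem _ (filtLT_mono (Nat.le_succ _) hg) h1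
      rwa [sub_add_cancel] at h2
    -- Write `u v - u' v' = (u - u') v + u' (v - v')`; each product lies in degree below `dg f + dg
    -- g`.
    have h3 := Submodule.add_mem _ (mul_mem_filtLT (D := dg f + dg g) (by omega) hf hg')
      (mul_mem_filtLT (D := dg f + dg g) (by omega) hf' hg)
    convert h3 using 1
    ring
  have h0 : evalMap n ns ks z (MvPolynomial.monomial (0 : CurVar n ns →₀ ℕ) 1) -
      evalAct n ns ks z (MvPolynomial.monomial ((0 : CurVar n ns →₀ ℕ).mapDomain (curIncl ns)) 1)
      ∈ filtLT n ns ks z (dg (0 : CurVar n ns →₀ ℕ)) := by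
    have e1 : evalMap n ns ks z (MvPolynomial.monomial (0 : CurVar n ns →₀ ℕ) 1) = 1 := map_one _
    have e2 : evalAct n ns ks z (MvPolynomial.monomial (0 : Gen n × ℕ →₀ ℕ) 1) = 1 := map_one _
    rw [Finsupp.mapDomain_zero, e1, e2, sub_self]
    exact Submodule.zero_mem _
  induction ε using Finsupp.induction_linear with
  | zero => exact h0
  | add f g hf hg => exact hadd f g hf hg
  | single v m =>
    induction m with
    | zero =>
      rw [Finsupp.single_zero]
      exact h0
    | succ m ih =>
      rw [Finsupp.single_add]
      refine hadd _ _ ih ?_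
      rw [Finsupp.mapDomain_single, dg_single, one_mul]
      exact evalMap_X_sub_mem ns ks z v

/-- In the associated graded space the variables `x_a[i]` with `i ≥ N_a` act by zero, so only the
variables of `R` matter. -/
theorem exists_mapDomain_or_mem (ns ks : ι → ℕ) (z : ι → ℂ) (m : Gen n × ℕ →₀ ℕ) :
    (∃ ε : CurVar n ns →₀ ℕ, ε.mapDomain (curIncl ns) = m) ∨
      evalAct n ns ks z (MvPolynomial.monomial m 1) ∈ filtLT n ns ks z (curDeg m) := by
  by_cases h : ∀ x ∈ m.support, x.2 < numActive ns x.1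
  · refine Or.inl ⟨_, Finsupp.mapDomain_comapDomain _ (curIncl_injective ns) m ?_⟩
    intro x hx
    exact ⟨⟨x.1, ⟨x.2, h x hx⟩⟩, rfl⟩
  · push Not at h
    obtain ⟨x, hx, hle⟩ := h
    right
    have hm : m - Finsupp.single x 1 + Finsupp.single x 1 = m := by
      refine tsub_add_cancel_of_le (Finsupp.single_le_iff.mpr ?_)
      exact Nat.one_le_iff_ne_zero.mpr (Finsupp.mem_support_iff.mp hx)
    have e1 : (MvPolynomial.monomial m (1 : ℂ)) = MvPolynomial.monomial (m - Finsupp.single x 1) 1 *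
        MvPolynomial.X x := by
      rw [MvPolynomial.X, MvPolynomial.monomial_mul, one_mul, hm]
    rw [e1, map_mul, ← hm, curDeg_add, curDeg_single, hm, one_mul]
    refine mul_mem_filtLT (d := curDeg (m - Finsupp.single x 1) + 1) (d' := x.2) (by omega)
      (evalAct_monomial_mem (by omega)) ?_
    exact evalAct_X_mem_of_le hle

end Filtration

/-! ### Finite dimension and cyclicity of the tensor product. -/

section Finiteness

variable {n : ℕ} {ι : Type} [Fintype ι]

instance (n m k : ℕ) : Algebra.IsIntegral ℂ (SymMod n m k) where
  isIntegral x := by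
    obtain ⟨f, rfl⟩ := Ideal.Quotient.mk_surjective x
    induction f using MvPolynomial.induction_on with
    | C c => exact isIntegral_algebraMap (R := ℂ) (A := SymMod n m k) (x := c)
    | add f g hf hg =>
      rw [map_add]
      exact hf.add hg
    | mul_X f a hf =>
      rw [map_mul]
      refine hf.mul (IsIntegral.of_pow (n := k + 1) (by omega) ?_)
      rw [← map_pow, Ideal.Quotient.eq_zero_iff_mem.mpr]
      · exact isIntegral_zero
      · exact idealOfVars_pow_le n m k (Ideal.pow_mem_pow (I := MvPolynomial.idealOfVars (Gen n) ℂ)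
          (Ideal.subset_span (Set.mem_range_self a)) _)

instance (n m k : ℕ) : Module.Finite ℂ (SymMod n m k) := Algebra.IsIntegral.finite

instance (n : ℕ) (ns ks : ι → ℕ) : Module.Finite ℂ (TensorMod n ns ks) :=
  inferInstanceAs (Module.Finite ℂ (⨂[ℂ] p, SymMod n (ns p) (ks p)))

theorem othersPoly_eval_ne_zero (ns : ι → ℕ) {z : ι → ℂ} (hz : Function.Injective z) (a : ℕ) (p : ι) :
    (othersPoly ns z a p).eval (z p) ≠ 0 := by
  classical
  rw [othersPoly, Polynomial.eval_prod]
  refine Finset.prod_ne_zero_iff.mpr fun i hi => ?_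
  rw [Polynomial.eval_sub, Polynomial.eval_X, Polynomial.eval_C]
  exact sub_ne_zero.mpr fun h => Finset.ne_of_mem_erase hi (hz h).symm

theorem othersPoly_eval_eq_zero {ns : ι → ℕ} (z : ι → ℂ) {a : ℕ} {p q : ι} (hq : q ∈ activeSet ns a)
    (h : q ≠ p) : (othersPoly ns z a p).eval (z q) = 0 := by
  classical
  rw [othersPoly, Polynomial.eval_prod]
  exact Finset.prod_eq_zero (Finset.mem_erase.mpr ⟨h, hq⟩) (by simp)

/-- Interpolation: combining the `x_a[j]` with the coefficients of a polynomial that vanishes at the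
other active points isolates the action on the factor `p`. -/
theorem factorGen_mem_range (ns ks : ι → ℕ) {z : ι → ℂ} (hz : Function.Injective z) (p : ι)
    (a : Gen n) : factorGen n ns ks p a ∈ (evalAct n ns ks z).range := by
  rcases lt_or_ge (a : ℕ) (ns p) with h | h
  · have h1 : ∑ j ∈ Finset.range ((othersPoly ns z a p).natDegree + 1),
        (othersPoly ns z a p).coeff j • evalAct n ns ks z (MvPolynomial.X (a, j))
        = (othersPoly ns z a p).eval (z p) • factorGen n ns ks p a := by
      simp only [evalAct_X, Finset.smul_sum]
      rw [Finset.sum_comm]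
      simp only [smul_smul, ← Finset.sum_smul, ← Polynomial.eval_eq_sum_range]
      refine Finset.sum_eq_single_of_mem p (mem_activeSet.mpr h) fun q hq hne => ?_
      rw [othersPoly_eval_eq_zero z hq hne, zero_smul]
    have h2 : (othersPoly ns z a p).eval (z p) • factorGen n ns ks p a
        ∈ (evalAct n ns ks z).range := by
      rw [← h1]
      exact Subalgebra.sum_mem _ fun j _ => Subalgebra.smul_mem _ (AlgHom.mem_range_self _ _) _
    have h3 := Subalgebra.smul_mem _ h2 ((othersPoly ns z a p).eval (z p))⁻¹
    rwa [inv_smul_smul₀ (othersPoly_eval_ne_zero ns hz a p)] at h3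
  · rw [factorGen_eq_zero h]
    exact Subalgebra.zero_mem _

theorem evalAct_surjective (ns ks : ι → ℕ) {z : ι → ℂ} (hz : Function.Injective z) :
    Function.Surjective (evalAct n ns ks z) := by
  classical
  have h1 : ∀ p (s : SymMod n (ns p) (ks p)), inFactor n ns ks p s ∈ (evalAct n ns ks z).range := by
    intro p s
    obtain ⟨f, rfl⟩ := Ideal.Quotient.mk_surjective s
    induction f using MvPolynomial.induction_on with
    | C c =>
      change inFactor n ns ks p (algebraMap ℂ _ c) ∈ _
      rw [AlgHom.commutes]
      exact Subalgebra.algebraMap_mem _ c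
    | add f g hf hg =>
      rw [map_add, map_add]
      exact Subalgebra.add_mem _ hf hg
    | mul_X f a hf =>
      rw [map_mul, map_mul]
      exact Subalgebra.mul_mem _ hf (factorGen_mem_range ns ks hz p a)
  rw [← AlgHom.range_eq_top, eq_top_iff]
  intro x _
  refine PiTensorProduct.induction_on (motive := fun t : ⨂[ℂ] p, SymMod n (ns p) (ks p) =>
    (show TensorMod n ns ks from t) ∈ (evalAct n ns ks z).range) x (fun c f => ?_)
    fun x y hx hy => Subalgebra.add_mem _ hx hy
  have h4 : (PiTensorProduct.tprod ℂ f : ⨂[ℂ] p, SymMod n (ns p) (ks p))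
      = ∏ p, inFactor n ns ks p (f p) := by
    have h5 : PiTensorProduct.tprodMonoidHom ℂ f
        = ∏ p, PiTensorProduct.tprodMonoidHom (A := fun p => SymMod n (ns p) (ks p)) ℂ
          (Pi.mulSingle p (f p) : (p : ι) → SymMod n (ns p) (ks p)) := by
      rw [← map_prod, Finset.univ_prod_mulSingle]
    exact h5
  refine Subalgebra.smul_mem (evalAct n ns ks z).range (x := ?_) ?_ c
  rw [h4]
  exact Subalgebra.prod_mem _ fun p _ => h1 p (f p)

end Finiteness

/-! ### The upper bound for the fusion components. -/

section Bounds

variable {n : ℕ} {ι : Type} [Fintype ι]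

theorem weight_bideg_apply_zero (m : Gen n × ℕ →₀ ℕ) :
    Finsupp.weight (fun x : Gen n × ℕ => bideg (x.1 : ℕ) x.2) m 0 = curDeg m := by
  induction m using Finsupp.induction_linear with
  | zero => simp [curDeg]
  | add f g hf hg => rw [map_add, Finsupp.add_apply, hf, hg, curDeg_add]
  | single x k =>
    have h : (x.1 : ℕ) ≠ 0 := by
      have := Finset.mem_Ico.mp x.1.2
      omega
    rw [Finsupp.weight_single, curDeg_single, bideg]
    simp [h]

theorem weight_bideg_mapDomain {ns : ι → ℕ} (ε : CurVar n ns →₀ ℕ) :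
    Finsupp.weight (fun x : Gen n × ℕ => bideg (x.1 : ℕ) x.2) (ε.mapDomain (curIncl ns))
      = Finsupp.weight (fun x : CurVar n ns => bideg (x.1 : ℕ) (x.2 : ℕ)) ε := by
  induction ε using Finsupp.induction_linear with
  | zero => simp
  | add f g hf hg => rw [Finsupp.mapDomain_add, map_add, map_add, hf, hg]
  | single v m =>
    rw [Finsupp.mapDomain_single, Finsupp.weight_single, Finsupp.weight_single]
    rfl

/-- A form on the quotient by `F^{<d}` gives a solution at distinct points that vanishes below
degree `d`, so its component of degree `d` is a degenerate solution. This component determines the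
form on the fusion component, which is spanned by the classes of monomials in the `x_a[i]` with `i <
N_a`. -/
theorem finrank_fusionComponent_le (ns ks : ι → ℕ) {z : ι → ℂ} (hz : Function.Injective z)
    (e : ℕ →₀ ℕ) : Module.finrank ℂ (fusionComponent n ns ks z e)
      ≤ gradedDim n ns (fun p => (ks p : ℤ)) (e.erase 0) (e 0) := by
  set N := filtLT n ns ks z (e 0) with hN
  let T : Module.Dual ℂ (TensorMod n ns ks ⧸ N) →ₗ[ℂ] (Exps n ns (e.erase 0) → ℂ) :=
    (component (fun ε => dg ε.1) (e 0)).comp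
      ((monoValues n ns ks z (e.erase 0)).comp N.mkQ.dualMap)
  let R : Module.Dual ℂ (TensorMod n ns ks ⧸ N) →ₗ[ℂ]
    Module.Dual ℂ (fusionComponent n ns ks z e) := (fusionComponent n ns ks z e).dualRestrict
  have hmk : ∀ (ε : CurVar n ns →₀ ℕ), dg ε ≤ e 0 →
      N.mkQ (evalMap n ns ks z (MvPolynomial.monomial ε 1))
        = N.mkQ (evalAct n ns ks z (MvPolynomial.monomial (ε.mapDomain (curIncl ns)) 1)) := by
    intro ε hε
    rw [← sub_eq_zero, ← map_sub, Submodule.mkQ_apply, Submodule.Quotient.mk_eq_zero]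
    exact filtLT_mono hε (evalMap_monomial_sub_mem ns ks z ε)
  have hker : LinearMap.ker T ≤ LinearMap.ker R := by
    intro φ hφ
    rw [LinearMap.mem_ker] at hφ ⊢
    have h1 : fusionComponent n ns ks z e ≤ LinearMap.ker φ := by
      rw [fusionComponent, Submodule.map_le_iff_le_comap]
      rintro _ ⟨f, hf, rfl⟩
      refine evalAct_mem_of_monomials fun m hm => ?_
      have hw := hf (MvPolynomial.mem_support_iff.mp hm)
      have hd : curDeg m = e 0 := by rw [← weight_bideg_apply_zero, hw]
      rw [Submodule.mem_comap, LinearMap.mem_ker]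
      rcases exists_mapDomain_or_mem ns ks z m with ⟨ε, rfl⟩ | hmem
      · rw [weight_bideg_mapDomain, weight_bideg_eq_iff] at hw
        change φ (N.mkQ _) = 0
        rw [← hmk ε hw.2.le]
        have h2 := congr_fun hφ ⟨ε, hw.1⟩
        have h3 : T φ ⟨ε, hw.1⟩ = if dg ε = e 0 then
          φ (N.mkQ (evalMap n ns ks z (MvPolynomial.monomial ε 1))) else 0 := rfl
        rw [h3, if_pos hw.2] at h2
        exact h2
      · rw [hd] at hmem
        rw [Submodule.mkQ_apply, (Submodule.Quotient.mk_eq_zero _).mpr hmem, map_zero]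
    ext u
    exact h1 u.2
  have hrange : LinearMap.range T ≤ homog (fun ε : Exps n ns (e.erase 0) => dg ε.1) (e 0) ⊓
      sol (curCoeff n ns (e.erase 0)) fun x => X ^ ∑ p, posOrd ns (fun p => (ks p : ℤ)) x.1 p := by
    rintro _ ⟨φ, rfl⟩
    refine ⟨component_mem_homog _ _ _, ?_⟩
    have h1 := component_mem_sol (deg := fun ε : Exps n ns (e.erase 0) => dg ε.1) (d := e 0)
      curCoeff_coeff (monoValues_mem_sol ns ks hz (e.erase 0) (φ.comp N.mkQ)) (fun ε hε => by
        rw [monoValues_apply, LinearMap.comp_apply, hmk ε.1 hε.le, Submodule.mkQ_apply,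
          (Submodule.Quotient.mk_eq_zero _).mpr, map_zero]
        exact evalAct_monomial_mem (by rw [curDeg_mapDomain]; exact hε))
    have h2 : (fun x : (Gen n → ℕ) × (CurVar n ns →₀ ℕ) =>
        (X : Polynomial ℂ) ^ (divisor ns z (fun p => (ks p : ℤ)) x.1).natDegree)
        = fun x => X ^ ∑ p, posOrd ns (fun p => (ks p : ℤ)) x.1 p := by
      funext x
      rw [natDegree_divisor]
    rw [h2] at h1
    exact h1
  have h1 := T.finrank_range_add_finrank_ker
  have h2 := R.finrank_range_add_finrank_ker
  have h3 := Submodule.finrank_mono hker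
  have h4 := Submodule.finrank_mono hrange
  have h5 : LinearMap.range R = ⊤ := LinearMap.range_eq_top.mpr
    (Subspace.dualRestrict_surjective (W := fusionComponent n ns ks z e))
  rw [h5, finrank_top, Subspace.dual_finrank_eq] at h2
  rw [gradedDim]
  omega

variable (n) in
/-- The image in `A / F^{< d}` of the elements of bidegree `e`. -/
def fusionPiece (ns ks : ι → ℕ) (z : ι → ℂ) (d : ℕ) (e : ℕ →₀ ℕ) :
    Submodule ℂ (TensorMod n ns ks ⧸ filtLT n ns ks z d) :=
  ((MvPolynomial.weightedHomogeneousSubmodule ℂ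
    (fun x : Gen n × ℕ => bideg (x.1 : ℕ) x.2) e).map (evalAct n ns ks z).toLinearMap).map
    (filtLT n ns ks z d).mkQ

theorem finrank_fusionPiece (ns ks : ι → ℕ) (z : ι → ℂ) {d : ℕ} {e : ℕ →₀ ℕ} (h : e 0 = d) :
    Module.finrank ℂ (fusionPiece n ns ks z d e)
      = Module.finrank ℂ (fusionComponent n ns ks z e) := by
  subst h
  rfl

theorem finrank_finset_sup_le {V τ : Type*} [AddCommGroup V] [Module ℂ V] [FiniteDimensional ℂ V]
    (s : Finset τ) (G : τ → Submodule ℂ V) :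
    Module.finrank ℂ (s.sup G : Submodule ℂ V) ≤ ∑ i ∈ s, Module.finrank ℂ (G i) := by
  classical
  induction s using Finset.induction_on with
  | empty =>
    rw [Finset.sup_empty, finrank_bot]
    exact Nat.zero_le _
  | insert a s ha ih =>
    rw [Finset.sup_insert, Finset.sum_insert ha]
    exact (Submodule.finrank_add_le_finrank_add_finrank _ _).trans (Nat.add_le_add_left ih _)

theorem exists_finrank_filtLT_succ_le (ns ks : ι → ℕ) (z : ι → ℂ) (d : ℕ) :
    ∃ S : Finset (ℕ →₀ ℕ), (∀ w ∈ S, w 0 = 0) ∧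
      Module.finrank ℂ (filtLT n ns ks z (d + 1)) ≤ Module.finrank ℂ (filtLT n ns ks z d) +
        ∑ w ∈ S, Module.finrank ℂ (fusionComponent n ns ks z (w + Finsupp.single 0 d)) := by
  classical
  let G : (ℕ →₀ ℕ) → Submodule ℂ (TensorMod n ns ks ⧸ filtLT n ns ks z d) := fun w =>
    fusionPiece n ns ks z d (w.erase 0 + Finsupp.single 0 d)
  -- The weight pieces together span the image of the next filtration step; by finite dimension
  -- finitely many of them suffice.
  obtain ⟨t, ht, hsup⟩ := CompleteLattice.WellFoundedGT.isSupFiniteCompact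
    (Submodule ℂ (TensorMod n ns ks ⧸ filtLT n ns ks z d)) (G '' Set.univ)
  obtain ⟨S, -, rfl⟩ := Finset.subset_set_image_iff.mp ht
  refine ⟨S.image (Finsupp.erase 0), ?_, ?_⟩
  · intro w hw
    obtain ⟨w', -, rfl⟩ := Finset.mem_image.mp hw
    exact Finsupp.erase_same
  have hle : (filtLT n ns ks z (d + 1)).map (filtLT n ns ks z d).mkQ
      ≤ (S.image (Finsupp.erase 0)).sup G := by
    rw [Finset.sup_image]
    have h1 : S.sup (G ∘ Finsupp.erase 0) = sSup (G '' Set.univ) := by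
      rw [hsup, Finset.sup_image]
      refine Finset.sup_congr rfl fun w _ => ?_
      change fusionPiece n ns ks z d ((w.erase 0).erase 0 + _) = fusionPiece n ns ks z d _
      rw [Finsupp.erase_idem]
    rw [h1, Submodule.map_le_iff_le_comap]
    refine filtLT_le fun m hm => ?_
    rw [Submodule.mem_comap]
    rcases Nat.lt_succ_iff_lt_or_eq.mp hm with h | h
    · rw [Submodule.mkQ_apply, (Submodule.Quotient.mk_eq_zero _).mpr (evalAct_monomial_mem h)]
      exact Submodule.zero_mem _
    · set e := Finsupp.weight (fun x : Gen n × ℕ => bideg (x.1 : ℕ) x.2) m with he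
      have he0 : e 0 = d := by rw [he, weight_bideg_apply_zero, h]
      have hG : G e = fusionPiece n ns ks z d e := by
        change fusionPiece n ns ks z d (e.erase 0 + Finsupp.single 0 d) = _
        rw [← he0, Finsupp.erase_add_single]
      refine (le_sSup (Set.mem_image_of_mem G (Set.mem_univ e)) : G e ≤ _) ?_
      rw [hG]
      refine Submodule.mem_map_of_mem (Submodule.mem_map_of_mem ?_)
      exact MvPolynomial.isWeightedHomogeneous_monomial _ _ _ rfl
  refine (finrank_le_add_of_map (filtLT n ns ks z d).mkQ (A' := filtLT n ns ks z d)
    (B := (S.image (Finsupp.erase 0)).sup G)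
    (fun v hv => hle (Submodule.mem_map_of_mem hv)) fun v _ hv => ?_).trans ?_
  · rwa [Submodule.mkQ_apply, Submodule.Quotient.mk_eq_zero] at hv
  · refine Nat.add_le_add_left ((finrank_finset_sup_le _ _).trans
      (Finset.sum_le_sum fun w hw => ?_)) _
    obtain ⟨w', -, rfl⟩ := Finset.mem_image.mp hw
    change Module.finrank ℂ (fusionPiece n ns ks z d ((w'.erase 0).erase 0 + _)) ≤ _
    rw [Finsupp.erase_idem, finrank_fusionPiece]
    simp

theorem exists_finrank_filtLT_le (ns ks : ι → ℕ) (z : ι → ℂ) (D : ℕ) :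
    ∃ S : Finset (ℕ →₀ ℕ), (∀ w ∈ S, w 0 = 0) ∧
      Module.finrank ℂ (filtLT n ns ks z D) ≤ ∑ w ∈ S, ∑ d ∈ Finset.range D,
        Module.finrank ℂ (fusionComponent n ns ks z (w + Finsupp.single 0 d)) := by
  classical
  induction D with
  | zero =>
    refine ⟨∅, by simp, ?_⟩
    have : filtLT n ns ks z 0 = ⊥ := by
      rw [eq_bot_iff]
      exact filtLT_le fun m hm => absurd hm (by omega)
    rw [this, finrank_bot]
    exact Nat.zero_le _
  | succ D ih =>
    obtain ⟨S, hS, h1⟩ := ih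
    obtain ⟨S', hS', h2⟩ := exists_finrank_filtLT_succ_le (n := n) ns ks z D
    refine ⟨S ∪ S', fun w hw => (Finset.mem_union.mp hw).elim (hS w) (hS' w), h2.trans ?_⟩
    simp only [Finset.sum_range_succ, Finset.sum_add_distrib]
    exact Nat.add_le_add (h1.trans (Finset.sum_le_sum_of_subset Finset.subset_union_left))
      (Finset.sum_le_sum_of_subset Finset.subset_union_right)

/-- The filtration stabilizes by finite dimension, and it is exhaustive because the cyclic vector
generates. -/
theorem exists_filtLT_eq_top (ns ks : ι → ℕ) {z : ι → ℂ} (hz : Function.Injective z) :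
    ∃ D, filtLT n ns ks z D = ⊤ := by
  obtain ⟨D, hD⟩ := monotone_stabilizes_iff_noetherian.mpr
    (inferInstance : IsNoetherian ℂ (TensorMod n ns ks)) ⟨filtLT n ns ks z, fun _ _ => filtLT_mono⟩
  refine ⟨D, eq_top_iff.mpr fun x _ => ?_⟩
  obtain ⟨f, rfl⟩ := evalAct_surjective ns ks hz x
  have h1 : evalAct n ns ks z f ∈ filtLT n ns ks z (D + ∑ m ∈ f.support, (curDeg m + 1)) := by
    refine evalAct_mem_of_monomials fun m hm => evalAct_monomial_mem ?_
    have := Finset.single_le_sum (f := fun m => curDeg m + 1) (fun _ _ => Nat.zero_le _) hm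
    omega
  have h2 := hD _ (Nat.le_add_right D (∑ m ∈ f.support, (curDeg m + 1)))
  exact (congrArg (evalAct n ns ks z f ∈ ·) h2).mpr h1

end Bounds

/-! ### Every solution at distinct points comes from the tensor product. -/

section Annihilation

variable {n : ℕ} {ι : Type} [Fintype ι]

theorem eval_pushPoly {A : Type*} [CommRing A] [Algebra ℂ A] (φ : A →ₗ[ℂ] ℂ) (P : Polynomial A)
    (c : ℂ) : (pushPoly φ P).eval c = φ (P.eval (algebraMap ℂ A c)) := by
  rw [pushPoly, Polynomial.eval_finsetSum, Polynomial.eval_eq_sum, Polynomial.sum, map_sum]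
  refine Finset.sum_congr rfl fun j _ => ?_
  rw [Polynomial.eval_monomial, ← map_pow, mul_comm (P.coeff j), ← Algebra.smul_def, map_smul,
    smul_eq_mul, mul_comm]

/-- The linear form on polynomials with given values on the monomials of weight `w`. -/
def weightForm {ns : ι → ℕ} (w : ℕ →₀ ℕ) (p : Exps n ns w → ℂ) : CurRing n ns →ₗ[ℂ] ℂ :=
  ∑ ε, p ε • MvPolynomial.lcoeff ℂ ε.1

theorem weightForm_apply {ns : ι → ℕ} (w : ℕ →₀ ℕ) (p : Exps n ns w → ℂ) (f : CurRing n ns) :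
    weightForm w p f = ∑ ε, p ε * f.coeff ε.1 := by
  rw [weightForm, LinearMap.sum_apply]
  rfl

/-- When the exponents active at `q` exceed `k_q` in total, `z - ζ_q` divides the divisor, so the
value at `z = ζ_q` vanishes. -/
theorem weightForm_mul_eval_eq_zero {ns ks : ι → ℕ} {z : ι → ℂ} {w : ℕ →₀ ℕ} {p : Exps n ns w → ℂ}
    (hp : p ∈ sol (curCoeff n ns w) fun x => divisor ns z (fun p => (ks p : ℤ)) x.1)
    {ν : Gen n → ℕ} {q : ι}
    (hν : ks q < ∑ a ∈ Finset.univ.filter (fun a : Gen n => (a : ℕ) < ns q), ν a)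
    (g : CurRing n ns) :
    weightForm w p (g * (∏ a, current n ns a ^ ν a).eval (MvPolynomial.C (z q))) = 0 := by
  have hmono : ∀ P : CurVar n ns →₀ ℕ, weightForm w p (MvPolynomial.monomial P 1 *
      (∏ a, current n ns a ^ ν a).eval (MvPolynomial.C (z q))) = 0 := by
    intro P
    have h1 : pushPoly ((weightForm w p).comp (LinearMap.mulLeft ℂ (MvPolynomial.monomial P 1)))
        (∏ a, current n ns a ^ ν a) = ∑ ε, p ε • curCoeff n ns w (ν, P) ε := by
      ext j
      rw [coeff_pushPoly, Polynomial.finsetSum_coeff, LinearMap.comp_apply,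
        LinearMap.mulLeft_apply, weightForm_apply]
      refine Finset.sum_congr rfl fun ε _ => ?_
      rw [Polynomial.coeff_smul, curCoeff_coeff_eq, smul_eq_mul]
    have h2 := eval_pushPoly ((weightForm w p).comp
      (LinearMap.mulLeft ℂ (MvPolynomial.monomial P 1))) (∏ a, current n ns a ^ ν a) (z q)
    rw [h1] at h2
    refine Eq.trans h2.symm ?_
    have h3 : (X - C (z q)) ∣ ∑ ε, p ε • curCoeff n ns w (ν, P) ε := by
      refine Dvd.dvd.trans ?_ (mem_sol.mp hp (ν, P))
      rw [divisor]
      refine Dvd.dvd.trans (dvd_pow_self _ ?_) (Finset.dvd_prod_of_mem _ (Finset.mem_univ q))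
      rw [posOrd]
      dsimp only
      omega
    exact Polynomial.dvd_iff_isRoot.mp h3
  induction g using MvPolynomial.induction_on' with
  | monomial P c =>
    rw [show MvPolynomial.monomial P c = c • MvPolynomial.monomial P (1 : ℂ) by
      rw [MvPolynomial.smul_monomial, smul_eq_mul, mul_one], smul_mul_assoc, map_smul, hmono,
      smul_zero]
  | add f g hf hg => rw [add_mul, map_add, hf, hg, add_zero]

/-- The largest ideal in the kernel of a linear form. -/
def formIdeal {A : Type*} [CommRing A] [Algebra ℂ A] (L : A →ₗ[ℂ] ℂ) : Ideal A where
  carrier := {f | ∀ g, L (g * f) = 0}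
  add_mem' := fun hf hf' g => by rw [mul_add, map_add, hf, hf', add_zero]
  zero_mem' := fun g => by rw [mul_zero, map_zero]
  smul_mem' := fun c f hf g => by rw [smul_eq_mul, ← mul_assoc, hf]

theorem mem_formIdeal {A : Type*} [CommRing A] [Algebra ℂ A] {L : A →ₗ[ℂ] ℂ} {f : A} :
    f ∈ formIdeal L ↔ ∀ g, L (g * f) = 0 := Iff.rfl

/-- Compare the coefficients of `z^m` in the Lagrange interpolation of `z^j` at the `N_a` active
points. -/
theorem lagrange_coeff {ns : ι → ℕ} {z : ι → ℂ} (hz : Function.Injective z) (a : ℕ) {j : ℕ}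
    (hj : j < numActive ns a) (m : ℕ) :
    ∑ p ∈ activeSet ns a, (othersPoly ns z a p).coeff m *
      (((othersPoly ns z a p).eval (z p))⁻¹ * z p ^ j) = if m = j then 1 else 0 := by
  have h1 : (X ^ j - ∑ p ∈ activeSet ns a,
      C (((othersPoly ns z a p).eval (z p))⁻¹ * z p ^ j) * othersPoly ns z a p : Polynomial ℂ) = 0 := by
    refine Polynomial.eq_zero_of_degree_lt_of_eval_index_eq_zero (activeSet ns a) hz.injOn ?_ ?_
    · have hcard : (activeSet ns a).card = numActive ns a := rfl
      rw [hcard]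
      refine (Polynomial.degree_sub_le _ _).trans_lt (max_lt ?_ ?_)
      · rw [Polynomial.degree_X_pow]
        exact_mod_cast hj
      · refine (Polynomial.degree_sum_le _ _).trans_lt ?_
        rw [Finset.sup_lt_iff (by exact_mod_cast WithBot.bot_lt_coe (numActive ns a))]
        intro p hp
        rw [← Polynomial.smul_eq_C_mul]
        refine (Polynomial.degree_smul_le _ _).trans_lt ?_
        refine Polynomial.degree_le_natDegree.trans_lt ?_
        rw [natDegree_othersPoly z hp]
        exact_mod_cast (show numActive ns a - 1 < numActive ns a by omega)
    · intro q hq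
      rw [Polynomial.eval_sub, Polynomial.eval_pow, Polynomial.eval_X, Polynomial.eval_finsetSum,
        Finset.sum_eq_single_of_mem q hq]
      · rw [Polynomial.eval_mul, Polynomial.eval_C, mul_right_comm,
          inv_mul_cancel₀ (othersPoly_eval_ne_zero ns hz a q), one_mul, sub_self]
      · intro p _ hne
        rw [Polynomial.eval_mul, othersPoly_eval_eq_zero z hq hne.symm, mul_zero]
  have h2 := congrArg (fun P => Polynomial.coeff P m) (sub_eq_zero.mp h1)
  simp only [Polynomial.coeff_X_pow, Polynomial.finsetSum_coeff, Polynomial.coeff_C_mul] at h2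
  rw [h2]
  exact Finset.sum_congr rfl fun p _ => mul_comm _ _

/-- Modulo the largest ideal in the kernel of `L`, the values `x_a(ζ_p)` satisfy the relations of
the `p`-th factor. Hence the tensor product maps to this quotient of `R`, and the composite with
`evalMap` is the projection. -/
theorem ker_evalMap_le {ns ks : ι → ℕ} {z : ι → ℂ} (hz : Function.Injective z)
    {L : CurRing n ns →ₗ[ℂ] ℂ}
    (hL : ∀ (q : ι) (ν : Gen n → ℕ),
      ks q < ∑ a ∈ Finset.univ.filter (fun a : Gen n => (a : ℕ) < ns q), ν a →
      ∀ g, L (g * (∏ a, current n ns a ^ ν a).eval (MvPolynomial.C (z q))) = 0)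
    {f : CurRing n ns} (hf : evalMap n ns ks z f = 0) : L f = 0 := by
  classical
  let B := CurRing n ns ⧸ formIdeal L
  let π : CurRing n ns →ₐ[ℂ] B := Ideal.Quotient.mkₐ ℂ (formIdeal L)
  -- The image of `x_a^{(p)}`. Under `evalMap`, `x_a(ζ_p)` becomes `x_a^{(p)}` times the product of
  -- `ζ_p - ζ_{p'}` over the other active points, and the inverse factor removes this product.
  let y : ι → Gen n → B := fun p a => if (a : ℕ) < ns p then
    ((othersPoly ns z a p).eval (z p))⁻¹ • π ((current n ns a).eval (MvPolynomial.C (z p))) else 0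
  have hy : ∀ p (ν : Gen n →₀ ℕ), (∀ a : Gen n, ns p ≤ (a : ℕ) → ν a = 0) → ν.degree = ks p + 1 →
      ∏ a, y p a ^ ν a = 0 := by
    intro p ν hν hdeg
    have h1 : ∏ a, y p a ^ ν a = (∏ a : Gen n, ((othersPoly ns z a p).eval (z p))⁻¹ ^ ν a) •
        π ((∏ a, current n ns a ^ ν a).eval (MvPolynomial.C (z p))) := by
      rw [Polynomial.eval_prod, map_prod, Algebra.smul_def, map_prod, ← Finset.prod_mul_distrib]
      refine Finset.prod_congr rfl fun a _ => ?_
      rw [Polynomial.eval_pow, map_pow, map_pow, ← mul_pow, ← Algebra.smul_def]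
      by_cases ha : (a : ℕ) < ns p
      · simp only [y, if_pos ha]
      · rw [hν a (by omega), pow_zero, pow_zero]
    have h2 : π ((∏ a, current n ns a ^ ν a).eval (MvPolynomial.C (z p))) = 0 := by
      refine Ideal.Quotient.eq_zero_iff_mem.mpr (mem_formIdeal.mpr fun g => hL p ν ?_ g)
      rw [Finset.sum_filter_of_ne, ← Finsupp.degree_eq_sum, hdeg]
      · omega
      · intro a _ ha
        by_contra h
        exact ha (hν a (by omega))
    rw [h1, h2, smul_zero]
  let θ : ∀ p, SymMod n (ns p) (ks p) →ₐ[ℂ] B := fun p =>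
    Ideal.Quotient.liftₐ (symIdeal n (ns p) (ks p)) (MvPolynomial.aeval (y p)) (by
      intro g hg
      have : symIdeal n (ns p) (ks p) ≤ RingHom.ker (MvPolynomial.aeval (R := ℂ) (y p)) := by
        rw [symIdeal, Ideal.span_le]
        rintro _ (⟨a, ha, rfl⟩ | ⟨ν, hν, hdeg, rfl⟩)
        · rw [SetLike.mem_coe, RingHom.mem_ker, MvPolynomial.aeval_X]
          simp only [y, if_neg (not_lt.mpr ha)]
        · rw [SetLike.mem_coe, RingHom.mem_ker, MvPolynomial.aeval_monomial, map_one, one_mul,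
            Finsupp.prod_fintype _ _ fun _ => pow_zero _]
          exact hy p ν hν hdeg
      exact this hg)
  let η : TensorMod n ns ks →ₐ[ℂ] B := PiTensorProduct.liftAlgHom (R := ℂ)
    (A := fun p => SymMod n (ns p) (ks p))
    ((MultilinearMap.mkPiAlgebra ℂ ι B).compLinearMap fun p => (θ p).toLinearMap)
    (by simp) (fun x x' => by simp [Finset.prod_mul_distrib])
  have hη : ∀ p (s : SymMod n (ns p) (ks p)), η (inFactor n ns ks p s) = θ p s := by
    intro p s
    have h1 : η (inFactor n ns ks p s)
        = ∏ q, θ q ((Pi.mulSingle p s : ∀ q, SymMod n (ns q) (ks q)) q) := by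
      refine (PiTensorProduct.lift.tprod _).trans ?_
      rfl
    rw [h1, Finset.prod_eq_single_of_mem p (Finset.mem_univ p), Pi.mulSingle_eq_same]
    intro q _ hq
    rw [Pi.mulSingle_eq_of_ne hq, map_one]
  have hηψ : η.comp (evalMap n ns ks z) = π := by
    refine MvPolynomial.algHom_ext fun v => ?_
    obtain ⟨a, i⟩ := v
    rw [AlgHom.comp_apply, evalMap, MvPolynomial.aeval_X, map_sum]
    have h1 : ∀ p ∈ activeSet ns a, η ((othersPoly ns z a p).coeff (numActive ns a - 1 - (i : ℕ)) •
        factorGen n ns ks p a) = ∑ i' : Fin (numActive ns a),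
          ((othersPoly ns z a p).coeff (numActive ns a - 1 - (i : ℕ)) *
            (((othersPoly ns z a p).eval (z p))⁻¹ * z p ^ (numActive ns a - 1 - (i' : ℕ)))) •
              π (MvPolynomial.X ⟨a, i'⟩) := by
      intro p hp
      have h2 : θ p (Ideal.Quotient.mk _ (MvPolynomial.X a)) = y p a := by
        change MvPolynomial.aeval (y p) (MvPolynomial.X a) = _
        rw [MvPolynomial.aeval_X]
      rw [map_smul, factorGen, hη, h2]
      simp only [y, if_pos (mem_activeSet.mp hp)]
      rw [current, Polynomial.eval_finsetSum, map_sum, Finset.smul_sum, Finset.smul_sum]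
      refine Finset.sum_congr rfl fun i' _ => ?_
      rw [Polynomial.eval_monomial, ← map_pow, mul_comm, MvPolynomial.C_mul', map_smul, smul_smul,
        smul_smul, mul_assoc]
    rw [Finset.sum_congr rfl h1, Finset.sum_comm]
    simp only [← Finset.sum_smul]
    rw [Finset.sum_eq_single_of_mem i (Finset.mem_univ i)]
    · rw [lagrange_coeff hz a (by have := i.2; omega), if_pos rfl, one_smul]
    · intro i' _ hne
      have h3 : (i' : ℕ) ≠ i := fun h => hne (Fin.ext h)
      have h4 := i.2
      have h5 := i'.2
      rw [lagrange_coeff hz a (by omega), if_neg (by omega), zero_smul]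
  have h1 : π f = 0 := by
    rw [← hηψ, AlgHom.comp_apply, hf, map_zero]
  have h2 := mem_formIdeal.mp (Ideal.Quotient.eq_zero_iff_mem.mp h1) 1
  rwa [one_mul] at h2

/-- Solutions of different weights are added up to one linear form on `R`. It vanishes on the kernel
of `evalMap`, so it comes from a form on the tensor product, whose values on monomials recover all
the solutions. -/
theorem sum_totalDim_le (ns ks : ι → ℕ) {z : ι → ℂ} (hz : Function.Injective z)
    (S : Finset (ℕ →₀ ℕ)) : ∑ w ∈ S, totalDim n ns z (fun p => (ks p : ℤ)) w
      ≤ Module.finrank ℂ (TensorMod n ns ks) := by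
  classical
  let Φ : Module.Dual ℂ (TensorMod n ns ks) →ₗ[ℂ] (∀ w : S, Exps n ns w.1 → ℂ) :=
    LinearMap.pi fun w => monoValues n ns ks z w.1
  let T : (∀ w : S, (sol (curCoeff n ns w.1) fun x => divisor ns z (fun p => (ks p : ℤ)) x.1 :
      Submodule ℂ (Exps n ns w.1 → ℂ))) →ₗ[ℂ] (∀ w : S, Exps n ns w.1 → ℂ) :=
    LinearMap.pi fun w => (Submodule.subtype _).comp (LinearMap.proj w)
  have hT : Function.Injective T := by
    intro p p' h
    funext w
    exact Subtype.ext (congr_fun h w)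
  have hrange : LinearMap.range T ≤ LinearMap.range Φ := by
    rintro _ ⟨p, rfl⟩
    let L : CurRing n ns →ₗ[ℂ] ℂ := ∑ w : S, weightForm w.1 (p w).1
    have hL : L ∈ LinearMap.range (evalMap n ns ks z).toLinearMap.dualMap := by
      rw [LinearMap.range_dualMap_eq_dualAnnihilator_ker, Submodule.mem_dualAnnihilator]
      intro f hf
      refine ker_evalMap_le hz (ks := ks) (fun q ν hν g => ?_) hf
      rw [LinearMap.sum_apply]
      exact Finset.sum_eq_zero fun w _ => weightForm_mul_eval_eq_zero (p w).2 hν g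
    obtain ⟨φ, hφ⟩ := hL
    refine ⟨φ, ?_⟩
    funext w ε
    have h1 : Φ φ w ε = L (MvPolynomial.monomial ε.1 1) := by
      rw [← hφ]
      rfl
    rw [h1, LinearMap.sum_apply, Finset.sum_eq_single_of_mem w (Finset.mem_univ w)]
    · rw [weightForm_apply, Finset.sum_eq_single_of_mem ε (Finset.mem_univ ε)]
      · rw [MvPolynomial.coeff_monomial, if_pos rfl, mul_one]
        rfl
      · intro ε' _ hne
        rw [MvPolynomial.coeff_monomial, if_neg fun h => hne (Subtype.ext h.symm), mul_zero]
    · intro w' _ hne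
      rw [weightForm_apply]
      refine Finset.sum_eq_zero fun ε' _ => ?_
      rw [MvPolynomial.coeff_monomial, if_neg, mul_zero]
      intro h
      apply hne
      apply Subtype.ext
      rw [← ε'.2, ← h]
      exact ε.2
  have h1 := LinearMap.finrank_range_of_inj hT
  rw [Module.finrank_pi_fintype] at h1
  have h2 := Submodule.finrank_mono hrange
  have h3 := LinearMap.finrank_range_le Φ
  rw [Subspace.dual_finrank_eq] at h3
  rw [← Finset.sum_coe_sort S]
  exact h1.symm.le.trans (h2.trans h3)

/-- The termwise bounds `finrank_fusionComponent_le` are equalities because the totals agree: the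
sum of the `gradedDim` is at most the dimension of the tensor product, and the fusion components add
up to at least that. -/
theorem finrank_fusionComponent (ns ks : ι → ℕ) {z : ι → ℂ} (hz : Function.Injective z)
    (e : ℕ →₀ ℕ) : Module.finrank ℂ (fusionComponent n ns ks z e)
      = gradedDim n ns (fun p => (ks p : ℤ)) (e.erase 0) (e 0) := by
  classical
  obtain ⟨D, hD⟩ := exists_filtLT_eq_top (n := n) ns ks hz
  obtain ⟨S, hS, hle⟩ := exists_finrank_filtLT_le (n := n) ns ks z D
  rw [hD, finrank_top] at hle
  -- The weight of `e` is added, so that its bidegree takes part in the comparison of totals.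
  set S' := insert (e.erase 0) S with hS'
  have hS'0 : ∀ w ∈ S', w 0 = 0 := by
    intro w hw
    rcases Finset.mem_insert.mp hw with rfl | h
    · exact Finsupp.erase_same
    · exact hS w h
  obtain ⟨B, hB⟩ : ∃ B, ∀ w ∈ S', ∀ ε : Exps n ns w, dg ε.1 < B := by
    refine ⟨∑ w ∈ S', ∑ ε : Exps n ns w, (dg ε.1 + 1), fun w hw ε => ?_⟩
    have h1 := Finset.single_le_sum (f := fun w => ∑ ε : Exps n ns w, (dg ε.1 + 1))
      (fun _ _ => Nat.zero_le _) hw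
    have h2 := Finset.single_le_sum (f := fun ε : Exps n ns w => dg ε.1 + 1)
      (fun _ _ => Nat.zero_le _) (Finset.mem_univ ε)
    exact (Nat.lt_succ_self _).trans_le (h2.trans h1)
  set B' := B + D + e 0 + 1 with hB'
  have hterm : ∀ w ∈ S', ∀ d : ℕ, Module.finrank ℂ
      (fusionComponent n ns ks z (w + Finsupp.single 0 d))
      ≤ gradedDim n ns (fun p => (ks p : ℤ)) w d := by
    intro w hw d
    have h0 : w.erase 0 = w := Finsupp.erase_of_notMem_support (by simpa using hS'0 w hw)
    have h1 := finrank_fusionComponent_le (n := n) ns ks hz (w + Finsupp.single 0 d)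
    refine h1.trans_eq ?_
    rw [Finsupp.erase_add, h0, Finsupp.erase_single, add_zero, Finsupp.add_apply, hS'0 w hw,
      zero_add, Finsupp.single_eq_same]
  have htot : ∑ w ∈ S', ∑ d ∈ Finset.range B', gradedDim n ns (fun p => (ks p : ℤ)) w d
      ≤ ∑ w ∈ S', ∑ d ∈ Finset.range B', Module.finrank ℂ
        (fusionComponent n ns ks z (w + Finsupp.single 0 d)) := by
    have h1 : ∑ w ∈ S', ∑ d ∈ Finset.range B', gradedDim n ns (fun p => (ks p : ℤ)) w d
        = ∑ w ∈ S', totalDim n ns z (fun p => (ks p : ℤ)) w :=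
      Finset.sum_congr rfl fun w hw =>
        (totalDim_eq_sum_gradedDim ns hz w _ B' fun ε => (hB w hw ε).trans (by omega)).symm
    rw [h1]
    refine (sum_totalDim_le ns ks hz S').trans (hle.trans ?_)
    refine (Finset.sum_le_sum_of_subset (Finset.subset_insert _ _)).trans
      (Finset.sum_le_sum fun w _ => Finset.sum_le_sum_of_subset (Finset.range_mono (by omega)))
  have hw := (Finset.sum_eq_sum_iff_of_le fun w hw =>
    Finset.sum_le_sum fun d _ => hterm w hw d).mp
      (le_antisymm (Finset.sum_le_sum fun w hw => Finset.sum_le_sum fun d _ => hterm w hw d) htot)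
      (e.erase 0) (Finset.mem_insert_self _ _)
  have hd := (Finset.sum_eq_sum_iff_of_le fun d _ =>
    hterm (e.erase 0) (Finset.mem_insert_self _ _) d).mp hw (e 0)
      (Finset.mem_range.mpr (by omega))
  rwa [Finsupp.erase_add_single] at hd

theorem chFusion_eq_chW (ns ks : ι → ℕ) {z : ι → ℂ} (hz : Function.Injective z) :
    chFusion n ns ks z = chW n ns ks := by
  funext e
  rw [chFusion, chW, finrank_fusionComponent ns ks hz, finrank_WComponent]

end Annihilation

end

end FusionProduct

theorem theorem2p11 (r : ℕ) :
    -- `χ^{(n)}[μ^{(n)}, …, μ^{(1)}]`, `n = r + 1`, is the character of `W(n, k)` and of the fusion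
    -- product at any distinct points
    (∀ (N : ℕ) (ns ks : Fin N → ℕ), (∀ p, 1 ≤ ns p ∧ ns p ≤ r + 1) →
      chW (r + 1) ns ks = chi (muOf r ns ks) ∧
      ∀ z : Fin N → ℂ, Function.Injective z →
        chFusion (r + 1) ns ks z = chi (muOf r ns ks)) ∧
    -- the recursion from `n = r + 2` to `n - 1 = r + 1`
    (∀ μ : Fin (r + 2) → ℕ →₀ ℕ, Admissible μ →
      chi μ = ∑ ν ∈ between (μ (Fin.last r).castSucc) (μ (Fin.last (r + 1))),
        MvPowerSeries.X (r + 1) ^ ((μ (Fin.last (r + 1))).degree - ν.degree) *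
          inQ (F (μ (Fin.last (r + 1)) - μ (Fin.last r).castSucc)
            (ν - μ (Fin.last r).castSucc)) *
          chi (Function.update (fun a : Fin (r + 1) => μ a.castSucc) (Fin.last r) ν)) ∧
    -- the fermionic formula for `n = r + 1`
    (∀ μ : Fin (r + 1) → ℕ →₀ ℕ, Admissible μ →
      chi μ = ∑ ν ∈ chains μ, ∏ a : Fin r,
        (MvPowerSeries.X ((a : ℕ) + 1) ^ ((ν a.succ).degree - (ν a.castSucc).degree) *
          inQ (F (ν a.succ - μ a.castSucc) (ν a.castSucc - μ a.castSucc)))) ∧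
    -- for `n_1 = ⋯ = n_N = n = r + 1` the coefficients are `q`-supernomial coefficients
    (∀ μ : ℕ →₀ ℕ, Antitone μ →
      chi (onlyLast r μ) = ∑ lam ∈ Finset.piAntidiag (Finset.univ : Finset (Fin (r + 1))) μ.degree,
        (∏ a : Fin r, MvPowerSeries.X ((a : ℕ) + 1) ^ lam a.succ) * inQ (supernomial lam μ)) ∧
    (∀ (N : ℕ) (ks : Fin N → ℕ) (z : Fin N → ℂ), Function.Injective z →
      chFusion (r + 1) (fun _ => r + 1) ks z =
        ∑ lam ∈ Finset.piAntidiag (Finset.univ : Finset (Fin (r + 1)))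
            (∑ p, column (ks p)).degree,
          (∏ a : Fin r, MvPowerSeries.X ((a : ℕ) + 1) ^ lam a.succ) *
            inQ (supernomial lam (∑ p, column (ks p)))) := by
  refine ⟨fun N ns ks h => ⟨chW_eq_chi h, fun z hz => (chFusion_eq_chW ns ks hz).trans (chW_eq_chi h)⟩,
    fun μ hμ => chi_eq_sum_between hμ, fun μ hμ => chi_eq_sum_chains hμ,
    fun μ hμ => chi_onlyLast r hμ, fun N ks z hz => ?_⟩
  rw [chFusion_eq_chW _ _ hz, chW_eq_chi fun _ => ⟨by omega, le_rfl⟩, muOf_const,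
    chi_onlyLast r (antitone_sum_column ks)]
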